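/- Let $M_0>0$, $h_0(x,v)=\frac{v^2}{2}-M_0\cos x$ on $\mathbb T\times\mathbb R$, where $\mathbb T=\mathbb R/2\pi\mathbb Z$ carries the normalized Lebesgue measure ($dx$ on $(-\pi,\pi]$ divided by $2\pi$), and let $\psi_t$ be the flow of the pendulum $\dot x=v$, $\dot v=-M_0\sin x$. Let $G:\mathbb R\to\mathbb R$ be of class $C^{10}$ and suppose that, for some $\mu>2$, $$\max_{n\le 10}\ \sup_{y\ge -M_0}\ (1+y^2)^{\mu/2}\,|G^{(n)}(y)|<\infty ,\qquad G'(y)<0\ \text{ for all } y\ge -M_0$$ ($[-M_0,\infty)$ is the range of $h_0$). Let $\eta=G(h_0)$, $X(x,v)=x$, $\{f,g\}=\partial_xf\,\partial_vg-\partial_vf\,\partial_xg$, and $$K_{\mathcal C}(t)=\mathbf 1_{t\ge0}\int_{\mathbb T\times\mathbb R}\{\eta,\cos X\}\cos(X\circ\psi_t)\,dx\,dv,\qquad K_{\mathcal S}(t)=-\mathbf 1_{t\ge0}\int_{\mathbb T\times\mathbb R}\{\eta,\sin X\}\sin(X\circ\psi_t)\,dx\,dv .$$ Then $K_{\mathcal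 C}$ and $K_{\mathcal S}$ are integrable on $\mathbb R$, and with $\hat F(\xi)=\int_{\mathbb R}F(t)e^{-it\xi}\,dt$ the zero-frequency Penrose condition $$1-\hat K_{\mathcal C}(0)>0\quad\text{and}\quad 1-\hat K_{\mathcal S}(0)>0$$ holds if and only if $\eta$ is linearly stable in the sense that $$1+\int_{\mathbb T\times\mathbb R}G'(h_0(x,v))\cos^2x\,dx\,dv-\sum_{*\in\{+,-,\circ\}}\int_{J_*}G'(h_0(a))\,C_0^*(a)^2\,da>0 .$$ Here $(\theta,a)\in(-\pi,\pi)\times J_*$ are the action-angle variables of the pendulum on $U_\pm=\{\pm v>0,\ h_0>M_0\}$ and $U_\circ=\{h_0<M_0\}$, with $J_\pm=(\frac4\pi\sqrt{M_0},\infty)$ and $J_\circ=(0,\frac8\pi\sqrt{M_0})$. That is, $a=a_*(h)$ is $\frac1{2\pi}$ times the integral of $v\,dx$ along the orbit of energy $h$ in $U_*$ (positively oriented, over one period), $h_0(a)$ is the inverse of $a_*$, $\theta$ is the time along the orbit times the frequency $\omega_*=\pi/r_*$, where $2r_*(h)$ is the period of the orbit, $\theta=0$ being the point with $x=0$ on $U_\pm$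 and the turning point $(\arccos(-h/M_0),0)$ on $U_\circ$; and $C_0^*(a)=\frac1{2\pi}\int_{-\pi}^{\pi}\cos(x(\theta,a))\,d\theta$. -/

import Mathlib

open Set MeasureTheory
open scoped NNReal

noncomputable section

namespace VlasovHMF

/-! ### The pendulum and its flow

The torus `ℝ / 2πℤ` is handled through its universal cover: points of phase space are pairs
`(x, v) : ℝ × ℝ`, all functions integrated over phase space are `2π`-periodic in `x`, and integrals
are taken over the fundamental domain `(-π, π] × ℝ`. -/

/-- The Hamiltonian `h₀(x, v) = v² / 2 - M₀ cos x`. -/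
def hamiltonian (M₀ : ℝ) (z : ℝ × ℝ) : ℝ := z.2 ^ 2 / 2 - M₀ * Real.cos z.1

/-- The vector field `(v, -M₀ sin x)` of the pendulum. -/
def pendulumField (M₀ : ℝ) (z : ℝ × ℝ) : ℝ × ℝ := (z.2, -M₀ * Real.sin z.1)

theorem lipschitzWith_pendulumField (M₀ : ℝ) :
    LipschitzWith (1 + ‖M₀‖₊) (pendulumField M₀) := by
  refine LipschitzWith.of_dist_le_mul fun z w => ?_
  rw [Prod.dist_eq (x := pendulumField M₀ z), max_le_iff]
  have h1 : dist z.1 w.1 ≤ dist z w := le_max_left _ _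
  have h2 : dist z.2 w.2 ≤ dist z w := le_max_right _ _
  have h0 : 0 ≤ dist z w := dist_nonneg
  have hs : |Real.sin z.1 - Real.sin w.1| ≤ |z.1 - w.1| := by
    simpa [Real.dist_eq] using Real.lipschitzWith_sin.dist_le_mul z.1 w.1
  push_cast
  rw [Real.norm_eq_abs]
  have hM := abs_nonneg M₀
  constructor
  · change dist z.2 w.2 ≤ _
    nlinarith
  · change dist (-M₀ * Real.sin z.1) (-M₀ * Real.sin w.1) ≤ _
    rw [Real.dist_eq, ← mul_sub, abs_mul, abs_neg]
    rw [Real.dist_eq] at h1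
    nlinarith [abs_nonneg (z.1 - w.1), abs_nonneg (Real.sin z.1 - Real.sin w.1)]

/-- Through every point passes a trajectory of the pendulum that is defined for all times. -/
theorem exists_pendulumTrajectory (M₀ : ℝ) (z : ℝ × ℝ) :
    ∃ γ : ℝ → ℝ × ℝ, γ 0 = z ∧ IsIntegralCurve γ (fun _ => pendulumField M₀) := by
  have hsm : ContDiff ℝ 1 (pendulumField M₀) := by
    unfold pendulumField; fun_prop
  set K : ℝ≥0 := 1 + ‖M₀‖₊ with hK
  have hK1 : (1 : ℝ) ≤ K := by simp [hK]
  have hL := lipschitzWith_pendulumField M₀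
  rw [← hK] at hL
  have hε : 0 < 1 / (2 * (K : ℝ)) := by positivity
  have key : ∀ x : ℝ × ℝ, ∃ γ : ℝ → ℝ × ℝ, γ 0 = x ∧
      IsMIntegralCurveOn (I := modelWithCornersSelf ℝ (ℝ × ℝ)) γ (pendulumField M₀)
        (Ioo (-(1 / (2 * (K : ℝ)))) (1 / (2 * (K : ℝ)))) := by
    intro x
    have hpl : IsPicardLindelof (fun _ => pendulumField M₀)
        (tmin := -(1 / (2 * (K : ℝ)))) (tmax := 1 / (2 * (K : ℝ)))
        ⟨0, by constructor <;> linarith⟩ x (‖pendulumField M₀ x‖₊ / K) 0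
        (2 * ‖pendulumField M₀ x‖₊) K := by
      refine IsPicardLindelof.of_time_independent (fun y hy => ?_) hL.lipschitzOnWith ?_
      · have h1 := hL.norm_sub_le y x
        have h2 : ‖y - x‖ ≤ ‖pendulumField M₀ x‖ / K := by
          simpa [dist_eq_norm] using hy
        have h3 : (K : ℝ) * ‖y - x‖ ≤ ‖pendulumField M₀ x‖ := by
          rw [le_div_iff₀ (by positivity)] at h2
          linarith
        have h4 := norm_le_norm_sub_add (pendulumField M₀ y) (pendulumField M₀ x)
        push_cast
        linarith
      · simp only [sub_zero, zero_sub, neg_neg, max_self]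
        push_cast
        field_simp
        simp
    obtain ⟨γ, h0, hγ⟩ := hpl.exists_eq_forall_mem_Icc_hasDerivWithinAt₀
    refine ⟨γ, h0, fun t ht => ?_⟩
    have := (hγ t (Ioo_subset_Icc_self ht)).hasFDerivWithinAt.mono Ioo_subset_Icc_self
    exact this.hasMFDerivWithinAt
  obtain ⟨γ, h0, hγ⟩ := exists_isMIntegralCurve_of_isMIntegralCurveOn
    (I := modelWithCornersSelf ℝ (ℝ × ℝ)) (v := pendulumField M₀)
    (contMDiff_vectorSpace_iff_contDiff.2 hsm) hε key z
  refine ⟨γ, h0, fun t => ?_⟩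
  have h : HasFDerivAt γ
      (ContinuousLinearMap.smulRight (1 : ℝ →L[ℝ] ℝ) (pendulumField M₀ (γ t))) t :=
    hasMFDerivAt_iff_hasFDerivAt.1 (hγ t)
  simpa using h.hasDerivAt

/-- The flow `ψ_t(x, v)` of the pendulum `x' = v`, `v' = -M₀ sin x`: the position at time `t` of the
(unique) trajectory that starts at `z = (x, v)`. -/
def pendulumFlow (M₀ t : ℝ) (z : ℝ × ℝ) : ℝ × ℝ :=
  (exists_pendulumTrajectory M₀ z).choose t

theorem pendulumFlow_zero (M₀ : ℝ) (z : ℝ × ℝ) : pendulumFlow M₀ 0 z = z :=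
  (exists_pendulumTrajectory M₀ z).choose_spec.1

theorem hasDerivAt_pendulumFlow (M₀ t : ℝ) (z : ℝ × ℝ) :
    HasDerivAt (fun s => pendulumFlow M₀ s z) (pendulumField M₀ (pendulumFlow M₀ t z)) t :=
  (exists_pendulumTrajectory M₀ z).choose_spec.2 t

/-- The measure `dx dv` on the product of the torus and the line, the Lebesgue measure of the torus
being normalized: Lebesgue measure on `(-π, π]` divided by `2π`, times Lebesgue measure on `ℝ`. -/
def phaseMeasure : Measure (ℝ × ℝ) :=
  (ENNReal.ofReal (1 / (2 * Real.pi)) • volume.restrict (Ioc (-Real.pi) Real.pi)).prod volume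

/-! ### The kernels and the Penrose condition at frequency zero -/

/-- The Poisson bracket `{f, g} = ∂ₓf ∂ᵥg - ∂ᵥf ∂ₓg`. -/
def poissonBracket (f g : ℝ × ℝ → ℝ) (z : ℝ × ℝ) : ℝ :=
  deriv (fun x => f (x, z.2)) z.1 * deriv (fun v => g (z.1, v)) z.2
    - deriv (fun v => f (z.1, v)) z.2 * deriv (fun x => g (x, z.2)) z.1

/-- The state `η = G(h₀)`. -/
def state (M₀ : ℝ) (G : ℝ → ℝ) (z : ℝ × ℝ) : ℝ := G (hamiltonian M₀ z)

/-- The kernel `K_C(t) = 1_{t ≥ 0} ∫ {η, cos X} cos (X ∘ ψ_t) dx dv`, where `X(x, v) = x`. -/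
def kernelC (M₀ : ℝ) (G : ℝ → ℝ) (t : ℝ) : ℝ :=
  if 0 ≤ t then
    ∫ z, poissonBracket (state M₀ G) (fun w => Real.cos w.1) z
      * Real.cos (pendulumFlow M₀ t z).1 ∂phaseMeasure
  else 0

/-- The kernel `K_S(t) = - 1_{t ≥ 0} ∫ {η, sin X} sin (X ∘ ψ_t) dx dv`, where `X(x, v) = x`. -/
def kernelS (M₀ : ℝ) (G : ℝ → ℝ) (t : ℝ) : ℝ :=
  if 0 ≤ t then
    -∫ z, poissonBracket (state M₀ G) (fun w => Real.sin w.1) z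
      * Real.sin (pendulumFlow M₀ t z).1 ∂phaseMeasure
  else 0

/-- The Fourier transform `F̂(ξ) = ∫ F(t) exp (-i t ξ) dt`, at a complex frequency `ξ`. -/
def fourierHat (F : ℝ → ℝ) (ξ : ℂ) : ℂ :=
  ∫ t : ℝ, (F t : ℂ) * Complex.exp (-(Complex.I * t * ξ))

/-- The Penrose condition at frequency zero: `1 - K̂_C(0) > 0` and `1 - K̂_S(0) > 0`. (Both kernels
are real valued, so both numbers are real, and equal to their real parts.) -/
def PenroseAtZero (M₀ : ℝ) (G : ℝ → ℝ) : Prop :=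
  0 < (1 - fourierHat (kernelC M₀ G) 0).re ∧ 0 < (1 - fourierHat (kernelS M₀ G) 0).re

/-! ### Action-angle variables -/

/-- The three charts: `plus` is `U₊ = {v > 0, h₀ > M₀}`, `minus` is `U₋ = {v < 0, h₀ > M₀}`, and
`eye` is `U_∘ = {h₀ < M₀}`. -/
inductive Chart
  | plus
  | minus
  | eye

/-- The interval `I_*` of energies of a chart. -/
def energies (M₀ : ℝ) : Chart → Set ℝ
  | .plus => Ioi M₀
  | .minus => Ioi M₀
  | .eye => Ioo (-M₀) M₀

/-- The interval `J_*` of actions of a chart. -/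
def actions (M₀ : ℝ) : Chart → Set ℝ
  | .plus => Ioi (4 / Real.pi * √M₀)
  | .minus => Ioi (4 / Real.pi * √M₀)
  | .eye => Ioo 0 (8 / Real.pi * √M₀)

/-- The turning point `x₀(h) ∈ (0, π)` of the orbit of energy `h ∈ (-M₀, M₀)`, the solution of
`h + M₀ cos x₀ = 0`. -/
def turningPoint (M₀ h : ℝ) : ℝ := Real.arccos (-h / M₀)

/-- The half period `r_*(h)` of the orbit of energy `h` in a chart, that is, half the integral of
`dx / v` along the orbit. -/
def halfPeriod (M₀ : ℝ) : Chart → ℝ → ℝ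
  | .plus, h => ∫ y in (0)..Real.pi, 1 / √(2 * (h + M₀ * Real.cos y))
  | .minus, h => ∫ y in (0)..Real.pi, 1 / √(2 * (h + M₀ * Real.cos y))
  | .eye, h => 2 * ∫ y in (0)..turningPoint M₀ h, 1 / √(2 * (h + M₀ * Real.cos y))

/-- The frequency `ω_*(h) = π / r_*(h)`. -/
def frequency (M₀ : ℝ) (c : Chart) (h : ℝ) : ℝ := Real.pi / halfPeriod M₀ c h

/-- The action `a_*(h)`, that is, the integral of `v dx` along the orbit of energy `h`, divided
by `2π`. -/
def action (M₀ : ℝ) : Chart → ℝ → ℝ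
  | .plus, h => 1 / Real.pi * ∫ y in (0)..Real.pi, √(2 * (h + M₀ * Real.cos y))
  | .minus, h => 1 / Real.pi * ∫ y in (0)..Real.pi, √(2 * (h + M₀ * Real.cos y))
  | .eye, h => 2 / Real.pi * ∫ y in (0)..turningPoint M₀ h, √(2 * (h + M₀ * Real.cos y))

/-- The energy `h₀(a) ∈ I_*` as a function of the action `a ∈ J_*`: the inverse of `a_*`, which is
an increasing bijection from `I_*` onto `J_*`. -/
def energyOfAction (M₀ : ℝ) (c : Chart) (a : ℝ) : ℝ :=
  Function.invFunOn (action M₀ c) (energies M₀ c) a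

/-- The point of angle `θ = 0` on the orbit of energy `h`: the point with `x = 0` in the charts `U₊`
and `U₋`, the turning point `(x₀(h), 0)` in the eye. -/
def basePoint (M₀ : ℝ) : Chart → ℝ → ℝ × ℝ
  | .plus, h => (0, √(2 * (h + M₀)))
  | .minus, h => (0, -√(2 * (h + M₀)))
  | .eye, h => (turningPoint M₀ h, 0)

/-- The change of variables `(θ, a) ↦ (x(θ, a), v(θ, a))` of a chart. The angle is the time along the
orbit, multiplied by the frequency, so that the point of angle `θ` is reached from the point of
angle zero by following the pendulum during the time `θ / ω_*`. -/
def actionAngle (M₀ : ℝ) (c : Chart) (θ a : ℝ) : ℝ × ℝ :=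
  pendulumFlow M₀ (θ / frequency M₀ c (energyOfAction M₀ c a))
    (basePoint M₀ c (energyOfAction M₀ c a))

/-- The zeroth Fourier coefficient `C₀^*(a)` of `θ ↦ cos x(θ, a)`. -/
def cosMean (M₀ : ℝ) (c : Chart) (a : ℝ) : ℝ :=
  1 / (2 * Real.pi) * ∫ θ in (-Real.pi)..Real.pi, Real.cos (actionAngle M₀ c θ a).1

/-- The integral over `J_*` of `G'(h₀(a)) C₀^*(a)²`. -/
def chartTerm (M₀ : ℝ) (G : ℝ → ℝ) (c : Chart) : ℝ :=
  ∫ a in actions M₀ c, deriv G (energyOfAction M₀ c a) * cosMean M₀ c a ^ 2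

/-- Linear stability of the state `η = G(h₀)`. -/
def LinearlyStable (M₀ : ℝ) (G : ℝ → ℝ) : Prop :=
  0 < 1 + (∫ z, deriv G (hamiltonian M₀ z) * Real.cos z.1 ^ 2 ∂phaseMeasure)
      - (chartTerm M₀ G .plus + chartTerm M₀ G .minus + chartTerm M₀ G .eye)

end VlasovHMF

end

noncomputable section

open Set MeasureTheory Filter Topology
open scoped NNReal

/-! The bracket `{η, cos X} = G'(h₀) v sin x` is minus the time derivative of `G'(h₀) cos x` along
the pendulum. Since the flow preserves phase volume, on `t ≥ 0` the kernel `K_C` is the derivative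
of the correlation `C(t) = ∫ G'(h₀) cos x cos (x ∘ ψ_t)`, and in the same way `K_S = -S'` for the
correlation `S` of `sin x`. Hence `K̂_C(0) = C(∞) - C(0)` and `K̂_S(0) = S(0) - S(∞)`.

The frequency of an orbit depends strictly monotonically on its energy in each chart, so phases mix
and a correlation tends to the one of the orbit averages. Thus `C(∞)` is the sum of the three chart
integrals, and `S(∞) = 0` because `sin x` has mean zero on every orbit. With `C(0) = ∫ G'(h₀) cos²
x`, the number `1 - K̂_C(0)` is exactly the stability expression. Moreover `S(0) = ∫ G'(h₀) sin² x ≤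
0` since `G' < 0`, so the condition on `K_S` always holds, and the equivalence follows.

The analytic work lies in the integrability of the kernels and in the limits. Write `M₀ = ρ²` and
parametrize orbits by `m ∈ (0, 1)`, the energy being `ρ² (2 m - 1)` in the eye and `ρ² (2 / m - 1)`
outside. Positions are Jacobi functions of a variable `u` that the flow shifts by `t ϖ`, with `ϖ =
ρ` in the eye and `ϖ = ρ / √m` outside. In the phase `σ = u / (2 K(m))` all orbits have the same
period, and the flow is the shift by `t ϖ / (2 K)`. The derivative of `ϖ / (2 K)` never vanishes;
let `q` be its reciprocal. Integration by parts in `m` at fixed `σ` then gains a factor `1 / t`. Two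
of them give `C', S' = O(t⁻²)` (`exists_abs_integral_le_div_sq`), one gives the convergence to the
limits at rate `1 / t` (`exists_abs_integral_le_div`).

The integrations by parts must survive three degenerate ends. At the separatrix `m → 1` a derivative
at fixed phase costs `K / (1 - m)`, while `q` is of order `(1 - m) K²`, so only powers of the
logarithm `K` remain. At the centre of the eye `m → 0` the second derivative costs a further `1 /
m`, which is paid by a factor `m` in the amplitude. At infinite energy, `m → 0` outside the eye, the
final integrand is of order `m^(μ - 3)`, which is integrable because `μ > 2`. The classes `EJet`,
`AJet` and `PhaseJet` carry this bookkeeping.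

Finally the kernels, the correlations and the chart integrals are brought to the same coordinates:
`integral_phaseMeasure` computes the Jacobian, `kernelC_eq` and `kernelS_eq` identify the kernels,
and `sum_chartTerm` identifies the limit, the derivative of the action with respect to `m` being an
explicit multiple of `K`. -/

namespace Pendulum

section

/-! ### Elliptic integrals -/

/-- The Legendre root `√(1 - m sin² φ)`. -/
def dlt (φ m : ℝ) : ℝ := √(1 - m * Real.sin φ ^ 2)

/-- The elliptic integral `∫₀^φ w(y) / √(1 - m sin² y) dy` with weight `w`. -/
def ellI (w : ℝ → ℝ) (φ m : ℝ) : ℝ := ∫ y in (0)..φ, w y / dlt y m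

/-- The incomplete elliptic integral of the first kind. -/
def ellF (φ m : ℝ) : ℝ := ellI (fun _ => 1) φ m

/-- The incomplete elliptic integral `∫₀^φ cos² y / √(1 - m sin² y) dy`. -/
def ellB (φ m : ℝ) : ℝ := ellI (fun y => Real.cos y ^ 2) φ m

/-- The complete elliptic integral of the first kind. -/
def compK (m : ℝ) : ℝ := ellF (Real.pi / 2) m

/-- The complete elliptic integral `∫₀^{π/2} cos² y / √(1 - m sin² y) dy`. -/
def compB (m : ℝ) : ℝ := ellB (Real.pi / 2) m

variable {m : ℝ}

lemma one_sub_mul_sin_sq_pos (hm : m < 1) (φ : ℝ) : 0 < 1 - m * Real.sin φ ^ 2 := by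
  have h1 := Real.sin_sq_le_one φ
  have h2 := sq_nonneg (Real.sin φ)
  rcases h2.eq_or_lt with h | h
  · rw [← h]; norm_num
  · nlinarith

lemma dlt_pos (hm : m < 1) (φ : ℝ) : 0 < dlt φ m :=
  Real.sqrt_pos.2 (one_sub_mul_sin_sq_pos hm φ)

lemma dlt_sq (hm : m < 1) (φ : ℝ) : dlt φ m ^ 2 = 1 - m * Real.sin φ ^ 2 :=
  Real.sq_sqrt (one_sub_mul_sin_sq_pos hm φ).le

lemma dlt_le_one (hm : 0 ≤ m) (φ : ℝ) : dlt φ m ≤ 1 := by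
  rw [dlt, Real.sqrt_le_one]
  nlinarith [sq_nonneg (Real.sin φ)]

lemma hasDerivAt_dlt (hm : m < 1) (φ : ℝ) :
    HasDerivAt (fun y => dlt y m) (-(m * Real.sin φ * Real.cos φ) / dlt φ m) φ := by
  have h := (((Real.hasDerivAt_sin φ).pow 2).const_mul m).const_sub 1
  have h2 := h.sqrt (one_sub_mul_sin_sq_pos hm φ).ne'
  refine h2.congr_deriv ?_
  simp only [dlt, Pi.pow_apply]
  have := (Real.sqrt_pos.2 (one_sub_mul_sin_sq_pos hm φ)).ne'
  field_simp
  simp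
  ring

lemma hasDerivAt_dlt_param (hm : m < 1) (φ : ℝ) :
    HasDerivAt (fun n => dlt φ n) (-(Real.sin φ ^ 2) / (2 * dlt φ m)) m := by
  have h := ((hasDerivAt_id m).mul_const (Real.sin φ ^ 2)).const_sub 1
  have h2 := h.sqrt (one_sub_mul_sin_sq_pos hm φ).ne'
  refine h2.congr_deriv ?_
  simp [dlt]

lemma continuous_dlt : Continuous (fun p : ℝ × ℝ => dlt p.1 p.2) := by
  unfold dlt; fun_prop

lemma continuous_dlt_left (m : ℝ) : Continuous (fun y => dlt y m) := by
  unfold dlt; fun_prop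

lemma continuous_div_dlt {w : ℝ → ℝ} (hw : Continuous w) (hm : m < 1) :
    Continuous (fun y => w y / dlt y m) :=
  hw.div (continuous_dlt_left m) fun y => (dlt_pos hm y).ne'

lemma hasDerivAt_ellI {w : ℝ → ℝ} (hw : Continuous w) (hm : m < 1) (φ : ℝ) :
    HasDerivAt (fun y => ellI w y m) (w φ / dlt φ m) φ :=
  intervalIntegral.integral_hasDerivAt_right ((continuous_div_dlt hw hm).intervalIntegrable _ _)
    ((continuous_div_dlt hw hm).stronglyMeasurableAtFilter _ _)
    (continuous_div_dlt hw hm).continuousAt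

lemma le_dlt_of_lt {n r : ℝ} (hr : r ≤ 1) (hr0 : 0 ≤ r) (hn : n < 1 - r) (φ : ℝ) : r ≤ dlt φ n := by
  apply Real.le_sqrt_of_sq_le
  have h1 := Real.sin_sq_le_one φ
  have h2 := sq_nonneg (Real.sin φ)
  rcases le_total n 0 with h | h <;> nlinarith

lemma hasDerivAt_ellI_param {w : ℝ → ℝ} (hw : Continuous w) (hm : m < 1) (φ : ℝ) :
    HasDerivAt (fun n => ellI w φ n)
      (∫ y in (0)..φ, w y * Real.sin y ^ 2 / (2 * dlt y m ^ 3)) m := by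
  -- The margin `r` bounds the root from below by `r` for every parameter below `1 - r`. This gives
  -- one integrable bound for the parameter derivative on a whole neighbourhood of `m`.
  obtain ⟨r, hr0, hr1, hr⟩ : ∃ r : ℝ, 0 < r ∧ r ≤ 1 ∧ m < 1 - r := by
    refine ⟨min 1 ((1 - m) / 2), by apply lt_min <;> linarith, min_le_left _ _, ?_⟩
    have := min_le_right 1 ((1 - m) / 2)
    linarith
  have hs : Iio (1 - r) ∈ 𝓝 m := Iio_mem_nhds hr
  have hlt : ∀ n ∈ Iio (1 - r), n < 1 := fun n hn => by
    have : n < 1 - r := hn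
    linarith
  refine (intervalIntegral.hasDerivAt_integral_of_dominated_loc_of_deriv_le
    (F := fun n y => w y / dlt y n) (F' := fun n y => w y * Real.sin y ^ 2 / (2 * dlt y n ^ 3))
    (bound := fun y => |w y| / (2 * r ^ 3)) hs ?_ ?_ ?_ ?_ ?_ ?_).2
  · filter_upwards [hs] with n hn
    exact (continuous_div_dlt hw (hlt n hn)).aestronglyMeasurable
  · exact (continuous_div_dlt hw hm).intervalIntegrable _ _
  · refine Continuous.aestronglyMeasurable ?_
    refine (hw.mul (Real.continuous_sin.pow 2)).div
      (continuous_const.mul ((continuous_dlt_left m).pow 3)) fun y => ?_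
    have := dlt_pos hm y
    positivity
  · refine Eventually.of_forall fun y _ n hn => ?_
    have h1 := dlt_pos (hlt n hn) y
    have h2 : r ≤ dlt y n := le_dlt_of_lt hr1 hr0.le hn y
    rw [Real.norm_eq_abs, abs_div, abs_mul, abs_of_nonneg (sq_nonneg (Real.sin y)),
      abs_of_pos (by positivity : 0 < 2 * dlt y n ^ 3)]
    gcongr
    exact mul_le_of_le_one_right (abs_nonneg _) (Real.sin_sq_le_one y)
  · exact (Continuous.div_const hw.abs _).intervalIntegrable _ _
  · refine Eventually.of_forall fun y _ n hn => ?_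
    have h1 := dlt_pos (hlt n hn) y
    refine ((hasDerivAt_const n (w y)).div (hasDerivAt_dlt_param (hlt n hn) y) h1.ne').congr_deriv ?_
    field_simp
    ring

/-- The boundary function of the reduction formulas. Its derivative combines the integrands of
`ellF` and `ellB` with those of their parameter derivatives, so integrating it from `0` to `φ`
expresses the latter through `ellF` and `ellB` again. -/
lemma hasDerivAt_sin_mul_cos_div_dlt (hm : m < 1) (φ : ℝ) :
    HasDerivAt (fun y => Real.sin y * Real.cos y / dlt y m)
      ((Real.cos φ ^ 2 - Real.sin φ ^ 2) / dlt φ m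
        + m * Real.sin φ ^ 2 * Real.cos φ ^ 2 / dlt φ m ^ 3) φ := by
  have h1 := dlt_pos hm φ
  refine (((Real.hasDerivAt_sin φ).mul (Real.hasDerivAt_cos φ)).div (hasDerivAt_dlt hm φ)
    h1.ne').congr_deriv ?_
  simp only [Pi.mul_apply]
  field_simp
  ring

lemma continuous_weight {w : ℝ → ℝ} (hw : Continuous w) (hm : m < 1) :
    Continuous fun y => w y * Real.sin y ^ 2 / (2 * dlt y m ^ 3) := by
  refine (hw.mul (Real.continuous_sin.pow 2)).div
      (continuous_const.mul ((continuous_dlt_left m).pow 3)) fun y => ?_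
  have := dlt_pos hm y
  positivity

lemma hasDerivAt_ellF_param (hm : m < 1) (φ : ℝ) :
    HasDerivAt (fun n => ellF φ n)
      ((ellB φ m - Real.sin φ * Real.cos φ / dlt φ m) / (2 * (1 - m))) m := by
  refine (hasDerivAt_ellI_param continuous_const hm φ).congr_deriv ?_
  have h1 : ∫ y in (0)..φ, (Real.cos y ^ 2 / dlt y m
      - 2 * (1 - m) * (1 * Real.sin y ^ 2 / (2 * dlt y m ^ 3)))
      = Real.sin φ * Real.cos φ / dlt φ m - Real.sin 0 * Real.cos 0 / dlt 0 m := by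
    refine intervalIntegral.integral_eq_sub_of_hasDerivAt
      (f := fun y => Real.sin y * Real.cos y / dlt y m) (fun y _ => ?_) ?_
    · refine (hasDerivAt_sin_mul_cos_div_dlt hm y).congr_deriv ?_
      have h2 := dlt_pos hm y
      field_simp
      rw [dlt_sq hm, Real.cos_sq']
      ring
    · exact ((continuous_div_dlt (Real.continuous_cos.pow 2) hm).sub
        (continuous_const.mul (continuous_weight continuous_const hm))).intervalIntegrable _ _
  have i1 : IntervalIntegrable (fun y => Real.cos y ^ 2 / dlt y m) volume 0 φ :=
    (continuous_div_dlt (Real.continuous_cos.pow 2) hm).intervalIntegrable _ _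
  have i2 : IntervalIntegrable (fun y => 1 * Real.sin y ^ 2 / (2 * dlt y m ^ 3)) volume 0 φ :=
    (continuous_weight continuous_const hm).intervalIntegrable _ _
  rw [intervalIntegral.integral_sub i1 (i2.const_mul _),
    intervalIntegral.integral_const_mul] at h1
  have h3 : 1 - m ≠ 0 := by linarith
  have h4 : ellB φ m = ∫ y in (0)..φ, Real.cos y ^ 2 / dlt y m := rfl
  rw [h4]
  simp only [Real.sin_zero, zero_mul, zero_div, sub_zero] at h1
  rw [eq_div_iff (by positivity)]
  linarith

lemma hasDerivAt_ellB_param (hm : m < 1) (hm0 : m ≠ 0) (φ : ℝ) :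
    HasDerivAt (fun n => ellB φ n)
      ((ellF φ m - 2 * ellB φ m + Real.sin φ * Real.cos φ / dlt φ m) / (2 * m)) m := by
  have hc : Continuous fun y => Real.cos y ^ 2 := Real.continuous_cos.pow 2
  refine (hasDerivAt_ellI_param hc hm φ).congr_deriv ?_
  have h1 : ∫ y in (0)..φ, ((2 * (Real.cos y ^ 2 / dlt y m) - 1 / dlt y m)
      + 2 * m * (Real.cos y ^ 2 * Real.sin y ^ 2 / (2 * dlt y m ^ 3)))
      = Real.sin φ * Real.cos φ / dlt φ m - Real.sin 0 * Real.cos 0 / dlt 0 m := by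
    refine intervalIntegral.integral_eq_sub_of_hasDerivAt
      (f := fun y => Real.sin y * Real.cos y / dlt y m) (fun y _ => ?_) ?_
    · refine (hasDerivAt_sin_mul_cos_div_dlt hm y).congr_deriv ?_
      have h2 := dlt_pos hm y
      field_simp
      rw [Real.cos_sq']
      ring
    · exact (((continuous_const.mul (continuous_div_dlt hc hm)).sub
        (continuous_div_dlt continuous_const hm)).add
        (continuous_const.mul (continuous_weight hc hm))).intervalIntegrable _ _
  have i1 : IntervalIntegrable (fun y => Real.cos y ^ 2 / dlt y m) volume 0 φ :=
    (continuous_div_dlt hc hm).intervalIntegrable _ _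
  have i2 : IntervalIntegrable (fun y => Real.cos y ^ 2 * Real.sin y ^ 2 / (2 * dlt y m ^ 3))
      volume 0 φ := (continuous_weight hc hm).intervalIntegrable _ _
  have i3 : IntervalIntegrable (fun y => 1 / dlt y m) volume 0 φ :=
    (continuous_div_dlt continuous_const hm).intervalIntegrable _ _
  rw [intervalIntegral.integral_add ((i1.const_mul _).sub i3) (i2.const_mul _),
    intervalIntegral.integral_sub (i1.const_mul _) i3,
    intervalIntegral.integral_const_mul, intervalIntegral.integral_const_mul] at h1
  have h4 : ellB φ m = ∫ y in (0)..φ, Real.cos y ^ 2 / dlt y m := rfl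
  have h5 : ellF φ m = ∫ y in (0)..φ, 1 / dlt y m := rfl
  rw [h4, h5]
  simp only [Real.sin_zero, zero_mul, zero_div, sub_zero] at h1
  rw [eq_div_iff (by positivity)]
  linarith

lemma hasDerivAt_compK (hm : m < 1) : HasDerivAt compK (compB m / (2 * (1 - m))) m := by
  refine (hasDerivAt_ellF_param hm (Real.pi / 2)).congr_deriv ?_
  simp [compB]

lemma hasDerivAt_compB (hm : m < 1) (hm0 : m ≠ 0) :
    HasDerivAt compB ((compK m - 2 * compB m) / (2 * m)) m := by
  refine (hasDerivAt_ellB_param hm hm0 (Real.pi / 2)).congr_deriv ?_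
  simp [compB, compK]

/-! ### A Leibniz rule -/

/-- The increment of an integral whose upper end is moved is linear to first order, also when the
integrand depends continuously on the parameter. -/
lemma isLittleO_integral_sub {k : ℝ → ℝ → ℝ} {b : ℝ → ℝ} {n₀ : ℝ}
    (hk : ContinuousAt (fun p : ℝ × ℝ => k p.1 p.2) (b n₀, n₀))
    (hkc : ∀ᶠ n in 𝓝 n₀, Continuous fun y => k y n) (hb : ContinuousAt b n₀) :
    (fun n => (∫ y in (b n₀)..(b n), k y n) - k (b n₀) n₀ * (b n - b n₀))
      =o[𝓝 n₀] fun n => b n - b n₀ := by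
  rw [Asymptotics.isLittleO_iff]
  intro ε hε
  have h1 : ∀ᶠ p : ℝ × ℝ in 𝓝 (b n₀, n₀), |k p.1 p.2 - k (b n₀) n₀| < ε := by
    have := Metric.continuousAt_iff'.1 hk ε hε
    simpa [Real.dist_eq] using this
  obtain ⟨δ, hδ, h2⟩ := Metric.eventually_nhds_iff.1 h1
  have h3 : ∀ᶠ n in 𝓝 n₀, |b n - b n₀| < δ := by
    have := Metric.continuousAt_iff'.1 hb δ hδ
    simpa [Real.dist_eq] using this
  have h4 : ∀ᶠ n in 𝓝 n₀, |n - n₀| < δ := by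
    have := Metric.ball_mem_nhds n₀ hδ
    filter_upwards [this] with n hn
    simpa [Real.dist_eq] using hn
  filter_upwards [h3, h4, hkc] with n hn3 hn4 hn5
  have h6 : (∫ y in (b n₀)..(b n), k y n) - k (b n₀) n₀ * (b n - b n₀)
      = ∫ y in (b n₀)..(b n), (k y n - k (b n₀) n₀) := by
    rw [intervalIntegral.integral_sub (hn5.intervalIntegrable _ _)
      (continuous_const.intervalIntegrable _ _), intervalIntegral.integral_const, smul_eq_mul]
    ring
  rw [h6, Real.norm_eq_abs (b n - b n₀)]
  refine intervalIntegral.norm_integral_le_of_norm_le_const fun y hy => ?_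
  refine (h2 (y := (y, n)) ?_).le
  rw [Prod.dist_eq, max_lt_iff, Real.dist_eq, Real.dist_eq]
  refine ⟨lt_of_le_of_lt ?_ hn3, hn4⟩
  have := uIoc_subset_uIcc hy
  exact abs_sub_left_of_mem_uIcc this

lemma hasDerivAt_integral_sub {k : ℝ → ℝ → ℝ} {b : ℝ → ℝ} {n₀ b' : ℝ}
    (hk : ContinuousAt (fun p : ℝ × ℝ => k p.1 p.2) (b n₀, n₀))
    (hkc : ∀ᶠ n in 𝓝 n₀, Continuous fun y => k y n) (hb : HasDerivAt b b' n₀) :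
    HasDerivAt (fun n => ∫ y in (b n₀)..(b n), k y n) (k (b n₀) n₀ * b') n₀ := by
  have h1 := isLittleO_integral_sub hk hkc hb.continuousAt
  have h2 : HasDerivAt (fun n => (∫ y in (b n₀)..(b n), k y n) - k (b n₀) n₀ * (b n - b n₀))
      0 n₀ := by
    rw [hasDerivAt_iff_isLittleO]
    simpa using h1.trans_isBigO hb.isBigO_sub
  have h3 := h2.fun_add ((hb.sub_const (b n₀)).const_mul (k (b n₀) n₀))
  simpa using h3

/-- An implicit function theorem in one variable: to first order the integral is its integrand times
the displacement of the upper end, so a derivative of the integral can be divided by a nonzero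
integrand. It applies to the amplitude, which is known only as the upper end of an integral of
prescribed value. -/
lemma hasDerivAt_of_hasDerivAt_integral_sub {k : ℝ → ℝ → ℝ} {b : ℝ → ℝ} {n₀ i : ℝ}
    (hk : ContinuousAt (fun p : ℝ × ℝ => k p.1 p.2) (b n₀, n₀))
    (hkc : ∀ᶠ n in 𝓝 n₀, Continuous fun y => k y n) (hb : ContinuousAt b n₀)
    (h0 : k (b n₀) n₀ ≠ 0)
    (hi : HasDerivAt (fun n => ∫ y in (b n₀)..(b n), k y n) i n₀) :
    HasDerivAt b (i / k (b n₀) n₀) n₀ := by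
  have h1 := isLittleO_integral_sub hk hkc hb
  have h2 : (fun n => b n - b n₀) =O[𝓝 n₀] fun n => ∫ y in (b n₀)..(b n), k y n := by
    have h3 := (h1.const_mul_right h0).right_isBigO_add
    have h4 : (fun n => k (b n₀) n₀ * (b n - b n₀)) =O[𝓝 n₀]
        fun n => ∫ y in (b n₀)..(b n), k y n := by simpa using h3
    exact (Asymptotics.isBigO_const_mul_left_iff h0).1 h4
  have h3 : (fun n => ∫ y in (b n₀)..(b n), k y n) =O[𝓝 n₀] fun n => n - n₀ := by
    simpa using hi.isBigO_sub
  have h4 : HasDerivAt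
      (fun n => (∫ y in (b n₀)..(b n), k y n) - k (b n₀) n₀ * (b n - b n₀)) 0 n₀ := by
    rw [hasDerivAt_iff_isLittleO]
    simpa using h1.trans_isBigO (h2.trans h3)
  have h5 := ((hi.sub h4).div_const (k (b n₀) n₀)).add_const (b n₀)
  refine (h5.congr_deriv (by simp)).congr_of_eventuallyEq (Eventually.of_forall fun n => ?_)
  simp only [Pi.sub_apply]
  field_simp
  ring

end

section

variable {m : ℝ}

/-! ### The amplitude -/

lemma hasDerivAt_ellF (hm : m < 1) (φ : ℝ) :
    HasDerivAt (fun y => ellF y m) (1 / dlt φ m) φ := hasDerivAt_ellI continuous_const hm φ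

lemma hasDerivAt_ellB (hm : m < 1) (φ : ℝ) :
    HasDerivAt (fun y => ellB y m) (Real.cos φ ^ 2 / dlt φ m) φ :=
  hasDerivAt_ellI (Real.continuous_cos.pow 2) hm φ

lemma ellF_zero (m : ℝ) : ellF 0 m = 0 := by simp [ellF, ellI]

lemma one_le_inv_dlt (hm : m ∈ Ioo (0 : ℝ) 1) (φ : ℝ) : 1 ≤ 1 / dlt φ m := by
  rw [le_div_iff₀ (dlt_pos hm.2 φ), one_mul]
  exact dlt_le_one hm.1.le φ

lemma monotone_ellF_sub (hm : m ∈ Ioo (0 : ℝ) 1) : Monotone fun φ => ellF φ m - φ := by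
  refine monotone_of_hasDerivAt_nonneg (f' := fun φ => 1 / dlt φ m - 1)
    (fun φ => (hasDerivAt_ellF hm.2 φ).sub (hasDerivAt_id φ)) fun φ => ?_
  have := one_le_inv_dlt hm φ
  simp only [Pi.zero_apply]
  linarith

/-- The integrand of `ellF` is at least `1`, so `ellF` expands distances and its inverse, the
amplitude, is a contraction. -/
lemma abs_sub_le_abs_ellF_sub (hm : m ∈ Ioo (0 : ℝ) 1) (φ ψ : ℝ) :
    |φ - ψ| ≤ |ellF φ m - ellF ψ m| := by
  have key : ∀ a b : ℝ, a ≤ b → |b - a| ≤ |ellF b m - ellF a m| := fun a b hab => by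
    have h := monotone_ellF_sub hm hab
    simp only at h
    rw [abs_of_nonneg (by linarith), abs_of_nonneg (by linarith)]
    linarith
  rcases le_total φ ψ with h | h
  · rw [abs_sub_comm φ, abs_sub_comm (ellF φ m)]
    exact key _ _ h
  · exact key _ _ h

lemma continuous_ellF (hm : m < 1) : Continuous fun φ => ellF φ m :=
  continuous_iff_continuousAt.2 fun φ => (hasDerivAt_ellF hm φ).continuousAt

lemma strictMono_ellF (hm : m < 1) : StrictMono fun φ => ellF φ m := by
  refine strictMono_of_hasDerivAt_pos (fun φ => hasDerivAt_ellF hm φ) fun φ => ?_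
  have := dlt_pos hm φ
  positivity

lemma surjective_ellF (hm : m ∈ Ioo (0 : ℝ) 1) : Function.Surjective fun φ => ellF φ m := by
  have h0 := ellF_zero m
  refine (continuous_ellF hm.2).surjective ?_ ?_
  · refine tendsto_atTop_mono' atTop ?_ tendsto_id
    filter_upwards [eventually_ge_atTop 0] with φ hφ
    have := monotone_ellF_sub hm hφ
    simp only [h0] at this
    simp only [id]
    linarith
  · refine tendsto_atBot_mono' atBot ?_ tendsto_id
    filter_upwards [eventually_le_atBot 0] with φ hφ
    have := monotone_ellF_sub hm hφ
    simp only [h0] at this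
    simp only [id]
    linarith

/-- The amplitude: the inverse of the elliptic integral of the first kind. -/
def am (u m : ℝ) : ℝ := Function.invFun (fun φ => ellF φ m) u

lemma ellF_am (hm : m ∈ Ioo (0 : ℝ) 1) (u : ℝ) : ellF (am u m) m = u :=
  Function.rightInverse_invFun (surjective_ellF hm) u

lemma am_ellF (hm : m < 1) (φ : ℝ) : am (ellF φ m) m = φ :=
  Function.leftInverse_invFun (strictMono_ellF hm).injective φ

lemma am_eq_of_ellF_eq (hm : m < 1) {φ u : ℝ} (h : ellF φ m = u) : am u m = φ := by
  rw [← h, am_ellF hm]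

lemma am_zero (hm : m < 1) : am 0 m = 0 := am_eq_of_ellF_eq hm (ellF_zero m)

lemma am_compK (hm : m < 1) : am (compK m) m = Real.pi / 2 := am_eq_of_ellF_eq hm rfl

lemma dlt_neg (φ m : ℝ) : dlt (-φ) m = dlt φ m := by simp [dlt]

lemma dlt_add_pi (φ m : ℝ) : dlt (φ + Real.pi) m = dlt φ m := by simp [dlt]

lemma ellI_neg {w : ℝ → ℝ} (hw : ∀ y, w (-y) = w y) (φ m : ℝ) : ellI w (-φ) m = -ellI w φ m := by
  have h := intervalIntegral.integral_comp_neg (fun y => w y / dlt y m) (a := 0) (b := φ)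
  simp only [hw, dlt_neg, neg_zero] at h
  rw [ellI, ellI, h, intervalIntegral.integral_symm]

lemma ellI_add_pi {w : ℝ → ℝ} (hc : Continuous w) (hw : ∀ y, w (-y) = w y)
    (hp : ∀ y, w (y + Real.pi) = w y) (hm : m < 1) (φ : ℝ) :
    ellI w (φ + Real.pi) m = ellI w φ m + 2 * ellI w (Real.pi / 2) m := by
  have hper : Function.Periodic (fun y => w y / dlt y m) Real.pi := fun y => by
    simp only [hp, dlt_add_pi]
  have hi : ∀ a b, IntervalIntegrable (fun y => w y / dlt y m) volume a b := fun a b =>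
    (continuous_div_dlt hc hm).intervalIntegrable _ _
  have h1 := hper.intervalIntegral_add_eq φ (-(Real.pi / 2))
  have h2 := intervalIntegral.integral_add_adjacent_intervals (hi 0 φ) (hi φ (φ + Real.pi))
  have h3 := intervalIntegral.integral_add_adjacent_intervals (hi (-(Real.pi / 2)) 0)
    (hi 0 (Real.pi / 2))
  have h4 := ellI_neg hw (Real.pi / 2) m
  have h5 : -(Real.pi / 2) + Real.pi = Real.pi / 2 := by ring
  rw [h5] at h1
  simp only [ellI] at h4 ⊢
  rw [intervalIntegral.integral_symm] at h4
  linarith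

lemma ellF_neg (φ m : ℝ) : ellF (-φ) m = -ellF φ m := ellI_neg (fun _ => rfl) φ m

lemma ellF_add_pi (hm : m < 1) (φ : ℝ) : ellF (φ + Real.pi) m = ellF φ m + 2 * compK m :=
  ellI_add_pi continuous_const (fun _ => rfl) (fun _ => rfl) hm φ

lemma ellB_add_pi (hm : m < 1) (φ : ℝ) : ellB (φ + Real.pi) m = ellB φ m + 2 * compB m :=
  ellI_add_pi (Real.continuous_cos.pow 2) (fun y => by simp) (fun y => by simp) hm φ

lemma am_neg (hm : m ∈ Ioo (0 : ℝ) 1) (u : ℝ) : am (-u) m = -am u m :=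
  am_eq_of_ellF_eq hm.2 (by rw [ellF_neg, ellF_am hm])

lemma am_add (hm : m ∈ Ioo (0 : ℝ) 1) (u : ℝ) : am (u + 2 * compK m) m = am u m + Real.pi :=
  am_eq_of_ellF_eq hm.2 (by rw [ellF_add_pi hm.2, ellF_am hm])

lemma abs_am_sub_le (hm : m ∈ Ioo (0 : ℝ) 1) (u φ : ℝ) : |am u m - φ| ≤ |u - ellF φ m| := by
  simpa [ellF_am hm] using abs_sub_le_abs_ellF_sub hm (am u m) φ

/-- By the contraction property, the change of the amplitude is at most the defect `|u - ellF φ n|`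
of the old angle `φ` in the new equation. The defect is continuous in `(u, n)` and vanishes at the
base point. -/
lemma continuousAt_am {p : ℝ × ℝ} (hp : p.2 ∈ Ioo (0 : ℝ) 1) :
    ContinuousAt (fun p : ℝ × ℝ => am p.1 p.2) p := by
  have h1 : Tendsto (fun q : ℝ × ℝ => |q.1 - ellF (am p.1 p.2) q.2|) (𝓝 p) (𝓝 0) := by
    have h2 : ContinuousAt (fun n => ellF (am p.1 p.2) n) p.2 :=
      (hasDerivAt_ellF_param hp.2 _).continuousAt
    have h3 : ContinuousAt (fun q : ℝ × ℝ => |q.1 - ellF (am p.1 p.2) q.2|) p :=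
      (continuousAt_fst.sub
        (ContinuousAt.comp (f := fun q : ℝ × ℝ => q.2) h2 continuousAt_snd)).abs
    have h4 := h3.tendsto
    rwa [ellF_am hp, sub_self, abs_zero] at h4
  rw [ContinuousAt, tendsto_iff_norm_sub_tendsto_zero]
  refine squeeze_zero' (Eventually.of_forall fun _ => norm_nonneg _) ?_ h1
  have : ∀ᶠ q : ℝ × ℝ in 𝓝 p, q.2 ∈ Ioo (0 : ℝ) 1 :=
    continuousAt_snd.eventually (Ioo_mem_nhds hp.1 hp.2)
  filter_upwards [this] with q hq
  exact abs_am_sub_le hq _ _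

lemma continuousAt_inv_dlt {w : ℝ → ℝ} (hw : Continuous w) {p : ℝ × ℝ} (hp : p.2 < 1) :
    ContinuousAt (fun q : ℝ × ℝ => w q.1 / dlt q.1 q.2) p :=
  (hw.comp continuous_fst).continuousAt.div continuous_dlt.continuousAt (dlt_pos hp p.1).ne'

/-- The derivative of the amplitude along a curve in the `(u, m)` plane. -/
lemma hasDerivAt_am_comp (hm : m ∈ Ioo (0 : ℝ) 1) {c : ℝ → ℝ} {c' : ℝ} (hc : HasDerivAt c c' m) :
    HasDerivAt (fun n => am (c n) n)
      (dlt (am (c m) m) m * (c' - (ellB (am (c m) m) m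
        - Real.sin (am (c m) m) * Real.cos (am (c m) m) / dlt (am (c m) m) m)
          / (2 * (1 - m)))) m := by
  have hmem : ∀ᶠ n in 𝓝 m, n ∈ Ioo (0 : ℝ) 1 := Ioo_mem_nhds hm.1 hm.2
  have hcont : ContinuousAt (fun n => am (c n) n) m :=
    ContinuousAt.comp (f := fun n => (c n, n)) (g := fun p : ℝ × ℝ => am p.1 p.2)
      (continuousAt_am hm) (hc.continuousAt.prodMk continuousAt_id)
  -- The equation `ellF (am (c n) n) n = c n` is split at the fixed angle `am (c m) m`. The piece up
  -- to that angle has a known parameter derivative, and the rest is the integral with moving upper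
  -- end.
  have hi : HasDerivAt (fun n => ∫ y in (am (c m) m)..(am (c n) n), 1 / dlt y n)
      (c' - (ellB (am (c m) m) m
        - Real.sin (am (c m) m) * Real.cos (am (c m) m) / dlt (am (c m) m) m)
          / (2 * (1 - m))) m := by
    refine (hc.fun_sub (hasDerivAt_ellF_param hm.2 (am (c m) m))).congr_of_eventuallyEq ?_
    filter_upwards [hmem] with n hn
    have h1 := intervalIntegral.integral_add_adjacent_intervals
      ((continuous_div_dlt (w := fun _ => 1) continuous_const hn.2).intervalIntegrable
        (μ := volume) 0 (am (c m) m))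
      ((continuous_div_dlt (w := fun _ => 1) continuous_const hn.2).intervalIntegrable
        (am (c m) m) (am (c n) n))
    have h2 := ellF_am hn (c n)
    simp only [ellF, ellI] at h2 ⊢
    linarith
  have h := hasDerivAt_of_hasDerivAt_integral_sub (k := fun y n => 1 / dlt y n)
    (b := fun n => am (c n) n)
    (continuousAt_inv_dlt continuous_const hm.2)
    (hmem.mono fun n hn => continuous_div_dlt continuous_const hn.2) hcont
    (by have := dlt_pos hm.2 (am (c m) m); positivity) hi
  refine h.congr_deriv ?_
  have := dlt_pos hm.2 (am (c m) m)
  field_simp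

lemma hasDerivAt_ellB_comp (hm : m ∈ Ioo (0 : ℝ) 1) {b : ℝ → ℝ} {b' : ℝ} (hb : HasDerivAt b b' m) :
    HasDerivAt (fun n => ellB (b n) n)
      ((ellF (b m) m - 2 * ellB (b m) m + Real.sin (b m) * Real.cos (b m) / dlt (b m) m) / (2 * m)
        + Real.cos (b m) ^ 2 / dlt (b m) m * b') m := by
  have hmem : ∀ᶠ n in 𝓝 m, n ∈ Ioo (0 : ℝ) 1 := Ioo_mem_nhds hm.1 hm.2
  have hw : Continuous fun y => Real.cos y ^ 2 := Real.continuous_cos.pow 2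
  have h1 := hasDerivAt_integral_sub (k := fun y n => Real.cos y ^ 2 / dlt y n)
    (continuousAt_inv_dlt hw hm.2) (hmem.mono fun n hn => continuous_div_dlt hw hn.2) hb
  refine ((hasDerivAt_ellB_param hm.2 hm.1.ne' (b m)).fun_add h1).congr_of_eventuallyEq ?_
  filter_upwards [hmem] with n hn
  exact (intervalIntegral.integral_add_adjacent_intervals
      ((continuous_div_dlt hw hn.2).intervalIntegrable 0 (b m))
      ((continuous_div_dlt hw hn.2).intervalIntegrable (b m) (b n))).symm

/-! ### Bounds of the complete integrals -/

lemma cos_le_dlt {φ : ℝ} (hm : m ≤ 1) : |Real.cos φ| ≤ dlt φ m := by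
  rw [← Real.sqrt_sq_eq_abs]
  refine Real.sqrt_le_sqrt ?_
  rw [Real.cos_sq']
  nlinarith [sq_nonneg (Real.sin φ)]

lemma integral_cos_sq_half : ∫ y in (0)..(Real.pi / 2), Real.cos y ^ 2 = Real.pi / 4 := by
  rw [integral_cos_sq]; simp; ring

lemma pi_div_two_le_compK (hm : m ∈ Ioo (0 : ℝ) 1) : Real.pi / 2 ≤ compK m := by
  have := abs_sub_le_abs_ellF_sub hm (Real.pi / 2) 0
  have h2 : (0 : ℝ) ≤ compK m := by
    have := (strictMono_ellF hm.2).monotone (by positivity : (0 : ℝ) ≤ Real.pi / 2)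
    simpa [ellF_zero, compK] using this
  rw [ellF_zero, sub_zero, sub_zero, abs_of_nonneg (by positivity)] at this
  rwa [← abs_of_nonneg h2]

lemma one_le_compK (hm : m ∈ Ioo (0 : ℝ) 1) : 1 ≤ compK m := by
  have := pi_div_two_le_compK hm
  have := Real.pi_gt_three
  linarith

lemma compK_pos (hm : m ∈ Ioo (0 : ℝ) 1) : 0 < compK m := by
  have := one_le_compK hm
  linarith

lemma pi_div_four_le_compB (hm : m ∈ Ioo (0 : ℝ) 1) : Real.pi / 4 ≤ compB m := by
  rw [← integral_cos_sq_half]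
  refine intervalIntegral.integral_mono_on (by positivity)
    ((Real.continuous_cos.pow 2).intervalIntegrable _ _)
    ((continuous_div_dlt (Real.continuous_cos.pow 2) hm.2).intervalIntegrable _ _) fun y _ => ?_
  have h1 := one_le_inv_dlt hm y
  rw [div_eq_mul_one_div]
  exact le_mul_of_one_le_right (sq_nonneg _) h1

lemma half_le_compB (hm : m ∈ Ioo (0 : ℝ) 1) : 1 / 2 ≤ compB m := by
  have := pi_div_four_le_compB hm
  have := Real.pi_gt_three
  linarith

lemma compB_le_one (hm : m ∈ Ioo (0 : ℝ) 1) : compB m ≤ 1 := by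
  have h : ∫ y in (0)..(Real.pi / 2), Real.cos y = 1 := by rw [integral_cos]; simp
  rw [← h]
  refine intervalIntegral.integral_mono_on (by positivity)
    ((continuous_div_dlt (Real.continuous_cos.pow 2) hm.2).intervalIntegrable _ _)
    (Real.continuous_cos.intervalIntegrable _ _) fun y hy => ?_
  have h0 : 0 ≤ Real.cos y := Real.cos_nonneg_of_mem_Icc ⟨by linarith [hy.1, Real.pi_pos], hy.2⟩
  have h1 := cos_le_dlt (φ := y) hm.2.le
  rw [abs_of_nonneg h0] at h1
  rw [div_le_iff₀ (dlt_pos hm.2 y)]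
  nlinarith

/-- At `m = 0` the difference vanishes, because `cos²` has mean `1 / 2`. The factor `m` obtained
here cancels the `1 / m` in the derivative of `compB`. -/
lemma abs_compK_sub_le (hm : m ∈ Ioo (0 : ℝ) 1) : |compK m - 2 * compB m| ≤ m * compK m := by
  have hi1 : IntervalIntegrable (fun y => 1 / dlt y m) volume 0 (Real.pi / 2) :=
    (continuous_div_dlt continuous_const hm.2).intervalIntegrable _ _
  have hi2 : IntervalIntegrable (fun y => Real.cos y ^ 2 / dlt y m) volume 0 (Real.pi / 2) :=
    (continuous_div_dlt (Real.continuous_cos.pow 2) hm.2).intervalIntegrable _ _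
  have hi3 : IntervalIntegrable (fun y => Real.cos y ^ 2) volume 0 (Real.pi / 2) :=
    (Real.continuous_cos.pow 2).intervalIntegrable _ _
  -- The integral of `1 - 2 cos²` over the quarter period is zero. Subtracting it puts a factor `1 -
  -- Δ`, which is at most `m`, into the integrand.
  have h1 : compK m - 2 * compB m
      = ∫ y in (0)..(Real.pi / 2), ((1 / dlt y m - 2 * (Real.cos y ^ 2 / dlt y m))
        - (1 - 2 * Real.cos y ^ 2)) := by
    rw [intervalIntegral.integral_sub (hi1.sub (hi2.const_mul 2))
      (intervalIntegrable_const.sub (hi3.const_mul 2)),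
      intervalIntegral.integral_sub hi1 (hi2.const_mul 2),
      intervalIntegral.integral_sub intervalIntegrable_const (hi3.const_mul 2),
      intervalIntegral.integral_const_mul, intervalIntegral.integral_const_mul,
      integral_cos_sq_half]
    simp [compK, compB, ellF, ellB, ellI]
    ring
  have h2 : m * compK m = ∫ y in (0)..(Real.pi / 2), m * (1 / dlt y m) := by
    rw [intervalIntegral.integral_const_mul]; rfl
  rw [h1, h2]
  refine (intervalIntegral.abs_integral_le_integral_abs (by positivity)).trans ?_
  refine intervalIntegral.integral_mono_on (by positivity)
    ((hi1.sub (hi2.const_mul 2)).sub (intervalIntegrable_const.sub (hi3.const_mul 2))).abs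
    (hi1.const_mul m) fun y _ => ?_
  have hd := dlt_pos hm.2 y
  have hd1 := dlt_le_one hm.1.le y
  have hd2 := dlt_sq hm.2 y
  have hs := Real.sin_sq_le_one y
  have hs0 := sq_nonneg (Real.sin y)
  have e : 1 / dlt y m - 2 * (Real.cos y ^ 2 / dlt y m) - (1 - 2 * Real.cos y ^ 2)
      = (1 - 2 * Real.cos y ^ 2) * (1 - dlt y m) * (1 / dlt y m) := by field_simp
  rw [e, abs_mul, abs_mul, abs_of_pos (by positivity : 0 < 1 / dlt y m)]
  refine mul_le_mul_of_nonneg_right ?_ (by positivity)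
  have h3 : |1 - 2 * Real.cos y ^ 2| ≤ 1 := by
    rw [Real.cos_sq', abs_le]; constructor <;> nlinarith
  have h4 : |1 - dlt y m| ≤ m := by
    rw [abs_of_nonneg (by linarith)]
    have := hm.1
    nlinarith
  calc _ ≤ 1 * m := by gcongr
    _ = m := one_mul m

/-! ### The Jacobi functions and the zeta function -/

/-- `sin` of the amplitude. -/
def sn (u m : ℝ) : ℝ := Real.sin (am u m)

/-- `cos` of the amplitude. -/
def cn (u m : ℝ) : ℝ := Real.cos (am u m)

/-- The delta amplitude. -/
def dn (u m : ℝ) : ℝ := dlt (am u m) m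

/-- The periodic primitive of `cn² - B / K` (Jacobi's zeta function divided by `m`). -/
def zet (u m : ℝ) : ℝ := ellB (am u m) m - compB m / compK m * u

lemma sn_sq_add_cn_sq (u m : ℝ) : sn u m ^ 2 + cn u m ^ 2 = 1 := Real.sin_sq_add_cos_sq _

lemma dn_sq (hm : m < 1) (u : ℝ) : dn u m ^ 2 = 1 - m * sn u m ^ 2 := dlt_sq hm _

lemma dn_pos (hm : m < 1) (u : ℝ) : 0 < dn u m := dlt_pos hm _

lemma dn_le_one (hm : 0 ≤ m) (u : ℝ) : dn u m ≤ 1 := dlt_le_one hm _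

lemma abs_sn_le (u m : ℝ) : |sn u m| ≤ 1 := Real.abs_sin_le_one _

lemma abs_cn_le (u m : ℝ) : |cn u m| ≤ 1 := Real.abs_cos_le_one _

lemma abs_dn_le (hm : m ∈ Ioo (0 : ℝ) 1) (u : ℝ) : |dn u m| ≤ 1 := by
  rw [abs_of_pos (dn_pos hm.2 u)]; exact dn_le_one hm.1.le u

/-- The logarithmic derivative of `K`. -/
def logK (m : ℝ) : ℝ := compB m / (2 * (1 - m) * compK m)

/-- The derivative of the amplitude with respect to `m` at a fixed phase `u / (2 K)`. -/
def amD (u m : ℝ) : ℝ := (sn u m * cn u m - dn u m * zet u m) / (2 * (1 - m))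

/-- `g` is differentiable along curves `(c(m), m)`: `gD` is its derivative in `m` at a fixed phase
`u / (2 K)`, and `gU` its derivative in `u`. -/
def HasD (g gD gU : ℝ → ℝ → ℝ) : Prop :=
  ∀ m ∈ Ioo (0 : ℝ) 1, ∀ (c : ℝ → ℝ) (c' : ℝ), HasDerivAt c c' m →
    HasDerivAt (fun n => g (c n) n) (gD (c m) m + gU (c m) m * (c' - c m * logK m)) m

/-- For `c = 2 K σ` with constant `σ` one has `c' = c logK`, so `amD` is the derivative at fixed
phase. At fixed `u` the derivative contains `ellB`, which grows linearly in `u`. Passing to the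
phase removes this secular part `(B / K) u` and leaves the periodic function `zet`. -/
lemma hasD_am : HasD am amD dn := by
  intro m hm c c' hc
  refine (hasDerivAt_am_comp hm hc).congr_deriv ?_
  have h1 := dlt_pos hm.2 (am (c m) m)
  have h2 : 1 - m ≠ 0 := by linarith [hm.2]
  have h3 := (compK_pos hm).ne'
  simp only [amD, logK, sn, cn, dn, zet]
  field_simp
  ring

lemma hasD_sn : HasD sn (fun u m => cn u m * amD u m) (fun u m => cn u m * dn u m) := by
  intro m hm c c' hc
  refine (hasD_am m hm c c' hc).sin.congr_deriv ?_
  simp only [cn]; ring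

lemma hasD_cn : HasD cn (fun u m => -(sn u m * amD u m)) (fun u m => -(sn u m * dn u m)) := by
  intro m hm c c' hc
  refine (hasD_am m hm c c' hc).cos.congr_deriv ?_
  simp only [sn]; ring

/-- The derivative of `dn` in `m` at a fixed phase. -/
def dnD (u m : ℝ) : ℝ :=
  -(sn u m ^ 2 * dn u m - m * sn u m * cn u m * zet u m) / (2 * (1 - m))

lemma hasD_dn : HasD dn dnD (fun u m => -(m * sn u m * cn u m)) := by
  intro m hm c c' hc
  have h1 := ((hasDerivAt_id m).mul ((hasD_sn m hm c c' hc).fun_pow 2)).const_sub 1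
  have h2 := h1.sqrt (one_sub_mul_sin_sq_pos hm.2 _).ne'
  refine h2.congr_deriv ?_
  have hd : √(1 - m * sn (c m) m ^ 2) = dn (c m) m := rfl
  simp only [Pi.mul_apply, id, hd]
  have h3 := dn_pos hm.2 (c m)
  have h4 : 1 - m ≠ 0 := by linarith [hm.2]
  have h5 := dn_sq hm.2 (c m)
  have h6 := sn_sq_add_cn_sq (c m) m
  simp only [dnD, amD]
  field_simp
  simp only [Nat.cast_ofNat, Nat.add_one_sub_one, pow_one]
  linear_combination 2 * sn (c m) m ^ 2 * h5 - 2 * m * sn (c m) m ^ 2 * h6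

/-- The derivative of `zet` in `m` at a fixed phase. -/
def zetD (u m : ℝ) : ℝ := (dn u m * amD u m - zet u m / 2) / m

/-- The derivative of `zet` in `u`. -/
def zetU (u m : ℝ) : ℝ := cn u m ^ 2 - compB m / compK m

lemma hasD_zet : HasD zet zetD zetU := by
  intro m hm c c' hc
  have h1 := hasDerivAt_ellB_comp hm (hasD_am m hm c c' hc)
  have h2 := ((hasDerivAt_compB hm.2 hm.1.ne').fun_div (hasDerivAt_compK hm.2)
    (compK_pos hm).ne').fun_mul hc
  refine (h1.fun_sub h2).congr_deriv ?_
  rw [ellF_am hm]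
  have h3 := dn_pos hm.2 (c m)
  have h4 : 1 - m ≠ 0 := by linarith [hm.2]
  have h5 := dn_sq hm.2 (c m)
  have h6 := sn_sq_add_cn_sq (c m) m
  have h7 := (compK_pos hm).ne'
  have h8 := hm.1.ne'
  have h9 : ellB (am (c m) m) m = zet (c m) m + compB m / compK m * c m := by simp [zet]
  rw [h9]
  change _ / (2 * m) + cn (c m) m ^ 2 / dn (c m) m * _ - _ = _
  change (_ - _ + sn (c m) m * cn (c m) m / dn (c m) m) / (2 * m) + _ - _ = _
  simp only [zetD, zetU, amD, logK]
  generalize zet (c m) m = z at *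
  generalize sn (c m) m = s at *
  generalize cn (c m) m = x at *
  generalize dn (c m) m = d at *
  have h10 : m * s ^ 2 = 1 - d ^ 2 := by linarith
  have h11 : m * x ^ 2 = d ^ 2 - (1 - m) := by linear_combination m * h6 - h10
  have hP : (s * x - d * z) = 2 * (1 - m) * ((s * x - d * z) / (2 * (1 - m))) := by field_simp
  generalize (s * x - d * z) / (2 * (1 - m)) = P at *
  -- This collects the fixed-phase terms. With `P` in place of `amD` and `m x² = d² - (1 - m)`, the
  -- quotients by `d` disappear and the shape of `zetD` emerges.
  have key : x ^ 2 / d * P + s * x / d / (2 * m) = d * P / m + z / (2 * m) := by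
    field_simp
    linear_combination hP + 2 * P * h11
  have e1 : (c m - 2 * (z + compB m / compK m * c m) + s * x / d) / (2 * m)
      + x ^ 2 / d * (P + d * (c' - c m * (compB m / (2 * (1 - m) * compK m))))
      = (x ^ 2 / d * P + s * x / d / (2 * m)) + (c m - 2 * (z + compB m / compK m * c m)) / (2 * m)
        + x ^ 2 * (c' - c m * (compB m / (2 * (1 - m) * compK m))) := by
    field_simp
    ring
  rw [e1, key]
  field_simp
  ring

end

section

/-! ### Calculus of derivatives along curves -/

namespace HasD

variable {f fD fU g gD gU : ℝ → ℝ → ℝ}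

lemma congr {fD' fU' : ℝ → ℝ → ℝ} (h : HasD f fD fU)
    (hD : ∀ m ∈ Ioo (0 : ℝ) 1, ∀ u, fD u m = fD' u m)
    (hU : ∀ m ∈ Ioo (0 : ℝ) 1, ∀ u, fU u m = fU' u m) : HasD f fD' fU' := by
  intro m hm c c' hc
  rw [← hD m hm, ← hU m hm]
  exact h m hm c c' hc

lemma congr_left {f' : ℝ → ℝ → ℝ} (h : HasD f fD fU)
    (hf : ∀ m ∈ Ioo (0 : ℝ) 1, ∀ u, f u m = f' u m) : HasD f' fD fU := by
  intro m hm c c' hc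
  refine (h m hm c c' hc).congr_of_eventuallyEq ?_
  filter_upwards [Ioo_mem_nhds hm.1 hm.2] with n hn
  exact (hf n hn _).symm

lemma of_hasDerivAt {x x' : ℝ → ℝ} (h : ∀ m ∈ Ioo (0 : ℝ) 1, HasDerivAt x (x' m) m) :
    HasD (fun _ m => x m) (fun _ m => x' m) (fun _ _ => 0) := by
  intro m hm c c' _
  simpa using h m hm

lemma const (a : ℝ) : HasD (fun _ _ => a) (fun _ _ => 0) (fun _ _ => 0) :=
  of_hasDerivAt fun m _ => hasDerivAt_const m a

lemma add (hf : HasD f fD fU) (hg : HasD g gD gU) :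
    HasD (fun u m => f u m + g u m) (fun u m => fD u m + gD u m)
      (fun u m => fU u m + gU u m) := by
  intro m hm c c' hc
  exact ((hf m hm c c' hc).fun_add (hg m hm c c' hc)).congr_deriv (by ring)

lemma sub (hf : HasD f fD fU) (hg : HasD g gD gU) :
    HasD (fun u m => f u m - g u m) (fun u m => fD u m - gD u m)
      (fun u m => fU u m - gU u m) := by
  intro m hm c c' hc
  exact ((hf m hm c c' hc).fun_sub (hg m hm c c' hc)).congr_deriv (by ring)

lemma neg (hf : HasD f fD fU) :
    HasD (fun u m => -f u m) (fun u m => -fD u m) (fun u m => -fU u m) := by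
  intro m hm c c' hc
  exact (hf m hm c c' hc).fun_neg.congr_deriv (by ring)

lemma mul (hf : HasD f fD fU) (hg : HasD g gD gU) :
    HasD (fun u m => f u m * g u m) (fun u m => fD u m * g u m + f u m * gD u m)
      (fun u m => fU u m * g u m + f u m * gU u m) := by
  intro m hm c c' hc
  exact ((hf m hm c c' hc).fun_mul (hg m hm c c' hc)).congr_deriv (by ring)

lemma inv (hf : HasD f fD fU) (h0 : ∀ m ∈ Ioo (0 : ℝ) 1, ∀ u, f u m ≠ 0) :
    HasD (fun u m => (f u m)⁻¹) (fun u m => -fD u m / f u m ^ 2)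
      (fun u m => -fU u m / f u m ^ 2) := by
  intro m hm c c' hc
  exact ((hf m hm c c' hc).fun_inv (h0 m hm _)).congr_deriv (by ring)

end HasD

/-- `g` has two derivatives in `m` at fixed phase, which together with `g` are bounded by multiples
of the weights `w₀`, `w₁`, `w₂`. -/
def JetBound (w₀ w₁ w₂ : ℝ → ℝ) (g g₁ g₂ : ℝ → ℝ → ℝ) : Prop :=
  (∃ gU, HasD g g₁ gU) ∧ (∃ gU, HasD g₁ g₂ gU) ∧ ∃ C, 0 ≤ C ∧ ∀ m ∈ Ioo (0 : ℝ) 1, ∀ u,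
    |g u m| ≤ C * w₀ m ∧ |g₁ u m| ≤ C * w₁ m ∧ |g₂ u m| ≤ C * w₂ m

/-- The existential version of `JetBound`. -/
def IsJet (w₀ w₁ w₂ : ℝ → ℝ) (g : ℝ → ℝ → ℝ) : Prop := ∃ g₁ g₂, JetBound w₀ w₁ w₂ g g₁ g₂

variable {w₀ w₁ w₂ v₀ v₁ v₂ : ℝ → ℝ} {f g : ℝ → ℝ → ℝ}

lemma IsJet.mono (h : IsJet w₀ w₁ w₂ g) {c : ℝ} (hc : 0 ≤ c)
    (h₀ : ∀ m ∈ Ioo (0 : ℝ) 1, w₀ m ≤ c * v₀ m) (h₁ : ∀ m ∈ Ioo (0 : ℝ) 1, w₁ m ≤ c * v₁ m)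
    (h₂ : ∀ m ∈ Ioo (0 : ℝ) 1, w₂ m ≤ c * v₂ m) : IsJet v₀ v₁ v₂ g := by
  obtain ⟨g₁, g₂, hu, hu1, C, hC, hb⟩ := h
  refine ⟨g₁, g₂, hu, hu1, C * c, by positivity, fun m hm u => ?_⟩
  obtain ⟨b0, b1, b2⟩ := hb m hm u
  refine ⟨b0.trans ?_, b1.trans ?_, b2.trans ?_⟩ <;> rw [mul_assoc]
  · exact mul_le_mul_of_nonneg_left (h₀ m hm) hC
  · exact mul_le_mul_of_nonneg_left (h₁ m hm) hC
  · exact mul_le_mul_of_nonneg_left (h₂ m hm) hC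

lemma IsJet.add (hf : IsJet w₀ w₁ w₂ f) (hg : IsJet w₀ w₁ w₂ g) :
    IsJet w₀ w₁ w₂ (fun u m => f u m + g u m) := by
  obtain ⟨f₁, f₂, ⟨_, hf0⟩, ⟨_, hf1⟩, C, hC, hb⟩ := hf
  obtain ⟨g₁, g₂, ⟨_, hg0⟩, ⟨_, hg1⟩, D, hD, hd⟩ := hg
  refine ⟨_, _, ⟨_, hf0.add hg0⟩, ⟨_, hf1.add hg1⟩, C + D, by positivity, fun m hm u => ?_⟩
  obtain ⟨b0, b1, b2⟩ := hb m hm u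
  obtain ⟨d0, d1, d2⟩ := hd m hm u
  refine ⟨?_, ?_, ?_⟩ <;> refine (abs_add_le _ _).trans ?_ <;> linarith

lemma abs_mul_le_of_le {x y a b : ℝ} (hx : |x| ≤ a) (hy : |y| ≤ b) : |x * y| ≤ a * b := by
  rw [abs_mul]
  exact mul_le_mul hx hy (abs_nonneg _) ((abs_nonneg _).trans hx)

lemma IsJet.mul (hf : IsJet w₀ w₁ w₂ f) (hg : IsJet v₀ v₁ v₂ g) :
    IsJet (fun m => w₀ m * v₀ m) (fun m => w₁ m * v₀ m + w₀ m * v₁ m)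
      (fun m => w₂ m * v₀ m + 2 * (w₁ m * v₁ m) + w₀ m * v₂ m) (fun u m => f u m * g u m) := by
  obtain ⟨f₁, f₂, ⟨_, hf0⟩, ⟨_, hf1⟩, C, hC, hb⟩ := hf
  obtain ⟨g₁, g₂, ⟨_, hg0⟩, ⟨_, hg1⟩, D, hD, hd⟩ := hg
  refine ⟨_, _, ⟨_, hf0.mul hg0⟩, ⟨_, (hf1.mul hg0).add (hf0.mul hg1)⟩, C * D, by positivity,
    fun m hm u => ?_⟩
  obtain ⟨b0, b1, b2⟩ := hb m hm u
  obtain ⟨d0, d1, d2⟩ := hd m hm u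
  have e00 := abs_mul_le_of_le b0 d0
  have e10 := abs_mul_le_of_le b1 d0
  have e01 := abs_mul_le_of_le b0 d1
  have e20 := abs_mul_le_of_le b2 d0
  have e11 := abs_mul_le_of_le b1 d1
  have e02 := abs_mul_le_of_le b0 d2
  refine ⟨e00.trans (by linarith), (abs_add_le _ _).trans (by linarith), ?_⟩
  refine (abs_add_le _ _).trans ((add_le_add (abs_add_le _ _) (abs_add_le _ _)).trans (by linarith))

lemma IsJet.inv (hf : IsJet w₀ w₁ w₂ f) {c : ℝ} (hc : 0 < c) (hw : ∀ m ∈ Ioo (0 : ℝ) 1, 0 < w₀ m)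
    (hw₁ : ∀ m ∈ Ioo (0 : ℝ) 1, 0 ≤ w₁ m) (hw₂ : ∀ m ∈ Ioo (0 : ℝ) 1, 0 ≤ w₂ m)
    (hcf : ∀ m ∈ Ioo (0 : ℝ) 1, ∀ u, c * w₀ m ≤ |f u m|) :
    IsJet (fun m => (w₀ m)⁻¹) (fun m => w₁ m / w₀ m ^ 2)
      (fun m => w₂ m / w₀ m ^ 2 + w₁ m ^ 2 / w₀ m ^ 3) (fun u m => (f u m)⁻¹) := by
  obtain ⟨f₁, f₂, ⟨_, hf0⟩, ⟨_, hf1⟩, C, hC, hb⟩ := hf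
  have h0 : ∀ m ∈ Ioo (0 : ℝ) 1, ∀ u, f u m ≠ 0 := fun m hm u => by
    have := mul_pos hc (hw m hm)
    exact abs_pos.1 (this.trans_le (hcf m hm u))
  have hi := hf0.inv h0
  have hi1 : HasD (fun u m => -f₁ u m / f u m ^ 2)
      (fun u m => -f₂ u m / f u m ^ 2 + 2 * f₁ u m ^ 2 / f u m ^ 3) _ :=
    ((hf1.neg.mul (hi.mul hi)).congr (fun m hm u => by field_simp [h0 m hm u]; ring)
      (fun m hm u => rfl)).congr_left (fun m hm u => by field_simp [h0 m hm u])
  refine ⟨_, _, ⟨_, hi⟩, ⟨_, hi1⟩, c⁻¹ + C / c ^ 2 + (C / c ^ 2 + 2 * C ^ 2 / c ^ 3), by positivity,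
    fun m hm u => ?_⟩
  obtain ⟨b0, b1, b2⟩ := hb m hm u
  have hW := hw m hm
  have hF := hcf m hm u
  have hF0 : 0 < |f u m| := abs_pos.2 (h0 m hm u)
  have w1 := hw₁ m hm
  have w2 := hw₂ m hm
  have hF2 : c ^ 2 * w₀ m ^ 2 ≤ |f u m| ^ 2 := by
    rw [← mul_pow]; gcongr
  have hF3 : c ^ 3 * w₀ m ^ 3 ≤ |f u m| ^ 3 := by
    rw [← mul_pow]; gcongr
  have e0 : |(f u m)⁻¹| ≤ c⁻¹ * (w₀ m)⁻¹ := by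
    rw [abs_inv, ← mul_inv]
    exact inv_anti₀ (by positivity) hF
  have e1 : |-f₁ u m / f u m ^ 2| ≤ C / c ^ 2 * (w₁ m / w₀ m ^ 2) := by
    rw [abs_div, abs_neg, abs_pow, div_mul_div_comm]
    exact div_le_div₀ (by positivity) b1 (by positivity) hF2
  have e2 : |-f₂ u m / f u m ^ 2| ≤ C / c ^ 2 * (w₂ m / w₀ m ^ 2) := by
    rw [abs_div, abs_neg, abs_pow, div_mul_div_comm]
    exact div_le_div₀ (by positivity) b2 (by positivity) hF2
  have e3 : |2 * f₁ u m ^ 2 / f u m ^ 3| ≤ 2 * C ^ 2 / c ^ 3 * (w₁ m ^ 2 / w₀ m ^ 3) := by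
    rw [abs_div, abs_mul, abs_pow, abs_pow, div_mul_div_comm, abs_two, mul_assoc, ← mul_pow]
    exact div_le_div₀ (by positivity) (by gcongr) (by positivity) hF3
  have n1 : 0 ≤ w₁ m / w₀ m ^ 2 := by positivity
  have n2 : 0 ≤ w₂ m / w₀ m ^ 2 := by positivity
  have n3 : 0 ≤ w₁ m ^ 2 / w₀ m ^ 3 := by positivity
  have k0 : 0 ≤ c⁻¹ := by positivity
  have k1 : 0 ≤ C / c ^ 2 := by positivity
  have k2 : 0 ≤ 2 * C ^ 2 / c ^ 3 := by positivity
  refine ⟨e0.trans ?_, e1.trans ?_, (abs_add_le _ _).trans ((add_le_add e2 e3).trans ?_)⟩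
  · gcongr
    linarith
  · gcongr
    linarith
  · rw [mul_add]
    gcongr <;> linarith

/-- Jets for which each derivative costs a factor `τ`, and the second one a further `1 / ℓ`. -/
def EJet (ℓ τ w : ℝ → ℝ) (g : ℝ → ℝ → ℝ) : Prop :=
  IsJet w (fun m => w m * τ m) (fun m => w m * τ m ^ 2 / ℓ m) g

/-- Jets with an additional factor `ℓ`, which may be lost in the first derivative. -/
def AJet (ℓ τ w : ℝ → ℝ) (g : ℝ → ℝ → ℝ) : Prop :=
  IsJet (fun m => w m * ℓ m) (fun m => w m * τ m) (fun m => w m * τ m ^ 2) g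

/-- The requirements on the loss functions of `EJet` and `AJet`. -/
def IsLoss (ℓ τ : ℝ → ℝ) : Prop := ∀ m ∈ Ioo (0 : ℝ) 1, 0 < ℓ m ∧ ℓ m ≤ 1 ∧ 1 ≤ τ m

/-! ### Algebra of jets with prescribed losses. -/

section Classes

variable {ℓ τ w v : ℝ → ℝ}

lemma EJet.mono (hℓ : IsLoss ℓ τ) (hg : EJet ℓ τ w g) {c : ℝ} (hc : 0 ≤ c)
    (h : ∀ m ∈ Ioo (0 : ℝ) 1, w m ≤ c * v m) : EJet ℓ τ v g := by
  refine IsJet.mono hg hc h (fun m hm => ?_) (fun m hm => ?_) <;> obtain ⟨h1, h2, h3⟩ := hℓ m hm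
  · rw [← mul_assoc]
    exact mul_le_mul_of_nonneg_right (h m hm) (by linarith)
  · rw [← mul_div_assoc, ← mul_assoc]
    have := h m hm
    gcongr

/-- In the second derivative the cross term costs only `τ²`, which is below `τ² / ℓ` since `ℓ ≤ 1`;
the class is therefore closed under products. -/
lemma EJet.mul (hℓ : IsLoss ℓ τ) (hw : ∀ m ∈ Ioo (0 : ℝ) 1, 0 ≤ w m)
    (hv : ∀ m ∈ Ioo (0 : ℝ) 1, 0 ≤ v m) (hf : EJet ℓ τ w f) (hg : EJet ℓ τ v g) :
    EJet ℓ τ (fun m => w m * v m) (fun u m => f u m * g u m) := by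
  refine (IsJet.mul hf hg).mono (c := 4) (by norm_num) (fun m hm => ?_) (fun m hm => ?_)
    (fun m hm => ?_)
  all_goals
    have h1 := mul_nonneg (hw m hm) (hv m hm)
    obtain ⟨hl, hl1, ht⟩ := hℓ m hm
    have ht0 : 0 ≤ τ m := by linarith
  · linarith
  · have := mul_nonneg h1 ht0
    linarith
  · have h2 : 0 ≤ w m * v m * τ m ^ 2 := by positivity
    have h3 : w m * v m * τ m ^ 2 ≤ w m * v m * τ m ^ 2 / ℓ m := le_div_self h2 hl hl1
    have e : w m * τ m ^ 2 / ℓ m * v m + 2 * (w m * τ m * (v m * τ m)) + w m * (v m * τ m ^ 2 / ℓ m)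
      = 2 * (w m * v m * τ m ^ 2 / ℓ m) + 2 * (w m * v m * τ m ^ 2) := by ring
    rw [e]
    linarith

/-- The factor `ℓ` in the size of `g` cancels the `1 / ℓ` in the second derivative of `f`. All three
contributions to the second derivative then cost only `τ²`. -/
lemma EJet.mul_aJet (hℓ : IsLoss ℓ τ) (hw : ∀ m ∈ Ioo (0 : ℝ) 1, 0 ≤ w m)
    (hv : ∀ m ∈ Ioo (0 : ℝ) 1, 0 ≤ v m) (hf : EJet ℓ τ w f) (hg : AJet ℓ τ v g) :
    AJet ℓ τ (fun m => w m * v m) (fun u m => f u m * g u m) := by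
  refine (IsJet.mul hf hg).mono (c := 4) (by norm_num) (fun m hm => ?_) (fun m hm => ?_)
    (fun m hm => ?_)
  all_goals
    have h1 := mul_nonneg (hw m hm) (hv m hm)
    obtain ⟨hl, hl1, ht⟩ := hℓ m hm
    have ht0 : 0 ≤ τ m := by linarith
  · have := mul_nonneg h1 hl.le
    linarith
  · have h2 := mul_nonneg h1 ht0
    have h3 := mul_le_of_le_one_right h2 hl1
    have e : w m * τ m * (v m * ℓ m) + w m * (v m * τ m)
      = w m * v m * τ m * ℓ m + w m * v m * τ m := by ring
    rw [e]
    linarith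
  · have h2 : 0 ≤ w m * v m * τ m ^ 2 := by positivity
    have e : w m * τ m ^ 2 / ℓ m * (v m * ℓ m) + 2 * (w m * τ m * (v m * τ m))
        + w m * (v m * τ m ^ 2) = 4 * (w m * v m * τ m ^ 2) := by field_simp; ring
    rw [e]

lemma AJet.eJet (hℓ : IsLoss ℓ τ) (hw : ∀ m ∈ Ioo (0 : ℝ) 1, 0 ≤ w m) (hg : AJet ℓ τ w g) :
    EJet ℓ τ w g := by
  refine IsJet.mono hg (c := 1) zero_le_one (fun m hm => ?_) (fun m hm => ?_) (fun m hm => ?_)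
  all_goals obtain ⟨hl, hl1, ht⟩ := hℓ m hm
  · rw [one_mul]; exact mul_le_of_le_one_right (hw m hm) hl1
  · rw [one_mul]
  · rw [one_mul]
    have := hw m hm
    exact le_div_self (by positivity) hl hl1

lemma EJet.inv (hℓ : IsLoss ℓ τ) (hw : ∀ m ∈ Ioo (0 : ℝ) 1, 0 < w m) (hf : EJet ℓ τ w f) {c : ℝ}
    (hc : 0 < c) (hcf : ∀ m ∈ Ioo (0 : ℝ) 1, ∀ u, c * w m ≤ |f u m|) :
    EJet ℓ τ (fun m => (w m)⁻¹) (fun u m => (f u m)⁻¹) := by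
  have hτ : ∀ m ∈ Ioo (0 : ℝ) 1, 0 ≤ τ m := fun m hm => by linarith [(hℓ m hm).2.2]
  refine (IsJet.inv hf hc hw (fun m hm => mul_nonneg (hw m hm).le (hτ m hm))
    (fun m hm => ?_) hcf).mono (c := 2) (by norm_num) (fun m hm => ?_) (fun m hm => ?_)
    (fun m hm => ?_)
  · exact div_nonneg (mul_nonneg (hw m hm).le (sq_nonneg _)) (hℓ m hm).1.le
  all_goals
    obtain ⟨hl, hl1, ht⟩ := hℓ m hm
    have hw0 := hw m hm
    have ht0 := hτ m hm
  · have : 0 < (w m)⁻¹ := by positivity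
    linarith
  · have e : w m * τ m / w m ^ 2 = (w m)⁻¹ * τ m := by field_simp
    have : 0 ≤ (w m)⁻¹ * τ m := by positivity
    rw [e]
    linarith
  · have e : w m * τ m ^ 2 / ℓ m / w m ^ 2 + (w m * τ m) ^ 2 / w m ^ 3
        = (w m)⁻¹ * τ m ^ 2 / ℓ m + (w m)⁻¹ * τ m ^ 2 := by field_simp
    have h2 : 0 ≤ (w m)⁻¹ * τ m ^ 2 := by positivity
    have h3 := le_div_self h2 hl hl1
    rw [e]
    linarith

lemma EJet.add (hf : EJet ℓ τ w f) (hg : EJet ℓ τ w g) : EJet ℓ τ w (fun u m => f u m + g u m) :=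
  IsJet.add hf hg

lemma EJet.const (hℓ : IsLoss ℓ τ) (a : ℝ) : EJet ℓ τ (fun _ => 1) (fun _ _ => a) := by
  refine ⟨_, _, ⟨_, HasD.const a⟩, ⟨_, HasD.const 0⟩, |a|, abs_nonneg a, fun m hm u => ?_⟩
  obtain ⟨hl, hl1, ht⟩ := hℓ m hm
  refine ⟨by simp, ?_, ?_⟩ <;> rw [abs_zero] <;> positivity

lemma EJet.of_hasDerivAt {x x₁ x₂ : ℝ → ℝ} (h₁ : ∀ m ∈ Ioo (0 : ℝ) 1, HasDerivAt x (x₁ m) m)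
    (h₂ : ∀ m ∈ Ioo (0 : ℝ) 1, HasDerivAt x₁ (x₂ m) m) {C : ℝ} (hC : 0 ≤ C)
    (hb : ∀ m ∈ Ioo (0 : ℝ) 1, |x m| ≤ C * w m ∧ |x₁ m| ≤ C * (w m * τ m) ∧
      |x₂ m| ≤ C * (w m * τ m ^ 2 / ℓ m)) : EJet ℓ τ w (fun _ m => x m) :=
  ⟨_, _, ⟨_, HasD.of_hasDerivAt h₁⟩, ⟨_, HasD.of_hasDerivAt h₂⟩, C, hC, fun m hm _ => hb m hm⟩

end Classes

/-! ### Oscillatory integrals -/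

lemma hasDerivAt_primitive {g : ℝ → ℝ} {α β : ℝ} (hα : 0 < α) (hβ : β < 1)
    (hg : ContinuousOn g (Ioo 0 1)) {x : ℝ} (hx : x ∈ Icc α β) :
    HasDerivAt (fun x => ∫ y in α..x, g y) (g x) x := by
  have hx' : x ∈ Ioo (0 : ℝ) 1 := ⟨hα.trans_le hx.1, hx.2.trans_lt hβ⟩
  have hsub : uIcc α x ⊆ Ioo 0 1 := by
    rw [uIcc_of_le hx.1]
    exact fun y hy => ⟨hα.trans_le hy.1, hy.2.trans_lt hx'.2⟩
  exact intervalIntegral.integral_hasDerivAt_right (hg.mono hsub).intervalIntegrable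
    (hg.stronglyMeasurableAtFilter isOpen_Ioo x hx')
    (hg.continuousAt (Ioo_mem_nhds hx'.1 hx'.2))

/-- The remainder `r` is controlled only pointwise and is not assumed to be integrable. So it is not
integrated: the mean value inequality compares `H - ∫ f`, whose derivative is `r`, with a primitive
of `M`. -/
lemma abs_integral_le_of_hasDerivAt {f r M H : ℝ → ℝ} {α β : ℝ} (hαβ : α ≤ β) (hα : 0 < α)
    (hβ : β < 1) (hH : ∀ x ∈ Icc α β, HasDerivAt H (f x + r x) x) (hf : ContinuousOn f (Ioo 0 1))
    (hM : ContinuousOn M (Ioo 0 1)) (hr : ∀ x ∈ Icc α β, |r x| ≤ M x) :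
    |∫ x in α..β, f x| ≤ |H α| + |H β| + ∫ x in α..β, M x := by
  have hd : ∀ x ∈ Icc α β, HasDerivAt (fun x => H x - H α - ∫ y in α..x, f y) (r x) x :=
    fun x hx => (((hH x hx).sub_const _).sub (hasDerivAt_primitive hα hβ hf hx)).congr_deriv
      (by ring)
  have key := image_norm_le_of_norm_deriv_right_le_deriv_boundary'
    (f := fun x => H x - H α - ∫ y in α..x, f y) (f' := r) (a := α) (b := β)
    (B := fun x => ∫ y in α..x, M y) (B' := M)
    (fun x hx => (hd x hx).continuousAt.continuousWithinAt)
    (fun x hx => (hd x (Ico_subset_Icc_self hx)).hasDerivWithinAt) (by simp)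
    (fun x hx => (hasDerivAt_primitive hα hβ hM hx).continuousAt.continuousWithinAt)
    (fun x hx => (hasDerivAt_primitive hα hβ hM (Ico_subset_Icc_self hx)).hasDerivWithinAt)
    (fun x hx => hr x (Ico_subset_Icc_self hx)) (right_mem_Icc.2 hαβ)
  simp only [Real.norm_eq_abs] at key
  have h1 := abs_sub_abs_le_abs_sub (∫ x in α..β, f x) (H β - H α)
  rw [abs_sub_comm (∫ x in α..β, f x)] at h1
  have h2 := abs_sub (H β) (H α)
  linarith

/-- Exhaustion of `(0, 1)` by compact intervals. Boundary terms are split into a part `J` that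
vanishes at both ends and a part that is merely bounded by `L`. The distinction matters later: `J`
may be arbitrarily large in `t`, while `L` enters the final constant. -/
lemma abs_setIntegral_le_of_hasDerivAt {f r M H J : ℝ → ℝ} {L : ℝ}
    (hH : ∀ x ∈ Ioo (0 : ℝ) 1, HasDerivAt H (f x + r x) x) (hf : ContinuousOn f (Ioo 0 1))
    (hfi : IntegrableOn f (Ioo 0 1)) (hM : ContinuousOn M (Ioo 0 1))
    (hMi : IntegrableOn M (Ioo 0 1)) (hr : ∀ x ∈ Ioo (0 : ℝ) 1, |r x| ≤ M x)
    (hJ : ∀ x ∈ Ioo (0 : ℝ) 1, |H x| ≤ J x + L) (hJ0 : Tendsto J (𝓝[>] 0) (𝓝 0))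
    (hJ1 : Tendsto J (𝓝[<] 1) (𝓝 0)) :
    |∫ x in Ioo (0 : ℝ) 1, f x| ≤ 2 * L + ∫ x in Ioo (0 : ℝ) 1, M x := by
  obtain ⟨a, -, ha, ha0⟩ := exists_seq_strictAnti_tendsto' (zero_lt_one (α := ℝ))
  have hbt : Tendsto (fun n => 1 - a n / 2) atTop (𝓝 1) := by
    simpa using (ha0.div_const 2).const_sub 1
  have hat : Tendsto (fun n => a n / 2) atTop (𝓝 0) := by simpa using ha0.div_const 2
  have lim : ∀ g : ℝ → ℝ, IntegrableOn g (Ioo 0 1) →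
      Tendsto (fun n => ∫ x in (a n / 2)..(1 - a n / 2), g x) atTop
        (𝓝 (∫ x in Ioo (0 : ℝ) 1, g x)) := by
    intro g hg
    have hcov := aecover_Ioo_of_Ioc (μ := volume) hat hbt
    refine (hcov.integral_tendsto_of_countably_generated hg).congr fun n => ?_
    have := ha n
    rw [intervalIntegral.integral_of_le (by linarith [this.1, this.2]), Measure.restrict_restrict
      measurableSet_Ioc, inter_eq_self_of_subset_left]
    intro y hy
    exact ⟨by linarith [hy.1, this.1], by linarith [hy.2, this.1]⟩
  have t0 : Tendsto (fun n => J (a n / 2)) atTop (𝓝 0) := by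
    refine hJ0.comp (tendsto_nhdsWithin_iff.2 ⟨hat, Eventually.of_forall fun n => ?_⟩)
    have := (ha n).1
    simp only [mem_Ioi]
    linarith
  have t1 : Tendsto (fun n => J (1 - a n / 2)) atTop (𝓝 0) := by
    refine hJ1.comp (tendsto_nhdsWithin_iff.2 ⟨hbt, Eventually.of_forall fun n => ?_⟩)
    have := (ha n).1
    simp only [mem_Iio]
    linarith
  refine le_of_tendsto_of_tendsto (lim f hfi).abs
    (b := atTop) (g := fun n => (J (a n / 2) + L) + (J (1 - a n / 2) + L)
      + ∫ x in (a n / 2)..(1 - a n / 2), M x) ?_ (Eventually.of_forall fun n => ?_)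
  · have := ((t0.add_const L).add (t1.add_const L)).add (lim M hMi)
    refine this.trans (le_of_eq ?_)
    congr 1
    ring
  · obtain ⟨hn0, hn1⟩ := ha n
    have hs : ∀ x ∈ Icc (a n / 2) (1 - a n / 2), x ∈ Ioo (0 : ℝ) 1 := fun x hx =>
      ⟨by linarith [hx.1], by linarith [hx.2]⟩
    have := abs_integral_le_of_hasDerivAt (by linarith : a n / 2 ≤ 1 - a n / 2) (by linarith)
      (by linarith) (fun x hx => hH x (hs x hx)) hf hM (fun x hx => hr x (hs x hx))
    have h1 := hJ (a n / 2) ⟨by linarith, by linarith⟩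
    have h2 := hJ (1 - a n / 2) ⟨by linarith, by linarith⟩
    simp only
    linarith

/-- `g` has two derivatives `g₁`, `g₂` in the phase `σ = u / (2 K)`, its derivative in `m` at fixed
phase has one, and the derivatives in `m` at fixed phase are those of an `EJet`. -/
def PhaseJet (ℓ τ w w₁ : ℝ → ℝ) (g g₁ g₂ : ℝ → ℝ → ℝ) : Prop :=
  ∃ p p₁ p₂ : ℝ → ℝ → ℝ, HasD g p (fun u m => g₁ u m / (2 * compK m)) ∧
    HasD g₁ p₁ (fun u m => g₂ u m / (2 * compK m)) ∧
    HasD p p₂ (fun u m => p₁ u m / (2 * compK m)) ∧ (∃ gD gU, HasD g₂ gD gU) ∧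
    ∃ C, 0 ≤ C ∧ ∀ m ∈ Ioo (0 : ℝ) 1, ∀ u, |g u m| ≤ C * w m ∧ |p u m| ≤ C * (w m * τ m) ∧
      |p₂ u m| ≤ C * (w m * τ m ^ 2 / ℓ m) ∧ |g₁ u m| ≤ C * w₁ m

lemma hasDerivAt_compK' {m : ℝ} (hm : m ∈ Ioo (0 : ℝ) 1) :
    HasDerivAt compK (compK m * logK m) m := by
  refine (hasDerivAt_compK hm.2).congr_deriv ?_
  have := (compK_pos hm).ne'
  rw [logK]
  field_simp

lemma HasD.phase {f fD fU : ℝ → ℝ → ℝ} (h : HasD f fD fU) (σ : ℝ) {m : ℝ}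
    (hm : m ∈ Ioo (0 : ℝ) 1) :
    HasDerivAt (fun n => f (2 * compK n * σ) n) (fD (2 * compK m * σ) m) m := by
  refine (h m hm _ _ (((hasDerivAt_compK' hm).const_mul 2).mul_const σ)).congr_deriv ?_
  ring

/-- The second argument has phase `σ + t ϖ / (2 K)`. The factor `t (ϖ' - ϖ logK)` is `2 K` times the
derivative of this phase in `m`, the quantity by which an integration by parts divides. -/
lemma HasD.phase_add {f fD fU : ℝ → ℝ → ℝ} (h : HasD f fD fU) (σ t : ℝ) {ϖ : ℝ → ℝ} {ϖ' m : ℝ}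
    (hm : m ∈ Ioo (0 : ℝ) 1) (hϖ : HasDerivAt ϖ ϖ' m) :
    HasDerivAt (fun n => f (2 * compK n * σ + t * ϖ n) n)
      (fD (2 * compK m * σ + t * ϖ m) m + fU (2 * compK m * σ + t * ϖ m) m
        * (t * (ϖ' - ϖ m * logK m))) m := by
  refine (h m hm _ _ ((((hasDerivAt_compK' hm).const_mul 2).mul_const σ).add
    (hϖ.const_mul t))).congr_deriv ?_
  simp only [Pi.add_apply]
  ring

/-- Two integrations by parts. -/
theorem exists_abs_integral_le_div_sq {ℓ τ Q A W W₁ ϖ ϖ' q : ℝ → ℝ} {a g g₁ g₂ : ℝ → ℝ → ℝ}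
    (hℓ : IsLoss ℓ τ) (hQ : ∀ m ∈ Ioo (0 : ℝ) 1, 0 ≤ Q m) (hA : ∀ m ∈ Ioo (0 : ℝ) 1, 0 ≤ A m)
    (hq : EJet ℓ τ Q (fun _ m => q m)) (ha : AJet ℓ τ A a) (hg : PhaseJet ℓ τ W W₁ g g₁ g₂)
    (hϖ : ∀ m ∈ Ioo (0 : ℝ) 1, HasDerivAt ϖ (ϖ' m) m)
    (hqϖ : ∀ m ∈ Ioo (0 : ℝ) 1, q m * (ϖ' m - ϖ m * logK m) = 2 * compK m)
    (hMc : ContinuousOn (fun m => Q m ^ 2 * A m * W m * τ m ^ 2) (Ioo 0 1))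
    (hMi : IntegrableOn (fun m => Q m ^ 2 * A m * W m * τ m ^ 2) (Ioo 0 1)) {L : ℝ}
    (hL : ∀ m ∈ Ioo (0 : ℝ) 1, Q m ^ 2 * A m * W m * τ m ≤ L)
    (hJ0 : Tendsto (fun m => Q m * A m * ℓ m * W₁ m) (𝓝[>] 0) (𝓝 0))
    (hJ1 : Tendsto (fun m => Q m * A m * ℓ m * W₁ m) (𝓝[<] 1) (𝓝 0))
    (hint : ∀ t σ : ℝ, IntegrableOn (fun m => a (2 * compK m * σ) m
      * g₂ (2 * compK m * σ + t * ϖ m) m) (Ioo 0 1)) :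
    ∃ C, ∀ t > 0, ∀ σ, |∫ m in Ioo (0 : ℝ) 1, a (2 * compK m * σ) m
      * g₂ (2 * compK m * σ + t * ϖ m) m| ≤ C / t ^ 2 := by
  obtain ⟨b₁, b₂, ⟨_, hb0⟩, ⟨_, hb1⟩, Cb, hCb, hb⟩ := EJet.mul_aJet hℓ hQ hA hq ha
  obtain ⟨q₁, q₂, ⟨_, hq0⟩, -, Cq, hCq, hqb⟩ := hq
  obtain ⟨a₁, -, ⟨_, ha0⟩, -, -⟩ := ha
  obtain ⟨p, p₁, p₂, hg0, hg1, hp0, ⟨_, _, hg2⟩, Cg, hCg, hgb⟩ := hg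
  set S := Cq * Cb * Cg with hS
  refine ⟨2 * (2 * S * L) + ∫ m in Ioo (0 : ℝ) 1, 6 * S * (Q m ^ 2 * A m * W m * τ m ^ 2),
    fun t ht σ => ?_⟩
  set x : ℝ → ℝ := fun m => 2 * compK m * σ with hx
  set y : ℝ → ℝ := fun m => 2 * compK m * σ + t * ϖ m with hy
  have dq := fun m (hm : m ∈ Ioo (0 : ℝ) 1) => hq0.phase σ hm
  have da := fun m (hm : m ∈ Ioo (0 : ℝ) 1) => ha0.phase σ hm
  have db := fun m (hm : m ∈ Ioo (0 : ℝ) 1) => hb0.phase σ hm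
  have db1 := fun m (hm : m ∈ Ioo (0 : ℝ) 1) => hb1.phase σ hm
  have dg := fun m (hm : m ∈ Ioo (0 : ℝ) 1) => hg0.phase_add σ t hm (hϖ m hm)
  have dg1 := fun m (hm : m ∈ Ioo (0 : ℝ) 1) => hg1.phase_add σ t hm (hϖ m hm)
  have dg2 := fun m (hm : m ∈ Ioo (0 : ℝ) 1) => hg2.phase_add σ t hm (hϖ m hm)
  have dp := fun m (hm : m ∈ Ioo (0 : ℝ) 1) => hp0.phase_add σ t hm (hϖ m hm)
  have hcont : ContinuousOn (fun m => t ^ 2 * (a (x m) m * g₂ (y m) m)) (Ioo 0 1) :=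
    fun m hm => (((da m hm).continuousAt.mul (dg2 m hm).continuousAt).const_mul
      (t ^ 2)).continuousWithinAt
  -- The first integration by parts contributes `t q a g₁` to `H` and leaves the errors `t (q a)'
  -- g₁` and `t q a p₁`. Both are again phase derivatives; the terms `q (q a)' g` and `q (q a) p` of
  -- `H` integrate them once more, leaving `r` free of `t`. Only the first boundary term carries a
  -- factor `t`, so it must vanish at the ends and is put into `J`.
  have key := abs_setIntegral_le_of_hasDerivAt
    (f := fun m => t ^ 2 * (a (x m) m * g₂ (y m) m))
    (r := fun m => -((q₁ (x m) m * b₁ (x m) m + q m * b₂ (x m) m) * g (y m) m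
      + (2 * (q m * b₁ (x m) m) + q₁ (x m) m * (q m * a (x m) m)) * p (y m) m
      + q m * (q m * a (x m) m) * p₂ (y m) m))
    (M := fun m => 6 * S * (Q m ^ 2 * A m * W m * τ m ^ 2))
    (H := fun m => t * (q m * a (x m) m * g₁ (y m) m)
      - (q m * b₁ (x m) m * g (y m) m + q m * (q m * a (x m) m) * p (y m) m))
    (J := fun m => t * Cb * Cg * (Q m * A m * ℓ m * W₁ m)) (L := 2 * S * L)
    (fun m hm => ?_) hcont ((hint t σ).const_mul _) (hMc.const_mul _) (hMi.const_mul _)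
    (fun m hm => ?_) (fun m hm => ?_) (by simpa using hJ0.const_mul (t * Cb * Cg))
    (by simpa using hJ1.const_mul (t * Cb * Cg))
  · rw [integral_const_mul, abs_mul, abs_of_pos (by positivity : 0 < t ^ 2)] at key
    rw [le_div_iff₀ (by positivity), mul_comm]
    exact key
  · have h := (((db m hm).fun_mul (dg1 m hm)).const_mul t).fun_sub
      ((((dq m hm).fun_mul (db1 m hm)).fun_mul (dg m hm)).fun_add
        (((dq m hm).fun_mul (db m hm)).fun_mul (dp m hm)))
    refine h.congr_deriv ?_
    have e : q m * (t * (ϖ' m - ϖ m * logK m)) = t * (2 * compK m) := by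
      rw [← hqϖ m hm]; ring
    have hK := (compK_pos hm).ne'
    generalize t * (ϖ' m - ϖ m * logK m) = E at *
    change t * (b₁ (x m) m * g₁ (y m) m + q m * a (x m) m
        * (p₁ (y m) m + g₂ (y m) m / (2 * compK m) * E))
      - ((q₁ (x m) m * b₁ (x m) m + q m * b₂ (x m) m) * g (y m) m
        + q m * b₁ (x m) m * (p (y m) m + g₁ (y m) m / (2 * compK m) * E)
        + ((q₁ (x m) m * (q m * a (x m) m) + q m * b₁ (x m) m) * p (y m) m
        + q m * (q m * a (x m) m) * (p₂ (y m) m + p₁ (y m) m / (2 * compK m) * E))) = _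
    have e1 : ∀ z : ℝ, q m * (z / (2 * compK m) * E) = t * z := fun z => by
      rw [show q m * (z / (2 * compK m) * E) = z / (2 * compK m) * (q m * E) by ring, e]
      field_simp
    linear_combination t * a (x m) m * e1 (g₂ (y m) m) - b₁ (x m) m * e1 (g₁ (y m) m)
      - q m * a (x m) m * e1 (p₁ (y m) m)
  · obtain ⟨q_0, q_1, -⟩ := hqb m hm (x m)
    obtain ⟨b_0, b_1, b_2⟩ := hb m hm (x m)
    obtain ⟨g_0, p_0, p_2, g_1⟩ := hgb m hm (y m)
    obtain ⟨hl, hl1, ht1⟩ := hℓ m hm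
    have i1 := abs_mul_le_of_le (abs_mul_le_of_le q_1 b_1) g_0
    have i2 := abs_mul_le_of_le (abs_mul_le_of_le q_0 b_2) g_0
    have i3 := abs_mul_le_of_le (abs_mul_le_of_le q_0 b_1) p_0
    have i4 := abs_mul_le_of_le (abs_mul_le_of_le q_1 b_0) p_0
    have i5 := abs_mul_le_of_le (abs_mul_le_of_le q_0 b_0) p_2
    have e1 : Cq * (Q m * τ m) * (Cb * (Q m * A m * τ m)) * (Cg * W m)
      = S * (Q m ^ 2 * A m * W m * τ m ^ 2) := by rw [hS]; ring
    have e2 : Cq * Q m * (Cb * (Q m * A m * τ m ^ 2)) * (Cg * W m)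
      = S * (Q m ^ 2 * A m * W m * τ m ^ 2) := by rw [hS]; ring
    have e3 : Cq * Q m * (Cb * (Q m * A m * τ m)) * (Cg * (W m * τ m))
      = S * (Q m ^ 2 * A m * W m * τ m ^ 2) := by rw [hS]; ring
    have e4 : Cq * (Q m * τ m) * (Cb * (Q m * A m * ℓ m)) * (Cg * (W m * τ m))
      = S * (Q m ^ 2 * A m * W m * τ m ^ 2) * ℓ m := by rw [hS]; ring
    have e5 : Cq * Q m * (Cb * (Q m * A m * ℓ m)) * (Cg * (W m * τ m ^ 2 / ℓ m))
      = S * (Q m ^ 2 * A m * W m * τ m ^ 2) := by rw [hS]; field_simp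
    rw [e1] at i1
    rw [e2] at i2
    rw [e3] at i3
    rw [e4] at i4
    rw [e5] at i5
    have i6 := mul_le_of_le_one_right ((abs_nonneg _).trans i1) hl1
    -- Splitting the term with coefficient `2` gives six products, each at most `S` times the common
    -- weight. This is the `6` in `M`.
    rw [abs_neg, show (q₁ (x m) m * b₁ (x m) m + q m * b₂ (x m) m) * g (y m) m
      + (2 * (q m * b₁ (x m) m) + q₁ (x m) m * (q m * a (x m) m)) * p (y m) m
      + q m * (q m * a (x m) m) * p₂ (y m) m
      = q₁ (x m) m * b₁ (x m) m * g (y m) m + q m * b₂ (x m) m * g (y m) m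
      + q m * b₁ (x m) m * p (y m) m + q m * b₁ (x m) m * p (y m) m
      + q₁ (x m) m * (q m * a (x m) m) * p (y m) m
      + q m * (q m * a (x m) m) * p₂ (y m) m by ring]
    refine (abs_add_le _ _).trans ?_
    refine (add_le_add_left (abs_add_le _ _) _).trans ?_
    refine (add_le_add_left (add_le_add_left (abs_add_le _ _) _) _).trans ?_
    refine (add_le_add_left (add_le_add_left (add_le_add_left (abs_add_le _ _) _) _) _).trans ?_
    refine (add_le_add_left (add_le_add_left (add_le_add_left (add_le_add_left
      (abs_add_le _ _) _) _) _) _).trans ?_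
    linarith
  · obtain ⟨q_0, q_1, -⟩ := hqb m hm (x m)
    obtain ⟨b_0, b_1, b_2⟩ := hb m hm (x m)
    obtain ⟨g_0, p_0, p_2, g_1⟩ := hgb m hm (y m)
    obtain ⟨hl, hl1, ht1⟩ := hℓ m hm
    have i1 := abs_mul_le_of_le (abs_mul_le_of_le (abs_of_pos ht).le b_0) g_1
    have i2 := abs_mul_le_of_le (abs_mul_le_of_le q_0 b_1) g_0
    have i3 := abs_mul_le_of_le (abs_mul_le_of_le q_0 b_0) p_0
    have e2 : Cq * Q m * (Cb * (Q m * A m * τ m)) * (Cg * W m)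
      = S * (Q m ^ 2 * A m * W m * τ m) := by rw [hS]; ring
    have e3 : Cq * Q m * (Cb * (Q m * A m * ℓ m)) * (Cg * (W m * τ m))
      = S * (Q m ^ 2 * A m * W m * τ m) * ℓ m := by rw [hS]; ring
    rw [e2] at i2
    rw [e3] at i3
    have i4 := mul_le_of_le_one_right ((abs_nonneg _).trans i2) hl1
    have i5 := mul_le_mul_of_nonneg_left (hL m hm) (by positivity : 0 ≤ S)
    refine (abs_sub _ _).trans ?_
    refine (add_le_add_right (abs_add_le _ _) _).trans ?_
    rw [mul_assoc t]  at i1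
    linarith

/-- One integration by parts. -/
theorem exists_abs_integral_le_div {ℓ τ Q A W W₁ ϖ ϖ' q : ℝ → ℝ} {a g g₁ g₂ : ℝ → ℝ → ℝ}
    (hℓ : IsLoss ℓ τ) (hQ : ∀ m ∈ Ioo (0 : ℝ) 1, 0 ≤ Q m) (hA : ∀ m ∈ Ioo (0 : ℝ) 1, 0 ≤ A m)
    (hq : EJet ℓ τ Q (fun _ m => q m)) (ha : EJet ℓ τ A a) (hg : PhaseJet ℓ τ W W₁ g g₁ g₂)
    (hϖ : ∀ m ∈ Ioo (0 : ℝ) 1, HasDerivAt ϖ (ϖ' m) m)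
    (hqϖ : ∀ m ∈ Ioo (0 : ℝ) 1, q m * (ϖ' m - ϖ m * logK m) = 2 * compK m)
    (hMc : ContinuousOn (fun m => Q m * A m * W m * τ m) (Ioo 0 1))
    (hMi : IntegrableOn (fun m => Q m * A m * W m * τ m) (Ioo 0 1)) {L : ℝ}
    (hL : ∀ m ∈ Ioo (0 : ℝ) 1, Q m * A m * W m ≤ L)
    (hint : ∀ t σ : ℝ, IntegrableOn (fun m => a (2 * compK m * σ) m
      * g₁ (2 * compK m * σ + t * ϖ m) m) (Ioo 0 1)) :
    ∃ C, ∀ t > 0, ∀ σ, |∫ m in Ioo (0 : ℝ) 1, a (2 * compK m * σ) m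
      * g₁ (2 * compK m * σ + t * ϖ m) m| ≤ C / t := by
  obtain ⟨b₁, b₂, ⟨_, hb0⟩, -, Cb, hCb, hb⟩ := EJet.mul hℓ hQ hA hq ha
  obtain ⟨a₁, -, ⟨_, ha0⟩, -, -⟩ := ha
  obtain ⟨p, p₁, p₂, hg0, hg1, -, -, Cg, hCg, hgb⟩ := hg
  set S := Cb * Cg with hS
  refine ⟨2 * (S * L) + ∫ m in Ioo (0 : ℝ) 1, 2 * S * (Q m * A m * W m * τ m),
    fun t ht σ => ?_⟩
  set x : ℝ → ℝ := fun m => 2 * compK m * σ with hx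
  set y : ℝ → ℝ := fun m => 2 * compK m * σ + t * ϖ m with hy
  have da := fun m (hm : m ∈ Ioo (0 : ℝ) 1) => ha0.phase σ hm
  have db := fun m (hm : m ∈ Ioo (0 : ℝ) 1) => hb0.phase σ hm
  have dg := fun m (hm : m ∈ Ioo (0 : ℝ) 1) => hg0.phase_add σ t hm (hϖ m hm)
  have dg1 := fun m (hm : m ∈ Ioo (0 : ℝ) 1) => hg1.phase_add σ t hm (hϖ m hm)
  have hcont : ContinuousOn (fun m => t * (a (x m) m * g₁ (y m) m)) (Ioo 0 1) :=
    fun m hm => (((da m hm).continuousAt.mul (dg1 m hm).continuousAt).const_mul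
      t).continuousWithinAt
  -- The single boundary term `q a g` has no factor `t`. Boundedness suffices, so `J` is zero.
  have key := abs_setIntegral_le_of_hasDerivAt
    (f := fun m => t * (a (x m) m * g₁ (y m) m))
    (r := fun m => b₁ (x m) m * g (y m) m + q m * a (x m) m * p (y m) m)
    (M := fun m => 2 * S * (Q m * A m * W m * τ m))
    (H := fun m => q m * a (x m) m * g (y m) m) (J := fun _ => 0) (L := S * L)
    (fun m hm => ?_) hcont ((hint t σ).const_mul _) (hMc.const_mul _) (hMi.const_mul _)
    (fun m hm => ?_) (fun m hm => ?_) tendsto_const_nhds tendsto_const_nhds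
  · rw [integral_const_mul, abs_mul, abs_of_pos ht] at key
    rw [le_div_iff₀ ht, mul_comm]
    exact key
  · refine ((db m hm).fun_mul (dg m hm)).congr_deriv ?_
    have e : q m * (t * (ϖ' m - ϖ m * logK m)) = t * (2 * compK m) := by
      rw [← hqϖ m hm]; ring
    have hK := (compK_pos hm).ne'
    generalize t * (ϖ' m - ϖ m * logK m) = E at *
    change b₁ (x m) m * g (y m) m + q m * a (x m) m
        * (p (y m) m + g₁ (y m) m / (2 * compK m) * E) = _
    have e1 : q m * (g₁ (y m) m / (2 * compK m) * E) = t * g₁ (y m) m := by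
      rw [show q m * (g₁ (y m) m / (2 * compK m) * E)
        = g₁ (y m) m / (2 * compK m) * (q m * E) by ring, e]
      field_simp
    linear_combination a (x m) m * e1
  · obtain ⟨b_0, b_1, -⟩ := hb m hm (x m)
    obtain ⟨g_0, p_0, -, -⟩ := hgb m hm (y m)
    have i1 := abs_mul_le_of_le b_1 g_0
    have i2 := abs_mul_le_of_le b_0 p_0
    refine (abs_add_le _ _).trans ((add_le_add i1 i2).trans (le_of_eq ?_))
    rw [hS]; ring
  · obtain ⟨b_0, -, -⟩ := hb m hm (x m)
    obtain ⟨g_0, -, -, -⟩ := hgb m hm (y m)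
    have i1 := abs_mul_le_of_le b_0 g_0
    have i5 := mul_le_mul_of_nonneg_left (hL m hm) (by positivity : 0 ≤ S)
    rw [zero_add]
    refine i1.trans (le_trans (le_of_eq ?_) i5)
    rw [hS]; ring

end

section

variable {m : ℝ}

/-! ### Second derivatives of the Jacobi functions -/

/-- The derivative of `amD` in `u`. -/
def amDU (u m : ℝ) : ℝ :=
  ((cn u m ^ 2 - sn u m ^ 2) * dn u m + m * sn u m * cn u m * zet u m - dn u m * zetU u m)
    / (2 * (1 - m))

/-- The second derivative of the amplitude in `m` at fixed phase. -/
def amDD (u m : ℝ) : ℝ :=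
  ((cn u m ^ 2 - sn u m ^ 2) * amD u m - dnD u m * zet u m - dn u m * zetD u m) / (2 * (1 - m))
    + amD u m / (1 - m)

lemma hasD_inv_one_sub : HasD (fun _ m => (2 * (1 - m))⁻¹) (fun _ m => (2 * (1 - m) ^ 2)⁻¹)
    (fun _ _ => 0) := by
  refine HasD.of_hasDerivAt (x := fun m => (2 * (1 - m))⁻¹) fun m hm => ?_
  have h : 1 - m ≠ 0 := by linarith [hm.2]
  refine ((((hasDerivAt_id m).const_sub 1).const_mul 2).fun_inv
    (mul_ne_zero two_ne_zero h)).congr_deriv ?_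
  simp only [id]
  field_simp

lemma hasD_id : HasD (fun _ m => m) (fun _ _ => 1) (fun _ _ => 0) :=
  HasD.of_hasDerivAt (x := fun m => m) fun m _ => hasDerivAt_id m

lemma hasD_inv_id : HasD (fun _ m => m⁻¹) (fun _ m => -1 / m ^ 2) (fun _ _ => 0) := by
  refine HasD.of_hasDerivAt (x := fun m => m⁻¹) fun m hm => ?_
  refine (hasDerivAt_inv hm.1.ne').congr_deriv ?_
  rw [neg_div, one_div]

lemma hasD_amD : HasD amD amDD amDU := by
  refine ((((hasD_sn.mul hasD_cn).sub (hasD_dn.mul hasD_zet)).mul hasD_inv_one_sub).congr_left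
    (fun m hm u => ?_)).congr (fun m hm u => ?_) (fun m hm u => ?_)
  · rw [amD, div_eq_mul_inv]
  · have h : 1 - m ≠ 0 := by linarith [hm.2]
    simp only [amDD, amD]
    field_simp
    ring
  · simp only [amDU]
    rw [div_eq_mul_inv]
    ring

/-- The second derivative of `zet` in `m` at fixed phase. -/
def zetDD (u m : ℝ) : ℝ :=
  (dnD u m * amD u m + dn u m * amDD u m - zetD u m / 2) / m - zetD u m / m

/-- The derivative of `zetD` in `u`. -/
def zetDU (u m : ℝ) : ℝ :=
  (-(m * sn u m * cn u m) * amD u m + dn u m * amDU u m - zetU u m / 2) / m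

lemma hasD_zetD : HasD zetD zetDD zetDU := by
  refine ((((hasD_dn.mul hasD_amD).sub (hasD_zet.mul (HasD.const (1 / 2)))).mul
    hasD_inv_id).congr_left (fun m hm u => ?_)).congr (fun m hm u => ?_) (fun m hm u => ?_)
  · rw [zetD, div_eq_mul_inv]; ring
  · have h := hm.1.ne'
    simp only [zetDD, zetD]
    field_simp
    ring
  · simp only [zetDU]
    rw [div_eq_mul_inv]
    ring

/-- The second derivative of `dn` in `m` at fixed phase. -/
def dnDD (u m : ℝ) : ℝ :=
  -(2 * sn u m * cn u m * amD u m * dn u m + sn u m ^ 2 * dnD u m - sn u m * cn u m * zet u m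
      - m * (cn u m ^ 2 - sn u m ^ 2) * amD u m * zet u m - m * sn u m * cn u m * zetD u m)
    / (2 * (1 - m)) + dnD u m / (1 - m)

/-- The derivative of `dnD` in `u`. -/
def dnDU (u m : ℝ) : ℝ :=
  -(2 * sn u m * cn u m * dn u m ^ 2 - m * sn u m ^ 3 * cn u m
      - m * ((cn u m ^ 2 - sn u m ^ 2) * dn u m * zet u m + sn u m * cn u m * zetU u m))
    / (2 * (1 - m))

lemma hasD_dnD : HasD dnD dnDD dnDU := by
  refine (((((hasD_sn.mul hasD_sn).mul hasD_dn).sub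
    (((hasD_id.mul hasD_sn).mul hasD_cn).mul hasD_zet)).neg.mul hasD_inv_one_sub).congr_left
    (fun m hm u => ?_)).congr (fun m hm u => ?_) (fun m hm u => ?_)
  · rw [dnD, div_eq_mul_inv]; ring
  · have h : 1 - m ≠ 0 := by linarith [hm.2]
    simp only [dnDD, dnD]
    field_simp
    ring
  · simp only [dnDU]
    rw [div_eq_mul_inv]
    ring

/-- The derivative of `B / K`. -/
def ratioD (m : ℝ) : ℝ :=
  (compK m - 2 * compB m) / (2 * m * compK m) - compB m ^ 2 / (2 * (1 - m) * compK m ^ 2)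

lemma hasD_ratio : HasD (fun _ m => compB m / compK m) (fun _ m => ratioD m) (fun _ _ => 0) := by
  refine HasD.of_hasDerivAt (x := fun m => compB m / compK m) fun m hm => ?_
  refine ((hasDerivAt_compB hm.2 hm.1.ne').fun_div (hasDerivAt_compK hm.2)
    (compK_pos hm).ne').congr_deriv ?_
  have h1 := (compK_pos hm).ne'
  have h2 := hm.1.ne'
  have h3 : 1 - m ≠ 0 := by linarith [hm.2]
  rw [ratioD]
  field_simp

lemma hasD_compK : HasD (fun _ m => compK m) (fun _ m => compK m * logK m) (fun _ _ => 0) :=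
  HasD.of_hasDerivAt (x := compK) fun _ hm => hasDerivAt_compK' hm

lemma hasD_zetU : HasD zetU (fun u m => -2 * cn u m * sn u m * amD u m - ratioD m)
    (fun u m => -2 * cn u m * sn u m * dn u m) := by
  refine (((hasD_cn.mul hasD_cn).sub hasD_ratio).congr_left (fun _ _ u => ?_)).congr
    (fun _ _ u => ?_) (fun _ _ u => ?_)
  · rw [zetU]; ring
  · ring
  · ring

/-- Derivatives in `m` and in the phase commute. The phase derivative is `2 K ∂ᵤ`, and
differentiating the factor `2 K` produces the term with `logK`; the rest is the fixed-phase
derivative of `zetU`. The two identities below say the same for `am` and `dn`. -/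
lemma zetDU_eq (hm : m ∈ Ioo (0 : ℝ) 1) (u : ℝ) :
    zetDU u m = logK m * zetU u m + (-2 * cn u m * sn u m * amD u m - ratioD m) := by
  have h1 := (compK_pos hm).ne'
  have h2 := hm.1.ne'
  have h3 : 1 - m ≠ 0 := by linarith [hm.2]
  have h5 := dn_sq hm.2 u
  have h6 := sn_sq_add_cn_sq u m
  simp only [zetDU, amD, amDU, ratioD, logK, zetU]
  generalize zet u m = z at *
  generalize sn u m = s at *
  generalize cn u m = x at *
  generalize dn u m = d at *
  generalize compK m = K at *
  generalize compB m = B at *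
  field_simp
  grind

lemma amDU_eq (hm : m ∈ Ioo (0 : ℝ) 1) (u : ℝ) :
    amDU u m = logK m * dn u m + dnD u m := by
  have h1 := (compK_pos hm).ne'
  have h3 : 1 - m ≠ 0 := by linarith [hm.2]
  have h6 := sn_sq_add_cn_sq u m
  simp only [amDU, dnD, logK, zetU]
  generalize zet u m = z at *
  generalize sn u m = s at *
  generalize cn u m = x at *
  generalize dn u m = d at *
  generalize compK m = K at *
  generalize compB m = B at *
  field_simp
  grind

lemma dnDU_eq (hm : m ∈ Ioo (0 : ℝ) 1) (u : ℝ) :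
    dnDU u m = logK m * -(m * sn u m * cn u m) - sn u m * cn u m
      - m * (cn u m ^ 2 - sn u m ^ 2) * amD u m := by
  have h1 := (compK_pos hm).ne'
  have h3 : 1 - m ≠ 0 := by linarith [hm.2]
  have h5 := dn_sq hm.2 u
  have h6 := sn_sq_add_cn_sq u m
  simp only [dnDU, amD, logK, zetU]
  generalize zet u m = z at *
  generalize sn u m = s at *
  generalize cn u m = x at *
  generalize dn u m = d at *
  generalize compK m = K at *
  generalize compB m = B at *
  field_simp
  grind

end

section

variable {m : ℝ}

/-! ### Bounds of the Jacobi functions and of their derivatives -/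

lemma zet_periodic (hm : m ∈ Ioo (0 : ℝ) 1) : Function.Periodic (fun u => zet u m) (2 * compK m) := by
  intro u
  have := (compK_pos hm).ne'
  simp only [zet, am_add hm, ellB_add_pi hm.2]
  field_simp
  ring

lemma ratio_mem (hm : m ∈ Ioo (0 : ℝ) 1) : compB m / compK m ∈ Icc (0 : ℝ) 1 := by
  have h1 := compK_pos hm
  have h2 := half_le_compB hm
  have h3 := compB_le_one hm
  have h4 := one_le_compK hm
  exact ⟨by positivity, by rw [div_le_one h1]; linarith⟩

lemma abs_zetU_le (hm : m ∈ Ioo (0 : ℝ) 1) (u : ℝ) : |zetU u m| ≤ 1 := by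
  have h1 := ratio_mem hm
  have h2 := sn_sq_add_cn_sq u m
  rw [zetU, abs_le]
  constructor <;> nlinarith [h1.1, h1.2, sq_nonneg (sn u m), sq_nonneg (cn u m)]

lemma abs_zet_le_abs (hm : m ∈ Ioo (0 : ℝ) 1) (u : ℝ) : |zet u m| ≤ |u| := by
  have key : ∀ φ, |ellB φ m - compB m / compK m * ellF φ m| ≤ |ellF φ m| := by
    intro φ
    have i1 : ∀ a b : ℝ, IntervalIntegrable (fun y => 1 / dlt y m) volume a b := fun a b =>
      (continuous_div_dlt (w := fun _ => 1) continuous_const hm.2).intervalIntegrable a b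
    have i2 : ∀ a b : ℝ, IntervalIntegrable (fun y => Real.cos y ^ 2 / dlt y m) volume a b :=
      fun a b => (continuous_div_dlt (Real.continuous_cos.pow 2) hm.2).intervalIntegrable a b
    have e : ellB φ m - compB m / compK m * ellF φ m
        = ∫ y in (0)..φ, (Real.cos y ^ 2 / dlt y m - compB m / compK m * (1 / dlt y m)) := by
      rw [intervalIntegral.integral_sub (i2 _ _) ((i1 _ _).const_mul _),
        intervalIntegral.integral_const_mul]
      rfl
    rw [e, ← Real.norm_eq_abs, ← Real.norm_eq_abs]
    refine intervalIntegral.norm_integral_le_abs_of_norm_le (Eventually.of_forall fun y => ?_)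
      (i1 _ _)
    have h1 := ratio_mem hm
    have h2 := dlt_pos hm.2 y
    have h3 := Real.cos_sq_le_one y
    rw [div_eq_mul_one_div (Real.cos y ^ 2), ← sub_mul, Real.norm_eq_abs, abs_mul,
      abs_of_pos (by positivity : 0 < 1 / dlt y m)]
    refine mul_le_of_le_one_left (by positivity) ?_
    rw [abs_le]
    constructor <;> nlinarith [h1.1, h1.2, sq_nonneg (Real.cos y)]
  have := key (am u m)
  rwa [ellF_am hm] at this

/-- By periodicity `u` may be moved to a window of length `2 K` around zero, where the linear bound
gives `K`. -/
lemma abs_zet_le (hm : m ∈ Ioo (0 : ℝ) 1) (u : ℝ) : |zet u m| ≤ compK m := by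
  have hK := compK_pos hm
  obtain ⟨y, hy, e⟩ := (zet_periodic hm).exists_mem_Ico (by positivity) u (-compK m)
  rw [e]
  refine (abs_zet_le_abs hm y).trans ?_
  rw [abs_le]
  exact ⟨hy.1, by linarith [hy.2]⟩

/-- The growth of derivatives near the separatrix, `K / (1 - m)`. -/
def growth (m : ℝ) : ℝ := compK m / (1 - m)

lemma growth_bounds (hm : m ∈ Ioo (0 : ℝ) 1) :
    1 ≤ growth m ∧ compK m ≤ growth m ∧ (1 - m)⁻¹ ≤ growth m ∧ compK m * (1 - m)⁻¹ = growth m := by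
  have h1 := one_le_compK hm
  have h2 : 1 ≤ (1 - m)⁻¹ := by
    rw [one_le_inv₀ (by linarith [hm.2])]; linarith [hm.1]
  have h3 : compK m * (1 - m)⁻¹ = growth m := by rw [growth, div_eq_mul_inv]
  refine ⟨?_, ?_, ?_, h3⟩ <;> rw [← h3] <;> nlinarith

lemma abs_sn_mul_cn_le (u m : ℝ) : |sn u m * cn u m| ≤ 1 := by
  simpa using abs_mul_le_of_le (abs_sn_le u m) (abs_cn_le u m)

lemma abs_cn_sq_sub_le (u m : ℝ) : |cn u m ^ 2 - sn u m ^ 2| ≤ 1 := by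
  have h2 := sn_sq_add_cn_sq u m
  rw [abs_le]
  constructor <;> nlinarith [sq_nonneg (sn u m), sq_nonneg (cn u m)]

lemma abs_sn_sq_le (u m : ℝ) : |sn u m ^ 2| ≤ 1 := by
  have h2 := sn_sq_add_cn_sq u m
  rw [abs_le]
  constructor <;> nlinarith [sq_nonneg (sn u m), sq_nonneg (cn u m)]

lemma abs_div_two_mul_le (hm : m ∈ Ioo (0 : ℝ) 1) {x a : ℝ} (h : |x| ≤ a) :
    |x / (2 * (1 - m))| ≤ a * (1 - m)⁻¹ / 2 := by
  have h1 : 0 < 1 - m := by linarith [hm.2]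
  rw [abs_div, abs_of_pos (by positivity : 0 < 2 * (1 - m))]
  refine (div_le_div_of_nonneg_right h (by positivity)).trans (le_of_eq ?_)
  field_simp

lemma abs_amD_le (hm : m ∈ Ioo (0 : ℝ) 1) (u : ℝ) : |amD u m| ≤ growth m := by
  obtain ⟨g1, g2, g3, g4⟩ := growth_bounds hm
  have h1 := abs_sn_mul_cn_le u m
  have h2 := abs_mul_le_of_le (abs_dn_le hm u) (abs_zet_le hm u)
  refine (abs_div_two_mul_le hm ((abs_sub _ _).trans (add_le_add h1 h2))).trans ?_
  linarith

lemma abs_dnD_le (hm : m ∈ Ioo (0 : ℝ) 1) (u : ℝ) : |dnD u m| ≤ growth m := by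
  obtain ⟨g1, g2, g3, g4⟩ := growth_bounds hm
  have h1 := abs_mul_le_of_le (abs_sn_sq_le u m) (abs_dn_le hm u)
  have hm1 : |m| ≤ 1 := by rw [abs_of_pos hm.1]; exact hm.2.le
  have h2 := abs_mul_le_of_le (abs_mul_le_of_le (abs_mul_le_of_le hm1 (abs_sn_le u m))
    (abs_cn_le u m)) (abs_zet_le hm u)
  have h3 : |-(sn u m ^ 2 * dn u m - m * sn u m * cn u m * zet u m)| ≤ 1 + compK m := by
    rw [abs_neg]
    exact (abs_sub _ _).trans (by linarith)
  refine (abs_div_two_mul_le hm h3).trans ?_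
  linarith

/-- The division by `m` in `zetD` is what brings negative powers of `m` into the second derivatives
below. -/
lemma abs_zetD_le (hm : m ∈ Ioo (0 : ℝ) 1) (u : ℝ) : |zetD u m| ≤ 2 * growth m / m := by
  obtain ⟨g1, g2, g3, g4⟩ := growth_bounds hm
  have h1 := abs_mul_le_of_le (abs_dn_le hm u) (abs_amD_le hm u)
  have h2 := abs_zet_le hm u
  rw [zetD, abs_div, abs_of_pos hm.1]
  refine div_le_div_of_nonneg_right ((abs_sub _ _).trans ?_) hm.1.le
  rw [abs_div, abs_two]
  linarith

lemma abs_amDD_le (hm : m ∈ Ioo (0 : ℝ) 1) (u : ℝ) : |amDD u m| ≤ 3 * growth m ^ 2 / m := by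
  obtain ⟨g1, g2, g3, g4⟩ := growth_bounds hm
  have hm0 := hm.1
  have h1 := abs_mul_le_of_le (abs_cn_sq_sub_le u m) (abs_amD_le hm u)
  have h2 := abs_mul_le_of_le (abs_dnD_le hm u) (abs_zet_le hm u)
  have h3 := abs_mul_le_of_le (abs_dn_le hm u) (abs_zetD_le hm u)
  have h4 := abs_div_two_mul_le hm ((abs_sub ((cn u m ^ 2 - sn u m ^ 2) * amD u m
    - dnD u m * zet u m) (dn u m * zetD u m)).trans (add_le_add ((abs_sub _ _).trans
    (add_le_add h1 h2)) h3))
  have h1m : 0 < 1 - m := by linarith [hm.2]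
  have h5 : |amD u m / (1 - m)| ≤ growth m * (1 - m)⁻¹ := by
    rw [abs_div, abs_of_pos h1m, ← div_eq_mul_inv]
    exact div_le_div_of_nonneg_right (abs_amD_le hm u) h1m.le
  have i1 : growth m * (1 - m)⁻¹ ≤ growth m ^ 2 := by nlinarith
  have i2 : growth m ^ 2 ≤ growth m ^ 2 / m := le_div_self (by positivity) hm0 hm.2.le
  have i3 : 2 * growth m / m * (1 - m)⁻¹ ≤ 2 * (growth m ^ 2 / m) := by
    rw [mul_div_assoc, mul_assoc, div_mul_eq_mul_div]
    gcongr
  have i4 : growth m * compK m * (1 - m)⁻¹ = growth m ^ 2 := by rw [mul_assoc, g4]; ring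
  have i5 : (1 * growth m + growth m * compK m + 1 * (2 * growth m / m)) * (1 - m)⁻¹ / 2
      = (growth m * (1 - m)⁻¹ + growth m * compK m * (1 - m)⁻¹
        + 2 * growth m / m * (1 - m)⁻¹) / 2 := by ring
  rw [i5] at h4
  refine (abs_add_le _ _).trans ((add_le_add h4 h5).trans ?_)
  rw [show 3 * growth m ^ 2 / m = 3 * (growth m ^ 2 / m) by ring]
  linarith

lemma abs_zetDD_le (hm : m ∈ Ioo (0 : ℝ) 1) (u : ℝ) : |zetDD u m| ≤ 7 * growth m ^ 2 / m ^ 2 := by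
  obtain ⟨g1, g2, g3, g4⟩ := growth_bounds hm
  have hm0 := hm.1
  have h1 := abs_mul_le_of_le (abs_dnD_le hm u) (abs_amD_le hm u)
  have h2 := abs_mul_le_of_le (abs_dn_le hm u) (abs_amDD_le hm u)
  have h3 := abs_zetD_le hm u
  have e : zetDD u m = (dnD u m * amD u m + dn u m * amDD u m - zetD u m * (3 / 2)) / m := by
    rw [zetDD]; ring
  have i2 : growth m ^ 2 ≤ growth m ^ 2 / m := le_div_self (by positivity) hm0 hm.2.le
  have i3 : growth m / m ≤ growth m ^ 2 / m := by
    gcongr; nlinarith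
  have i4 : 7 * growth m ^ 2 / m ^ 2 = 7 * (growth m ^ 2 / m) / m := by field_simp
  rw [e, abs_div, abs_of_pos hm0, i4]
  refine div_le_div_of_nonneg_right ?_ hm0.le
  refine (abs_sub _ _).trans ((add_le_add_left (abs_add_le _ _) _).trans ?_)
  rw [abs_mul (zetD u m), abs_of_pos (by norm_num : (0 : ℝ) < 3 / 2)]
  rw [mul_div_assoc] at h2 h3
  linarith

/-- Here `zetD` occurs only with a factor `m`, which cancels its `1 / m`. Unlike for `amDD`, no
negative power of `m` survives. -/
lemma abs_dnDD_le (hm : m ∈ Ioo (0 : ℝ) 1) (u : ℝ) : |dnDD u m| ≤ 5 * growth m ^ 2 := by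
  obtain ⟨g1, g2, g3, g4⟩ := growth_bounds hm
  have hm0 := hm.1
  have h1m : 0 < 1 - m := by linarith [hm.2]
  have hm1 : |m| ≤ 1 := by rw [abs_of_pos hm.1]; exact hm.2.le
  have k1 := abs_mul_le_of_le (abs_mul_le_of_le (abs_mul_le_of_le (abs_mul_le_of_le
    (abs_of_pos (two_pos (α := ℝ))).le (abs_sn_le u m)) (abs_cn_le u m)) (abs_amD_le hm u))
    (abs_dn_le hm u)
  have k2 := abs_mul_le_of_le (abs_sn_sq_le u m) (abs_dnD_le hm u)
  have k3 := abs_mul_le_of_le (abs_sn_mul_cn_le u m) (abs_zet_le hm u)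
  have k4 := abs_mul_le_of_le (abs_mul_le_of_le (abs_mul_le_of_le hm1
    (abs_cn_sq_sub_le u m)) (abs_amD_le hm u)) (abs_zet_le hm u)
  have k5 : |m * sn u m * cn u m * zetD u m| ≤ 2 * growth m := by
    have := abs_mul_le_of_le (abs_mul_le_of_le (abs_mul_le_of_le (abs_of_pos hm0).le
      (abs_sn_le u m)) (abs_cn_le u m)) (abs_zetD_le hm u)
    refine this.trans (le_of_eq ?_)
    field_simp
  have k6 : |-(2 * sn u m * cn u m * amD u m * dn u m + sn u m ^ 2 * dnD u m
      - sn u m * cn u m * zet u m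
      - m * (cn u m ^ 2 - sn u m ^ 2) * amD u m * zet u m - m * sn u m * cn u m * zetD u m)|
      ≤ 5 * growth m + compK m + growth m * compK m := by
    rw [abs_neg]
    refine (abs_sub _ _).trans ((add_le_add_left (abs_sub _ _) _).trans
      ((add_le_add_left (add_le_add_left (abs_sub _ _) _) _).trans
      ((add_le_add_left (add_le_add_left (add_le_add_left (abs_add_le _ _) _) _) _).trans ?_)))
    linarith
  have h5 : |dnD u m / (1 - m)| ≤ growth m * (1 - m)⁻¹ := by
    rw [abs_div, abs_of_pos h1m, ← div_eq_mul_inv]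
    exact div_le_div_of_nonneg_right (abs_dnD_le hm u) h1m.le
  have i1 : growth m * (1 - m)⁻¹ ≤ growth m ^ 2 := by nlinarith
  have i4 : growth m * compK m * (1 - m)⁻¹ = growth m ^ 2 := by rw [mul_assoc, g4]; ring
  have i5 : growth m ≤ growth m ^ 2 := by nlinarith
  refine (abs_add_le _ _).trans ((add_le_add (abs_div_two_mul_le hm k6) h5).trans ?_)
  linarith

/-! ### Classes of the basic functions -/

lemma EJet.of_bounds {ℓ τ w : ℝ → ℝ} {g g₁ g₂ gU gU' : ℝ → ℝ → ℝ} (h : HasD g g₁ gU)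
    (h₁ : HasD g₁ g₂ gU') {C : ℝ} (hC : 0 ≤ C)
    (hb : ∀ m ∈ Ioo (0 : ℝ) 1, ∀ u, |g u m| ≤ C * w m ∧ |g₁ u m| ≤ C * (w m * τ m) ∧
      |g₂ u m| ≤ C * (w m * τ m ^ 2 / ℓ m)) : EJet ℓ τ w g :=
  ⟨_, _, ⟨_, h⟩, ⟨_, h₁⟩, C, hC, hb⟩

/-- Loss functions for which the Jacobi functions are jets. -/
def IsJacobiLoss (ℓ τ : ℝ → ℝ) : Prop :=
  IsLoss ℓ τ ∧ ∀ m ∈ Ioo (0 : ℝ) 1, growth m ≤ τ m ∧ growth m ^ 2 / m ≤ τ m ^ 2 / ℓ m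

section

variable {ℓ τ : ℝ → ℝ}

lemma IsJacobiLoss.sq_le (h : IsJacobiLoss ℓ τ) (hm : m ∈ Ioo (0 : ℝ) 1) :
    growth m ^ 2 ≤ τ m ^ 2 / ℓ m :=
  (le_div_self (by positivity) hm.1 hm.2.le).trans (h.2 m hm).2

lemma eJet_sn (h : IsJacobiLoss ℓ τ) : EJet ℓ τ (fun _ => 1) sn := by
  refine EJet.of_bounds (C := 4) hasD_sn (hasD_cn.mul hasD_amD) (by norm_num) fun m hm u => ?_
  have h2 := h.2 m hm
  have h3 := h.sq_le hm
  have h4 := (growth_bounds hm).1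
  have b1 := abs_mul_le_of_le (abs_cn_le u m) (abs_amD_le hm u)
  have b2 := abs_mul_le_of_le (abs_cn_le u m) (abs_amDD_le hm u)
  have b3 := abs_mul_le_of_le (abs_mul_le_of_le (abs_sn_le u m) (abs_amD_le hm u))
    (abs_amD_le hm u)
  have b0 := abs_sn_le u m
  simp only [one_mul] at *
  refine ⟨by linarith, by linarith, (abs_add_le _ _).trans ?_⟩
  rw [neg_mul, abs_neg]
  rw [mul_div_assoc] at b2
  linarith

lemma eJet_cn (h : IsJacobiLoss ℓ τ) : EJet ℓ τ (fun _ => 1) cn := by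
  refine EJet.of_bounds (C := 4) hasD_cn (hasD_sn.mul hasD_amD).neg (by norm_num) fun m hm u => ?_
  have h2 := h.2 m hm
  have h3 := h.sq_le hm
  have h4 := (growth_bounds hm).1
  have b1 := abs_mul_le_of_le (abs_sn_le u m) (abs_amD_le hm u)
  have b2 := abs_mul_le_of_le (abs_sn_le u m) (abs_amDD_le hm u)
  have b3 := abs_mul_le_of_le (abs_mul_le_of_le (abs_cn_le u m) (abs_amD_le hm u))
    (abs_amD_le hm u)
  have b0 := abs_cn_le u m
  simp only [one_mul] at *
  refine ⟨by linarith, by rw [abs_neg]; linarith, ?_⟩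
  rw [abs_neg]
  refine (abs_add_le _ _).trans ?_
  rw [mul_div_assoc] at b2
  linarith

lemma eJet_dn (h : IsJacobiLoss ℓ τ) : EJet ℓ τ (fun _ => 1) dn := by
  refine EJet.of_bounds (C := 5) hasD_dn hasD_dnD (by norm_num) fun m hm u => ?_
  have h2 := h.2 m hm
  have h3 := h.sq_le hm
  have h4 := (growth_bounds hm).1
  have b0 := abs_dn_le hm u
  have b1 := abs_dnD_le hm u
  have b2 := abs_dnDD_le hm u
  simp only [one_mul]
  exact ⟨by linarith, by linarith, by linarith⟩

end

end

section

variable {m : ℝ} {ℓ τ : ℝ → ℝ}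

/-! ### Phase jets -/

/-- The hypothesis `hcomm` is the commutation of the `m`- and phase derivatives. It makes the
fixed-phase derivative of `2 K gU` equal to the phase derivative of `p`, as a phase jet requires. -/
lemma PhaseJet.of_hasD {w : ℝ → ℝ} {g gU gUU p p₂ pU r : ℝ → ℝ → ℝ} (hg : HasD g p gU)
    (hU : HasD gU r gUU) (hp : HasD p p₂ pU)
    (hcomm : ∀ m ∈ Ioo (0 : ℝ) 1, ∀ u, pU u m = logK m * gU u m + r u m)
    (hUU : ∃ gD gU, HasD gUU gD gU) {C : ℝ} (hC : 0 ≤ C)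
    (hb : ∀ m ∈ Ioo (0 : ℝ) 1, ∀ u, |g u m| ≤ C * w m ∧ |p u m| ≤ C * (w m * τ m) ∧
      |p₂ u m| ≤ C * (w m * τ m ^ 2 / ℓ m) ∧ |gU u m| ≤ C) :
    PhaseJet ℓ τ w compK g (fun u m => 2 * compK m * gU u m)
      (fun u m => (2 * compK m) ^ 2 * gUU u m) := by
  have hK : ∀ m ∈ Ioo (0 : ℝ) 1, 2 * compK m ≠ 0 := fun m hm => by
    have := compK_pos hm; positivity
  have h2K : HasD (fun _ m => 2 * compK m) (fun _ m => 2 * (compK m * logK m)) (fun _ _ => 0) :=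
    ((HasD.const 2).mul hasD_compK).congr (fun _ _ u => by ring) (fun _ _ u => by ring)
  obtain ⟨_, _, h3⟩ := hUU
  refine ⟨p, fun u m => 2 * compK m * pU u m, p₂,
    hg.congr (fun _ _ _ => rfl) (fun m hm u => ?_),
    (h2K.mul hU).congr (fun m hm u => ?_) (fun m hm u => ?_),
    hp.congr (fun _ _ _ => rfl) (fun m hm u => ?_),
    ⟨_, _, ((h2K.mul h2K).mul h3).congr_left (fun m hm u => ?_)⟩, 2 * C, by positivity,
    fun m hm u => ?_⟩
  · rw [mul_div_cancel_left₀ _ (hK m hm)]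
  · rw [hcomm m hm]; ring
  · have := hK m hm
    field_simp
    ring
  · rw [mul_div_cancel_left₀ _ (hK m hm)]
  · ring
  · obtain ⟨b0, b1, b2, b3⟩ := hb m hm u
    have i0 := (abs_nonneg _).trans b0
    have i1 := (abs_nonneg _).trans b1
    have i2 := (abs_nonneg _).trans b2
    have hK0 := compK_pos hm
    refine ⟨by linarith, by linarith, by linarith, ?_⟩
    rw [abs_mul, abs_of_pos (by positivity)]
    nlinarith

/-- A primitive of `cn²` with its mean removed is needed so that it stays bounded in the phase. The
hypothesis allows a loss of `1 / m` per derivative, as available outside the eye. -/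
lemma phaseJet_zet (h : ∀ m ∈ Ioo (0 : ℝ) 1, growth m / m ≤ τ m ∧
    growth m ^ 2 / m ^ 2 ≤ τ m ^ 2 / ℓ m) :
    PhaseJet ℓ τ compK compK zet (fun u m => 2 * compK m * zetU u m)
      (fun u m => (2 * compK m) ^ 2 * (-2 * cn u m * sn u m * dn u m)) := by
  refine PhaseJet.of_hasD (C := 7) hasD_zet hasD_zetU hasD_zetD
    (fun m hm u => zetDU_eq hm u)
    ⟨_, _, (((HasD.const (-2)).mul hasD_cn).mul hasD_sn).mul hasD_dn⟩ (by norm_num)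
    fun m hm u => ?_
  obtain ⟨h1, h2⟩ := h m hm
  have hK := one_le_compK hm
  have b0 := abs_zet_le hm u
  have b1 := abs_zetD_le hm u
  have b2 := abs_zetDD_le hm u
  have b3 := abs_zetU_le hm u
  have hg := (growth_bounds hm).1
  have hm0 := hm.1
  have p1 : 0 ≤ growth m / m := by positivity
  have p2 : 0 ≤ growth m ^ 2 / m ^ 2 := by positivity
  rw [mul_div_assoc] at b1 b2
  refine ⟨by linarith, b1.trans ?_, b2.trans ?_, by linarith⟩
  · nlinarith
  · rw [mul_div_assoc]
    nlinarith

/-- Inside the eye the first derivative must not lose a power of `m`. The factor `m` provides this: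
`zet + m zetD = dn amD + zet / 2` has no denominator `m`, and the second derivative has a single
one, which `τ² / ℓ` covers. -/
lemma phaseJet_mul_zet (h : IsJacobiLoss ℓ τ) :
    PhaseJet ℓ τ compK compK (fun u m => m * zet u m) (fun u m => 2 * compK m * (m * zetU u m))
      (fun u m => (2 * compK m) ^ 2 * (m * (-2 * cn u m * sn u m * dn u m))) := by
  refine PhaseJet.of_hasD (C := 5)
    (p := fun u m => zet u m + m * zetD u m)
    (r := fun u m => zetU u m + m * (-2 * cn u m * sn u m * amD u m - ratioD m))
    (p₂ := fun u m => zetD u m + (zetD u m + m * zetDD u m))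
    (pU := fun u m => zetU u m + m * zetDU u m)
    ((hasD_id.mul hasD_zet).congr (fun _ _ u => by ring) (fun _ _ u => by ring))
    ((hasD_id.mul hasD_zetU).congr (fun _ _ u => by ring) (fun _ _ u => by ring))
    ((hasD_zet.add (hasD_id.mul hasD_zetD)).congr (fun _ _ u => by ring) (fun _ _ u => by ring))
    (fun m hm u => by rw [zetDU_eq hm]; ring)
    ⟨_, _, hasD_id.mul ((((HasD.const (-2)).mul hasD_cn).mul hasD_sn).mul hasD_dn)⟩ (by norm_num)
    fun m hm u => ?_
  have hK := one_le_compK hm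
  have hm0 := hm.1
  have h2 := h.2 m hm
  obtain ⟨g1, g2, g3, g4⟩ := growth_bounds hm
  have b0 := abs_zet_le hm u
  have b3 := abs_zetU_le hm u
  have e1 : zet u m + m * zetD u m = dn u m * amD u m + zet u m / 2 := by
    rw [zetD]; field_simp; ring
  have e2 : zetD u m + (zetD u m + m * zetDD u m)
      = dnD u m * amD u m + dn u m * amDD u m + zetD u m / 2 := by
    rw [zetDD]; field_simp; ring
  have i1 := abs_mul_le_of_le (abs_dn_le hm u) (abs_amD_le hm u)
  have i2 := abs_mul_le_of_le (abs_dnD_le hm u) (abs_amD_le hm u)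
  have i3 := abs_mul_le_of_le (abs_dn_le hm u) (abs_amDD_le hm u)
  have i4 := abs_zetD_le hm u
  have k2 : growth m ^ 2 ≤ growth m ^ 2 / m := le_div_self (by positivity) hm0 hm.2.le
  have k3 : growth m / m ≤ growth m ^ 2 / m := by
    gcongr; nlinarith
  rw [e1, e2]
  refine ⟨?_, ?_, ?_, ?_⟩
  · rw [abs_mul, abs_of_pos hm0]
    nlinarith [hm.2, abs_nonneg (zet u m)]
  · refine (abs_add_le _ _).trans ?_
    rw [abs_div, abs_two]
    nlinarith
  · refine ((abs_add_le _ _).trans (add_le_add_left (abs_add_le _ _) _)).trans ?_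
    rw [abs_div, abs_two]
    rw [show 1 * (3 * growth m ^ 2 / m) = 3 * (growth m ^ 2 / m) by ring] at i3
    rw [show 2 * growth m / m = 2 * (growth m / m) by ring] at i4
    have j1 : 5 * (growth m ^ 2 / m) ≤ 5 * (τ m ^ 2 / ℓ m) := by linarith [h2.2]
    have j2 : 5 * (τ m ^ 2 / ℓ m) ≤ 5 * (compK m * τ m ^ 2 / ℓ m) := by
      rw [mul_div_assoc]
      have : 0 ≤ τ m ^ 2 / ℓ m := le_trans (by positivity) h2.2
      nlinarith
    refine le_trans ?_ (j1.trans j2)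
    linarith
  · rw [abs_mul, abs_of_pos hm0]
    nlinarith [hm.2, abs_nonneg (zetU u m)]

lemma phaseJet_cn (h : IsJacobiLoss ℓ τ) :
    PhaseJet ℓ τ (fun _ => 1) compK cn (fun u m => 2 * compK m * -(sn u m * dn u m))
      (fun u m => (2 * compK m) ^ 2 * -(cn u m * dn u m * dn u m
        + sn u m * -(m * sn u m * cn u m))) := by
  refine PhaseJet.of_hasD (C := 4) hasD_cn (hasD_sn.mul hasD_dn).neg (hasD_sn.mul hasD_amD).neg
    (fun m hm u => by rw [amDU_eq hm]; ring)
    ⟨_, _, (((hasD_cn.mul hasD_dn).mul hasD_dn).add (hasD_sn.mul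
      ((hasD_id.mul hasD_sn).mul hasD_cn).neg)).neg⟩ (by norm_num) fun m hm u => ?_
  have h2 := h.2 m hm
  have h3 := h.sq_le hm
  have h4 := (growth_bounds hm).1
  have b1 := abs_mul_le_of_le (abs_sn_le u m) (abs_amD_le hm u)
  have b2 := abs_mul_le_of_le (abs_sn_le u m) (abs_amDD_le hm u)
  have b3 := abs_mul_le_of_le (abs_mul_le_of_le (abs_cn_le u m) (abs_amD_le hm u))
    (abs_amD_le hm u)
  have b4 := abs_mul_le_of_le (abs_sn_le u m) (abs_dn_le hm u)
  have b0 := abs_cn_le u m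
  simp only [one_mul] at *
  refine ⟨by linarith, by rw [abs_neg]; linarith, ?_, by rw [abs_neg]; linarith⟩
  rw [abs_neg]
  refine (abs_add_le _ _).trans ?_
  rw [mul_div_assoc] at b2
  linarith

lemma one_sub_dn_le (hm : m ∈ Ioo (0 : ℝ) 1) (u : ℝ) : |1 - dn u m| ≤ m := by
  have h1 := dn_pos hm.2 u
  have h2 := dn_le_one hm.1.le u
  have h3 := dn_sq hm.2 u
  have h4 := sn_sq_add_cn_sq u m
  rw [abs_of_nonneg (by linarith)]
  nlinarith [sq_nonneg (cn u m), hm.1]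

/-- The product `sn cn` is the derivative of `-dn / m`. Replacing `-dn` by `1 - dn`, which is at
most `m`, changes no `u`-derivative and keeps the primitive bounded as `m → 0`. -/
lemma phaseJet_one_sub_dn (h : ∀ m ∈ Ioo (0 : ℝ) 1, growth m / m ≤ τ m ∧
    growth m ^ 2 / m ^ 2 ≤ τ m ^ 2 / ℓ m) :
    PhaseJet ℓ τ (fun _ => 1) compK (fun u m => (1 - dn u m) * m⁻¹)
      (fun u m => 2 * compK m * (sn u m * cn u m))
      (fun u m => (2 * compK m) ^ 2 * ((cn u m ^ 2 - sn u m ^ 2) * dn u m)) := by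
  have hone := (HasD.const 1).sub hasD_dn
  have hinv2 : HasD (fun _ m => (m ^ 2)⁻¹) (fun _ m => -2 / m ^ 3) (fun _ _ => 0) :=
    ((hasD_inv_id.mul hasD_inv_id).congr_left (fun m hm u => by field_simp)).congr
      (fun m hm u => by have := hm.1.ne'; field_simp; norm_num) (fun _ _ u => by ring)
  refine PhaseJet.of_hasD (C := 9) (gU := fun u m => sn u m * cn u m)
    (p := fun u m => -dnD u m * m⁻¹ - (1 - dn u m) * (m ^ 2)⁻¹)
    (p₂ := fun u m => -dnDD u m * m⁻¹ + 2 * dnD u m * (m ^ 2)⁻¹ + 2 * (1 - dn u m) * (m ^ 3)⁻¹)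
    (pU := fun u m => -dnDU u m * m⁻¹ - sn u m * cn u m * m⁻¹)
    (r := fun u m => (cn u m ^ 2 - sn u m ^ 2) * amD u m)
    ((hone.mul hasD_inv_id).congr (fun m hm u => ?_) (fun m hm u => ?_))
    ((hasD_sn.mul hasD_cn).congr (fun _ _ u => by ring) (fun _ _ u => by ring))
    (((hasD_dnD.neg.mul hasD_inv_id).sub (hone.mul hinv2)).congr (fun m hm u => ?_)
      (fun m hm u => ?_)) (fun m hm u => ?_)
    ⟨_, _, ((((hasD_cn.mul hasD_cn).sub (hasD_sn.mul hasD_sn)).mul hasD_dn)).congr_left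
      (fun _ _ u => by ring)⟩ (by norm_num) fun m hm u => ?_
  all_goals have hm0 := hm.1
  · field_simp; ring
  · field_simp; ring
  · field_simp; ring
  · field_simp; ring
  · rw [dnDU_eq hm]; field_simp; ring
  · obtain ⟨h1, h2⟩ := h m hm
    have hg := (growth_bounds hm).1
    have b1 := abs_dnD_le hm u
    have b2 := abs_dnDD_le hm u
    have b3 := abs_sn_mul_cn_le u m
    have b4 := one_sub_dn_le hm u
    have i0 : |m⁻¹| = m⁻¹ := abs_of_pos (by positivity)
    have i2 : |(m ^ 2)⁻¹| = (m ^ 2)⁻¹ := abs_of_pos (by positivity)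
    have i3 : |(m ^ 3)⁻¹| = (m ^ 3)⁻¹ := abs_of_pos (by positivity)
    have m1 : 1 ≤ m⁻¹ := by rw [one_le_inv₀ hm0]; exact hm.2.le
    have gi : growth m * m⁻¹ = growth m / m := by rw [div_eq_mul_inv]
    have e2 : growth m ^ 2 / m ^ 2 = growth m ^ 2 * m⁻¹ * m⁻¹ := by field_simp
    simp only [one_mul]
    refine ⟨?_, ?_, ?_, by linarith⟩
    · rw [abs_mul, i0]
      have : |1 - dn u m| * m⁻¹ ≤ m * m⁻¹ := by gcongr
      rw [mul_inv_cancel₀ hm0.ne'] at this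
      linarith
    · refine (abs_sub _ _).trans ?_
      rw [abs_mul, abs_mul, i0, i2, abs_neg]
      have k1 : |dnD u m| * m⁻¹ ≤ growth m * m⁻¹ := by gcongr
      have k2 : |1 - dn u m| * (m ^ 2)⁻¹ ≤ m * (m ^ 2)⁻¹ := by gcongr
      have k3 : m * (m ^ 2)⁻¹ = m⁻¹ := by field_simp
      have k4 : m⁻¹ ≤ growth m * m⁻¹ := by nlinarith
      linarith
    · refine (abs_add_le _ _).trans ((add_le_add_left (abs_add_le _ _) _).trans ?_)
      rw [abs_mul, abs_mul, abs_mul, abs_mul, abs_mul, i0, i2, i3, abs_neg, abs_two]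
      have k1 : |dnDD u m| * m⁻¹ ≤ 5 * growth m ^ 2 * m⁻¹ := by gcongr
      have k2 : 2 * |dnD u m| * (m ^ 2)⁻¹ ≤ 2 * growth m * (m ^ 2)⁻¹ := by gcongr
      have k3 : 2 * |1 - dn u m| * (m ^ 3)⁻¹ ≤ 2 * m * (m ^ 3)⁻¹ := by gcongr
      have k4 : 2 * m * (m ^ 3)⁻¹ = 2 * (m⁻¹ * m⁻¹) := by field_simp
      have k5 : 2 * growth m * (m ^ 2)⁻¹ = 2 * (growth m * (m⁻¹ * m⁻¹)) := by field_simp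
      have n1 : 0 ≤ m⁻¹ * m⁻¹ := by positivity
      have k6 : growth m * (m⁻¹ * m⁻¹) ≤ growth m ^ 2 * (m⁻¹ * m⁻¹) := by
        gcongr; nlinarith
      have k7 : m⁻¹ * m⁻¹ ≤ growth m ^ 2 * (m⁻¹ * m⁻¹) := by
        refine le_mul_of_one_le_left n1 ?_
        nlinarith
      have k8 : growth m ^ 2 * m⁻¹ ≤ growth m ^ 2 * m⁻¹ * m⁻¹ :=
        le_mul_of_one_le_right (by positivity) m1
      have k9 : growth m ^ 2 * m⁻¹ * m⁻¹ = growth m ^ 2 * (m⁻¹ * m⁻¹) := by ring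
      linarith

end

section

variable {m : ℝ} {ℓ τ : ℝ → ℝ}

/-! ### Growth of the complete integral -/

lemma compK_zero : compK 0 = Real.pi / 2 := by simp [compK, ellF, ellI, dlt]

/-- The derivative of `K + log (1 - m) / 2` is `(B - 1) / (2 (1 - m))`, which is nonpositive because
`B ≤ 1`. -/
lemma compK_le_log (hm : m ∈ Ioo (0 : ℝ) 1) :
    compK m ≤ Real.pi / 2 + Real.log (1 - m)⁻¹ / 2 := by
  have hd : ∀ x ∈ Ico (0 : ℝ) 1, HasDerivAt (fun x => compK x + Real.log (1 - x) / 2)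
      (compB x / (2 * (1 - x)) + -1 / (1 - x) / 2) x := fun x hx => by
    have h : 1 - x ≠ 0 := by linarith [hx.2]
    exact (hasDerivAt_compK hx.2).fun_add ((((hasDerivAt_id x).const_sub 1).log h).div_const 2)
  have hanti : AntitoneOn (fun x => compK x + Real.log (1 - x) / 2) (Ico 0 1) := by
    refine antitoneOn_of_deriv_nonpos (convex_Ico 0 1)
      (fun x hx => (hd x hx).continuousAt.continuousWithinAt) ?_ ?_
    · rw [interior_Ico]
      exact fun x hx => (hd x (Ioo_subset_Ico_self hx)).differentiableAt.differentiableWithinAt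
    · rw [interior_Ico]
      intro x hx
      rw [(hd x (Ioo_subset_Ico_self hx)).deriv]
      have h : 0 < 1 - x := by linarith [hx.2]
      have hB := compB_le_one hx
      have e : compB x / (2 * (1 - x)) + -1 / (1 - x) / 2 = (compB x - 1) / (2 * (1 - x)) := by
        field_simp; ring
      rw [e]
      exact div_nonpos_of_nonpos_of_nonneg (by linarith) (by positivity)
  have := hanti (left_mem_Ico.2 one_pos) (Ioo_subset_Ico_self hm) hm.1.le
  simp only [compK_zero, sub_zero, Real.log_one, zero_div, add_zero] at this
  rw [Real.log_inv]
  linarith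

/-- The logarithm is estimated by a power with exponent `1 / 16`, so that the eighth power of `K`
costs only `(1 - m)^(-1/2)`, which is integrable. The largest power of `K` in the estimates below is
the seventh. -/
lemma compK_pow_le (hm : m ∈ Ioo (0 : ℝ) 1) :
    compK m ^ 8 ≤ 10 ^ 8 * (1 - m) ^ (-(1 / 2) : ℝ) := by
  have h0 : 0 < 1 - m := by linarith [hm.2]
  have h1 := compK_le_log hm
  have h2 := Real.log_le_rpow_div (x := (1 - m)⁻¹) (by positivity)
    (by norm_num : (0 : ℝ) < 1 / 16)
  have h3 : (1 : ℝ) ≤ (1 - m)⁻¹ ^ (1 / 16 : ℝ) := by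
    refine Real.one_le_rpow ?_ (by norm_num)
    rw [one_le_inv₀ h0]; linarith [hm.1]
  -- Half of the factor `16` from the logarithm, plus `π / 2 ≤ 2`, gives the constant `10`.
  have h4 : compK m ≤ 10 * (1 - m)⁻¹ ^ (1 / 16 : ℝ) := by
    have := Real.pi_lt_four
    have e : (1 - m)⁻¹ ^ (1 / 16 : ℝ) / (1 / 16) = 16 * (1 - m)⁻¹ ^ (1 / 16 : ℝ) := by ring
    rw [e] at h2
    linarith
  have h5 : ((1 - m)⁻¹ ^ (1 / 16 : ℝ)) ^ 8 = (1 - m) ^ (-(1 / 2) : ℝ) := by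
    rw [← Real.rpow_natCast, ← Real.rpow_mul (by positivity), Real.inv_rpow h0.le,
      ← Real.rpow_neg h0.le]
    norm_num
  calc compK m ^ 8 ≤ (10 * (1 - m)⁻¹ ^ (1 / 16 : ℝ)) ^ 8 :=
        pow_le_pow_left₀ (compK_pos hm).le h4 8
    _ = _ := by rw [mul_pow, h5]

lemma compK_pow_le_pow (hm : m ∈ Ioo (0 : ℝ) 1) {n : ℕ} (hn : n ≤ 8) :
    compK m ^ n ≤ compK m ^ 8 := pow_le_pow_right₀ (one_le_compK hm) hn

lemma integrableOn_one_sub_rpow : IntegrableOn (fun m : ℝ => (1 - m) ^ (-(1 / 2) : ℝ)) (Ioo 0 1) := by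
  have h := (intervalIntegral.intervalIntegrable_rpow' (a := 0) (b := 1)
    (by norm_num : (-1 : ℝ) < -(1 / 2))).comp_sub_left 1
  simp only [sub_zero, sub_self] at h
  have h2 := h.symm
  rw [intervalIntegrable_iff_integrableOn_Ioo_of_le zero_le_one] at h2
  exact h2

lemma integrableOn_rpow {s : ℝ} (hs : -1 < s) : IntegrableOn (fun m : ℝ => m ^ s) (Ioo 0 1) := by
  have h := intervalIntegral.intervalIntegrable_rpow' (a := 0) (b := 1) hs
  rwa [intervalIntegrable_iff_integrableOn_Ioo_of_le zero_le_one] at h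

lemma continuousOn_compK : ContinuousOn compK (Ioo 0 1) := fun _ hm =>
  (hasDerivAt_compK hm.2).continuousAt.continuousWithinAt

lemma continuousOn_rpow_unit (s : ℝ) : ContinuousOn (fun m : ℝ => m ^ s) (Ioo 0 1) := fun _ hm =>
  (Real.continuousAt_rpow_const _ _ (Or.inl hm.1.ne')).continuousWithinAt

lemma integrableOn_compK_pow_mul_rpow {s : ℝ} (hs : -1 < s) {n : ℕ} (hn : n ≤ 8) :
    IntegrableOn (fun m => compK m ^ n * m ^ s) (Ioo 0 1) := by
  have hb : IntegrableOn (fun m : ℝ => 2 * 10 ^ 8 * (m ^ s + (1 - m) ^ (-(1 / 2) : ℝ)))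
      (Ioo 0 1) := ((integrableOn_rpow hs).add integrableOn_one_sub_rpow).const_mul _
  refine hb.mono' ((((continuousOn_compK.pow n).mul (continuousOn_rpow_unit s))
    ).aestronglyMeasurable measurableSet_Ioo) ?_
  refine (ae_restrict_iff' measurableSet_Ioo).2 (Eventually.of_forall fun m hm => ?_)
  have h0 : 0 < 1 - m := by linarith [hm.2]
  have h1 := (compK_pow_le_pow hm hn).trans (compK_pow_le hm)
  have hm0 := hm.1
  have hK := compK_pos hm
  rw [Real.norm_eq_abs, abs_of_nonneg (by positivity)]
  refine (mul_le_mul_of_nonneg_right h1 (by positivity)).trans ?_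
  have p1 : 0 ≤ m ^ s := by positivity
  have p2 : 0 ≤ (1 - m) ^ (-(1 / 2) : ℝ) := by positivity
  -- The two singularities sit at opposite ends: on each half of the interval one of the factors is
  -- at most `2`.
  have key : (1 - m) ^ (-(1 / 2) : ℝ) * m ^ s ≤ 2 * (m ^ s + (1 - m) ^ (-(1 / 2) : ℝ)) := by
    rcases le_total m (1 / 2) with h | h
    · have h2 : (1 - m) ^ (-(1 / 2) : ℝ) ≤ (1 - m) ^ (-1 : ℝ) :=
        Real.rpow_le_rpow_of_exponent_ge h0 (by linarith) (by norm_num)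
      have h3 : (1 - m) ^ (-1 : ℝ) ≤ 2 := by
        rw [Real.rpow_neg_one, inv_le_comm₀ h0 two_pos]; linarith
      nlinarith
    · have h2 : m ^ s ≤ m ^ (-1 : ℝ) :=
        Real.rpow_le_rpow_of_exponent_ge hm0 hm.2.le hs.le
      have h3 : m ^ (-1 : ℝ) ≤ 2 := by
        rw [Real.rpow_neg_one, inv_le_comm₀ hm0 two_pos]; linarith
      nlinarith
  calc _ = 10 ^ 8 * ((1 - m) ^ (-(1 / 2) : ℝ) * m ^ s) := by ring
    _ ≤ 10 ^ 8 * (2 * (m ^ s + (1 - m) ^ (-(1 / 2) : ℝ))) := by gcongr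
    _ = _ := by ring

lemma one_sub_mul_compK_pow_le (hm : m ∈ Ioo (0 : ℝ) 1) {n : ℕ} (hn : n ≤ 8) :
    (1 - m) * compK m ^ n ≤ 10 ^ 8 * (1 - m) ^ (1 / 2 : ℝ) := by
  have h0 : 0 < 1 - m := by linarith [hm.2]
  have h1 := (compK_pow_le_pow hm hn).trans (compK_pow_le hm)
  have e : (1 - m) * (1 - m) ^ (-(1 / 2) : ℝ) = (1 - m) ^ (1 / 2 : ℝ) := by
    nth_rewrite 1 [← Real.rpow_one (1 - m)]
    rw [← Real.rpow_add h0]; norm_num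
  calc _ ≤ (1 - m) * (10 ^ 8 * (1 - m) ^ (-(1 / 2) : ℝ)) := by gcongr
    _ = 10 ^ 8 * ((1 - m) * (1 - m) ^ (-(1 / 2) : ℝ)) := by ring
    _ = _ := by rw [e]

lemma one_sub_mul_compK_pow_le' (hm : m ∈ Ioo (0 : ℝ) 1) {n : ℕ} (hn : n ≤ 8) :
    (1 - m) * compK m ^ n ≤ 10 ^ 8 := by
  refine (one_sub_mul_compK_pow_le hm hn).trans (mul_le_of_le_one_right (by norm_num) ?_)
  exact Real.rpow_le_one (by linarith [hm.2]) (by linarith [hm.1]) (by norm_num)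

lemma tendsto_rpow_mul_compK {s : ℝ} (hs : 0 < s) {n : ℕ} (hn : n ≤ 8) :
    Tendsto (fun m => m ^ s * ((1 - m) * compK m ^ n)) (𝓝[>] 0) (𝓝 0) ∧
    Tendsto (fun m => m ^ s * ((1 - m) * compK m ^ n)) (𝓝[<] 1) (𝓝 0) := by
  have e0 : ∀ᶠ m : ℝ in 𝓝[>] 0, m ∈ Ioo (0 : ℝ) 1 := Ioo_mem_nhdsGT one_pos
  have e1 : ∀ᶠ m : ℝ in 𝓝[<] 1, m ∈ Ioo (0 : ℝ) 1 := Ioo_mem_nhdsLT one_pos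
  have nonneg : ∀ m ∈ Ioo (0 : ℝ) 1, 0 ≤ m ^ s * ((1 - m) * compK m ^ n) := fun m hm => by
    have h0 : 0 < 1 - m := by linarith [hm.2]
    have hm0 := hm.1
    have hK := compK_pos hm
    positivity
  constructor
  · have h : Tendsto (fun m : ℝ => m ^ s * 10 ^ 8) (𝓝[>] 0) (𝓝 0) := by
      have : ContinuousAt (fun m : ℝ => m ^ s * 10 ^ 8) 0 :=
        (Real.continuousAt_rpow_const 0 s (Or.inr hs.le)).mul_const _
      have h2 := this.tendsto.mono_left (nhdsWithin_le_nhds (s := Ioi 0))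
      simpa [Real.zero_rpow hs.ne'] using h2
    refine squeeze_zero' (e0.mono nonneg) (e0.mono fun m hm => ?_) h
    have hm0 := hm.1
    have := one_sub_mul_compK_pow_le' hm hn
    gcongr
  · have h : Tendsto (fun m : ℝ => 10 ^ 8 * (1 - m) ^ (1 / 2 : ℝ)) (𝓝[<] 1) (𝓝 0) := by
      have : ContinuousAt (fun m : ℝ => 10 ^ 8 * (1 - m) ^ (1 / 2 : ℝ)) 1 :=
        ((continuousAt_const.sub continuousAt_id).rpow_const (Or.inr (by norm_num))).const_mul _
      have h2 := this.tendsto.mono_left (nhdsWithin_le_nhds (s := Iio 1))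
      simpa using h2
    refine squeeze_zero' (e1.mono nonneg) (e1.mono fun m hm => ?_) h
    have hm0 := hm.1
    have h0 : 0 < 1 - m := by linarith [hm.2]
    have hK := compK_pos hm
    have h1 : m ^ s ≤ 1 := Real.rpow_le_one hm0.le hm.2.le hs.le
    exact (mul_le_of_le_one_left (by positivity) h1).trans (one_sub_mul_compK_pow_le hm hn)

/-! ### Jets of functions of the modulus -/

lemma abs_compB_deriv_le (hm : m ∈ Ioo (0 : ℝ) 1) :
    |(compK m - 2 * compB m) / (2 * m)| ≤ compK m / 2 := by
  have hm0 := hm.1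
  rw [abs_div, abs_of_pos (by positivity : 0 < 2 * m), div_le_iff₀ (by positivity)]
  have := abs_compK_sub_le hm
  linarith

lemma inv_one_sub_bounds (hm : m ∈ Ioo (0 : ℝ) 1) : 1 ≤ (1 - m)⁻¹ := by
  rw [one_le_inv₀ (by linarith [hm.2])]; linarith [hm.1]

lemma abs_compK_deriv_le (hm : m ∈ Ioo (0 : ℝ) 1) :
    |compB m / (2 * (1 - m))| ≤ (1 - m)⁻¹ / 2 := by
  have h := compB_le_one hm
  have h2 := half_le_compB hm
  refine (abs_div_two_mul_le hm (a := 1) ?_).trans (le_of_eq (by ring))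
  rw [abs_of_nonneg (by linarith)]
  exact h

lemma eJet_compK (h : IsJacobiLoss ℓ τ) : EJet ℓ τ compK (fun _ m => compK m) := by
  refine EJet.of_hasDerivAt (C := 1) (x₁ := fun m => compB m / (2 * (1 - m)))
    (x₂ := fun m => (compK m - 2 * compB m) / (2 * m) / (2 * (1 - m))
      + compB m / (2 * (1 - m)) / (1 - m))
    (fun m hm => hasDerivAt_compK hm.2) (fun m hm => ?_) zero_le_one fun m hm => ?_
  · have h1 : 1 - m ≠ 0 := by linarith [hm.2]
    refine ((hasDerivAt_compB hm.2 hm.1.ne').fun_div (((hasDerivAt_id m).const_sub 1).const_mul 2)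
      (mul_ne_zero two_ne_zero h1)).congr_deriv ?_
    have := hm.1.ne'
    simp only [id]
    field_simp
    ring
  · obtain ⟨g1, g2, g3, g4⟩ := growth_bounds hm
    have hK := one_le_compK hm
    have h2 := h.2 m hm
    have h3 := h.sq_le hm
    have hi := inv_one_sub_bounds hm
    have b1 := abs_compK_deriv_le hm
    have b2 := abs_div_two_mul_le hm (abs_compB_deriv_le hm)
    have h0 : 0 < 1 - m := by linarith [hm.2]
    have b3 : |compB m / (2 * (1 - m)) / (1 - m)| ≤ (1 - m)⁻¹ / 2 * (1 - m)⁻¹ := by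
      rw [abs_div, abs_of_pos h0, ← div_eq_mul_inv]
      gcongr
    simp only [one_mul]
    refine ⟨by rw [abs_of_pos (compK_pos hm)], b1.trans ?_, (abs_add_le _ _).trans ?_⟩
    · nlinarith [h2.1]
    · have k1 : (1 - m)⁻¹ / 2 * (1 - m)⁻¹ ≤ growth m ^ 2 / 2 := by nlinarith
      have k2 : compK m / 2 * (1 - m)⁻¹ / 2 ≤ growth m ^ 2 / 4 := by
        rw [show compK m / 2 * (1 - m)⁻¹ / 2 = (compK m * (1 - m)⁻¹) / 4 by ring, g4]
        nlinarith
      rw [mul_div_assoc]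
      nlinarith

lemma eJet_compB (h : IsJacobiLoss ℓ τ) : EJet ℓ τ (fun _ => 1) (fun _ m => compB m) := by
  refine EJet.of_hasDerivAt (C := 2) (x₁ := fun m => (compK m - 2 * compB m) / (2 * m))
    (x₂ := fun m => (compB m / (2 * (1 - m)) - 4 * ((compK m - 2 * compB m) / (2 * m))) / (2 * m))
    (fun m hm => hasDerivAt_compB hm.2 hm.1.ne') (fun m hm => ?_) zero_le_two fun m hm => ?_
  · have h1 : 1 - m ≠ 0 := by linarith [hm.2]
    have h2 := hm.1.ne'
    refine (((hasDerivAt_compK hm.2).fun_sub ((hasDerivAt_compB hm.2 h2).const_mul 2)).fun_div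
      ((hasDerivAt_id m).const_mul 2) (mul_ne_zero two_ne_zero h2)).congr_deriv ?_
    simp only [id]
    field_simp
    ring
  · obtain ⟨g1, g2, g3, g4⟩ := growth_bounds hm
    have hK := one_le_compK hm
    have h2 := h.2 m hm
    have hm0 := hm.1
    have b1 := abs_compK_deriv_le hm
    have b2 := abs_compB_deriv_le hm
    have hB := compB_le_one hm
    have hB2 := half_le_compB hm
    simp only [one_mul]
    refine ⟨by rw [abs_of_nonneg (by linarith)]; linarith, by linarith, ?_⟩
    rw [abs_div, abs_of_pos (by positivity : 0 < 2 * m)]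
    have k1 : |compB m / (2 * (1 - m)) - 4 * ((compK m - 2 * compB m) / (2 * m))|
        ≤ 4 * growth m ^ 2 := by
      refine (abs_sub _ _).trans ?_
      rw [abs_mul, abs_of_pos (by norm_num : (0 : ℝ) < 4)]
      nlinarith
    calc _ ≤ 4 * growth m ^ 2 / (2 * m) := by gcongr
      _ = 2 * (growth m ^ 2 / m) := by field_simp; norm_num
      _ ≤ _ := by linarith

/-- The complete elliptic integral of the second kind. -/
def compE (m : ℝ) : ℝ := (1 - m) * compK m + m * compB m

lemma compE_eq_integral (hm : m ∈ Ioo (0 : ℝ) 1) :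
    compE m = ∫ y in (0)..(Real.pi / 2), dlt y m := by
  have i1 : IntervalIntegrable (fun y => 1 / dlt y m) volume 0 (Real.pi / 2) :=
    (continuous_div_dlt continuous_const hm.2).intervalIntegrable _ _
  have i2 : IntervalIntegrable (fun y => Real.cos y ^ 2 / dlt y m) volume 0 (Real.pi / 2) :=
    (continuous_div_dlt (Real.continuous_cos.pow 2) hm.2).intervalIntegrable _ _
  have e : compE m = ∫ y in (0)..(Real.pi / 2),
      ((1 - m) * (1 / dlt y m) + m * (Real.cos y ^ 2 / dlt y m)) := by
    rw [intervalIntegral.integral_add (i1.const_mul _) (i2.const_mul _),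
      intervalIntegral.integral_const_mul, intervalIntegral.integral_const_mul]
    rfl
  rw [e]
  refine intervalIntegral.integral_congr fun y _ => ?_
  have h1 := dlt_pos hm.2 y
  have h2 := dlt_sq hm.2 y
  field_simp
  rw [h2, Real.cos_sq']
  ring

lemma compE_le (hm : m ∈ Ioo (0 : ℝ) 1) : compE m ≤ 2 := by
  have h : ∫ y in (0)..(Real.pi / 2), dlt y m ≤ ∫ y in (0)..(Real.pi / 2), (1 : ℝ) :=
    intervalIntegral.integral_mono_on (by positivity)
      ((continuous_dlt_left m).intervalIntegrable _ _) intervalIntegrable_const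
      fun y _ => dlt_le_one hm.1.le y
  rw [compE_eq_integral hm]
  have := Real.pi_lt_four
  simp at h
  linarith

lemma half_le_compE (hm : m ∈ Ioo (0 : ℝ) 1) : 1 / 2 ≤ compE m := by
  have h1 := half_le_compB hm
  have h2 := one_le_compK hm
  have h3 := hm.1
  have h4 := hm.2
  rw [compE]
  nlinarith

lemma hasDerivAt_compE (hm : m ∈ Ioo (0 : ℝ) 1) :
    HasDerivAt compE ((compB m - compK m) / 2) m := by
  refine (((hasDerivAt_id m).const_sub 1).fun_mul (hasDerivAt_compK hm.2)).fun_add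
    ((hasDerivAt_id m).fun_mul (hasDerivAt_compB hm.2 hm.1.ne')) |>.congr_deriv ?_
  have h1 : 1 - m ≠ 0 := by linarith [hm.2]
  have h2 := hm.1.ne'
  simp only [id]
  field_simp
  ring

lemma eJet_compE (h : IsJacobiLoss ℓ τ) : EJet ℓ τ (fun _ => 1) (fun _ m => compE m) := by
  refine EJet.of_hasDerivAt (C := 2) (x₁ := fun m => (compB m - compK m) / 2)
    (x₂ := fun m => ((compK m - 2 * compB m) / (2 * m) - compB m / (2 * (1 - m))) / 2)
    (fun m hm => hasDerivAt_compE hm) (fun m hm => ?_) zero_le_two fun m hm => ?_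
  · exact ((hasDerivAt_compB hm.2 hm.1.ne').fun_sub (hasDerivAt_compK hm.2)).div_const 2
  · obtain ⟨g1, g2, g3, g4⟩ := growth_bounds hm
    have hK := one_le_compK hm
    have h2 := h.2 m hm
    have h3 := h.sq_le hm
    have b1 := abs_compK_deriv_le hm
    have b2 := abs_compB_deriv_le hm
    have hB := compB_le_one hm
    have hB2 := half_le_compB hm
    have hE := compE_le hm
    have hE2 := half_le_compE hm
    simp only [one_mul]
    refine ⟨by rw [abs_of_nonneg (by linarith)]; linarith, ?_, ?_⟩
    · rw [abs_div, abs_two, abs_of_nonpos (by linarith)]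
      linarith
    · rw [abs_div, abs_two]
      have := abs_sub ((compK m - 2 * compB m) / (2 * m)) (compB m / (2 * (1 - m)))
      nlinarith

/-- The derivative `-1` does not vanish with `1 - m`, but `(1 - m) growth = K ≥ 1`, so the loss of
one derivative accounts for it. -/
lemma eJet_one_sub (h : IsJacobiLoss ℓ τ) : EJet ℓ τ (fun m => 1 - m) (fun _ m => 1 - m) := by
  refine EJet.of_hasDerivAt (C := 1) (x₁ := fun _ => -1) (x₂ := fun _ => 0)
    (fun m hm => (hasDerivAt_id m).const_sub 1) (fun m hm => hasDerivAt_const _ _) zero_le_one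
    fun m hm => ?_
  have h0 : 0 < 1 - m := by linarith [hm.2]
  have h1 := (h.2 m hm).1
  have hℓ := h.1 m hm
  have hK := one_le_compK hm
  simp only [one_mul, abs_neg, abs_one, abs_zero]
  refine ⟨by rw [abs_of_pos h0], ?_, by have := hℓ.1; positivity⟩
  have : (1 - m) * growth m = compK m := by rw [growth]; field_simp
  nlinarith

lemma eJet_rpow (h : IsJacobiLoss ℓ τ) (hτ : ∀ m ∈ Ioo (0 : ℝ) 1, m⁻¹ ≤ τ m) (s : ℝ) :
    EJet ℓ τ (fun m => m ^ s) (fun _ m => m ^ s) := by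
  refine EJet.of_hasDerivAt (C := 1 + |s| + |s| * |s - 1|) (x₁ := fun m => s * m ^ (s - 1))
    (x₂ := fun m => s * ((s - 1) * m ^ (s - 1 - 1)))
    (fun m hm => Real.hasDerivAt_rpow_const (Or.inl hm.1.ne'))
    (fun m hm => (Real.hasDerivAt_rpow_const (Or.inl hm.1.ne')).const_mul s) (by positivity)
    fun m hm => ?_
  have hm0 := hm.1
  obtain ⟨l1, l2, l3⟩ := h.1 m hm
  have h1 := hτ m hm
  have p : 0 < m ^ s := by positivity
  have e1 : m ^ (s - 1) = m ^ s * m⁻¹ := by rw [Real.rpow_sub hm0, Real.rpow_one]; rfl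
  have e2 : m ^ (s - 1 - 1) = m ^ s * m⁻¹ * m⁻¹ := by
    rw [Real.rpow_sub hm0, e1, Real.rpow_one]; rfl
  have hs := abs_nonneg s
  have hs1 := abs_nonneg (s - 1)
  have hss := mul_nonneg hs hs1
  have p1 : 0 < m ^ s * m⁻¹ := by positivity
  have p2 : 0 < m ^ s * m⁻¹ * m⁻¹ := by positivity
  have q1 : m ^ s * m⁻¹ ≤ m ^ s * τ m := by gcongr
  have q2 : m ^ s * m⁻¹ * m⁻¹ ≤ m ^ s * τ m ^ 2 / ℓ m := by
    refine le_trans ?_ (le_div_self (by positivity) l1 l2)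
    rw [mul_assoc, pow_two]
    gcongr
  rw [e2, e1, abs_mul s, abs_mul s, abs_mul (s - 1), abs_of_pos p, abs_of_pos p1, abs_of_pos p2]
  refine ⟨by nlinarith, by nlinarith, ?_⟩
  rw [← mul_assoc]
  nlinarith

end

section

variable {m : ℝ} {ℓ τ : ℝ → ℝ}

/-! ### Double integrals -/

/-- Joint continuity on `ℝ × (0, 1)`. -/
def Cts (g : ℝ → ℝ → ℝ) : Prop := ContinuousOn (fun p : ℝ × ℝ => g p.1 p.2) (univ ×ˢ Ioo 0 1)

namespace Cts

variable {f g : ℝ → ℝ → ℝ}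

lemma mul (hf : Cts f) (hg : Cts g) : Cts fun u m => f u m * g u m := ContinuousOn.mul hf hg

lemma add (hf : Cts f) (hg : Cts g) : Cts fun u m => f u m + g u m := ContinuousOn.add hf hg

lemma sub (hf : Cts f) (hg : Cts g) : Cts fun u m => f u m - g u m := ContinuousOn.sub hf hg

lemma neg (hf : Cts f) : Cts fun u m => -f u m := ContinuousOn.neg hf

lemma pow (hf : Cts f) (n : ℕ) : Cts fun u m => f u m ^ n := ContinuousOn.pow hf n

lemma const (c : ℝ) : Cts fun _ _ => c := continuousOn_const

lemma of_continuousOn {x : ℝ → ℝ} (hx : ContinuousOn x (Ioo 0 1)) : Cts fun _ m => x m :=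
  hx.comp continuousOn_snd fun _ hp => hp.2

lemma id : Cts fun _ m => m := continuousOn_snd

lemma phase_add (hg : Cts g) {ϖ : ℝ → ℝ} (hϖ : ContinuousOn ϖ (Ioo 0 1)) (t : ℝ) :
    Cts fun σ m => g (2 * compK m * σ + t * ϖ m) m := by
  have hK : Cts fun _ m => compK m := of_continuousOn continuousOn_compK
  have h : ContinuousOn (fun p : ℝ × ℝ => (2 * compK p.2 * p.1 + t * ϖ p.2, p.2))
      (univ ×ˢ Ioo 0 1) := by
    refine ContinuousOn.prodMk ?_ continuousOn_snd
    exact ((continuousOn_const.mul hK).mul continuousOn_fst).add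
      (continuousOn_const.mul (of_continuousOn hϖ))
  exact ContinuousOn.comp (g := fun p : ℝ × ℝ => g p.1 p.2) hg h fun p hp => ⟨mem_univ _, hp.2⟩

lemma phase (hg : Cts g) : Cts fun σ m => g (2 * compK m * σ) m := by
  simpa using hg.phase_add (ϖ := fun _ => 0) continuousOn_const 0

lemma continuous_left (hg : Cts g) (hm : m ∈ Ioo (0 : ℝ) 1) : Continuous fun u => g u m := by
  have h : ContinuousOn (fun u : ℝ => g u m) univ :=
    ContinuousOn.comp (g := fun p : ℝ × ℝ => g p.1 p.2) (f := fun u : ℝ => (u, m)) hg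
      (by fun_prop) fun u _ => ⟨mem_univ _, hm⟩
  exact continuousOn_univ.1 h

lemma continuousOn_right (hg : Cts g) (u : ℝ) : ContinuousOn (fun m => g u m) (Ioo 0 1) :=
  ContinuousOn.comp (g := fun p : ℝ × ℝ => g p.1 p.2) (f := fun m : ℝ => (u, m)) hg
      (by fun_prop) fun _ hm => ⟨mem_univ _, hm⟩

end Cts

lemma cts_am : Cts am := fun _ hp => (continuousAt_am hp.2).continuousWithinAt

lemma cts_sn : Cts sn := Real.continuous_sin.comp_continuousOn cts_am

lemma cts_cn : Cts cn := Real.continuous_cos.comp_continuousOn cts_am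

lemma cts_dn : Cts dn := continuous_dlt.comp_continuousOn (cts_am.prodMk continuousOn_snd)

lemma continuousOn_compB : ContinuousOn compB (Ioo 0 1) := fun _ hm =>
  (hasDerivAt_compB hm.2 hm.1.ne').continuousAt.continuousWithinAt

lemma cts_zetU : Cts zetU := (cts_cn.pow 2).sub (Cts.of_continuousOn
  (continuousOn_compB.div continuousOn_compK fun _ hm => (compK_pos hm).ne'))

lemma integrable_of_cts {f : ℝ → ℝ → ℝ} {N : ℝ → ℝ} (hf : Cts f) (hN : IntegrableOn N (Ioo 0 1))
    (hb : ∀ m ∈ Ioo (0 : ℝ) 1, ∀ σ, |f σ m| ≤ N m) :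
    Integrable (fun p : ℝ × ℝ => f p.1 p.2)
      ((volume.restrict (Ioc (-1 : ℝ) 1)).prod (volume.restrict (Ioo (0 : ℝ) 1))) := by
  have h1 : Integrable (fun p : ℝ × ℝ => N p.2)
      ((volume.restrict (Ioc (-1 : ℝ) 1)).prod (volume.restrict (Ioo (0 : ℝ) 1))) :=
    Integrable.comp_snd hN _
  rw [Measure.prod_restrict] at h1 ⊢
  refine h1.mono' ((hf.mono (prod_mono_left (subset_univ _))).aestronglyMeasurable
    (measurableSet_Ioc.prod measurableSet_Ioo)) ?_
  exact (ae_restrict_iff' (measurableSet_Ioc.prod measurableSet_Ioo)).2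
    (Eventually.of_forall fun p hp => hb p.2 hp.2 p.1)

/-- The integral over the phase-space coordinates `(σ, m)`. -/
def phaseInt (f : ℝ → ℝ → ℝ) : ℝ := ∫ m in Ioo (0 : ℝ) 1, ∫ σ in (-1 : ℝ)..1, f σ m

/-- The oscillatory estimates hold for the integral in `m` at a fixed phase, uniformly in it.
Fubini's theorem brings that integral inside, and the factor `2` is the length of the phase
interval. -/
lemma abs_phaseInt_le {f : ℝ → ℝ → ℝ} {N : ℝ → ℝ} (hf : Cts f) (hN : IntegrableOn N (Ioo 0 1))
    (hb : ∀ m ∈ Ioo (0 : ℝ) 1, ∀ σ, |f σ m| ≤ N m) {D : ℝ}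
    (hD : ∀ σ, |∫ m in Ioo (0 : ℝ) 1, f σ m| ≤ D) : |phaseInt f| ≤ 2 * D := by
  have hi := integrable_of_cts hf hN hb
  have e : phaseInt f = ∫ σ in (-1 : ℝ)..1, ∫ m in Ioo (0 : ℝ) 1, f σ m := by
    rw [phaseInt, intervalIntegral.integral_of_le (by norm_num)]
    simp_rw [intervalIntegral.integral_of_le (show (-1 : ℝ) ≤ 1 by norm_num)]
    exact (integral_integral_swap hi).symm
  rw [e]
  have := intervalIntegral.norm_integral_le_of_norm_le_const (a := -1) (b := 1) (C := D)
    (f := fun σ => ∫ m in Ioo (0 : ℝ) 1, f σ m) fun σ _ => hD σ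
  rw [Real.norm_eq_abs] at this
  refine this.trans (le_of_eq ?_)
  rw [show |(1 : ℝ) - -1| = 2 by norm_num]
  ring

lemma integrableOn_of_cts {f : ℝ → ℝ → ℝ} {N : ℝ → ℝ} (hf : Cts f) (hN : IntegrableOn N (Ioo 0 1))
    (hb : ∀ m ∈ Ioo (0 : ℝ) 1, ∀ σ, |f σ m| ≤ N m) (σ : ℝ) :
    IntegrableOn (fun m => f σ m) (Ioo 0 1) := by
  refine hN.mono' ((hf.continuousOn_right σ).aestronglyMeasurable measurableSet_Ioo) ?_
  exact (ae_restrict_iff' measurableSet_Ioo).2 (Eventually.of_forall fun m hm => hb m hm σ)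

/-! ### Decay in the eye -/

lemma isJacobiLoss_eye : IsJacobiLoss (fun m => m) growth :=
  ⟨fun _ hm => ⟨hm.1, hm.2.le, (growth_bounds hm).1⟩, fun _ _ => ⟨le_rfl, le_rfl⟩⟩

/-- The reciprocal of the derivative of the frequency in the eye. -/
def qEye (ρ m : ℝ) : ℝ := -4 / ρ * ((1 - m) * (compK m * compK m) * (compB m)⁻¹)

lemma eJet_compB_inv (h : IsJacobiLoss ℓ τ) : EJet ℓ τ (fun _ => 1) (fun _ m => (compB m)⁻¹) := by
  have := EJet.inv h.1 (fun _ _ => one_pos) (eJet_compB h) (c := 1 / 2) (by norm_num)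
    fun m hm u => by
      have := half_le_compB hm
      rw [abs_of_nonneg (by linarith)]
      linarith
  simpa using this

lemma eJet_compE_inv (h : IsJacobiLoss ℓ τ) : EJet ℓ τ (fun _ => 1) (fun _ m => (compE m)⁻¹) := by
  have := EJet.inv h.1 (fun _ _ => one_pos) (eJet_compE h) (c := 1 / 2) (by norm_num)
    fun m hm u => by
      have := half_le_compE hm
      rw [abs_of_nonneg (by linarith)]
      linarith
  simpa using this

lemma eJet_compK_inv (h : IsJacobiLoss ℓ τ) : EJet ℓ τ (fun _ => 1) (fun _ m => (compK m)⁻¹) := by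
  have := EJet.inv h.1 (fun m hm => compK_pos hm) (eJet_compK h) (c := 1) one_pos
    fun m hm u => by rw [one_mul]; exact le_abs_self _
  refine this.mono h.1 (c := 1) zero_le_one fun m hm => ?_
  rw [one_mul]
  exact inv_le_one_of_one_le₀ (one_le_compK hm)

lemma eJet_qEye (h : IsJacobiLoss ℓ τ) (ρ : ℝ) :
    EJet ℓ τ (fun m => (1 - m) * compK m ^ 2) (fun _ m => qEye ρ m) := by
  have hK : ∀ m ∈ Ioo (0 : ℝ) 1, 0 ≤ compK m := fun m hm => (compK_pos hm).le
  have h1m : ∀ m ∈ Ioo (0 : ℝ) 1, 0 ≤ 1 - m := fun m hm => by linarith [hm.2]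
  have hKK : ∀ m ∈ Ioo (0 : ℝ) 1, 0 ≤ compK m * compK m := fun _ _ => mul_self_nonneg _
  have h1 := (EJet.const h.1 (-4 / ρ)).mul h.1 (fun _ _ => zero_le_one)
    (fun m hm => mul_nonneg (mul_nonneg (h1m m hm) (hKK m hm)) zero_le_one)
    (((eJet_one_sub h).mul h.1 h1m hKK ((eJet_compK h).mul h.1 hK hK (eJet_compK h))).mul h.1
      (fun m hm => mul_nonneg (h1m m hm) (hKK m hm)) (fun _ _ => zero_le_one) (eJet_compB_inv h))
  refine EJet.mono h.1 h1 (c := 1) zero_le_one fun m hm => le_of_eq ?_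
  ring

/-- In the eye the frequency per phase is `ρ / (2 K)`, and its derivative is nonzero because `K' = B
/ (2 (1 - m))` with `B ≥ 1 / 2`. -/
lemma qEye_mul {ρ : ℝ} (hρ : 0 < ρ) (hm : m ∈ Ioo (0 : ℝ) 1) :
    qEye ρ m * (0 - ρ * logK m) = 2 * compK m := by
  have h1 := compK_pos hm
  have h2 := half_le_compB hm
  have h3 : 1 - m ≠ 0 := by linarith [hm.2]
  have h4 : compB m ≠ 0 := by linarith
  rw [qEye, logK]
  field_simp
  ring

/-- The factor `m` is the gain `ℓ` of an `AJet`. It also absorbs the `1 / m` in the second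
derivative, at the price that one derivative may fall on it. -/
lemma aJet_eye {f : ℝ → ℝ → ℝ} {w : ℝ → ℝ} (hw : ∀ m ∈ Ioo (0 : ℝ) 1, 0 ≤ w m)
    (hf : EJet (fun m => m) growth w f) :
    AJet (fun m => m) growth w (fun u m => m * f u m) := by
  have hid : IsJet (fun m => m) (fun _ => 1) (fun _ => 0) (fun _ m => m) := by
    refine ⟨_, _, ⟨_, hasD_id⟩, ⟨_, HasD.const 1⟩, 1, zero_le_one, fun m hm u => ?_⟩
    simp [abs_of_pos hm.1]
  refine (IsJet.mul hid hf).mono (c := 3) (by norm_num) (fun m hm => ?_) (fun m hm => ?_)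
    (fun m hm => ?_)
  all_goals
    have h1 := hw m hm
    have hm0 := hm.1
    have hm1 := hm.2
    have hg := (growth_bounds hm).1
  · nlinarith
  · have : m * (w m * growth m) ≤ 1 * (w m * growth m) := by gcongr
    nlinarith
  · have e : m * (w m * growth m ^ 2 / m) = w m * growth m ^ 2 := by field_simp
    rw [e]
    have : w m * growth m ≤ w m * growth m ^ 2 := by
      gcongr; nlinarith
    linarith

lemma PhaseJet.mono {w w' w₁ : ℝ → ℝ} {g g₁ g₂ : ℝ → ℝ → ℝ} (h : PhaseJet ℓ τ w w₁ g g₁ g₂)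
    (hℓ : IsLoss ℓ τ) (hw : ∀ m ∈ Ioo (0 : ℝ) 1, w m ≤ w' m) : PhaseJet ℓ τ w' w₁ g g₁ g₂ := by
  obtain ⟨p, p₁, p₂, h1, h2, h3, h4, C, hC, hb⟩ := h
  refine ⟨p, p₁, p₂, h1, h2, h3, h4, C, hC, fun m hm u => ?_⟩
  obtain ⟨b0, b1, b2, b3⟩ := hb m hm u
  obtain ⟨l1, l2, l3⟩ := hℓ m hm
  have := hw m hm
  refine ⟨b0.trans (by gcongr), b1.trans (by gcongr), b2.trans (by gcongr), b3⟩

section Eye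

variable {ρ : ℝ} {α : ℝ → ℝ} {f g gU gUU : ℝ → ℝ → ℝ}

/-- With `q` of order `(1 - m) K²`, primitive `K` and loss `K / (1 - m)`, all powers of `1 - m`
cancel in the final integrand, which is `K^7`. The boundary terms are of order `m (1 - m) K³`,
vanishing at both ends, and `(1 - m) K^6`, which is bounded. -/
theorem eye_decay_sq (hρ : 0 < ρ) (hα : EJet (fun m => m) growth (fun _ => 1) (fun _ m => α m))
    (hf : EJet (fun m => m) growth (fun _ => 1) f) (hαc : ContinuousOn α (Ioo 0 1)) (hfc : Cts f)
    (hgc : Cts gUU) {C : ℝ} (hb : ∀ m ∈ Ioo (0 : ℝ) 1, ∀ u, |gUU u m| ≤ C)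
    (hg : PhaseJet (fun m => m) growth compK compK g (fun u m => 2 * compK m * gU u m)
      (fun u m => (2 * compK m) ^ 2 * gUU u m)) :
    ∃ D, ∀ t > 0, |phaseInt fun σ m => α m * (m * f (2 * compK m * σ) m)
      * ((2 * compK m) ^ 2 * gUU (2 * compK m * σ + t * ρ) m)| ≤ D / t ^ 2 := by
  have hℓ := isJacobiLoss_eye
  have h1m : ∀ m ∈ Ioo (0 : ℝ) 1, 0 < 1 - m := fun m hm => by linarith [hm.2]
  have ha : AJet (fun m => m) growth (fun _ => 1) (fun u m => α m * (m * f u m)) := by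
    have := EJet.mul_aJet hℓ.1 (fun _ _ => zero_le_one) (fun _ _ => zero_le_one) hα
      (aJet_eye (fun _ _ => zero_le_one) hf)
    simpa using this
  have hac : Cts fun u m => α m * (m * f u m) :=
    (Cts.of_continuousOn hαc).mul (Cts.id.mul hfc)
  have hg2c : Cts fun u m => (2 * compK m) ^ 2 * gUU u m :=
    (Cts.of_continuousOn ((continuousOn_const.mul continuousOn_compK).pow 2)).mul hgc
  have hcts : ∀ t, Cts fun σ m => α m * (m * f (2 * compK m * σ) m)
      * ((2 * compK m) ^ 2 * gUU (2 * compK m * σ + t * ρ) m) := fun t =>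
    hac.phase.mul (hg2c.phase_add (ϖ := fun _ => ρ) continuousOn_const t)
  obtain ⟨_, _, _, _, Ca, hCa, hab⟩ := id ha
  have hNi : IntegrableOn (fun m => Ca * (4 * C) * (compK m ^ 2 * m ^ (0 : ℝ))) (Ioo 0 1) :=
    (integrableOn_compK_pow_mul_rpow (by norm_num) (by norm_num)).const_mul _
  have hNb : ∀ t, ∀ m ∈ Ioo (0 : ℝ) 1, ∀ σ, |α m * (m * f (2 * compK m * σ) m)
      * ((2 * compK m) ^ 2 * gUU (2 * compK m * σ + t * ρ) m)|
      ≤ Ca * (4 * C) * (compK m ^ 2 * m ^ (0 : ℝ)) := by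
    intro t m hm σ
    have b1 := (hab m hm (2 * compK m * σ)).1
    have b2 := abs_mul_le_of_le (abs_of_nonneg (sq_nonneg (2 * compK m))).le
      (hb m hm (2 * compK m * σ + t * ρ))
    have b3 : Ca * (1 * m) ≤ Ca := by nlinarith [hm.2]
    refine (abs_mul_le_of_le (b1.trans b3) b2).trans (le_of_eq ?_)
    rw [Real.rpow_zero]
    ring
  have hM : (fun m => ((1 - m) * compK m ^ 2) ^ 2 * 1 * compK m * growth m ^ 2)
      =ᶠ[ae (volume.restrict (Ioo (0 : ℝ) 1))] fun m => compK m ^ 7 * m ^ (0 : ℝ) := by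
    refine (ae_restrict_iff' measurableSet_Ioo).2 (Eventually.of_forall fun m hm => ?_)
    have := (h1m m hm).ne'
    simp only [growth, Real.rpow_zero]
    field_simp
  have hgr : ContinuousOn growth (Ioo 0 1) := continuousOn_compK.div
    (continuousOn_const.sub continuousOn_id) fun m hm => (h1m m hm).ne'
  have hQc : ContinuousOn (fun m => (1 - m) * compK m ^ 2) (Ioo 0 1) :=
    (continuousOn_const.sub continuousOn_id).mul (continuousOn_compK.pow 2)
  have hlim := tendsto_rpow_mul_compK (s := 1) one_pos (n := 3) (by norm_num)
  have hJ : (fun m : ℝ => m ^ (1 : ℝ) * ((1 - m) * compK m ^ 3))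
      = fun m => (1 - m) * compK m ^ 2 * 1 * m * compK m := by
    funext m; rw [Real.rpow_one]; ring
  rw [hJ] at hlim
  have hL : ∀ m ∈ Ioo (0 : ℝ) 1,
      ((1 - m) * compK m ^ 2) ^ 2 * 1 * compK m * growth m ≤ 10 ^ 8 := fun m hm => by
    refine le_trans (le_of_eq ?_) (one_sub_mul_compK_pow_le' hm (n := 6) (by norm_num))
    have := (h1m m hm).ne'
    simp only [growth]
    field_simp
  obtain ⟨D, hD⟩ := exists_abs_integral_le_div_sq (ϖ := fun _ => ρ) (ϖ' := fun _ => 0)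
    (L := 10 ^ 8) hℓ.1
    (fun m hm => mul_nonneg (h1m m hm).le (sq_nonneg _)) (fun _ _ => zero_le_one)
    (eJet_qEye hℓ ρ) ha hg (fun m _ => hasDerivAt_const m ρ) (fun m hm => qEye_mul hρ hm)
    ((((hQc.pow 2).mul continuousOn_const).mul continuousOn_compK).mul (hgr.pow 2))
    (((integrableOn_compK_pow_mul_rpow (by norm_num) (by norm_num)).congr hM.symm))
    hL hlim.1 hlim.2
    (fun t σ => integrableOn_of_cts (hcts t) hNi (hNb t) σ)
  refine ⟨2 * D, fun t ht => ?_⟩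
  refine (abs_phaseInt_le (hcts t) hNi (hNb t) (hD t ht)).trans (le_of_eq ?_)
  ring

/-- A single integration by parts takes no second derivative of the amplitude, so no factor `m` is
demanded of it. The final integrand is `K^4`, and the boundary term `(1 - m) K³` is bounded. -/
theorem eye_decay (hρ : 0 < ρ) (hα : EJet (fun m => m) growth (fun _ => 1) (fun _ m => α m))
    (hf : EJet (fun m => m) growth (fun _ => 1) f) (hαc : ContinuousOn α (Ioo 0 1)) (hfc : Cts f)
    (hgc : Cts gU) {C : ℝ} (hb : ∀ m ∈ Ioo (0 : ℝ) 1, ∀ u, |gU u m| ≤ C)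
    (hg : PhaseJet (fun m => m) growth compK compK g (fun u m => 2 * compK m * gU u m)
      (fun u m => (2 * compK m) ^ 2 * gUU u m)) :
    ∃ D, ∀ t > 0, |phaseInt fun σ m => α m * f (2 * compK m * σ) m
      * (2 * compK m * gU (2 * compK m * σ + t * ρ) m)| ≤ D / t := by
  have hℓ := isJacobiLoss_eye
  have h1m : ∀ m ∈ Ioo (0 : ℝ) 1, 0 < 1 - m := fun m hm => by linarith [hm.2]
  have ha : EJet (fun m => m) growth (fun _ => 1) (fun u m => α m * f u m) := by
    have := EJet.mul hℓ.1 (fun _ _ => zero_le_one) (fun _ _ => zero_le_one) hα hf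
    simpa using this
  have hac : Cts fun u m => α m * f u m := (Cts.of_continuousOn hαc).mul hfc
  have hg2c : Cts fun u m => 2 * compK m * gU u m :=
    (Cts.of_continuousOn (continuousOn_const.mul continuousOn_compK)).mul hgc
  have hcts : ∀ t, Cts fun σ m => α m * f (2 * compK m * σ) m
      * (2 * compK m * gU (2 * compK m * σ + t * ρ) m) := fun t =>
    hac.phase.mul (hg2c.phase_add (ϖ := fun _ => ρ) continuousOn_const t)
  obtain ⟨_, _, _, _, Ca, hCa, hab⟩ := id ha
  have hNi : IntegrableOn (fun m => Ca * (2 * C) * (compK m ^ 1 * m ^ (0 : ℝ))) (Ioo 0 1) :=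
    (integrableOn_compK_pow_mul_rpow (by norm_num) (by norm_num)).const_mul _
  have hNb : ∀ t, ∀ m ∈ Ioo (0 : ℝ) 1, ∀ σ, |α m * f (2 * compK m * σ) m
      * (2 * compK m * gU (2 * compK m * σ + t * ρ) m)|
      ≤ Ca * (2 * C) * (compK m ^ 1 * m ^ (0 : ℝ)) := by
    intro t m hm σ
    have b1 := (hab m hm (2 * compK m * σ)).1
    have hK := compK_pos hm
    have b2 := abs_mul_le_of_le (abs_of_nonneg (by positivity : 0 ≤ 2 * compK m)).le
      (hb m hm (2 * compK m * σ + t * ρ))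
    refine (abs_mul_le_of_le b1 b2).trans (le_of_eq ?_)
    rw [Real.rpow_zero]
    ring
  have hM : (fun m => (1 - m) * compK m ^ 2 * 1 * compK m * growth m)
      =ᶠ[ae (volume.restrict (Ioo (0 : ℝ) 1))] fun m => compK m ^ 4 * m ^ (0 : ℝ) := by
    refine (ae_restrict_iff' measurableSet_Ioo).2 (Eventually.of_forall fun m hm => ?_)
    have := (h1m m hm).ne'
    simp only [growth, Real.rpow_zero]
    field_simp
  have hgr : ContinuousOn growth (Ioo 0 1) := continuousOn_compK.div
    (continuousOn_const.sub continuousOn_id) fun m hm => (h1m m hm).ne'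
  have hQc : ContinuousOn (fun m => (1 - m) * compK m ^ 2) (Ioo 0 1) :=
    (continuousOn_const.sub continuousOn_id).mul (continuousOn_compK.pow 2)
  have hL : ∀ m ∈ Ioo (0 : ℝ) 1, (1 - m) * compK m ^ 2 * 1 * compK m ≤ 10 ^ 8 := fun m hm => by
    refine le_trans (le_of_eq ?_) (one_sub_mul_compK_pow_le' hm (n := 3) (by norm_num))
    ring
  obtain ⟨D, hD⟩ := exists_abs_integral_le_div (ϖ := fun _ => ρ) (ϖ' := fun _ => 0)
    (L := 10 ^ 8) hℓ.1
    (fun m hm => mul_nonneg (h1m m hm).le (sq_nonneg _)) (fun _ _ => zero_le_one)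
    (eJet_qEye hℓ ρ) ha hg (fun m _ => hasDerivAt_const m ρ) (fun m hm => qEye_mul hρ hm)
    (((hQc.mul continuousOn_const).mul continuousOn_compK).mul hgr)
    (((integrableOn_compK_pow_mul_rpow (by norm_num) (by norm_num)).congr hM.symm))
    hL (fun t σ => integrableOn_of_cts (hcts t) hNi (hNb t) σ)
  refine ⟨2 * D, fun t ht => ?_⟩
  refine (abs_phaseInt_le (hcts t) hNi (hNb t) (hD t ht)).trans (le_of_eq ?_)
  ring

end Eye

end

section

variable {m : ℝ} {ℓ τ : ℝ → ℝ}

/-! ### Decay outside the eye -/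

/-- The loss of a derivative outside the eye. -/
def loss (m : ℝ) : ℝ := growth m / m ^ 2

lemma inv_le_loss (hm : m ∈ Ioo (0 : ℝ) 1) : m⁻¹ ≤ loss m := by
  have h := (growth_bounds hm).1
  have h0 := hm.1
  rw [loss, le_div_iff₀ (by positivity)]
  have : m⁻¹ * m ^ 2 = m := by field_simp
  rw [this]
  linarith [hm.2]

lemma growth_le_loss (hm : m ∈ Ioo (0 : ℝ) 1) : growth m / m ≤ loss m := by
  have h := (growth_bounds hm).1
  have h0 := hm.1
  have h1 := hm.2
  rw [loss]
  gcongr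
  nlinarith

/-- The Jacobi functions would need only `growth / m` here. The square in `loss` is made for the
profile: the derivative of the energy is of order `m⁻²`, and derivatives of `G'` are assumed to
decay only as fast as `G'`. -/
lemma isJacobiLoss_outer : IsJacobiLoss (fun _ => 1) loss := by
  have hg : ∀ m ∈ Ioo (0 : ℝ) 1, growth m ≤ growth m / m := fun m hm =>
    le_div_self (by linarith [(growth_bounds hm).1]) hm.1 hm.2.le
  refine ⟨fun m hm => ⟨one_pos, le_rfl, ?_⟩, fun m hm => ⟨?_, ?_⟩⟩
  · exact (growth_bounds hm).1.trans ((hg m hm).trans (growth_le_loss hm))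
  · exact (hg m hm).trans (growth_le_loss hm)
  · have h := growth_le_loss hm
    have h0 := hm.1
    have h1 := hm.2.le
    have hp : 0 ≤ growth m / m := (by linarith [(growth_bounds hm).1, hg m hm])
    calc growth m ^ 2 / m = m * (growth m / m) ^ 2 := by field_simp
      _ ≤ 1 * loss m ^ 2 := by gcongr
      _ = _ := by ring

lemma outer_bounds : ∀ m ∈ Ioo (0 : ℝ) 1, growth m / m ≤ loss m ∧
    growth m ^ 2 / m ^ 2 ≤ loss m ^ 2 / 1 := fun m hm => by
  have h := growth_le_loss hm
  have hp : 0 ≤ growth m / m := div_nonneg (by linarith [(growth_bounds hm).1]) hm.1.le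
  refine ⟨h, ?_⟩
  rw [← div_pow, div_one]
  gcongr

/-- The reciprocal of the derivative of the frequency outside the eye. -/
def qOuter (ρ m : ℝ) : ℝ :=
  -4 / ρ * (m ^ (3 / 2 : ℝ) * ((1 - m) * (compK m * compK m) * (compE m)⁻¹))

lemma eJet_qOuter (ρ : ℝ) : EJet (fun _ => 1) loss
    (fun m => m ^ (3 / 2 : ℝ) * ((1 - m) * compK m ^ 2)) (fun _ m => qOuter ρ m) := by
  have h := isJacobiLoss_outer
  have hK : ∀ m ∈ Ioo (0 : ℝ) 1, 0 ≤ compK m := fun m hm => (compK_pos hm).le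
  have h1m : ∀ m ∈ Ioo (0 : ℝ) 1, 0 ≤ 1 - m := fun m hm => by linarith [hm.2]
  have hKK : ∀ m ∈ Ioo (0 : ℝ) 1, 0 ≤ compK m * compK m := fun _ _ => mul_self_nonneg _
  have hmr : ∀ m ∈ Ioo (0 : ℝ) 1, 0 ≤ m ^ (3 / 2 : ℝ) := fun m hm => Real.rpow_nonneg hm.1.le _
  have h1 := (((eJet_one_sub h).mul h.1 h1m hKK ((eJet_compK h).mul h.1 hK hK (eJet_compK h))).mul
    h.1 (fun m hm => mul_nonneg (h1m m hm) (hKK m hm)) (fun _ _ => zero_le_one) (eJet_compE_inv h))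
  have hw := fun m hm => mul_nonneg (mul_nonneg (h1m m hm) (hKK m hm)) zero_le_one
  have h2 := (EJet.const h.1 (-4 / ρ)).mul h.1 (fun _ _ => zero_le_one)
    (fun m hm => mul_nonneg (hmr m hm) (hw m hm))
    ((eJet_rpow h (fun m hm => inv_le_loss hm) (3 / 2)).mul h.1 hmr hw h1)
  refine EJet.mono h.1 h2 (c := 1) zero_le_one fun m hm => le_of_eq ?_
  ring

lemma hasDerivAt_outer_freq (ρ : ℝ) (hm : m ∈ Ioo (0 : ℝ) 1) :
    HasDerivAt (fun m => ρ / √m) (-(ρ / (2 * m * √m))) m := by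
  have h0 := hm.1
  refine ((hasDerivAt_const m ρ).fun_div (Real.hasDerivAt_sqrt h0.ne') (by positivity)).congr_deriv ?_
  rw [Real.sq_sqrt h0.le]
  field_simp
  ring

lemma rpow_three_halves (hm : 0 < m) : m ^ (3 / 2 : ℝ) = m * √m := by
  rw [Real.sqrt_eq_rpow, ← Real.rpow_one_add' hm.le (by norm_num)]
  norm_num

/-- Both `ρ / √m` and `1 / K` decrease in `m`, so the two contributions to the derivative of the
frequency have the same sign. They add up to a multiple of `E = (1 - m) K + m B`, which is bounded
below. -/
lemma qOuter_mul {ρ : ℝ} (hρ : 0 < ρ) (hm : m ∈ Ioo (0 : ℝ) 1) :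
    qOuter ρ m * (-(ρ / (2 * m * √m)) - ρ / √m * logK m) = 2 * compK m := by
  have h0 := hm.1
  have h1 := compK_pos hm
  have h3 : 1 - m ≠ 0 := by linarith [hm.2]
  have h4 : compE m ≠ 0 := by linarith [half_le_compE hm]
  have hs : √m ≠ 0 := by positivity
  have e : -(ρ / (2 * m * √m)) - ρ / √m * logK m
      = -(ρ * compE m / (2 * m * √m * (1 - m) * compK m)) := by
    rw [logK, compE]
    field_simp
    ring
  rw [qOuter, e, rpow_three_halves h0]
  field_simp
  ring

lemma continuousOn_growth : ContinuousOn growth (Ioo 0 1) :=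
  continuousOn_compK.div (continuousOn_const.sub continuousOn_id) fun m hm => by
    have := hm.2; exact ne_of_gt (sub_pos.2 this)

lemma continuousOn_loss : ContinuousOn loss (Ioo 0 1) :=
  continuousOn_growth.div (continuousOn_id.pow 2) fun m hm => by
    exact pow_ne_zero 2 hm.1.ne'

lemma continuousOn_outer_freq (ρ : ℝ) : ContinuousOn (fun m => ρ / √m) (Ioo 0 1) :=
  fun _ hm => (hasDerivAt_outer_freq ρ hm).continuousAt.continuousWithinAt

section Outer

variable {ρ μ : ℝ} {α : ℝ → ℝ} {f g gU gUU : ℝ → ℝ → ℝ}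

/-- The powers of `m` are `3` from `q²`, `μ - 2` from the amplitude and `-4` from the two losses.
The final integrand is `K^7 m^(μ - 3)`, integrable because `μ > 2`. The boundary terms carry `m^(μ -
1/2)` and `m^(μ - 1)` and are harmless. -/
theorem outer_decay_sq (hρ : 0 < ρ) (hμ : 2 < μ)
    (hα : EJet (fun _ => 1) loss (fun m => m ^ (μ - 2)) (fun _ m => α m))
    (hf : EJet (fun _ => 1) loss (fun _ => 1) f) (hαc : ContinuousOn α (Ioo 0 1)) (hfc : Cts f)
    (hgc : Cts gUU) {C : ℝ} (hb : ∀ m ∈ Ioo (0 : ℝ) 1, ∀ u, |gUU u m| ≤ C)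
    (hg : PhaseJet (fun _ => 1) loss compK compK g (fun u m => 2 * compK m * gU u m)
      (fun u m => (2 * compK m) ^ 2 * gUU u m)) :
    ∃ D, ∀ t > 0, |phaseInt fun σ m => α m * f (2 * compK m * σ) m
      * ((2 * compK m) ^ 2 * gUU (2 * compK m * σ + t * (ρ / √m)) m)| ≤ D / t ^ 2 := by
  have hℓ := isJacobiLoss_outer
  have h1m : ∀ m ∈ Ioo (0 : ℝ) 1, 0 < 1 - m := fun m hm => by linarith [hm.2]
  have hmr : ∀ s : ℝ, ∀ m ∈ Ioo (0 : ℝ) 1, 0 ≤ m ^ s := fun s m hm => Real.rpow_nonneg hm.1.le _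
  have ha : EJet (fun _ => 1) loss (fun m => m ^ (μ - 2)) (fun u m => α m * f u m) := by
    have := EJet.mul hℓ.1 (hmr _) (fun _ _ => zero_le_one) hα hf
    simpa using this
  have ha' : AJet (fun _ => 1) loss (fun m => m ^ (μ - 2)) (fun u m => α m * f u m) :=
    IsJet.mono ha zero_le_one (fun m _ => by simp) (fun m _ => by simp) (fun m _ => by simp)
  have hac : Cts fun u m => α m * f u m := (Cts.of_continuousOn hαc).mul hfc
  have hg2c : Cts fun u m => (2 * compK m) ^ 2 * gUU u m :=
    (Cts.of_continuousOn ((continuousOn_const.mul continuousOn_compK).pow 2)).mul hgc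
  have hcts : ∀ t, Cts fun σ m => α m * f (2 * compK m * σ) m
      * ((2 * compK m) ^ 2 * gUU (2 * compK m * σ + t * (ρ / √m)) m) := fun t =>
    hac.phase.mul (hg2c.phase_add (continuousOn_outer_freq ρ) t)
  obtain ⟨_, _, _, _, Ca, hCa, hab⟩ := id ha
  have hNi : IntegrableOn (fun m => Ca * (4 * C) * (compK m ^ 2 * m ^ (μ - 2))) (Ioo 0 1) :=
    (integrableOn_compK_pow_mul_rpow (by linarith) (by norm_num)).const_mul _
  have hNb : ∀ t, ∀ m ∈ Ioo (0 : ℝ) 1, ∀ σ, |α m * f (2 * compK m * σ) m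
      * ((2 * compK m) ^ 2 * gUU (2 * compK m * σ + t * (ρ / √m)) m)|
      ≤ Ca * (4 * C) * (compK m ^ 2 * m ^ (μ - 2)) := by
    intro t m hm σ
    have b1 := (hab m hm (2 * compK m * σ)).1
    have b2 := abs_mul_le_of_le (abs_of_nonneg (sq_nonneg (2 * compK m))).le
      (hb m hm (2 * compK m * σ + t * (ρ / √m)))
    refine (abs_mul_le_of_le b1 b2).trans (le_of_eq ?_)
    ring
  have hM : (fun m => (m ^ (3 / 2 : ℝ) * ((1 - m) * compK m ^ 2)) ^ 2 * m ^ (μ - 2) * compK m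
      * loss m ^ 2) =ᶠ[ae (volume.restrict (Ioo (0 : ℝ) 1))] fun m => compK m ^ 7 * m ^ (μ - 3) := by
    refine (ae_restrict_iff' measurableSet_Ioo).2 (Eventually.of_forall fun m hm => ?_)
    have := (h1m m hm).ne'
    have h0 := hm.1
    have e : m ^ (μ - 2) = m ^ (μ - 3) * m := by
      rw [← Real.rpow_add_one h0.ne']; ring_nf
    have e2 : (m ^ (3 / 2 : ℝ)) ^ 2 = m ^ 3 := by
      rw [rpow_three_halves h0, mul_pow, Real.sq_sqrt h0.le]; ring
    simp only [loss, growth]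
    rw [mul_pow, e2, e]
    field_simp
  have hQc : ContinuousOn (fun m => m ^ (3 / 2 : ℝ) * ((1 - m) * compK m ^ 2)) (Ioo 0 1) :=
    (continuousOn_rpow_unit _).mul
      ((continuousOn_const.sub continuousOn_id).mul (continuousOn_compK.pow 2))
  have hlim := tendsto_rpow_mul_compK (s := μ - 1 / 2) (by linarith) (n := 3) (by norm_num)
  have hJ : ∀ m ∈ Ioo (0 : ℝ) 1, m ^ (μ - 1 / 2) * ((1 - m) * compK m ^ 3)
      = m ^ (3 / 2 : ℝ) * ((1 - m) * compK m ^ 2) * m ^ (μ - 2) * 1 * compK m := by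
    intro m hm
    have e : m ^ (μ - 1 / 2) = m ^ (3 / 2 : ℝ) * m ^ (μ - 2) := by
      rw [← Real.rpow_add hm.1]; ring_nf
    rw [e]; ring
  have e0 : ∀ᶠ m : ℝ in 𝓝[>] 0, m ∈ Ioo (0 : ℝ) 1 := Ioo_mem_nhdsGT one_pos
  have e1 : ∀ᶠ m : ℝ in 𝓝[<] 1, m ∈ Ioo (0 : ℝ) 1 := Ioo_mem_nhdsLT one_pos
  have hL : ∀ m ∈ Ioo (0 : ℝ) 1, (m ^ (3 / 2 : ℝ) * ((1 - m) * compK m ^ 2)) ^ 2 * m ^ (μ - 2)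
      * compK m * loss m ≤ 10 ^ 8 := fun m hm => by
    refine le_trans (le_of_eq ?_) ((mul_le_of_le_one_left (mul_nonneg (h1m m hm).le
      (pow_nonneg (compK_pos hm).le 6)) (Real.rpow_le_one hm.1.le hm.2.le (z := μ - 1)
        (by linarith))).trans (one_sub_mul_compK_pow_le' hm (n := 6) (by norm_num)))
    have := (h1m m hm).ne'
    have h0 := hm.1
    have e : m ^ (μ - 1) = m ^ (μ - 2) * m := by
      rw [← Real.rpow_add_one h0.ne']; ring_nf
    have e2 : (m ^ (3 / 2 : ℝ)) ^ 2 = m ^ 3 := by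
      rw [rpow_three_halves h0, mul_pow, Real.sq_sqrt h0.le]; ring
    simp only [loss, growth]
    rw [mul_pow, e2, e]
    field_simp
  obtain ⟨D, hD⟩ := exists_abs_integral_le_div_sq (L := 10 ^ 8) hℓ.1
    (fun m hm => mul_nonneg (hmr _ m hm) (mul_nonneg (h1m m hm).le (sq_nonneg _))) (hmr _)
    (eJet_qOuter ρ) ha' hg (fun m hm => hasDerivAt_outer_freq ρ hm) (fun m hm => qOuter_mul hρ hm)
    ((((hQc.pow 2).mul (continuousOn_rpow_unit _)).mul continuousOn_compK).mul
      (continuousOn_loss.pow 2))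
    (((integrableOn_compK_pow_mul_rpow (by linarith) (by norm_num)).congr hM.symm))
    hL (hlim.1.congr' (e0.mono hJ)) (hlim.2.congr' (e1.mono hJ))
    (fun t σ => integrableOn_of_cts (hcts t) hNi (hNb t) σ)
  refine ⟨2 * D, fun t ht => ?_⟩
  refine (abs_phaseInt_le (hcts t) hNi (hNb t) (hD t ht)).trans (le_of_eq ?_)
  ring

/-- The final integrand is `K^4 m^(μ - 5/2)`: one integration by parts leaves room in the exponent,
where two leave none. -/
theorem outer_decay (hρ : 0 < ρ) (hμ : 2 < μ)
    (hα : EJet (fun _ => 1) loss (fun m => m ^ (μ - 2)) (fun _ m => α m))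
    (hf : EJet (fun _ => 1) loss (fun _ => 1) f) (hαc : ContinuousOn α (Ioo 0 1)) (hfc : Cts f)
    (hgc : Cts gU) {C : ℝ} (hb : ∀ m ∈ Ioo (0 : ℝ) 1, ∀ u, |gU u m| ≤ C)
    (hg : PhaseJet (fun _ => 1) loss compK compK g (fun u m => 2 * compK m * gU u m)
      (fun u m => (2 * compK m) ^ 2 * gUU u m)) :
    ∃ D, ∀ t > 0, |phaseInt fun σ m => α m * f (2 * compK m * σ) m
      * (2 * compK m * gU (2 * compK m * σ + t * (ρ / √m)) m)| ≤ D / t := by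
  have hℓ := isJacobiLoss_outer
  have h1m : ∀ m ∈ Ioo (0 : ℝ) 1, 0 < 1 - m := fun m hm => by linarith [hm.2]
  have hmr : ∀ s : ℝ, ∀ m ∈ Ioo (0 : ℝ) 1, 0 ≤ m ^ s := fun s m hm => Real.rpow_nonneg hm.1.le _
  have ha : EJet (fun _ => 1) loss (fun m => m ^ (μ - 2)) (fun u m => α m * f u m) := by
    have := EJet.mul hℓ.1 (hmr _) (fun _ _ => zero_le_one) hα hf
    simpa using this
  have hac : Cts fun u m => α m * f u m := (Cts.of_continuousOn hαc).mul hfc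
  have hg2c : Cts fun u m => 2 * compK m * gU u m :=
    (Cts.of_continuousOn (continuousOn_const.mul continuousOn_compK)).mul hgc
  have hcts : ∀ t, Cts fun σ m => α m * f (2 * compK m * σ) m
      * (2 * compK m * gU (2 * compK m * σ + t * (ρ / √m)) m) := fun t =>
    hac.phase.mul (hg2c.phase_add (continuousOn_outer_freq ρ) t)
  obtain ⟨_, _, _, _, Ca, hCa, hab⟩ := id ha
  have hNi : IntegrableOn (fun m => Ca * (2 * C) * (compK m ^ 1 * m ^ (μ - 2))) (Ioo 0 1) :=
    (integrableOn_compK_pow_mul_rpow (by linarith) (by norm_num)).const_mul _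
  have hNb : ∀ t, ∀ m ∈ Ioo (0 : ℝ) 1, ∀ σ, |α m * f (2 * compK m * σ) m
      * (2 * compK m * gU (2 * compK m * σ + t * (ρ / √m)) m)|
      ≤ Ca * (2 * C) * (compK m ^ 1 * m ^ (μ - 2)) := by
    intro t m hm σ
    have b1 := (hab m hm (2 * compK m * σ)).1
    have hK := compK_pos hm
    have b2 := abs_mul_le_of_le (abs_of_nonneg (by positivity : 0 ≤ 2 * compK m)).le
      (hb m hm (2 * compK m * σ + t * (ρ / √m)))
    refine (abs_mul_le_of_le b1 b2).trans (le_of_eq ?_)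
    ring
  have hM : (fun m => m ^ (3 / 2 : ℝ) * ((1 - m) * compK m ^ 2) * m ^ (μ - 2) * compK m
      * loss m) =ᶠ[ae (volume.restrict (Ioo (0 : ℝ) 1))]
      fun m => compK m ^ 4 * m ^ (μ - 5 / 2) := by
    refine (ae_restrict_iff' measurableSet_Ioo).2 (Eventually.of_forall fun m hm => ?_)
    have := (h1m m hm).ne'
    have h0 := hm.1
    have e : m ^ (μ - 5 / 2) * m ^ 2 = m ^ (3 / 2 : ℝ) * m ^ (μ - 2) := by
      rw [← Real.rpow_natCast, ← Real.rpow_add h0, ← Real.rpow_add h0]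
      push_cast
      ring_nf
    simp only [loss, growth]
    generalize m ^ (μ - 5 / 2) = x, m ^ (3 / 2 : ℝ) = y, m ^ (μ - 2) = z at *
    field_simp
    linear_combination -compK m ^ 4 * e
  have hQc : ContinuousOn (fun m => m ^ (3 / 2 : ℝ) * ((1 - m) * compK m ^ 2)) (Ioo 0 1) :=
    (continuousOn_rpow_unit _).mul
      ((continuousOn_const.sub continuousOn_id).mul (continuousOn_compK.pow 2))
  have hL : ∀ m ∈ Ioo (0 : ℝ) 1, m ^ (3 / 2 : ℝ) * ((1 - m) * compK m ^ 2) * m ^ (μ - 2)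
      * compK m ≤ 10 ^ 8 := fun m hm => by
    refine le_trans (le_of_eq ?_) ((mul_le_of_le_one_left (mul_nonneg (h1m m hm).le
      (pow_nonneg (compK_pos hm).le 3)) (Real.rpow_le_one hm.1.le hm.2.le (z := μ - 1 / 2)
        (by linarith))).trans (one_sub_mul_compK_pow_le' hm (n := 3) (by norm_num)))
    have e : m ^ (μ - 1 / 2) = m ^ (3 / 2 : ℝ) * m ^ (μ - 2) := by
      rw [← Real.rpow_add hm.1]; ring_nf
    rw [e]; ring
  obtain ⟨D, hD⟩ := exists_abs_integral_le_div (L := 10 ^ 8) hℓ.1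
    (fun m hm => mul_nonneg (hmr _ m hm) (mul_nonneg (h1m m hm).le (sq_nonneg _))) (hmr _)
    (eJet_qOuter ρ) ha hg (fun m hm => hasDerivAt_outer_freq ρ hm) (fun m hm => qOuter_mul hρ hm)
    (((hQc.mul (continuousOn_rpow_unit _)).mul continuousOn_compK).mul continuousOn_loss)
    (((integrableOn_compK_pow_mul_rpow (by linarith) (by norm_num)).congr hM.symm))
    hL (fun t σ => integrableOn_of_cts (hcts t) hNi (hNb t) σ)
  refine ⟨2 * D, fun t ht => ?_⟩
  refine (abs_phaseInt_le (hcts t) hNi (hNb t) (hD t ht)).trans (le_of_eq ?_)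
  ring

end Outer

end

section

variable {m : ℝ} {ℓ τ : ℝ → ℝ}

/-! ### Derivatives with respect to the argument -/

lemma hasDerivAt_am (hm : m ∈ Ioo (0 : ℝ) 1) (u : ℝ) :
    HasDerivAt (fun u => am u m) (dn u m) u := by
  have hd := dlt_pos (φ := am u m) hm.2
  have h := HasDerivAt.of_local_left_inverse (f := fun φ => ellF φ m) (g := fun u => am u m)
    (a := u) (f' := 1 / dlt (am u m) m) (cts_am.continuous_left hm).continuousAt
    (hasDerivAt_ellF hm.2 _) (by positivity) (Eventually.of_forall fun x => ellF_am hm x)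
  exact h.congr_deriv (by rw [dn]; field_simp)

lemma hasDerivAt_sn (hm : m ∈ Ioo (0 : ℝ) 1) (u : ℝ) :
    HasDerivAt (fun u => sn u m) (cn u m * dn u m) u := (hasDerivAt_am hm u).sin

lemma hasDerivAt_cn (hm : m ∈ Ioo (0 : ℝ) 1) (u : ℝ) :
    HasDerivAt (fun u => cn u m) (-sn u m * dn u m) u := (hasDerivAt_am hm u).cos

lemma hasDerivAt_dn (hm : m ∈ Ioo (0 : ℝ) 1) (u : ℝ) :
    HasDerivAt (fun u => dn u m) (-(m * sn u m * cn u m)) u := by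
  refine ((hasDerivAt_dlt hm.2 (am u m)).comp u (hasDerivAt_am hm u)).congr_deriv ?_
  have hd := (dlt_pos (φ := am u m) hm.2).ne'
  simp only [sn, cn, dn]
  field_simp

lemma hasDerivAt_zet (hm : m ∈ Ioo (0 : ℝ) 1) (u : ℝ) :
    HasDerivAt (fun u => zet u m) (zetU u m) u := by
  have h := ((hasDerivAt_ellB hm.2 (am u m)).comp u (hasDerivAt_am hm u)).sub
    ((hasDerivAt_id u).const_mul (compB m / compK m))
  refine h.congr_deriv ?_
  have hd := (dlt_pos (φ := am u m) hm.2).ne'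
  simp only [zetU, cn, dn]
  field_simp

lemma sn_add (hm : m ∈ Ioo (0 : ℝ) 1) (u : ℝ) : sn (u + 2 * compK m) m = -sn u m := by
  rw [sn, am_add hm, Real.sin_add_pi, sn]

lemma cn_add (hm : m ∈ Ioo (0 : ℝ) 1) (u : ℝ) : cn (u + 2 * compK m) m = -cn u m := by
  rw [cn, am_add hm, Real.cos_add_pi, cn]

lemma dn_add (hm : m ∈ Ioo (0 : ℝ) 1) (u : ℝ) : dn (u + 2 * compK m) m = dn u m := by
  rw [dn, am_add hm, dlt_add_pi, dn]

/-! ### Means over a period -/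

/-- The mean over a period, in the coordinate `σ ∈ (-1, 1)`, of a derivative vanishes. -/
lemma integral_phase_eq_zero (hm : m ∈ Ioo (0 : ℝ) 1) {F f : ℝ → ℝ}
    (hF : ∀ u, HasDerivAt F (f u) u) (hf : Continuous f)
    (hper : ∀ u, F (u + 2 * compK m) = F (u - 2 * compK m)) (c : ℝ) :
    ∫ σ in (-1 : ℝ)..1, f (2 * compK m * σ + c) = 0 := by
  have hK := compK_pos hm
  rw [intervalIntegral.integral_comp_mul_add f (by positivity),
    intervalIntegral.integral_eq_sub_of_hasDerivAt (fun x _ => hF x) (hf.intervalIntegrable _ _)]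
  have := hper c
  rw [show 2 * compK m * 1 + c = c + 2 * compK m by ring,
    show 2 * compK m * -1 + c = c - 2 * compK m by ring, this]
  simp

lemma integral_scd (hm : m ∈ Ioo (0 : ℝ) 1) (c : ℝ) : ∫ σ in (-1 : ℝ)..1,
    -2 * cn (2 * compK m * σ + c) m * sn (2 * compK m * σ + c) m * dn (2 * compK m * σ + c) m = 0 := by
  refine integral_phase_eq_zero hm (F := fun u => -sn u m ^ 2)
    (f := fun u => -2 * cn u m * sn u m * dn u m)
    (fun u => ((hasDerivAt_sn hm u).fun_pow 2).fun_neg.congr_deriv ?_) ?_ (fun u => ?_) c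
  · norm_num; ring
  · exact ((((Cts.const (-2)).mul cts_cn).mul cts_sn).mul cts_dn).continuous_left hm
  · have h := sn_add hm (u - 2 * compK m)
    rw [sub_add_cancel] at h
    rw [sn_add hm, h]; ring

lemma integral_zetU (hm : m ∈ Ioo (0 : ℝ) 1) (c : ℝ) :
    ∫ σ in (-1 : ℝ)..1, zetU (2 * compK m * σ + c) m = 0 := by
  refine integral_phase_eq_zero hm (hasDerivAt_zet hm) (cts_zetU.continuous_left hm) (fun u => ?_) c
  have h1 : zet (u + 2 * compK m) m = zet u m := zet_periodic hm u
  have h2 : zet (u - 2 * compK m + 2 * compK m) m = zet (u - 2 * compK m) m :=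
    zet_periodic hm (u - 2 * compK m)
  rw [sub_add_cancel] at h2
  rw [h1, h2]

lemma phaseInt_congr {f g : ℝ → ℝ → ℝ} (h : ∀ m ∈ Ioo (0 : ℝ) 1, ∀ σ, f σ m = g σ m) :
    phaseInt f = phaseInt g :=
  setIntegral_congr_fun measurableSet_Ioo fun m hm => by simp only [h m hm]

lemma phaseInt_const_mul (c : ℝ) (f : ℝ → ℝ → ℝ) :
    phaseInt (fun σ m => c * f σ m) = c * phaseInt f := by
  simp only [phaseInt, intervalIntegral.integral_const_mul, integral_const_mul]

end

section

variable {m : ℝ} {ℓ τ : ℝ → ℝ}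

/-! ### The profile -/

/-- Three derivatives of the derivative `g₁` of a profile are bounded by `C (1 + y²)^(-μ/2)` on the
range of the energy. -/
structure IsProfile (ρ μ : ℝ) (g₁ : ℝ → ℝ) : Prop where
  exists_jet : ∃ g₂ g₃ : ℝ → ℝ, (∀ y, HasDerivAt g₁ (g₂ y) y) ∧ (∀ y, HasDerivAt g₂ (g₃ y) y) ∧
    ∃ C, 0 ≤ C ∧ ∀ y, -ρ ^ 2 ≤ y → (1 + y ^ 2) ^ (μ / 2) * |g₁ y| ≤ C ∧
      (1 + y ^ 2) ^ (μ / 2) * |g₂ y| ≤ C ∧ (1 + y ^ 2) ^ (μ / 2) * |g₃ y| ≤ C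

/-- The energy of an orbit in the eye. -/
def energyEye (ρ m : ℝ) : ℝ := ρ ^ 2 * (2 * m - 1)

/-- The energy of an orbit outside the eye. -/
def energyOuter (ρ m : ℝ) : ℝ := ρ ^ 2 * (2 / m - 1)

lemma neg_sq_le_energyEye (ρ : ℝ) (hm : m ∈ Ioo (0 : ℝ) 1) : -ρ ^ 2 ≤ energyEye ρ m := by
  rw [energyEye]; nlinarith [hm.1, mul_nonneg (sq_nonneg ρ) hm.1.le]

lemma le_energyOuter (ρ : ℝ) (hm : m ∈ Ioo (0 : ℝ) 1) : ρ ^ 2 / m ≤ energyOuter ρ m := by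
  have h : 1 ≤ 1 / m := by rw [le_div_iff₀ hm.1]; linarith [hm.2]
  have e : energyOuter ρ m - ρ ^ 2 / m = ρ ^ 2 * (1 / m - 1) := by rw [energyOuter]; ring
  have : 0 ≤ ρ ^ 2 * (1 / m - 1) := mul_nonneg (sq_nonneg _) (by linarith)
  linarith

lemma neg_sq_le_energyOuter (ρ : ℝ) (hm : m ∈ Ioo (0 : ℝ) 1) : -ρ ^ 2 ≤ energyOuter ρ m :=
  (by have : 0 ≤ ρ ^ 2 / m := div_nonneg (sq_nonneg _) hm.1.le
      nlinarith [sq_nonneg ρ] : -ρ ^ 2 ≤ ρ ^ 2 / m).trans (le_energyOuter ρ hm)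

lemma abs_le_of_weight {μ C x y : ℝ} (hμ : 0 ≤ μ) (h : (1 + y ^ 2) ^ (μ / 2) * |x| ≤ C) :
    |x| ≤ C :=
  (le_mul_of_one_le_left (abs_nonneg x) (Real.one_le_rpow (by nlinarith [sq_nonneg y])
    (by positivity))).trans h

/-- Outside the eye the energy is at least a multiple of `1 / m`, so decay in the energy becomes the
power `m^μ` at `m = 0`. -/
lemma abs_le_of_weight_of_le {μ C x y b : ℝ} (hμ : 0 ≤ μ) (hb : 0 < b) (hm : m ∈ Ioo (0 : ℝ) 1)
    (hy : b / m ≤ y) (h : (1 + y ^ 2) ^ (μ / 2) * |x| ≤ C) : |x| ≤ C * b ^ (-μ) * m ^ μ := by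
  have hm0 := hm.1
  have h1 : (b / m) ^ μ ≤ (1 + y ^ 2) ^ (μ / 2) := by
    have e : (b / m) ^ μ = ((b / m) ^ 2) ^ (μ / 2) := by
      rw [← Real.rpow_natCast, ← Real.rpow_mul (by positivity)]
      congr 1; push_cast; ring
    rw [e]
    refine Real.rpow_le_rpow (by positivity) ?_ (by positivity)
    have : (b / m) ^ 2 ≤ y ^ 2 := pow_le_pow_left₀ (by positivity) hy 2
    linarith
  have h2 : (b / m) ^ μ * |x| ≤ C := (mul_le_mul_of_nonneg_right h1 (abs_nonneg x)).trans h
  have h3 : b ^ (-μ) * m ^ μ * (b / m) ^ μ = 1 := by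
    rw [Real.div_rpow hb.le hm0.le, Real.rpow_neg hb.le]
    have := (Real.rpow_pos_of_pos hb μ).ne'
    have := (Real.rpow_pos_of_pos hm0 μ).ne'
    field_simp
  calc |x| = b ^ (-μ) * m ^ μ * ((b / m) ^ μ * |x|) := by rw [← mul_assoc, h3, one_mul]
    _ ≤ b ^ (-μ) * m ^ μ * C := by gcongr
    _ = _ := by ring

variable {ρ μ : ℝ} {g₁ : ℝ → ℝ}

lemma IsProfile.continuous (hg : IsProfile ρ μ g₁) : Continuous g₁ := by
  obtain ⟨g₂, g₃, h1, -⟩ := hg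
  exact continuous_iff_continuousAt.2 fun y => (h1 y).continuousAt

lemma hasDerivAt_energyEye (ρ m : ℝ) : HasDerivAt (energyEye ρ) (2 * ρ ^ 2) m :=
  ((((hasDerivAt_id m).const_mul 2).sub_const 1).const_mul (ρ ^ 2)).congr_deriv (by ring)

lemma hasDerivAt_energyOuter (ρ : ℝ) (hm : m ≠ 0) :
    HasDerivAt (energyOuter ρ) (-2 * ρ ^ 2 / m ^ 2) m :=
  ((((hasDerivAt_const m (2 : ℝ)).fun_div (hasDerivAt_id m) hm).sub_const 1).const_mul
    (ρ ^ 2)).congr_deriv (by simp; ring)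

lemma eJet_profile_eye (hμ : 0 ≤ μ) (hg : IsProfile ρ μ g₁) (h : IsJacobiLoss ℓ τ) :
    EJet ℓ τ (fun _ => 1) (fun _ m => g₁ (energyEye ρ m)) := by
  obtain ⟨g₂, g₃, d1, d2, C, hC, hb⟩ := hg
  refine EJet.of_hasDerivAt (C := C + C * (2 * ρ ^ 2) + C * (2 * ρ ^ 2) * (2 * ρ ^ 2))
    (x₁ := fun m => g₂ (energyEye ρ m) * (2 * ρ ^ 2))
    (x₂ := fun m => g₃ (energyEye ρ m) * (2 * ρ ^ 2) * (2 * ρ ^ 2))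
    (fun m hm => (d1 _).comp m (hasDerivAt_energyEye ρ m))
    (fun m hm => ((d2 _).comp m (hasDerivAt_energyEye ρ m)).mul_const _) (by positivity)
    fun m hm => ?_
  obtain ⟨b1, b2, b3⟩ := hb _ (neg_sq_le_energyEye ρ hm)
  have c1 := abs_le_of_weight hμ b1
  have c2 := abs_le_of_weight hμ b2
  have c3 := abs_le_of_weight hμ b3
  have p : 0 ≤ 2 * ρ ^ 2 := by positivity
  obtain ⟨l1, l2, l3⟩ := h.1 m hm
  have l4 : 1 ≤ τ m ^ 2 / ℓ m := by rw [le_div_iff₀ l1]; nlinarith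
  have hC2 : 0 ≤ C * (2 * ρ ^ 2) := by positivity
  have hC3 : 0 ≤ C * (2 * ρ ^ 2) * (2 * ρ ^ 2) := by positivity
  have e2 : |g₂ (energyEye ρ m) * (2 * ρ ^ 2)| ≤ C * (2 * ρ ^ 2) := by
    rw [abs_mul, abs_of_nonneg p]; gcongr
  have e3 : |g₃ (energyEye ρ m) * (2 * ρ ^ 2) * (2 * ρ ^ 2)| ≤ C * (2 * ρ ^ 2) * (2 * ρ ^ 2) := by
    rw [abs_mul, abs_mul, abs_of_nonneg p]; gcongr
  simp only [one_mul]
  refine ⟨by linarith, e2.trans ?_, e3.trans ?_⟩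
  · exact (by linarith : _ ≤ C + C * (2 * ρ ^ 2) + C * (2 * ρ ^ 2) * (2 * ρ ^ 2)).trans
      (le_mul_of_one_le_right (by positivity) l3)
  · exact (by linarith : _ ≤ C + C * (2 * ρ ^ 2) + C * (2 * ρ ^ 2) * (2 * ρ ^ 2)).trans
      (le_mul_of_one_le_right (by positivity) l4)

lemma eJet_profile_outer (hρ : 0 < ρ) (hμ : 0 ≤ μ) (hg : IsProfile ρ μ g₁) :
    EJet (fun _ => 1) loss (fun m => m ^ μ) (fun _ m => g₁ (energyOuter ρ m)) := by
  obtain ⟨g₂, g₃, d1, d2, C, hC, hb⟩ := hg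
  -- The factor `(ρ²)^(-μ)` comes from the lower bound `ρ² / m` of the energy.
  set A := C * (ρ ^ 2) ^ (-μ) with hA
  have hA0 : 0 ≤ A := by positivity
  refine EJet.of_hasDerivAt (C := A + A * (2 * ρ ^ 2) + A * (2 * ρ ^ 2) * (2 * ρ ^ 2)
      + A * (4 * ρ ^ 2))
    (x₁ := fun m => g₂ (energyOuter ρ m) * (-2 * ρ ^ 2 / m ^ 2))
    (x₂ := fun m => g₃ (energyOuter ρ m) * (-2 * ρ ^ 2 / m ^ 2) * (-2 * ρ ^ 2 / m ^ 2)
      + g₂ (energyOuter ρ m) * (4 * ρ ^ 2 / m ^ 3))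
    (fun m hm => (d1 _).comp m (hasDerivAt_energyOuter ρ hm.1.ne'))
    (fun m hm => (((d2 _).comp m (hasDerivAt_energyOuter ρ hm.1.ne')).fun_mul
      ((hasDerivAt_const m (-2 * ρ ^ 2)).fun_div ((hasDerivAt_id m).fun_pow 2)
        (pow_ne_zero 2 hm.1.ne'))).congr_deriv ?_) (by positivity) fun m hm => ?_
  · have := hm.1.ne'
    simp only [id, Function.comp]
    field_simp
    norm_num
    ring
  obtain ⟨b1, b2, b3⟩ := hb _ (neg_sq_le_energyOuter ρ hm)
  have hρ2 : 0 < ρ ^ 2 := by positivity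
  have c1 := abs_le_of_weight_of_le hμ hρ2 hm (le_energyOuter ρ hm) b1
  have c2 := abs_le_of_weight_of_le hμ hρ2 hm (le_energyOuter ρ hm) b2
  have c3 := abs_le_of_weight_of_le hμ hρ2 hm (le_energyOuter ρ hm) b3
  rw [← hA] at c1 c2 c3
  have hm0 := hm.1
  have hw : 0 < m ^ μ := Real.rpow_pos_of_pos hm0 μ
  have hgr := (growth_bounds hm).1
  have l1 : 1 / m ^ 2 ≤ loss m := by rw [loss]; gcongr
  have l0 : 1 ≤ 1 / m ^ 2 := by
    rw [le_div_iff₀ (by positivity)]; nlinarith [hm.2]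
  have l2 : 1 / m ^ 4 ≤ loss m ^ 2 := by
    have := pow_le_pow_left₀ (by positivity) l1 2
    refine le_trans (le_of_eq ?_) this
    field_simp
  have l3 : 1 / m ^ 3 ≤ loss m ^ 2 := by
    refine le_trans ?_ l2
    exact one_div_le_one_div_of_le (by positivity)
      (pow_le_pow_of_le_one hm0.le hm.2.le (by norm_num))
  have hl : 0 < loss m := lt_of_lt_of_le (by positivity) l1
  have a2 : |-2 * ρ ^ 2 / m ^ 2| = 2 * ρ ^ 2 * (1 / m ^ 2) := by
    rw [abs_div, abs_mul, abs_of_pos hρ2, abs_of_pos (by positivity : 0 < m ^ 2)]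
    norm_num; ring
  have a3 : |4 * ρ ^ 2 / m ^ 3| = 4 * ρ ^ 2 * (1 / m ^ 3) := by
    rw [abs_of_pos (by positivity)]; ring
  have e2 : |g₂ (energyOuter ρ m) * (-2 * ρ ^ 2 / m ^ 2)|
      ≤ A * (2 * ρ ^ 2) * (m ^ μ * loss m) := by
    rw [abs_mul, a2]
    calc _ ≤ A * m ^ μ * (2 * ρ ^ 2 * loss m) := by gcongr
      _ = _ := by ring
  have e3 : |g₃ (energyOuter ρ m) * (-2 * ρ ^ 2 / m ^ 2) * (-2 * ρ ^ 2 / m ^ 2)|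
      ≤ A * (2 * ρ ^ 2) * (2 * ρ ^ 2) * (m ^ μ * loss m ^ 2) := by
    rw [abs_mul, abs_mul, a2]
    calc _ ≤ A * m ^ μ * (2 * ρ ^ 2 * loss m) * (2 * ρ ^ 2 * loss m) := by gcongr
      _ = _ := by ring
  have e4 : |g₂ (energyOuter ρ m) * (4 * ρ ^ 2 / m ^ 3)|
      ≤ A * (4 * ρ ^ 2) * (m ^ μ * loss m ^ 2) := by
    rw [abs_mul, a3]
    calc _ ≤ A * m ^ μ * (4 * ρ ^ 2 * loss m ^ 2) := by gcongr
      _ = _ := by ring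
  have q1 : 0 ≤ A * (2 * ρ ^ 2) := by positivity
  have q2 : 0 ≤ A * (2 * ρ ^ 2) * (2 * ρ ^ 2) := by positivity
  have q3 : 0 ≤ A * (4 * ρ ^ 2) := by positivity
  refine ⟨c1.trans ?_, e2.trans ?_, ?_⟩
  · gcongr; linarith
  · gcongr; linarith
  · rw [div_one]
    refine (abs_add_le _ _).trans ((add_le_add e3 e4).trans ?_)
    rw [← add_mul]
    gcongr
    linarith

lemma continuousOn_energyEye (ρ : ℝ) : ContinuousOn (energyEye ρ) (Ioo 0 1) := fun m _ =>
  (hasDerivAt_energyEye ρ m).continuousAt.continuousWithinAt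

lemma continuousOn_energyOuter (ρ : ℝ) : ContinuousOn (energyOuter ρ) (Ioo 0 1) := fun _ hm =>
  (hasDerivAt_energyOuter ρ hm.1.ne').continuousAt.continuousWithinAt

/-! ### The kernels in elliptic coordinates -/

section Kernels

lemma eJet_eye_coeff (hμ : 0 ≤ μ) (hg : IsProfile ρ μ g₁) (c : ℝ) :
    EJet (fun m => m) growth (fun _ => 1) (fun _ m => c * g₁ (energyEye ρ m)) := by
  have h := isJacobiLoss_eye
  simpa using (EJet.const h.1 c).mul h.1 (fun _ _ => zero_le_one) (fun _ _ => zero_le_one)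
    (eJet_profile_eye hμ hg h)

lemma eJet_eye_coeff_div (hμ : 0 ≤ μ) (hg : IsProfile ρ μ g₁) (c : ℝ) :
    EJet (fun m => m) growth (fun _ => 1) (fun _ m => c * g₁ (energyEye ρ m) * (compK m)⁻¹) := by
  have h := isJacobiLoss_eye
  simpa using (eJet_eye_coeff hμ hg c).mul h.1 (fun _ _ => zero_le_one) (fun _ _ => zero_le_one)
    (eJet_compK_inv h)

lemma eJet_outer_coeff (hρ : 0 < ρ) (hμ : 0 ≤ μ) (hg : IsProfile ρ μ g₁) (c s : ℝ) :
    EJet (fun _ => 1) loss (fun m => m ^ (μ + s))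
      (fun _ m => c * (m ^ s * g₁ (energyOuter ρ m))) := by
  have h := isJacobiLoss_outer
  have hmr : ∀ s : ℝ, ∀ m ∈ Ioo (0 : ℝ) 1, 0 ≤ m ^ s := fun s m hm => Real.rpow_nonneg hm.1.le _
  have := (EJet.const h.1 c).mul h.1 (fun _ _ => zero_le_one)
    (fun m hm => mul_nonneg (hmr s m hm) (hmr μ m hm))
    ((eJet_rpow h (fun m hm => inv_le_loss hm) s).mul h.1 (hmr _) (hmr _)
      (eJet_profile_outer hρ hμ hg))
  refine EJet.mono h.1 this zero_le_one fun m hm => le_of_eq ?_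
  rw [Real.rpow_add hm.1]
  ring

lemma eJet_outer_coeff_div (hρ : 0 < ρ) (hμ : 0 ≤ μ) (hg : IsProfile ρ μ g₁) (c s : ℝ) :
    EJet (fun _ => 1) loss (fun m => m ^ (μ + s))
      (fun _ m => c * (m ^ s * g₁ (energyOuter ρ m)) * (compK m)⁻¹) := by
  have h := isJacobiLoss_outer
  have hmr : ∀ s : ℝ, ∀ m ∈ Ioo (0 : ℝ) 1, 0 ≤ m ^ s := fun s m hm => Real.rpow_nonneg hm.1.le _
  simpa using (eJet_outer_coeff hρ hμ hg c s).mul h.1 (hmr _) (fun _ _ => zero_le_one)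
    (eJet_compK_inv h)

lemma continuousOn_eye_coeff (hg : IsProfile ρ μ g₁) (c : ℝ) :
    ContinuousOn (fun m => c * g₁ (energyEye ρ m)) (Ioo 0 1) :=
  continuousOn_const.mul (hg.continuous.comp_continuousOn (continuousOn_energyEye ρ))

lemma continuousOn_compK_inv : ContinuousOn (fun m => (compK m)⁻¹) (Ioo 0 1) :=
  continuousOn_compK.inv₀ fun _ hm => (compK_pos hm).ne'

lemma continuousOn_outer_coeff (hg : IsProfile ρ μ g₁) (c s : ℝ) :
    ContinuousOn (fun m => c * (m ^ s * g₁ (energyOuter ρ m))) (Ioo 0 1) :=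
  continuousOn_const.mul ((continuousOn_rpow_unit s).mul
    (hg.continuous.comp_continuousOn (continuousOn_energyOuter ρ)))

end Kernels

end

section

variable {m ρ μ : ℝ} {g₁ : ℝ → ℝ}

/-! ### Decay of the kernels in elliptic coordinates -/

lemma exists_decay_of_const_mul {F F' : ℝ → ℝ} {c : ℝ} (e : ∀ t > 0, F' t = c * F t) {r : ℝ → ℝ}
    (h : ∃ D, ∀ t > 0, |F t| ≤ D / r t) : ∃ D, ∀ t > 0, |F' t| ≤ D / r t := by
  obtain ⟨D, hD⟩ := h
  refine ⟨|c| * D, fun t ht => ?_⟩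
  rw [e t ht, abs_mul, mul_div_assoc]
  exact mul_le_mul_of_nonneg_left (hD t ht) (abs_nonneg c)

lemma cts_scd : Cts fun u m => -2 * cn u m * sn u m * dn u m :=
  (((Cts.const (-2)).mul cts_cn).mul cts_sn).mul cts_dn

lemma abs_scd_le (hm : m ∈ Ioo (0 : ℝ) 1) (u : ℝ) : |-2 * cn u m * sn u m * dn u m| ≤ 2 := by
  have h := abs_mul_le_of_le (abs_mul_le_of_le (abs_mul_le_of_le (by norm_num : |(-2 : ℝ)| ≤ 2)
    (abs_cn_le u m)) (abs_sn_le u m)) (abs_dn_le hm u)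
  linarith

lemma abs_mul_le_of_unit {a b : ℝ} (ha : 0 ≤ a) (ha1 : a ≤ 1) : |a * b| ≤ |b| := by
  rw [abs_mul, abs_of_nonneg ha]
  exact mul_le_of_le_one_left (abs_nonneg b) ha1

theorem kernelC_eye (hρ : 0 < ρ) (hμ : 0 ≤ μ) (hg : IsProfile ρ μ g₁) :
    ∃ D, ∀ t > 0, |phaseInt fun σ m => compK m * g₁ (energyEye ρ m)
      * ((1 - 2 * m * sn (2 * compK m * σ) m ^ 2)
        * (m * (-2 * cn (2 * compK m * σ + t * ρ) m * sn (2 * compK m * σ + t * ρ) m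
          * dn (2 * compK m * σ + t * ρ) m)))| ≤ D / t ^ 2 := by
  have hℓ := isJacobiLoss_eye
  have hf : EJet (fun m => m) growth (fun _ => 1) (fun u m => sn u m * sn u m) := by
    simpa using (eJet_sn hℓ).mul hℓ.1 (fun _ _ => zero_le_one) (fun _ _ => zero_le_one) (eJet_sn hℓ)
  refine exists_decay_of_const_mul (c := 1) (fun t _ => ?_) (eye_decay_sq hρ
    (eJet_eye_coeff_div hμ hg (-1 / 2)) hf
    ((continuousOn_eye_coeff hg _).mul continuousOn_compK_inv) (cts_sn.mul cts_sn)
    (Cts.id.mul cts_scd) (C := 2)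
    (fun m hm u => (abs_mul_le_of_unit hm.1.le hm.2.le).trans (abs_scd_le hm u))
    (phaseJet_mul_zet hℓ))
  rw [one_mul]
  refine setIntegral_congr_fun measurableSet_Ioo fun m hm => ?_
  have hK := (compK_pos hm).ne'
  -- The constant `1` in `cos x = 1 - 2 m sn²` contributes nothing, since the other factor is a
  -- derivative with mean zero over a period. What remains of the amplitude is `m sn²`, with the
  -- factor `m` that the two integrations by parts in the eye require.
  have h0 := integral_scd hm (t * ρ)
  have e : ∀ σ, compK m * g₁ (energyEye ρ m) * ((1 - 2 * m * sn (2 * compK m * σ) m ^ 2)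
        * (m * (-2 * cn (2 * compK m * σ + t * ρ) m * sn (2 * compK m * σ + t * ρ) m
          * dn (2 * compK m * σ + t * ρ) m)))
      = compK m * g₁ (energyEye ρ m) * m * (-2 * cn (2 * compK m * σ + t * ρ) m
        * sn (2 * compK m * σ + t * ρ) m * dn (2 * compK m * σ + t * ρ) m)
      + -1 / 2 * g₁ (energyEye ρ m) * (compK m)⁻¹ * (m * (sn (2 * compK m * σ) m
        * sn (2 * compK m * σ) m)) * ((2 * compK m) ^ 2 * (m * (-2 * cn (2 * compK m * σ + t * ρ) m
          * sn (2 * compK m * σ + t * ρ) m * dn (2 * compK m * σ + t * ρ) m))) := by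
    intro σ; field_simp; ring
  have hc1 := (cts_scd.phase_add (ϖ := fun _ => ρ) continuousOn_const t).continuous_left hm
  have hc2 := cts_sn.phase.continuous_left hm
  simp only [e]
  rw [intervalIntegral.integral_add, intervalIntegral.integral_const_mul, h0, mul_zero, zero_add]
  · exact (continuous_const.mul hc1).intervalIntegrable _ _
  · exact ((continuous_const.mul (continuous_const.mul (hc2.mul hc2))).mul
      (continuous_const.mul (continuous_const.mul hc1))).intervalIntegrable _ _

lemma eJet_one_sub_two_sn_sq {ℓ τ : ℝ → ℝ} (hℓ : IsJacobiLoss ℓ τ) :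
    EJet ℓ τ (fun _ => 1) (fun u m => 1 - 2 * sn u m ^ 2) := by
  have h := (EJet.const hℓ.1 (-2)).mul hℓ.1 (fun _ _ => zero_le_one) (fun _ _ => by norm_num)
    ((eJet_sn hℓ).mul hℓ.1 (fun _ _ => zero_le_one) (fun _ _ => zero_le_one) (eJet_sn hℓ))
  have h2 := (EJet.const hℓ.1 1).add (h.mono hℓ.1 (v := fun _ => 1) zero_le_one (by norm_num))
  have e : (fun u m => 1 - 2 * sn u m ^ 2) = fun u m : ℝ => 1 + -2 * (sn u m * sn u m) := by
    funext u m; ring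
  rw [e]
  exact h2

lemma cts_one_sub_two_sn_sq : Cts fun u m => 1 - 2 * sn u m ^ 2 :=
  (Cts.const 1).sub ((Cts.const 2).mul (cts_sn.pow 2))

lemma eJet_two_dn_sq_sub {ℓ τ : ℝ → ℝ} (hℓ : IsJacobiLoss ℓ τ) :
    EJet ℓ τ (fun _ => 1) (fun u m => -1 + 2 * (dn u m * dn u m)) := by
  have h := (EJet.const hℓ.1 2).mul hℓ.1 (fun _ _ => zero_le_one) (fun _ _ => by norm_num)
    ((eJet_dn hℓ).mul hℓ.1 (fun _ _ => zero_le_one) (fun _ _ => zero_le_one) (eJet_dn hℓ))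
  exact (EJet.const hℓ.1 (-1)).add (h.mono hℓ.1 (v := fun _ => 1) zero_le_one (by norm_num))

lemma rpow_weight (μ s : ℝ) : (fun m : ℝ => m ^ (μ + -s)) = fun m => m ^ (μ - s) := by
  simp only [sub_eq_add_neg]

theorem kernelC_outer (hρ : 0 < ρ) (hμ : 2 < μ) (hg : IsProfile ρ μ g₁) :
    ∃ D, ∀ t > 0, |phaseInt fun σ m => compK m * (m ^ (-2 : ℝ) * g₁ (energyOuter ρ m))
      * ((1 - 2 * sn (2 * compK m * σ) m ^ 2)
        * (-2 * cn (2 * compK m * σ + t * (ρ / √m)) m * sn (2 * compK m * σ + t * (ρ / √m)) m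
          * dn (2 * compK m * σ + t * (ρ / √m)) m))| ≤ D / t ^ 2 := by
  have hℓ := isJacobiLoss_outer
  have hα := eJet_outer_coeff_div hρ (by linarith) hg (1 / 4) (-2)
  rw [rpow_weight] at hα
  refine exists_decay_of_const_mul (c := 1) (fun t _ => ?_) (outer_decay_sq hρ hμ hα
    (eJet_one_sub_two_sn_sq hℓ) ((continuousOn_outer_coeff hg _ _).mul continuousOn_compK_inv)
    cts_one_sub_two_sn_sq cts_scd (fun m hm u => abs_scd_le hm u)
    (phaseJet_zet outer_bounds))
  rw [one_mul]
  refine phaseInt_congr fun m hm σ => ?_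
  have hK := (compK_pos hm).ne'
  field_simp
  ring

/-- The twofold primitive is `cn`, because `cn'' = -cn (1 - 2 m sn²)`. The factor `m` of the
amplitude is the product of the two factors `√m` in `sin x` and in its derivative. -/
theorem kernelS_eye (hρ : 0 < ρ) (hμ : 0 ≤ μ) (hg : IsProfile ρ μ g₁) :
    ∃ D, ∀ t > 0, |phaseInt fun σ m => compK m * g₁ (energyEye ρ m)
      * (m * (sn (2 * compK m * σ) m * dn (2 * compK m * σ) m)
        * (cn (2 * compK m * σ + t * ρ) m * (1 - 2 * m * sn (2 * compK m * σ + t * ρ) m ^ 2)))|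
      ≤ D / t ^ 2 := by
  have hℓ := isJacobiLoss_eye
  have hf : EJet (fun m => m) growth (fun _ => 1) (fun u m => sn u m * dn u m) := by
    simpa using (eJet_sn hℓ).mul hℓ.1 (fun _ _ => zero_le_one) (fun _ _ => zero_le_one) (eJet_dn hℓ)
  refine exists_decay_of_const_mul (c := 1) (fun t _ => ?_) (eye_decay_sq hρ
    (eJet_eye_coeff_div hμ hg (-1 / 4)) hf
    ((continuousOn_eye_coeff hg _).mul continuousOn_compK_inv) (cts_sn.mul cts_dn)
    ((((cts_cn.mul cts_dn).mul cts_dn).add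
      (cts_sn.mul ((Cts.id.mul cts_sn).mul cts_cn).neg)).neg) (C := 2)
    (fun m hm u => ?_) ((phaseJet_cn hℓ).mono hℓ.1 fun m hm => one_le_compK hm))
  · rw [one_mul]
    refine phaseInt_congr fun m hm σ => ?_
    have hK := (compK_pos hm).ne'
    have hd := dn_sq hm.2 (2 * compK m * σ + t * ρ)
    generalize 2 * compK m * σ + t * ρ = y at *
    generalize 2 * compK m * σ = x at *
    field_simp
    linear_combination (-m * g₁ (energyEye ρ m) * sn x m * dn x m * cn y m * 4) * hd
  · have h1 := abs_mul_le_of_le (abs_mul_le_of_le (abs_cn_le u m) (abs_dn_le hm u)) (abs_dn_le hm u)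
    have h2 := abs_mul_le_of_le (abs_sn_le u m) (abs_mul_le_of_le (abs_sn_le u m) (abs_cn_le u m))
    have h3 := abs_mul_le_of_unit (b := sn u m * (sn u m * cn u m)) hm.1.le hm.2.le
    rw [abs_neg, show cn u m * dn u m * dn u m + sn u m * -(m * sn u m * cn u m)
      = cn u m * dn u m * dn u m - m * (sn u m * (sn u m * cn u m)) by ring]
    refine (abs_sub _ _).trans ?_
    linarith

lemma eJet_sn_mul_cn {ℓ τ : ℝ → ℝ} (hℓ : IsJacobiLoss ℓ τ) :
    EJet ℓ τ (fun _ => 1) (fun u m => sn u m * cn u m) := by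
  simpa using (eJet_sn hℓ).mul hℓ.1 (fun _ _ => zero_le_one) (fun _ _ => zero_le_one) (eJet_cn hℓ)

theorem kernelS_outer (hρ : 0 < ρ) (hμ : 2 < μ) (hg : IsProfile ρ μ g₁) :
    ∃ D, ∀ t > 0, |phaseInt fun σ m => compK m * (m ^ (-2 : ℝ) * g₁ (energyOuter ρ m))
      * ((sn (2 * compK m * σ) m * cn (2 * compK m * σ) m)
        * (dn (2 * compK m * σ + t * (ρ / √m)) m
          * (1 - 2 * sn (2 * compK m * σ + t * (ρ / √m)) m ^ 2)))| ≤ D / t ^ 2 := by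
  have hℓ := isJacobiLoss_outer
  have hα := eJet_outer_coeff_div hρ (by linarith) hg (1 / 4) (-2)
  rw [rpow_weight] at hα
  refine exists_decay_of_const_mul (c := 1) (fun t _ => ?_) (outer_decay_sq hρ hμ hα
    (eJet_sn_mul_cn hℓ) ((continuousOn_outer_coeff hg _ _).mul continuousOn_compK_inv)
    (cts_sn.mul cts_cn) (((cts_cn.pow 2).sub (cts_sn.pow 2)).mul cts_dn) (C := 1) (fun m hm u => ?_)
    ((phaseJet_one_sub_dn outer_bounds).mono hℓ.1 fun m hm => one_le_compK hm))
  · rw [one_mul]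
    refine phaseInt_congr fun m hm σ => ?_
    have hK := (compK_pos hm).ne'
    have hs := sn_sq_add_cn_sq (2 * compK m * σ + t * (ρ / √m)) m
    have hc : cn (2 * compK m * σ + t * (ρ / √m)) m ^ 2
      = 1 - sn (2 * compK m * σ + t * (ρ / √m)) m ^ 2 := by linarith
    rw [hc]
    field_simp
    ring
  · have h := abs_mul_le_of_le (abs_cn_sq_sub_le u m) (abs_dn_le hm u)
    linarith

/-- Subtracting the orbit mean from `cos x` leaves `2 m zetU`, the derivative of the periodic
function `2 m zet`, so that one integration by parts is possible. The unshifted factor is rewritten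
as `2 dn² - 1`. -/
theorem meanC_eye (hρ : 0 < ρ) (hμ : 0 ≤ μ) (hg : IsProfile ρ μ g₁) :
    ∃ D, ∀ t > 0, |phaseInt fun σ m => compK m * g₁ (energyEye ρ m)
      * ((1 - 2 * m * sn (2 * compK m * σ) m ^ 2) * (m * zetU (2 * compK m * σ + t * ρ) m))|
      ≤ D / t := by
  have hℓ := isJacobiLoss_eye
  refine exists_decay_of_const_mul (c := 1) (fun t _ => ?_) (eye_decay hρ
    (eJet_eye_coeff hμ hg (1 / 2)) (eJet_two_dn_sq_sub hℓ)
    (continuousOn_eye_coeff hg _) ((Cts.const (-1)).add ((Cts.const 2).mul (cts_dn.mul cts_dn)))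
    (Cts.id.mul cts_zetU) (C := 1)
    (fun m hm u => (abs_mul_le_of_unit hm.1.le hm.2.le).trans (abs_zetU_le hm u))
    (phaseJet_mul_zet hℓ))
  rw [one_mul]
  refine phaseInt_congr fun m hm σ => ?_
  have hd := dn_sq hm.2 (2 * compK m * σ)
  linear_combination (-2 * compK m * g₁ (energyEye ρ m) * (m * zetU (2 * compK m * σ + t * ρ) m)) * hd

theorem meanC_outer (hρ : 0 < ρ) (hμ : 2 < μ) (hg : IsProfile ρ μ g₁) :
    ∃ D, ∀ t > 0, |phaseInt fun σ m => compK m * (m ^ (-(3 / 2) : ℝ) * g₁ (energyOuter ρ m))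
      * ((1 - 2 * sn (2 * compK m * σ) m ^ 2) * zetU (2 * compK m * σ + t * (ρ / √m)) m)|
      ≤ D / t := by
  have hℓ := isJacobiLoss_outer
  -- The Jacobian gives `m^(μ - 3/2)`, which is better than the weight `m^(μ - 2)` for which the
  -- decay is stated.
  have hα := (eJet_outer_coeff hρ (by linarith) hg (1 / 2) (-(3 / 2))).mono hℓ.1
    (v := fun m => m ^ (μ - 2)) zero_le_one fun m hm => by
      rw [one_mul]; exact Real.rpow_le_rpow_of_exponent_ge hm.1 hm.2.le (by linarith)
  refine exists_decay_of_const_mul (c := 1) (fun t _ => ?_) (outer_decay hρ hμ hα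
    (eJet_one_sub_two_sn_sq hℓ) (continuousOn_outer_coeff hg _ _)
    cts_one_sub_two_sn_sq cts_zetU (fun m hm u => abs_zetU_le hm u) (phaseJet_zet outer_bounds))
  rw [one_mul]
  refine phaseInt_congr fun m hm σ => ?_
  norm_num
  ring

theorem meanS_eye (hρ : 0 < ρ) (hμ : 0 ≤ μ) (hg : IsProfile ρ μ g₁) :
    ∃ D, ∀ t > 0, |phaseInt fun σ m => compK m * g₁ (energyEye ρ m)
      * (m * (sn (2 * compK m * σ) m * dn (2 * compK m * σ) m)
        * (sn (2 * compK m * σ + t * ρ) m * dn (2 * compK m * σ + t * ρ) m))| ≤ D / t := by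
  have hℓ := isJacobiLoss_eye
  have hf : EJet (fun m => m) growth (fun _ => 1) (fun u m => sn u m * dn u m) := by
    simpa using (eJet_sn hℓ).mul hℓ.1 (fun _ _ => zero_le_one) (fun _ _ => zero_le_one) (eJet_dn hℓ)
  refine exists_decay_of_const_mul (c := 1) (fun t _ => ?_) (eye_decay hρ
    (eJet_eye_coeff hμ hg (-1 / 2)) ((aJet_eye (fun _ _ => zero_le_one) hf).eJet hℓ.1
      (fun _ _ => zero_le_one))
    (continuousOn_eye_coeff hg _) (Cts.id.mul (cts_sn.mul cts_dn))
    (cts_sn.mul cts_dn).neg (C := 1)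
    (fun m hm u => by
      rw [abs_neg]
      exact (abs_mul_le_of_le (abs_sn_le u m) (abs_dn_le hm u)).trans (by norm_num))
    ((phaseJet_cn hℓ).mono hℓ.1 fun m hm => one_le_compK hm))
  rw [one_mul]
  refine phaseInt_congr fun m hm σ => ?_
  norm_num
  ring

theorem meanS_outer (hρ : 0 < ρ) (hμ : 2 < μ) (hg : IsProfile ρ μ g₁) :
    ∃ D, ∀ t > 0, |phaseInt fun σ m => compK m * (m ^ (-(3 / 2) : ℝ) * g₁ (energyOuter ρ m))
      * ((sn (2 * compK m * σ) m * cn (2 * compK m * σ) m)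
        * (sn (2 * compK m * σ + t * (ρ / √m)) m * cn (2 * compK m * σ + t * (ρ / √m)) m))|
      ≤ D / t := by
  have hℓ := isJacobiLoss_outer
  have hα := (eJet_outer_coeff hρ (by linarith) hg (1 / 2) (-(3 / 2))).mono hℓ.1
    (v := fun m => m ^ (μ - 2)) zero_le_one fun m hm => by
      rw [one_mul]; exact Real.rpow_le_rpow_of_exponent_ge hm.1 hm.2.le (by linarith)
  refine exists_decay_of_const_mul (c := 1) (fun t _ => ?_) (outer_decay hρ hμ hα
    (eJet_sn_mul_cn hℓ) (continuousOn_outer_coeff hg _ _)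
    (cts_sn.mul cts_cn) (cts_sn.mul cts_cn) (C := 1)
    (fun m hm u => (abs_mul_le_of_le (abs_sn_le u m) (abs_cn_le u m)).trans (by norm_num))
    ((phaseJet_one_sub_dn outer_bounds).mono hℓ.1 fun m hm => one_le_compK hm))
  rw [one_mul]
  refine phaseInt_congr fun m hm σ => ?_
  norm_num
  ring

end

section

variable {m ρ M : ℝ}

/-! ### The flow of the pendulum -/

open VlasovHMF

lemma pendulumFlow_eq {γ : ℝ → ℝ × ℝ} (hγ : ∀ t, HasDerivAt γ (pendulumField M (γ t)) t) (t : ℝ) :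
    pendulumFlow M t (γ 0) = γ t := by
  have h := ODE_solution_unique_univ (v := fun _ => pendulumField M) (s := fun _ => univ)
    (K := 1 + ‖M‖₊) (t₀ := 0) (f := fun t => pendulumFlow M t (γ 0)) (g := γ)
    (fun _ => (lipschitzWith_pendulumField M).lipschitzOnWith)
    (fun t => ⟨hasDerivAt_pendulumFlow M t (γ 0), mem_univ _⟩) (fun t => ⟨hγ t, mem_univ _⟩)
    (pendulumFlow_zero M _)
  exact congrFun h t

/-- The vector field is odd. This symmetry folds the lower half of phase space onto the upper one
and identifies the charts `U₊` and `U₋`. -/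
lemma pendulumFlow_neg (t : ℝ) (z : ℝ × ℝ) : pendulumFlow M t (-z) = -pendulumFlow M t z := by
  have h := pendulumFlow_eq (M := M) (γ := fun t => -pendulumFlow M t z) (fun t => ?_) t
  · simpa [pendulumFlow_zero] using h
  · refine (hasDerivAt_pendulumFlow M t z).neg.congr_deriv ?_
    simp [pendulumField, Prod.neg_mk]

lemma pendulumFlow_add_two_pi (t : ℝ) (z : ℝ × ℝ) :
    pendulumFlow M t (z + (2 * Real.pi, 0)) = pendulumFlow M t z + (2 * Real.pi, 0) := by
  have h := pendulumFlow_eq (M := M) (γ := fun t => pendulumFlow M t z + (2 * Real.pi, 0))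
    (fun t => ?_) t
  · simpa [pendulumFlow_zero] using h
  · refine ((hasDerivAt_pendulumFlow M t z).add_const _).congr_deriv ?_
    simp [pendulumField]

/-- Grönwall's inequality with the global Lipschitz constant of the field. -/
lemma continuous_pendulumFlow {t : ℝ} (ht : 0 ≤ t) : Continuous (pendulumFlow M t) := by
  set K : ℝ≥0 := 1 + ‖M‖₊
  refine (LipschitzWith.of_dist_le_mul (K := ⟨Real.exp (K * (t - 0)), (Real.exp_pos _).le⟩)
    fun z w => ?_).continuous
  have hc : ∀ z, Continuous fun s => pendulumFlow M s z := fun z =>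
    continuous_iff_continuousAt.2 fun s => (hasDerivAt_pendulumFlow M s z).continuousAt
  have h := dist_le_of_trajectories_ODE (v := fun _ => pendulumField M) (K := K)
    (f := fun s => pendulumFlow M s z) (g := fun s => pendulumFlow M s w) (a := 0) (b := t)
    (δ := dist z w) (fun _ => lipschitzWith_pendulumField M) (hc z).continuousOn
    (fun s _ => (hasDerivAt_pendulumFlow M s z).hasDerivWithinAt) (hc w).continuousOn
    (fun s _ => (hasDerivAt_pendulumFlow M s w).hasDerivWithinAt) (by simp [pendulumFlow_zero])
    t ⟨ht, le_rfl⟩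
  rw [mul_comm] at h
  exact h

/-- The point of the orbit with modulus `m` in the eye, in the elliptic coordinate `u`. -/
def eyePt (ρ u m : ℝ) : ℝ × ℝ := (2 * Real.arcsin (√m * sn u m), 2 * ρ * √m * cn u m)

/-- The point of the orbit with modulus `m` outside the eye, in the elliptic coordinate `u`. -/
def outerPt (ρ u m : ℝ) : ℝ × ℝ := (2 * am u m, 2 * (ρ / √m) * dn u m)

lemma sq_sqrt_mul_sn (hm : m ∈ Ioo (0 : ℝ) 1) (u : ℝ) : (√m * sn u m) ^ 2 = m * sn u m ^ 2 := by
  rw [mul_pow, Real.sq_sqrt hm.1.le]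

lemma m_mul_sn_sq_lt (hm : m ∈ Ioo (0 : ℝ) 1) (u : ℝ) : m * sn u m ^ 2 < 1 := by
  have h1 := sn_sq_add_cn_sq u m
  nlinarith [hm.1, hm.2, sq_nonneg (cn u m), sq_nonneg (sn u m)]

lemma sqrt_mul_sn_mem (hm : m ∈ Ioo (0 : ℝ) 1) (u : ℝ) : √m * sn u m ∈ Ioo (-1 : ℝ) 1 := by
  have := m_mul_sn_sq_lt hm u
  rw [← sq_sqrt_mul_sn hm] at this
  exact abs_lt.1 ((sq_lt_one_iff_abs_lt_one _).1 this)

lemma cos_arcsin_sqrt_mul_sn (hm : m ∈ Ioo (0 : ℝ) 1) (u : ℝ) :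
    Real.cos (Real.arcsin (√m * sn u m)) = dn u m := by
  rw [Real.cos_arcsin, sq_sqrt_mul_sn hm]; rfl

lemma sin_arcsin_sqrt_mul_sn (hm : m ∈ Ioo (0 : ℝ) 1) (u : ℝ) :
    Real.sin (Real.arcsin (√m * sn u m)) = √m * sn u m :=
  Real.sin_arcsin (sqrt_mul_sn_mem hm u).1.le (sqrt_mul_sn_mem hm u).2.le

lemma sin_eyePt (hm : m ∈ Ioo (0 : ℝ) 1) (u : ℝ) :
    Real.sin (eyePt ρ u m).1 = 2 * √m * (sn u m * dn u m) := by
  rw [eyePt, Real.sin_two_mul, sin_arcsin_sqrt_mul_sn hm, cos_arcsin_sqrt_mul_sn hm]; ring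

lemma cos_eyePt (hm : m ∈ Ioo (0 : ℝ) 1) (u : ℝ) :
    Real.cos (eyePt ρ u m).1 = 1 - 2 * m * sn u m ^ 2 := by
  rw [eyePt, Real.cos_two_mul, cos_arcsin_sqrt_mul_sn hm, dn_sq hm.2]; ring

lemma sin_outerPt (u m : ℝ) : Real.sin (outerPt ρ u m).1 = 2 * (sn u m * cn u m) := by
  rw [outerPt, Real.sin_two_mul, sn, cn]; ring

lemma cos_outerPt (u m : ℝ) : Real.cos (outerPt ρ u m).1 = 1 - 2 * sn u m ^ 2 := by
  rw [outerPt, Real.cos_two_mul, sn, Real.cos_sq']; ring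

lemma hamiltonian_eyePt (hm : m ∈ Ioo (0 : ℝ) 1) (u : ℝ) :
    hamiltonian (ρ ^ 2) (eyePt ρ u m) = energyEye ρ m := by
  have h := Real.sq_sqrt hm.1.le
  have h2 := sn_sq_add_cn_sq u m
  rw [hamiltonian, cos_eyePt hm, eyePt, energyEye]
  linear_combination (2 * ρ ^ 2 * cn u m ^ 2) * h + 2 * ρ ^ 2 * m * h2

lemma hamiltonian_outerPt (hm : m ∈ Ioo (0 : ℝ) 1) (u : ℝ) :
    hamiltonian (ρ ^ 2) (outerPt ρ u m) = energyOuter ρ m := by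
  have h := dn_sq hm.2 u
  have hm0 := hm.1
  have e : (ρ / √m) ^ 2 = ρ ^ 2 / m := by rw [div_pow, Real.sq_sqrt hm0.le]
  rw [hamiltonian, cos_outerPt, outerPt, energyOuter]
  simp only
  rw [mul_pow, mul_pow, e, h]
  field_simp
  ring

lemma hasDerivAt_eyePt (hm : m ∈ Ioo (0 : ℝ) 1) (u t : ℝ) :
    HasDerivAt (fun t => eyePt ρ (u + ρ * t) m)
      (pendulumField (ρ ^ 2) (eyePt ρ (u + ρ * t) m)) t := by
  have hu : HasDerivAt (fun t => u + ρ * t) ρ t := by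
    simpa using ((hasDerivAt_id t).const_mul ρ).const_add u
  have hs := (hasDerivAt_sn hm (u + ρ * t)).comp t hu
  have hc := (hasDerivAt_cn hm (u + ρ * t)).comp t hu
  have hmem := sqrt_mul_sn_mem hm (u + ρ * t)
  have hd := dn_pos hm.2 (u + ρ * t)
  have h1 := ((Real.hasDerivAt_arcsin hmem.1.ne' hmem.2.ne).comp t (hs.const_mul √m)).const_mul 2
  have h2 := hc.const_mul (2 * ρ * √m)
  have e : √(1 - (√m * sn (u + ρ * t) m) ^ 2) = dn (u + ρ * t) m := by
    rw [sq_sqrt_mul_sn hm]; rfl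
  refine (h1.prodMk h2).congr_deriv ?_
  rw [pendulumField, sin_eyePt hm, e]
  refine Prod.ext ?_ ?_
  · simp only [eyePt]
    field_simp
  · simp only
    ring

lemma hasDerivAt_outerPt (hm : m ∈ Ioo (0 : ℝ) 1) (u t : ℝ) :
    HasDerivAt (fun t => outerPt ρ (u + ρ / √m * t) m)
      (pendulumField (ρ ^ 2) (outerPt ρ (u + ρ / √m * t) m)) t := by
  have hm0 := hm.1
  have hu : HasDerivAt (fun t => u + ρ / √m * t) (ρ / √m) t := by
    simpa using ((hasDerivAt_id t).const_mul (ρ / √m)).const_add u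
  have ha := (hasDerivAt_am hm (u + ρ / √m * t)).comp t hu
  have hd := (hasDerivAt_dn hm (u + ρ / √m * t)).comp t hu
  have e : (ρ / √m) ^ 2 * m = ρ ^ 2 := by
    rw [div_pow, Real.sq_sqrt hm0.le]; field_simp
  refine ((ha.const_mul 2).prodMk (hd.const_mul (2 * (ρ / √m)))).congr_deriv ?_
  rw [pendulumField, sin_outerPt]
  refine Prod.ext ?_ ?_
  · simp only [outerPt]
    ring
  · simp only
    rw [← e]
    ring

lemma pendulumFlow_eyePt (hm : m ∈ Ioo (0 : ℝ) 1) (u t : ℝ) :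
    pendulumFlow (ρ ^ 2) t (eyePt ρ u m) = eyePt ρ (u + t * ρ) m := by
  have h := pendulumFlow_eq (fun t => hasDerivAt_eyePt (ρ := ρ) hm u t) t
  simpa [mul_comm t] using h

lemma pendulumFlow_outerPt (hm : m ∈ Ioo (0 : ℝ) 1) (u t : ℝ) :
    pendulumFlow (ρ ^ 2) t (outerPt ρ u m) = outerPt ρ (u + t * (ρ / √m)) m := by
  have h := pendulumFlow_eq (fun t => hasDerivAt_outerPt (ρ := ρ) hm u t) t
  simpa [mul_comm t] using h

/-- A shift of `u` by `2 K` is half a revolution in the eye and a full turn of `x` outside.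
Functions invariant under the point reflection and under `x ↦ x + 2 π` therefore have period one in
the phase in both regions. -/
lemma eyePt_add (hm : m ∈ Ioo (0 : ℝ) 1) (u : ℝ) : eyePt ρ (u + 2 * compK m) m = -eyePt ρ u m := by
  simp [eyePt, sn_add hm, cn_add hm]

lemma outerPt_add (hm : m ∈ Ioo (0 : ℝ) 1) (u : ℝ) :
    outerPt ρ (u + 2 * compK m) m = outerPt ρ u m + (2 * Real.pi, 0) := by
  simp [outerPt, am_add hm, dn_add hm, mul_add]

end

section

variable {m ρ : ℝ}

/-! ### Elliptic coordinates on the upper half of the phase space -/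

open VlasovHMF

/-- The coordinates `(m, φ)` in the eye. -/
def eyeMap (ρ : ℝ) (p : ℝ × ℝ) : ℝ × ℝ :=
  (2 * Real.arcsin (√p.1 * Real.sin p.2), 2 * ρ * √p.1 * Real.cos p.2)

/-- The coordinates `(m, φ)` above the eye. -/
def outerMap (ρ : ℝ) (p : ℝ × ℝ) : ℝ × ℝ := (2 * p.2, 2 * (ρ / √p.1) * dlt p.2 p.1)

/-- The domain of the coordinates `(m, φ)`. -/
def coordDomain : Set (ℝ × ℝ) := Ioo 0 1 ×ˢ Ioo (-(Real.pi / 2)) (Real.pi / 2)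

lemma det_prod_smul (a b c d : ℝ) :
    ((a • ContinuousLinearMap.fst ℝ ℝ ℝ + b • ContinuousLinearMap.snd ℝ ℝ ℝ).prod
      (c • ContinuousLinearMap.fst ℝ ℝ ℝ + d • ContinuousLinearMap.snd ℝ ℝ ℝ)).det
      = a * d - b * c := by
  rw [← Matrix.toLin_finTwoProd_toContinuousLinearMap]
  simp [LinearMap.det_toContinuousLinearMap, LinearMap.det_toLin, Matrix.det_fin_two_of]

lemma mul_sin_sq_lt (hm : m ∈ Ioo (0 : ℝ) 1) (φ : ℝ) : m * Real.sin φ ^ 2 < 1 := by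
  have h1 := Real.sin_sq_add_cos_sq φ
  nlinarith [hm.1, hm.2, sq_nonneg (Real.cos φ), sq_nonneg (Real.sin φ)]

lemma sqrt_mul_sin_mem (hm : m ∈ Ioo (0 : ℝ) 1) (φ : ℝ) : √m * Real.sin φ ∈ Ioo (-1 : ℝ) 1 := by
  have h : (√m * Real.sin φ) ^ 2 < 1 := by
    rw [mul_pow, Real.sq_sqrt hm.1.le]; exact mul_sin_sq_lt hm φ
  exact abs_lt.1 ((sq_lt_one_iff_abs_lt_one _).1 h)

lemma hasFDerivAt_eyeMap (ρ : ℝ) {p : ℝ × ℝ} (hp : p.1 ∈ Ioo (0 : ℝ) 1) :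
    HasFDerivAt (eyeMap ρ)
      (((Real.sin p.2 / (√p.1 * dlt p.2 p.1)) • ContinuousLinearMap.fst ℝ ℝ ℝ
          + (2 * √p.1 * Real.cos p.2 / dlt p.2 p.1) • ContinuousLinearMap.snd ℝ ℝ ℝ).prod
        ((ρ * Real.cos p.2 / √p.1) • ContinuousLinearMap.fst ℝ ℝ ℝ
          + (-(2 * ρ * √p.1 * Real.sin p.2)) • ContinuousLinearMap.snd ℝ ℝ ℝ)) p := by
  have hm0 := hp.1
  have hs : √p.1 ≠ 0 := by positivity
  have hd := (dlt_pos (φ := p.2) hp.2).ne'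
  have hmem := sqrt_mul_sin_mem hp p.2
  have f1 := hasFDerivAt_fst (𝕜 := ℝ) (E := ℝ) (F := ℝ) (p := p)
  have f2 := hasFDerivAt_snd (𝕜 := ℝ) (E := ℝ) (F := ℝ) (p := p)
  have h1 : HasFDerivAt (fun p : ℝ × ℝ => √p.1) _ p :=
    HasDerivAt.comp_hasFDerivAt (f := fun p : ℝ × ℝ => p.1) p (Real.hasDerivAt_sqrt hm0.ne')
      f1
  have h2 : HasFDerivAt (fun p : ℝ × ℝ => Real.sin p.2) _ p :=
    (Real.hasDerivAt_sin p.2).comp_hasFDerivAt p f2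
  have h3 : HasFDerivAt (fun p : ℝ × ℝ => Real.cos p.2) _ p :=
    (Real.hasDerivAt_cos p.2).comp_hasFDerivAt p f2
  have h4 : HasFDerivAt (fun p : ℝ × ℝ => Real.arcsin (√p.1 * Real.sin p.2)) _ p :=
    HasDerivAt.comp_hasFDerivAt (f := fun p : ℝ × ℝ => √p.1 * Real.sin p.2) p
      (Real.hasDerivAt_arcsin hmem.1.ne' hmem.2.ne) (h1.fun_mul h2)
  have e : √(1 - (√p.1 * Real.sin p.2) ^ 2) = dlt p.2 p.1 := by
    rw [mul_pow, Real.sq_sqrt hm0.le]; rfl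
  rw [e] at h4
  refine ((h4.const_mul 2).prodMk ((h1.const_mul (2 * ρ)).mul h3)).congr_fderiv ?_
  refine ContinuousLinearMap.ext fun q => Prod.ext ?_ ?_
  · simp
    field_simp
    ring
  · simp
    field_simp
    ring

lemma hasFDerivAt_outerMap (ρ : ℝ) {p : ℝ × ℝ} (hp : p.1 ∈ Ioo (0 : ℝ) 1) :
    HasFDerivAt (outerMap ρ)
      (((0 : ℝ) • ContinuousLinearMap.fst ℝ ℝ ℝ + (2 : ℝ) • ContinuousLinearMap.snd ℝ ℝ ℝ).prod
        ((-(ρ / (p.1 * √p.1 * dlt p.2 p.1))) • ContinuousLinearMap.fst ℝ ℝ ℝ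
          + (-(2 * ρ * √p.1 * Real.sin p.2 * Real.cos p.2 / dlt p.2 p.1))
            • ContinuousLinearMap.snd ℝ ℝ ℝ)) p := by
  have hm0 := hp.1
  have hs : √p.1 ≠ 0 := by positivity
  have hd := (dlt_pos (φ := p.2) hp.2).ne'
  have f1 := hasFDerivAt_fst (𝕜 := ℝ) (E := ℝ) (F := ℝ) (p := p)
  have f2 := hasFDerivAt_snd (𝕜 := ℝ) (E := ℝ) (F := ℝ) (p := p)
  have h1 : HasFDerivAt (fun p : ℝ × ℝ => ρ / √p.1) _ p :=
    HasDerivAt.comp_hasFDerivAt (f := fun p : ℝ × ℝ => p.1) p (hasDerivAt_outer_freq ρ hp)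
      f1
  have h2 : HasFDerivAt (fun p : ℝ × ℝ => Real.sin p.2) _ p :=
    (Real.hasDerivAt_sin p.2).comp_hasFDerivAt p f2
  have h3 : HasFDerivAt (fun p : ℝ × ℝ => 1 - p.1 * Real.sin p.2 ^ 2) _ p :=
    (f1.mul (h2.pow 2)).const_sub 1
  have hne : 1 - p.1 * Real.sin p.2 ^ 2 ≠ 0 := (by linarith [mul_sin_sq_lt hp p.2] : (0:ℝ) < _).ne'
  have h4 : HasFDerivAt (fun p : ℝ × ℝ => dlt p.2 p.1) _ p :=
    (Real.hasDerivAt_sqrt hne).comp_hasFDerivAt p h3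
  have e : √(1 - p.1 * Real.sin p.2 ^ 2) = dlt p.2 p.1 := rfl
  rw [e] at h4
  refine ((f2.const_mul 2).prodMk ((h1.const_mul 2).mul h4)).congr_fderiv ?_
  have hd2 : dlt p.2 p.1 ^ 2 = 1 - p.1 * Real.sin p.2 ^ 2 := dlt_sq hp.2 _
  have hs2 : √p.1 ^ 2 = p.1 := Real.sq_sqrt hm0.le
  refine ContinuousLinearMap.ext fun q => Prod.ext ?_ ?_
  · simp
  · simp
    generalize √p.1 = k at *
    generalize dlt p.2 p.1 = d at *
    have hp0 : p.1 ≠ 0 := hm0.ne'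
    clear h1 h2 h3 h4 f1 f2 hne e
    generalize p.1 = n at *
    subst hs2
    field_simp
    linear_combination (-ρ * q.1) * hd2

/-- The function of the energy that equals the modulus in the eye and its reciprocal outside. -/
def level (ρ : ℝ) (z : ℝ × ℝ) : ℝ := Real.sin (z.1 / 2) ^ 2 + (z.2 / (2 * ρ)) ^ 2

lemma continuous_level (ρ : ℝ) : Continuous (level ρ) := by unfold level; fun_prop

/-- The upper half of the phase space. -/
def upperHalf : Set (ℝ × ℝ) := Ioo (-Real.pi) Real.pi ×ˢ Ioi 0

lemma level_eyeMap (hρ : 0 < ρ) {p : ℝ × ℝ} (hp : p.1 ∈ Ioo (0 : ℝ) 1) :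
    level ρ (eyeMap ρ p) = p.1 := by
  have hmem := sqrt_mul_sin_mem hp p.2
  have hs2 : √p.1 ^ 2 = p.1 := Real.sq_sqrt hp.1.le
  have e : 2 * ρ * √p.1 * Real.cos p.2 / (2 * ρ) = √p.1 * Real.cos p.2 := by field_simp
  rw [level, eyeMap]
  simp only
  rw [mul_div_cancel_left₀ _ two_ne_zero, Real.sin_arcsin hmem.1.le hmem.2.le, e, mul_pow, mul_pow,
    hs2, ← mul_add, Real.sin_sq_add_cos_sq, mul_one]

lemma level_outerMap (hρ : 0 < ρ) {p : ℝ × ℝ} (hp : p.1 ∈ Ioo (0 : ℝ) 1) :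
    level ρ (outerMap ρ p) = p.1⁻¹ := by
  have hm0 := hp.1
  have hs2 : √p.1 ^ 2 = p.1 := Real.sq_sqrt hm0.le
  have e : 2 * (ρ / √p.1) * dlt p.2 p.1 / (2 * ρ) = dlt p.2 p.1 / √p.1 := by field_simp
  rw [level, outerMap]
  simp only
  rw [mul_div_cancel_left₀ _ two_ne_zero, e, div_pow, hs2, dlt_sq hp.2]
  field_simp
  ring

lemma injOn_sin_half : InjOn Real.sin (Ioo (-(Real.pi / 2)) (Real.pi / 2)) :=
  Real.injOn_sin.mono Ioo_subset_Icc_self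

lemma injOn_eyeMap (hρ : 0 < ρ) : InjOn (eyeMap ρ) coordDomain := by
  rintro ⟨m, φ⟩ ⟨hm, hφ⟩ ⟨n, θ⟩ ⟨hn, hθ⟩ h
  have e : m = n := by
    have := congrArg (level ρ) h
    rwa [level_eyeMap hρ hm, level_eyeMap hρ hn] at this
  subst e
  have h1 := congrArg Prod.fst h
  simp only [eyeMap] at h1 hm hφ hθ
  have h2 := Real.injOn_arcsin (Ioo_subset_Icc_self (sqrt_mul_sin_mem hm φ))
    (Ioo_subset_Icc_self (sqrt_mul_sin_mem hm θ)) (by linarith)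
  have hs : √m ≠ 0 := (Real.sqrt_pos.2 hm.1).ne'
  rw [injOn_sin_half hφ hθ (mul_left_cancel₀ hs h2)]

lemma injOn_outerMap (hρ : 0 < ρ) : InjOn (outerMap ρ) coordDomain := by
  rintro ⟨m, φ⟩ ⟨hm, hφ⟩ ⟨n, θ⟩ ⟨hn, hθ⟩ h
  have e : m = n := by
    have := congrArg (level ρ) h
    rw [level_outerMap hρ hm, level_outerMap hρ hn] at this
    exact inv_injective this
  have h1 := congrArg Prod.fst h
  simp only [outerMap] at h1
  rw [e, mul_left_cancel₀ two_ne_zero h1]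

lemma image_eyeMap (hρ : 0 < ρ) :
    eyeMap ρ '' coordDomain = upperHalf ∩ {z | level ρ z < 1} := by
  ext z
  constructor
  · rintro ⟨p, ⟨hm, hφ⟩, rfl⟩
    have hmem := sqrt_mul_sin_mem hm p.2
    have hs := Real.sqrt_pos.2 hm.1
    refine ⟨⟨⟨?_, ?_⟩, ?_⟩, ?_⟩
    · have := Real.arcsin_lt_arcsin le_rfl hmem.1 hmem.2.le
      rw [Real.arcsin_neg_one] at this
      simp only [eyeMap]; linarith
    · have := Real.arcsin_lt_arcsin hmem.1.le hmem.2 le_rfl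
      rw [Real.arcsin_one] at this
      simp only [eyeMap]; linarith
    · have := Real.cos_pos_of_mem_Ioo hφ
      simp only [eyeMap, mem_Ioi]; positivity
    · rw [mem_ofPred_eq, level_eyeMap hρ hm]; exact hm.2
  · rintro ⟨⟨⟨hx1, hx2⟩, hv⟩, hl⟩
    rw [mem_Ioi] at hv
    rw [mem_ofPred_eq] at hl
    have hl0 : 0 < level ρ z := by rw [level]; positivity
    set n := level ρ z with hn
    have hs := Real.sqrt_pos.2 hl0
    have hs2 : √n ^ 2 = n := Real.sq_sqrt hl0.le
    -- The preimage is `(level, arcsin (sin (x / 2) / √level))`; the identity `hyl` says that `y`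
    -- and the rescaled velocity are the sine and the cosine of this angle.
    set y := Real.sin (z.1 / 2) / √n with hy
    have hyl : y ^ 2 + (z.2 / (2 * ρ) / √n) ^ 2 = 1 := by
      rw [hy, div_pow, div_pow _ √n, hs2, ← add_div]
      exact div_self hl0.ne'
    have hw : 0 < z.2 / (2 * ρ) / √n := by positivity
    have hy1 : |y| < 1 := (sq_lt_one_iff_abs_lt_one _).1 (by nlinarith [sq_pos_of_pos hw])
    obtain ⟨hy2, hy3⟩ := abs_lt.1 hy1
    refine ⟨(n, Real.arcsin y), ⟨⟨hl0, hl⟩, ?_, ?_⟩, ?_⟩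
    · have := Real.arcsin_lt_arcsin le_rfl hy2 hy3.le
      rwa [Real.arcsin_neg_one] at this
    · have := Real.arcsin_lt_arcsin hy2.le hy3 le_rfl
      rwa [Real.arcsin_one] at this
    · refine Prod.ext ?_ ?_
      · simp only [eyeMap]
        rw [Real.sin_arcsin hy2.le hy3.le, hy, mul_div_cancel₀ _ hs.ne',
          Real.arcsin_sin (by linarith) (by linarith)]
        ring
      · simp only [eyeMap]
        rw [Real.cos_arcsin, show 1 - y ^ 2 = (z.2 / (2 * ρ) / √n) ^ 2 by linarith,
          Real.sqrt_sq hw.le]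
        field_simp

lemma image_outerMap (hρ : 0 < ρ) :
    outerMap ρ '' coordDomain = upperHalf ∩ {z | 1 < level ρ z} := by
  ext z
  constructor
  · rintro ⟨p, ⟨hm, hφ⟩, rfl⟩
    have hs := Real.sqrt_pos.2 hm.1
    have hd := dlt_pos (φ := p.2) hm.2
    refine ⟨⟨⟨?_, ?_⟩, ?_⟩, ?_⟩
    · simp only [outerMap]; linarith [hφ.1]
    · simp only [outerMap]; linarith [hφ.2]
    · simp only [outerMap, mem_Ioi]; positivity
    · rw [mem_ofPred_eq, level_outerMap hρ hm]; exact (one_lt_inv₀ hm.1).2 hm.2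
  · rintro ⟨⟨⟨hx1, hx2⟩, hv⟩, hl⟩
    rw [mem_Ioi] at hv
    rw [mem_ofPred_eq] at hl
    have hl0 : 0 < level ρ z := by linarith
    refine ⟨((level ρ z)⁻¹, z.1 / 2), ⟨⟨by positivity, inv_lt_one_of_one_lt₀ hl⟩,
      by simp only; linarith, by simp only; linarith⟩, Prod.ext ?_ ?_⟩
    · simp only [outerMap]; ring
    · have e : 1 - (level ρ z)⁻¹ * Real.sin (z.1 / 2) ^ 2
          = (level ρ z)⁻¹ * (z.2 / (2 * ρ)) ^ 2 := by
        have : Real.sin (z.1 / 2) ^ 2 = level ρ z - (z.2 / (2 * ρ)) ^ 2 := by rw [level]; ring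
        rw [this]; field_simp; ring
      simp only [outerMap, dlt]
      rw [e, Real.sqrt_mul (by positivity), Real.sqrt_sq (by positivity)]
      have : √(level ρ z)⁻¹ ≠ 0 := by positivity
      field_simp

lemma measurableSet_coordDomain : MeasurableSet coordDomain :=
  measurableSet_Ioo.prod measurableSet_Ioo

/-- The separatrix is the level `1`. For each `x` it contains at most one point with `v > 0`, so it
is a null set. -/
lemma upperHalf_ae_eq (hρ : 0 < ρ) : (upperHalf : Set (ℝ × ℝ)) =ᵐ[volume]
    (upperHalf ∩ {z | level ρ z < 1} ∪ upperHalf ∩ {z | 1 < level ρ z} : Set (ℝ × ℝ)) := by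
  have hnull : volume (upperHalf ∩ {z | level ρ z = 1}) = 0 := by
    rw [Measure.volume_eq_prod, Measure.measure_prod_null]
    · refine Eventually.of_forall fun x => ?_
      refine Set.Subsingleton.measure_zero ?_ _
      rintro v ⟨⟨-, hv⟩, hv1⟩ w ⟨⟨-, hw⟩, hw1⟩
      simp only [mem_Ioi, mem_ofPred_eq, level] at hv hw hv1 hw1
      have h : (v / (2 * ρ)) ^ 2 = (w / (2 * ρ)) ^ 2 := by linarith
      have h2 : v / (2 * ρ) = w / (2 * ρ) :=
        (pow_left_inj₀ (by positivity) (by positivity) two_ne_zero).1 h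
      have h3 : (2 * ρ) ≠ 0 := by positivity
      exact (div_left_inj' h3).1 h2
    · exact (measurableSet_Ioo.prod measurableSet_Ioi).inter
        ((continuous_level ρ).measurable (measurableSet_singleton 1))
  rw [← inter_union_distrib_left]
  refine (ae_eq_set).2 ⟨measure_mono_null ?_ hnull, ?_⟩
  · rintro z ⟨hz, hz2⟩
    refine ⟨hz, ?_⟩
    rcases lt_trichotomy (level ρ z) 1 with h | h | h
    · exact absurd ⟨hz, Or.inl h⟩ hz2
    · exact h
    · exact absurd ⟨hz, Or.inr h⟩ hz2
  · rw [sdiff_eq_empty.2 inter_subset_left, measure_empty]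

end

section

variable {m ρ : ℝ}

open VlasovHMF

/-! ### Integrals over the phase space in elliptic coordinates -/

/-- Integration in the angle `φ = am (2 K σ)`. -/
lemma integral_angle_eq (hm : m ∈ Ioo (0 : ℝ) 1) {g : ℝ → ℝ} (hg : Continuous g)
    (hper : ∀ u, g (am (u + 2 * compK m) m) = g (am u m)) :
    2 * ∫ φ in Ioo (-(Real.pi / 2)) (Real.pi / 2), g φ / dlt φ m
      = ∫ σ in (-1 : ℝ)..1, 2 * compK m * g (am (2 * compK m * σ) m) := by
  have hpi := Real.pi_pos
  have hK := compK_pos hm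
  set h : ℝ → ℝ := fun σ => 2 * compK m * g (am (2 * compK m * σ) m) with hh
  have hac : Continuous fun u => am u m := cts_am.continuous_left hm
  have hhc : Continuous h := by
    rw [hh]
    exact continuous_const.mul (hg.comp (hac.comp (continuous_const.mul continuous_id)))
  have hperiod : Function.Periodic h 1 := fun σ => by
    simp only [hh, mul_add, mul_one, hper]
  have e1 : ∫ φ in Ioo (-(Real.pi / 2)) (Real.pi / 2), g φ / dlt φ m
      = ∫ σ in (-(1 / 2) : ℝ)..(1 / 2), h σ := by
    rw [← integral_Ioc_eq_integral_Ioo, ← intervalIntegral.integral_of_le (by linarith)]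
    have hcv := intervalIntegral.integral_comp_mul_deriv (a := -(1 / 2)) (b := 1 / 2)
      (f := fun σ => am (2 * compK m * σ) m)
      (f' := fun σ => dn (2 * compK m * σ) m * (2 * compK m)) (g := fun φ => g φ / dlt φ m)
      (fun σ _ => by
        have hl : HasDerivAt (fun σ => 2 * compK m * σ) (2 * compK m) σ := by
          simpa using (hasDerivAt_id σ).const_mul (2 * compK m)
        exact (hasDerivAt_am hm (2 * compK m * σ)).comp σ hl)
      ((((cts_dn.continuous_left hm).comp (continuous_const.mul continuous_id)).mul
        continuous_const).continuousOn) (continuous_div_dlt hg hm.2)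
    have l1 : am (2 * compK m * (1 / 2)) m = Real.pi / 2 := by
      rw [show 2 * compK m * (1 / 2) = compK m by ring, am_compK hm.2]
    have l2 : am (2 * compK m * -(1 / 2)) m = -(Real.pi / 2) := by
      rw [show 2 * compK m * -(1 / 2) = -compK m by ring, am_neg hm, am_compK hm.2]
    simp only [l1, l2] at hcv
    rw [← hcv]
    refine intervalIntegral.integral_congr fun σ _ => ?_
    have hd := (dlt_pos (φ := am (2 * compK m * σ) m) hm.2).ne'
    simp only [hh, Function.comp, dn]
    field_simp
  -- The angles in `(-π/2, π/2)` fill the phases in `(-1/2, 1/2)`. Since the integrand has period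
  -- one, each of `(-1, 0)` and `(0, 1)` gives the same integral, which accounts for the factor `2`.
  -- The longer interval is used because `sn` and `cn` have period two in the phase.
  have p1 := hperiod.intervalIntegral_add_eq (-(1 / 2)) (-1)
  have p2 := hperiod.intervalIntegral_add_eq (-(1 / 2)) 0
  norm_num at p1 p2
  have hadd := intervalIntegral.integral_add_adjacent_intervals (μ := volume)
    (hhc.intervalIntegrable (-1) 0) (hhc.intervalIntegrable 0 1)
  rw [e1]
  norm_num at hadd ⊢
  linarith

lemma continuous_eyeMap (ρ m : ℝ) : Continuous fun φ => eyeMap ρ (m, φ) := by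
  unfold eyeMap
  exact (continuous_const.mul (Real.continuous_arcsin.comp (by fun_prop))).prodMk (by fun_prop)

lemma continuous_outerMap (ρ m : ℝ) : Continuous fun φ => outerMap ρ (m, φ) := by
  unfold outerMap
  exact (by fun_prop : Continuous fun φ : ℝ => 2 * φ).prodMk
    ((continuous_const (y := 2 * (ρ / √m))).mul (continuous_dlt_left m))

section

variable {f : ℝ × ℝ → ℝ}

/-- The symmetries of the functions that are integrated in elliptic coordinates. -/
structure IsPhaseFunction (f : ℝ × ℝ → ℝ) : Prop where
  continuous : Continuous f
  neg : ∀ z, f (-z) = f z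
  add : ∀ z, f (z + (2 * Real.pi, 0)) = f z

/-- Integration over the image of coordinates `(m, φ)` whose Jacobian is `c(m) / Δ`. -/
lemma integral_image_coordDomain {F : ℝ × ℝ → ℝ × ℝ} {F' : ℝ × ℝ → ℝ × ℝ →L[ℝ] ℝ × ℝ} {c : ℝ → ℝ}
    {pt : ℝ → ℝ → ℝ × ℝ} (hF : ∀ p ∈ coordDomain, HasFDerivAt F (F' p) p)
    (hinj : InjOn F coordDomain) (hdet : ∀ p ∈ coordDomain, |(F' p).det| = c p.1 / dlt p.2 p.1)
    (hFc : ∀ m, Continuous fun φ => F (m, φ)) (hpt : ∀ m u, F (m, am u m) = pt u m)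
    (hf : Continuous f)
    (hper : ∀ m ∈ Ioo (0 : ℝ) 1, ∀ u, f (pt (u + 2 * compK m) m) = f (pt u m))
    (hi : IntegrableOn f (F '' coordDomain)) :
    2 * ∫ z in F '' coordDomain, f z
      = phaseInt fun σ m => 2 * c m * (compK m * f (pt (2 * compK m * σ) m)) := by
  have hF' : ∀ p ∈ coordDomain, HasFDerivWithinAt F (F' p) coordDomain p := fun p hp =>
    (hF p hp).hasFDerivWithinAt
  have hi2 := (integrableOn_image_iff_integrableOn_abs_det_fderiv_smul volume
    measurableSet_coordDomain hF' hinj f).1 hi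
  rw [integral_image_eq_integral_abs_det_fderiv_smul volume measurableSet_coordDomain hF' hinj]
  have e : ∀ p ∈ coordDomain, |(F' p).det| • f (F p) = c p.1 * f (F p) / dlt p.2 p.1 := by
    intro p hp; rw [hdet p hp, smul_eq_mul]; ring
  have hi3 := hi2.congr_fun e measurableSet_coordDomain
  rw [setIntegral_congr_fun measurableSet_coordDomain e]
  rw [coordDomain, Measure.volume_eq_prod] at hi3 ⊢
  rw [setIntegral_prod _ hi3, ← integral_const_mul, phaseInt]
  refine setIntegral_congr_fun measurableSet_Ioo fun m hm => ?_
  have h := integral_angle_eq hm (g := fun φ => c m * f (F (m, φ)))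
    (continuous_const.mul (hf.comp (hFc m))) (fun u => by simp only [hpt, hper m hm])
  simp only at h ⊢
  rw [h]
  refine intervalIntegral.integral_congr fun σ _ => ?_
  simp only [hpt]
  ring

/-- The Jacobians are `2 ρ / Δ` in the eye and `2 ρ m^(-3/2) / Δ` above it. The factor `2` on the
left reflects that the phases in `(-1, 1)` cover the angles twice. -/
lemma integral_upperHalf (hρ : 0 < ρ) (hf : IsPhaseFunction f) (hi : IntegrableOn f upperHalf) :
    2 * ∫ z in upperHalf, f z
      = phaseInt (fun σ m => 2 * (2 * ρ) * (compK m * f (eyePt ρ (2 * compK m * σ) m)))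
      + phaseInt (fun σ m => 2 * (2 * ρ * m ^ (-(3 / 2) : ℝ))
          * (compK m * f (outerPt ρ (2 * compK m * σ) m))) := by
  have hmu : MeasurableSet upperHalf := measurableSet_Ioo.prod measurableSet_Ioi
  have hm1 : MeasurableSet {z | level ρ z < 1} := measurableSet_lt
    (continuous_level ρ).measurable measurable_const
  have hm2 : MeasurableSet {z | 1 < level ρ z} := measurableSet_lt
    measurable_const (continuous_level ρ).measurable
  rw [setIntegral_congr_set (upperHalf_ae_eq hρ), setIntegral_union _ (hmu.inter hm2)
    (hi.mono_set inter_subset_left) (hi.mono_set inter_subset_left), mul_add,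
    ← image_eyeMap hρ, ← image_outerMap hρ]
  · congr 1
    · refine integral_image_coordDomain (c := fun _ => 2 * ρ) (pt := eyePt ρ)
        (fun p hp => hasFDerivAt_eyeMap ρ hp.1) (injOn_eyeMap hρ) (fun p hp => ?_)
        (continuous_eyeMap ρ) (fun _ _ => rfl) hf.continuous
        (fun m hm u => by rw [eyePt_add hm, hf.neg])
        (by rw [image_eyeMap hρ]; exact hi.mono_set inter_subset_left)
      have hd := dlt_pos (φ := p.2) hp.1.2
      have hs := Real.sqrt_pos.2 hp.1.1
      have hsc := Real.sin_sq_add_cos_sq p.2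
      rw [det_prod_smul, show Real.sin p.2 / (√p.1 * dlt p.2 p.1)
        * -(2 * ρ * √p.1 * Real.sin p.2) - 2 * √p.1 * Real.cos p.2 / dlt p.2 p.1
        * (ρ * Real.cos p.2 / √p.1) = -(2 * ρ / dlt p.2 p.1) by
          field_simp
          linear_combination (-1) * hsc, abs_neg, abs_of_pos (by positivity)]
    · refine integral_image_coordDomain (c := fun m => 2 * ρ * m ^ (-(3 / 2) : ℝ))
        (pt := outerPt ρ) (fun p hp => hasFDerivAt_outerMap ρ hp.1) (injOn_outerMap hρ)
        (fun p hp => ?_) (continuous_outerMap ρ) (fun _ _ => rfl) hf.continuous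
        (fun m hm u => by rw [outerPt_add hm, hf.add])
        (by rw [image_outerMap hρ]; exact hi.mono_set inter_subset_left)
      have hd := dlt_pos (φ := p.2) hp.1.2
      have hp0 := hp.1.1
      have hs := Real.sqrt_pos.2 hp0
      rw [det_prod_smul, Real.rpow_neg hp0.le, rpow_three_halves hp0, zero_mul, zero_sub, mul_neg,
        neg_neg, abs_of_pos (by positivity)]
      field_simp
  · refine Set.disjoint_left.2 fun z h1 h2 => ?_
    have a := h1.2
    have b := h2.2
    simp only [mem_ofPred_eq] at a b
    linarith

lemma phaseMeasure_eq : phaseMeasure = ENNReal.ofReal (1 / (2 * Real.pi)) •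
    (volume.restrict (Ioo (-Real.pi) Real.pi ×ˢ (univ : Set ℝ)) : Measure (ℝ × ℝ)) := by
  rw [phaseMeasure, Measure.prod_smul_left, Measure.volume_eq_prod, ← Measure.prod_restrict,
    Measure.restrict_univ, Measure.restrict_congr_set Ioo_ae_eq_Ioc]

/-- Integrals over the phase space in elliptic coordinates. -/
theorem integral_phaseMeasure (hρ : 0 < ρ) (hf : IsPhaseFunction f)
    (hi : Integrable f phaseMeasure) : ∫ z, f z ∂phaseMeasure = 1 / (2 * Real.pi)
      * (phaseInt (fun σ m => 2 * (2 * ρ) * (compK m * f (eyePt ρ (2 * compK m * σ) m)))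
      + phaseInt (fun σ m => 2 * (2 * ρ * m ^ (-(3 / 2) : ℝ))
          * (compK m * f (outerPt ρ (2 * compK m * σ) m)))) := by
  have hpi := Real.pi_pos
  have hc : ENNReal.ofReal (1 / (2 * Real.pi)) ≠ 0 := by
    simp only [ne_eq, ENNReal.ofReal_eq_zero, not_le]; positivity
  rw [phaseMeasure_eq] at hi ⊢
  rw [integrable_smul_measure hc ENNReal.ofReal_ne_top] at hi
  rw [integral_smul_measure, ENNReal.toReal_ofReal (by positivity), smul_eq_mul]
  congr 1
  set lowerHalf : Set (ℝ × ℝ) := Ioo (-Real.pi) Real.pi ×ˢ Iio 0 with hl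
  have hstrip : (Ioo (-Real.pi) Real.pi ×ˢ (univ : Set ℝ) : Set (ℝ × ℝ))
      =ᵐ[volume] (upperHalf ∪ lowerHalf : Set (ℝ × ℝ)) := by
    rw [upperHalf, hl, ← prod_union, Measure.volume_eq_prod]
    refine Measure.set_prod_ae_eq (ae_eq_refl _) ?_
    refine (ae_eq_univ.2 ?_).symm
    rw [union_comm, Iio_union_Ioi, compl_compl]
    exact measure_singleton 0
  have hmu : MeasurableSet upperHalf := measurableSet_Ioo.prod measurableSet_Ioi
  have hml : MeasurableSet lowerHalf := measurableSet_Ioo.prod measurableSet_Iio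
  have hiu : IntegrableOn f upperHalf := IntegrableOn.mono_set hi (prod_mono_right (subset_univ _))
  have hil : IntegrableOn f lowerHalf := IntegrableOn.mono_set hi (prod_mono_right (subset_univ _))
  have hdisj : Disjoint upperHalf lowerHalf := by
    refine Set.disjoint_left.2 fun z h1 h2 => ?_
    have a := h1.2
    have b := h2.2
    simp only [mem_Ioi, mem_Iio] at a b
    linarith
  -- The point reflection maps the lower half onto the upper one and preserves both the measure and
  -- `f`.
  have hneg : ∫ z in lowerHalf, f z = ∫ z in upperHalf, f z := by
    have h := (Measure.measurePreserving_neg (volume : Measure (ℝ × ℝ))).setIntegral_preimage_emb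
      (MeasurableEquiv.neg (ℝ × ℝ)).measurableEmbedding f upperHalf
    have e : Neg.neg ⁻¹' upperHalf = lowerHalf := by
      ext z
      simp only [upperHalf, hl, mem_preimage, mem_prod, mem_Ioo, mem_Ioi, mem_Iio, Prod.fst_neg,
        Prod.snd_neg]
      constructor <;> rintro ⟨⟨a, b⟩, c⟩ <;> refine ⟨⟨?_, ?_⟩, ?_⟩ <;> linarith
    rw [e] at h
    simpa only [hf.neg] using h
  rw [setIntegral_congr_set hstrip, setIntegral_union hdisj hml hiu hil, hneg, ← two_mul,
    integral_upperHalf hρ hf hiu]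

end

end

section

variable {m : ℝ}

/-! ### Correlations in elliptic coordinates -/

lemma phaseInt_eq_integral_prod {f : ℝ → ℝ → ℝ} (hi : Integrable (fun p : ℝ × ℝ => f p.1 p.2)
    ((volume.restrict (Ioc (-1 : ℝ) 1)).prod (volume.restrict (Ioo (0 : ℝ) 1)))) :
    phaseInt f = ∫ p : ℝ × ℝ, f p.1 p.2
      ∂((volume.restrict (Ioc (-1 : ℝ) 1)).prod (volume.restrict (Ioo (0 : ℝ) 1))) := by
  rw [integral_prod_symm _ hi, phaseInt]
  refine setIntegral_congr_fun measurableSet_Ioo fun m _ => ?_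
  exact intervalIntegral.integral_of_le (by norm_num)

lemma phaseInt_add {f g : ℝ → ℝ → ℝ} {M N : ℝ → ℝ} (hf : Cts f) (hM : IntegrableOn M (Ioo 0 1))
    (hfM : ∀ m ∈ Ioo (0 : ℝ) 1, ∀ σ, |f σ m| ≤ M m) (hg : Cts g) (hN : IntegrableOn N (Ioo 0 1))
    (hgN : ∀ m ∈ Ioo (0 : ℝ) 1, ∀ σ, |g σ m| ≤ N m) :
    phaseInt (fun σ m => f σ m + g σ m) = phaseInt f + phaseInt g := by
  have h1 := integrable_of_cts hf hM hfM
  have h2 := integrable_of_cts hg hN hgN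
  rw [phaseInt_eq_integral_prod h1, phaseInt_eq_integral_prod h2,
    phaseInt_eq_integral_prod (h1.add h2)]
  exact integral_add h1 h2

lemma hasDerivAt_phaseInt {f f' : ℝ → ℝ → ℝ → ℝ} {M N : ℝ → ℝ} (hf : ∀ t, Cts (f t))
    (hM : IntegrableOn M (Ioo 0 1)) (hfM : ∀ t, ∀ m ∈ Ioo (0 : ℝ) 1, ∀ σ, |f t σ m| ≤ M m)
    (hf' : ∀ t, Cts (f' t)) (hN : IntegrableOn N (Ioo 0 1))
    (hfN : ∀ t, ∀ m ∈ Ioo (0 : ℝ) 1, ∀ σ, |f' t σ m| ≤ N m)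
    (hd : ∀ t, ∀ m ∈ Ioo (0 : ℝ) 1, ∀ σ, HasDerivAt (fun t => f t σ m) (f' t σ m) t) (t : ℝ) :
    HasDerivAt (fun t => phaseInt (f t)) (phaseInt (f' t)) t := by
  have hi := fun t => integrable_of_cts (hf t) hM (hfM t)
  have hi' := fun t => integrable_of_cts (hf' t) hN (hfN t)
  have hb : Integrable (fun p : ℝ × ℝ => N p.2)
      ((volume.restrict (Ioc (-1 : ℝ) 1)).prod (volume.restrict (Ioo (0 : ℝ) 1))) :=
    Integrable.comp_snd hN _
  simp_rw [fun t => phaseInt_eq_integral_prod (hi t), phaseInt_eq_integral_prod (hi' t)]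
  have hae : ∀ᵐ p : ℝ × ℝ ∂((volume.restrict (Ioc (-1 : ℝ) 1)).prod
      (volume.restrict (Ioo (0 : ℝ) 1))), p.2 ∈ Ioo (0 : ℝ) 1 := by
    rw [Measure.prod_restrict]
    exact (ae_restrict_iff' (measurableSet_Ioc.prod measurableSet_Ioo)).2
      (Eventually.of_forall fun p hp => hp.2)
  refine (hasDerivAt_integral_of_dominated_loc_of_deriv_le (bound := fun p => N p.2)
    (F := fun t (p : ℝ × ℝ) => f t p.1 p.2) (F' := fun t (p : ℝ × ℝ) => f' t p.1 p.2)
    (s := univ) univ_mem (Eventually.of_forall fun t => (hi t).aestronglyMeasurable) (hi t)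
    (hi' t).aestronglyMeasurable ?_ hb ?_).2
  · filter_upwards [hae] with p hp t _ using hfN t p.2 hp p.1
  · filter_upwards [hae] with p hp t _ using hd t p.2 hp p.1

/-- The reflection `u ↦ -u - s` in an integral over a period. -/
lemma integral_reverse (hm : m ∈ Ioo (0 : ℝ) 1) {A B : ℝ → ℝ}
    (hA : ∀ u, A (u + 4 * compK m) = A u) (hB : ∀ u, B (u + 4 * compK m) = B u) (s : ℝ) :
    ∫ σ in (-1 : ℝ)..1, A (2 * compK m * σ) * B (2 * compK m * σ + s)
      = ∫ σ in (-1 : ℝ)..1, A (-(2 * compK m * σ + s)) * B (-(2 * compK m * σ)) := by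
  have hK := compK_pos hm
  set H : ℝ → ℝ := fun σ => A (2 * compK m * σ) * B (2 * compK m * σ + s) with hH
  have hp : Function.Periodic H 2 := fun σ => by
    simp only [hH]
    rw [show 2 * compK m * (σ + 2) = 2 * compK m * σ + 4 * compK m by ring, hA,
      show 2 * compK m * σ + 4 * compK m + s = 2 * compK m * σ + s + 4 * compK m by ring, hB]
  have e : ∀ σ, A (-(2 * compK m * σ + s)) * B (-(2 * compK m * σ))
      = H (-(s / (2 * compK m)) - σ) := fun σ => by
    simp only [hH]
    have e1 : 2 * compK m * (-(s / (2 * compK m)) - σ) = -(2 * compK m * σ + s) := by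
      field_simp; ring
    rw [e1]
    congr 2; ring
  simp_rw [e]
  rw [intervalIntegral.integral_comp_sub_left H]
  have := hp.intervalIntegral_add_eq (-1) (-(s / (2 * compK m)) - 1)
  rw [show (-1 : ℝ) + 2 = 1 by norm_num,
    show -(s / (2 * compK m)) - 1 + 2 = -(s / (2 * compK m)) - -1 by ring] at this
  exact this

/-- The correlation of a function along an orbit, with weight `w` and frequency `ϖ`. -/
def corr (w ϖ : ℝ → ℝ) (A : ℝ → ℝ → ℝ) (t : ℝ) : ℝ :=
  phaseInt fun σ m => w m * (A (2 * compK m * σ) m * A (2 * compK m * σ + t * ϖ m) m)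

/-- The derivative of the correlation. -/
def corrD (w ϖ : ℝ → ℝ) (A A' : ℝ → ℝ → ℝ) (t : ℝ) : ℝ :=
  phaseInt fun σ m => w m * (A (2 * compK m * σ) m * (ϖ m * A' (2 * compK m * σ + t * ϖ m) m))

/-- The requirements on the weight, the frequency and the function in a correlation. -/
structure IsCorr (w ϖ : ℝ → ℝ) (A A' : ℝ → ℝ → ℝ) : Prop where
  cts_weight : ContinuousOn w (Ioo 0 1)
  cts_freq : ContinuousOn ϖ (Ioo 0 1)
  cts_left : Cts A
  cts_right : Cts A'
  integrable : IntegrableOn w (Ioo 0 1)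
  integrable_mul : IntegrableOn (fun m => w m * ϖ m) (Ioo 0 1)
  bounded : ∃ C, ∀ m ∈ Ioo (0 : ℝ) 1, ∀ u, |A u m| ≤ C ∧ |A' u m| ≤ C
  hasDerivAt : ∀ m ∈ Ioo (0 : ℝ) 1, ∀ u, HasDerivAt (fun u => A u m) (A' u m) u

/-! ### Derivative, reversal and limit of a correlation. -/

namespace IsCorr

variable {w ϖ : ℝ → ℝ} {A A' : ℝ → ℝ → ℝ}

lemma exists_bound (h : IsCorr w ϖ A A') : ∃ N : ℝ → ℝ, IntegrableOn N (Ioo 0 1) ∧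
    ∀ t, ∀ m ∈ Ioo (0 : ℝ) 1, ∀ σ,
      |w m * (A (2 * compK m * σ) m * (ϖ m * A' (2 * compK m * σ + t * ϖ m) m))| ≤ N m := by
  obtain ⟨C, hC⟩ := h.bounded
  refine ⟨fun m => |w m * ϖ m| * (C * C), h.integrable_mul.abs.mul_const _, fun t m hm σ => ?_⟩
  have b := abs_mul_le_of_le (hC m hm (2 * compK m * σ)).1 (hC m hm (2 * compK m * σ + t * ϖ m)).2
  rw [show w m * (A (2 * compK m * σ) m * (ϖ m * A' (2 * compK m * σ + t * ϖ m) m))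
    = w m * ϖ m * (A (2 * compK m * σ) m * A' (2 * compK m * σ + t * ϖ m) m) by ring, abs_mul]
  exact mul_le_mul_of_nonneg_left b (abs_nonneg _)

lemma cts_deriv (h : IsCorr w ϖ A A') (t : ℝ) : Cts fun σ m =>
    w m * (A (2 * compK m * σ) m * (ϖ m * A' (2 * compK m * σ + t * ϖ m) m)) :=
  (Cts.of_continuousOn h.cts_weight).mul (h.cts_left.phase.mul
    ((Cts.of_continuousOn h.cts_freq).mul (h.cts_right.phase_add h.cts_freq t)))

theorem hasDerivAt_corr (h : IsCorr w ϖ A A') (t : ℝ) :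
    HasDerivAt (corr w ϖ A) (corrD w ϖ A A' t) t := by
  obtain ⟨C, hC⟩ := h.bounded
  obtain ⟨N, hN, hNb⟩ := h.exists_bound
  have hw := Cts.of_continuousOn h.cts_weight
  refine hasDerivAt_phaseInt (M := fun m => |w m| * (C * C)) (N := N)
    (fun t => hw.mul (h.cts_left.phase.mul (h.cts_left.phase_add h.cts_freq t)))
    (h.integrable.abs.mul_const _) (fun t m hm σ => ?_) h.cts_deriv hN hNb
    (fun t m hm σ => ?_) t
  · have b := abs_mul_le_of_le (hC m hm (2 * compK m * σ)).1 (hC m hm (2 * compK m * σ + t * ϖ m)).1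
    rw [abs_mul]
    exact mul_le_mul_of_nonneg_left b (abs_nonneg _)
  · have hl : HasDerivAt (fun t => 2 * compK m * σ + t * ϖ m) (ϖ m) t := by
      simpa using ((hasDerivAt_id t).mul_const (ϖ m)).const_add (2 * compK m * σ)
    refine ((((h.hasDerivAt m hm _).comp t hl).const_mul (A (2 * compK m * σ) m)).const_mul
      (w m)).congr_deriv (by ring)

theorem exists_abs_corrD_le (h : IsCorr w ϖ A A') : ∃ D, ∀ t, |corrD w ϖ A A' t| ≤ D := by
  obtain ⟨N, hN, hNb⟩ := h.exists_bound
  refine ⟨2 * ∫ m in Ioo (0 : ℝ) 1, N m, fun t => ?_⟩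
  refine abs_phaseInt_le (h.cts_deriv t) hN (hNb t) fun σ => ?_
  refine (abs_integral_le_integral_abs).trans (setIntegral_mono_on
    (integrableOn_of_cts (h.cts_deriv t) hN (hNb t) σ).abs hN measurableSet_Ioo
    fun m hm => hNb t m hm σ)

/-- The kernels carry the derivative on the unshifted factor, whereas differentiating a correlation
in time puts it on the shifted one. The reflection `u ↦ -u - t ϖ` exchanges the two factors. As `A`
and `A'` have opposite parities, a minus sign appears. In these coordinates it plays the role of
invariance under the flow. -/
theorem phaseInt_reverse (hA : ∀ m ∈ Ioo (0 : ℝ) 1, ∀ u, A (u + 4 * compK m) m = A u m)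
    (hA' : ∀ m ∈ Ioo (0 : ℝ) 1, ∀ u, A' (u + 4 * compK m) m = A' u m) {ε : ℝ} (hε : ε * ε = 1)
    (hn : ∀ m ∈ Ioo (0 : ℝ) 1, ∀ u, A (-u) m = ε * A u m)
    (hn' : ∀ m ∈ Ioo (0 : ℝ) 1, ∀ u, A' (-u) m = -ε * A' u m) (t : ℝ) :
    phaseInt (fun σ m => w m * (ϖ m * A' (2 * compK m * σ) m
      * A (2 * compK m * σ + t * ϖ m) m)) = -corrD w ϖ A A' t := by
  rw [corrD, phaseInt, phaseInt, ← integral_neg]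
  refine setIntegral_congr_fun measurableSet_Ioo fun m hm => ?_
  have h := integral_reverse hm (A := fun u => A' u m) (B := fun u => A u m) (hA' m hm) (hA m hm)
    (t * ϖ m)
  simp only [hn m hm, hn' m hm] at h
  simp only [mul_assoc (ϖ m), intervalIntegral.integral_const_mul]
  rw [h, ← mul_neg, ← intervalIntegral.integral_const_mul,
    ← intervalIntegral.integral_neg]
  congr 1
  refine intervalIntegral.integral_congr fun σ _ => ?_
  linear_combination (-ϖ m * A' (2 * compK m * σ + t * ϖ m) m * A (2 * compK m * σ) m) * hε

/-- The shifted factor is replaced by its orbit mean `a`, and the error is the oscillatory integral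
assumed to be `O(1 / t)`. The limit retains the unshifted factor. -/
theorem tendsto_corr (h : IsCorr w ϖ A A') {a : ℝ → ℝ} (ha : ContinuousOn a (Ioo 0 1))
    {C : ℝ} (hC : ∀ m ∈ Ioo (0 : ℝ) 1, |a m| ≤ C)
    (hz : ∃ D, ∀ t > 0, |phaseInt fun σ m => w m * (A (2 * compK m * σ) m
      * (A (2 * compK m * σ + t * ϖ m) m - a m))| ≤ D / t) :
    Tendsto (corr w ϖ A) atTop
      (𝓝 (phaseInt fun σ m => w m * (A (2 * compK m * σ) m * a m))) := by
  obtain ⟨B, hB⟩ := h.bounded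
  obtain ⟨D, hD⟩ := hz
  have hw := Cts.of_continuousOn h.cts_weight
  have hac := Cts.of_continuousOn ha
  have e : ∀ t, corr w ϖ A t = phaseInt (fun σ m => w m * (A (2 * compK m * σ) m * a m))
      + phaseInt (fun σ m => w m * (A (2 * compK m * σ) m
        * (A (2 * compK m * σ + t * ϖ m) m - a m))) := by
    intro t
    rw [← phaseInt_add (M := fun m => |w m| * (B * C)) (N := fun m => |w m| * (B * (B + C)))
      (hw.mul (h.cts_left.phase.mul hac)) (h.integrable.abs.mul_const _) (fun m hm σ => ?_)
      (hw.mul (h.cts_left.phase.mul ((h.cts_left.phase_add h.cts_freq t).sub hac)))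
      (h.integrable.abs.mul_const _) (fun m hm σ => ?_)]
    · refine phaseInt_congr fun m _ σ => ?_
      ring
    · rw [abs_mul]
      exact mul_le_mul_of_nonneg_left
        (abs_mul_le_of_le (hB m hm (2 * compK m * σ)).1 (hC m hm)) (abs_nonneg _)
    · rw [abs_mul]
      refine mul_le_mul_of_nonneg_left (abs_mul_le_of_le (hB m hm (2 * compK m * σ)).1
        ((abs_sub _ _).trans (add_le_add (hB m hm _).1 (hC m hm)))) (abs_nonneg _)
  have h0 : Tendsto (fun t => phaseInt (fun σ m => w m * (A (2 * compK m * σ) m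
        * (A (2 * compK m * σ + t * ϖ m) m - a m)))) atTop (𝓝 0) := by
    refine squeeze_zero_norm' ?_ (tendsto_const_nhds.div_atTop tendsto_id : Tendsto
      (fun t : ℝ => D / t) atTop (𝓝 0))
    filter_upwards [eventually_gt_atTop 0] with t ht using hD t ht
  have := h0.const_add (phaseInt (fun σ m => w m * (A (2 * compK m * σ) m * a m)))
  rw [add_zero] at this
  exact this.congr fun t => (e t).symm

end IsCorr

end

section

variable {m ρ μ : ℝ} {g₁ : ℝ → ℝ}

/-! ### The correlations of `cos x` and `sin x` -/

lemma sn_neg (hm : m ∈ Ioo (0 : ℝ) 1) (u : ℝ) : sn (-u) m = -sn u m := by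
  rw [sn, am_neg hm, Real.sin_neg, sn]

lemma cn_neg (hm : m ∈ Ioo (0 : ℝ) 1) (u : ℝ) : cn (-u) m = cn u m := by
  rw [cn, am_neg hm, Real.cos_neg, cn]

lemma dn_neg (hm : m ∈ Ioo (0 : ℝ) 1) (u : ℝ) : dn (-u) m = dn u m := by
  rw [dn, am_neg hm, dlt_neg, dn]

lemma sn_add_four (hm : m ∈ Ioo (0 : ℝ) 1) (u : ℝ) : sn (u + 4 * compK m) m = sn u m := by
  rw [show u + 4 * compK m = u + 2 * compK m + 2 * compK m by ring, sn_add hm, sn_add hm, neg_neg]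

lemma cn_add_four (hm : m ∈ Ioo (0 : ℝ) 1) (u : ℝ) : cn (u + 4 * compK m) m = cn u m := by
  rw [show u + 4 * compK m = u + 2 * compK m + 2 * compK m by ring, cn_add hm, cn_add hm, neg_neg]

lemma dn_add_four (hm : m ∈ Ioo (0 : ℝ) 1) (u : ℝ) : dn (u + 4 * compK m) m = dn u m := by
  rw [show u + 4 * compK m = u + 2 * compK m + 2 * compK m by ring, dn_add hm, dn_add hm]

/-- `cos x` in the eye. -/
def cosEye (u m : ℝ) : ℝ := 1 - 2 * m * sn u m ^ 2

/-- The derivative of `cosEye`. -/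
def cosEyeD (u m : ℝ) : ℝ := -4 * m * (sn u m * cn u m * dn u m)

/-- `sin x` in the eye. -/
def sinEye (u m : ℝ) : ℝ := 2 * √m * (sn u m * dn u m)

/-- The derivative of `sinEye`. -/
def sinEyeD (u m : ℝ) : ℝ := 2 * √m * (cn u m * (1 - 2 * m * sn u m ^ 2))

/-- `cos x` outside the eye. -/
def cosOuter (u m : ℝ) : ℝ := 1 - 2 * sn u m ^ 2

/-- The derivative of `cosOuter`. -/
def cosOuterD (u m : ℝ) : ℝ := -4 * (sn u m * cn u m * dn u m)

/-- `sin x` outside the eye. -/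
def sinOuter (u m : ℝ) : ℝ := 2 * (sn u m * cn u m)

/-- The derivative of `sinOuter`. -/
def sinOuterD (u m : ℝ) : ℝ := 2 * (dn u m * (1 - 2 * sn u m ^ 2))

/-- The weight of the correlations in the eye. -/
def weightEye (ρ : ℝ) (g₁ : ℝ → ℝ) (m : ℝ) : ℝ := 2 * (2 * ρ) * (compK m * g₁ (energyEye ρ m))

/-- The weight of the correlations outside the eye. -/
def weightOuter (ρ : ℝ) (g₁ : ℝ → ℝ) (m : ℝ) : ℝ :=
  2 * (2 * ρ * m ^ (-(3 / 2) : ℝ)) * (compK m * g₁ (energyOuter ρ m))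

lemma continuousOn_weightEye (hg : IsProfile ρ μ g₁) : ContinuousOn (weightEye ρ g₁) (Ioo 0 1) :=
  continuousOn_const.mul (continuousOn_compK.mul
    (hg.continuous.comp_continuousOn (continuousOn_energyEye ρ)))

lemma continuousOn_weightOuter (hg : IsProfile ρ μ g₁) :
    ContinuousOn (weightOuter ρ g₁) (Ioo 0 1) :=
  (continuousOn_const.mul (continuousOn_const.mul (continuousOn_rpow_unit _))).mul
    (continuousOn_compK.mul (hg.continuous.comp_continuousOn (continuousOn_energyOuter ρ)))

lemma integrableOn_of_abs_le {f : ℝ → ℝ} {C s : ℝ} (hf : ContinuousOn f (Ioo 0 1)) (hs : -1 < s)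
    (hb : ∀ m ∈ Ioo (0 : ℝ) 1, |f m| ≤ C * (compK m ^ 1 * m ^ s)) : IntegrableOn f (Ioo 0 1) :=
  Integrable.mono' ((integrableOn_compK_pow_mul_rpow hs (by norm_num)).const_mul C)
    (hf.aestronglyMeasurable measurableSet_Ioo)
    ((ae_restrict_iff' measurableSet_Ioo).2 (Eventually.of_forall hb))

lemma integrableOn_weightEye (hρ : 0 < ρ) (hμ : 0 ≤ μ) (hg : IsProfile ρ μ g₁) :
    IntegrableOn (weightEye ρ g₁) (Ioo 0 1) := by
  obtain ⟨_, _, _, _, C, hC, hb⟩ := eJet_eye_coeff hμ hg 1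
  refine integrableOn_of_abs_le (C := 4 * ρ * C) (s := 0) (continuousOn_weightEye hg) (by norm_num)
    fun m hm => ?_
  have h := (hb m hm 0).1
  have hK := compK_pos hm
  simp only [one_mul, mul_one] at h
  rw [weightEye, Real.rpow_zero, ← mul_assoc, abs_mul, abs_of_pos (by positivity)]
  have := mul_le_mul_of_nonneg_left h (by positivity : 0 ≤ 2 * (2 * ρ) * compK m)
  linarith

lemma abs_weightOuter_le (hρ : 0 < ρ) (hμ : 0 ≤ μ) (hg : IsProfile ρ μ g₁) :
    ∃ C, ∀ m ∈ Ioo (0 : ℝ) 1, |weightOuter ρ g₁ m| ≤ C * (compK m ^ 1 * m ^ (μ - 3 / 2)) := by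
  obtain ⟨_, _, _, _, C, hC, hb⟩ := eJet_outer_coeff hρ hμ hg 1 (-(3 / 2))
  refine ⟨4 * ρ * C, fun m hm => ?_⟩
  have h := (hb m hm 0).1
  have hK := compK_pos hm
  simp only [one_mul, ← sub_eq_add_neg] at h
  rw [weightOuter, show 2 * (2 * ρ * m ^ (-(3 / 2) : ℝ)) * (compK m * g₁ (energyOuter ρ m))
    = 4 * ρ * compK m * (m ^ (-(3 / 2) : ℝ) * g₁ (energyOuter ρ m)) by ring, abs_mul,
    abs_of_pos (by positivity)]
  have := mul_le_mul_of_nonneg_left h (by positivity : 0 ≤ 4 * ρ * compK m)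
  linarith

lemma integrableOn_weightOuter (hρ : 0 < ρ) (hμ : 2 < μ) (hg : IsProfile ρ μ g₁) :
    IntegrableOn (weightOuter ρ g₁) (Ioo 0 1) := by
  obtain ⟨C, hC⟩ := abs_weightOuter_le hρ (by linarith) hg
  exact integrableOn_of_abs_le (continuousOn_weightOuter hg) (by linarith) hC

lemma integrableOn_weightOuter_mul (hρ : 0 < ρ) (hμ : 2 < μ) (hg : IsProfile ρ μ g₁) :
    IntegrableOn (fun m => weightOuter ρ g₁ m * (ρ / √m)) (Ioo 0 1) := by
  obtain ⟨C, hC⟩ := abs_weightOuter_le hρ (by linarith) hg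
  refine integrableOn_of_abs_le (C := C * ρ) (s := μ - 2)
    ((continuousOn_weightOuter hg).mul (continuousOn_outer_freq ρ)) (by linarith) fun m hm => ?_
  have h0 := hm.1
  have hs := Real.sqrt_pos.2 h0
  have e : m ^ (μ - 3 / 2) = m ^ (μ - 2) * √m := by
    rw [Real.sqrt_eq_rpow, ← Real.rpow_add h0]; ring_nf
  rw [abs_mul, abs_of_pos (by positivity : 0 < ρ / √m)]
  refine (mul_le_mul_of_nonneg_right (hC m hm) (by positivity)).trans (le_of_eq ?_)
  rw [e]
  field_simp

lemma abs_snn_le (hm : m ∈ Ioo (0 : ℝ) 1) (u : ℝ) : |sn u m * cn u m * dn u m| ≤ 1 := by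
  have h := abs_mul_le_of_le (abs_mul_le_of_le (abs_sn_le u m) (abs_cn_le u m)) (abs_dn_le hm u)
  linarith

lemma abs_one_sub_two_le {x : ℝ} (h0 : 0 ≤ x) (h1 : x ≤ 1) : |1 - 2 * x| ≤ 1 := by
  rw [abs_le]; constructor <;> linarith

lemma sn_sq_le (u m : ℝ) : sn u m ^ 2 ≤ 1 := by
  nlinarith [sn_sq_add_cn_sq u m, sq_nonneg (cn u m)]

lemma abs_cosEye_le (hm : m ∈ Ioo (0 : ℝ) 1) (u : ℝ) : |1 - 2 * m * sn u m ^ 2| ≤ 1 := by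
  rw [mul_assoc]
  exact abs_one_sub_two_le (mul_nonneg hm.1.le (sq_nonneg _)) (m_mul_sn_sq_lt hm u).le

lemma abs_cosOuter_le (u m : ℝ) : |1 - 2 * sn u m ^ 2| ≤ 1 :=
  abs_one_sub_two_le (sq_nonneg _) (sn_sq_le u m)

lemma sqrt_le_one (hm : m ∈ Ioo (0 : ℝ) 1) : √m ≤ 1 := Real.sqrt_le_one.2 hm.2.le

lemma continuousOn_sqrt_unit : ContinuousOn (fun m : ℝ => √m) (Ioo 0 1) :=
  Real.continuous_sqrt.continuousOn

lemma isCorr_cosEye (hρ : 0 < ρ) (hμ : 0 ≤ μ) (hg : IsProfile ρ μ g₁) :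
    IsCorr (weightEye ρ g₁) (fun _ => ρ) cosEye cosEyeD where
  cts_weight := continuousOn_weightEye hg
  cts_freq := continuousOn_const
  cts_left := (Cts.const 1).sub (((Cts.const 2).mul Cts.id).mul (cts_sn.pow 2))
  cts_right := ((Cts.const (-4)).mul Cts.id).mul ((cts_sn.mul cts_cn).mul cts_dn)
  integrable := integrableOn_weightEye hρ hμ hg
  integrable_mul := (integrableOn_weightEye hρ hμ hg).mul_const ρ
  bounded := ⟨4, fun m hm u => by
    refine ⟨(abs_cosEye_le hm u).trans (by norm_num), ?_⟩
    have h := abs_snn_le hm u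
    rw [cosEyeD, abs_mul, abs_mul, abs_of_pos hm.1, show |(-4 : ℝ)| = 4 by norm_num]
    have : m * |sn u m * cn u m * dn u m| ≤ 1 * 1 :=
      mul_le_mul hm.2.le h (abs_nonneg _) zero_le_one
    linarith⟩
  hasDerivAt m hm u := ((((hasDerivAt_sn hm u).fun_pow 2).const_mul (2 * m)).const_sub
    1).congr_deriv (by rw [cosEyeD]; norm_num; ring)

lemma isCorr_sinEye (hρ : 0 < ρ) (hμ : 0 ≤ μ) (hg : IsProfile ρ μ g₁) :
    IsCorr (weightEye ρ g₁) (fun _ => ρ) sinEye sinEyeD where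
  cts_weight := continuousOn_weightEye hg
  cts_freq := continuousOn_const
  cts_left := ((Cts.const 2).mul (Cts.of_continuousOn continuousOn_sqrt_unit)).mul
    (cts_sn.mul cts_dn)
  cts_right := ((Cts.const 2).mul (Cts.of_continuousOn continuousOn_sqrt_unit)).mul
    (cts_cn.mul ((Cts.const 1).sub (((Cts.const 2).mul Cts.id).mul (cts_sn.pow 2))))
  integrable := integrableOn_weightEye hρ hμ hg
  integrable_mul := (integrableOn_weightEye hρ hμ hg).mul_const ρ
  bounded := ⟨2, fun m hm u => by
    have hs : |2 * √m| ≤ 2 := by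
      rw [abs_of_nonneg (by positivity)]; linarith [sqrt_le_one hm]
    constructor
    · have h := abs_mul_le_of_le hs (abs_mul_le_of_le (abs_sn_le u m) (abs_dn_le hm u))
      rw [sinEye]; linarith
    · have h := abs_mul_le_of_le hs (abs_mul_le_of_le (abs_cn_le u m) (abs_cosEye_le hm u))
      rw [sinEyeD]; linarith⟩
  hasDerivAt m hm u := (((hasDerivAt_sn hm u).fun_mul (hasDerivAt_dn hm u)).const_mul
    (2 * √m)).congr_deriv (by
      rw [sinEyeD]
      linear_combination (2 * √m * cn u m) * dn_sq hm.2 u)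

lemma isCorr_cosOuter (hρ : 0 < ρ) (hμ : 2 < μ) (hg : IsProfile ρ μ g₁) :
    IsCorr (weightOuter ρ g₁) (fun m => ρ / √m) cosOuter cosOuterD where
  cts_weight := continuousOn_weightOuter hg
  cts_freq := continuousOn_outer_freq ρ
  cts_left := (Cts.const 1).sub ((Cts.const 2).mul (cts_sn.pow 2))
  cts_right := (Cts.const (-4)).mul ((cts_sn.mul cts_cn).mul cts_dn)
  integrable := integrableOn_weightOuter hρ hμ hg
  integrable_mul := integrableOn_weightOuter_mul hρ hμ hg
  bounded := ⟨4, fun m hm u => by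
    refine ⟨(abs_cosOuter_le u m).trans (by norm_num), ?_⟩
    have h := abs_snn_le hm u
    rw [cosOuterD, abs_mul, show |(-4 : ℝ)| = 4 by norm_num]
    linarith⟩
  hasDerivAt m hm u := ((((hasDerivAt_sn hm u).fun_pow 2).const_mul 2).const_sub
    1).congr_deriv (by rw [cosOuterD]; norm_num; ring)

lemma isCorr_sinOuter (hρ : 0 < ρ) (hμ : 2 < μ) (hg : IsProfile ρ μ g₁) :
    IsCorr (weightOuter ρ g₁) (fun m => ρ / √m) sinOuter sinOuterD where
  cts_weight := continuousOn_weightOuter hg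
  cts_freq := continuousOn_outer_freq ρ
  cts_left := (Cts.const 2).mul (cts_sn.mul cts_cn)
  cts_right := (Cts.const 2).mul (cts_dn.mul ((Cts.const 1).sub ((Cts.const 2).mul (cts_sn.pow 2))))
  integrable := integrableOn_weightOuter hρ hμ hg
  integrable_mul := integrableOn_weightOuter_mul hρ hμ hg
  bounded := ⟨2, fun m hm u => by
    have h2 : |(2 : ℝ)| ≤ 2 := by norm_num
    constructor
    · have h := abs_mul_le_of_le h2 (abs_mul_le_of_le (abs_sn_le u m) (abs_cn_le u m))
      rw [sinOuter]; linarith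
    · have h := abs_mul_le_of_le h2 (abs_mul_le_of_le (abs_dn_le hm u) (abs_cosOuter_le u m))
      rw [sinOuterD]; linarith⟩
  hasDerivAt m hm u := (((hasDerivAt_sn hm u).fun_mul (hasDerivAt_cn hm u)).const_mul
    2).congr_deriv (by
      rw [sinOuterD]
      linear_combination (2 * dn u m) * sn_sq_add_cn_sq u m)

/-- The mean of `cos x` along an orbit in the eye. -/
def meanEye (m : ℝ) : ℝ := 1 - 2 * m + 2 * m * (compB m / compK m)

/-- The mean of `cos x` along an orbit outside the eye. -/
def meanOuter (m : ℝ) : ℝ := 2 * (compB m / compK m) - 1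

/-- The splitting of `cos x` into its orbit mean and a derivative of a periodic function. It yields
both the mean and the decay of the oscillating part. -/
lemma cosEye_eq (u m : ℝ) : cosEye u m = meanEye m + 2 * m * zetU u m := by
  rw [cosEye, meanEye, zetU]
  linear_combination (-2 * m) * sn_sq_add_cn_sq u m

lemma cosOuter_eq (u m : ℝ) : cosOuter u m = meanOuter m + 2 * zetU u m := by
  rw [cosOuter, meanOuter, zetU]
  linear_combination (-2) * sn_sq_add_cn_sq u m

lemma integral_cosEye (hm : m ∈ Ioo (0 : ℝ) 1) (c : ℝ) :
    ∫ σ in (-1 : ℝ)..1, cosEye (2 * compK m * σ + c) m = 2 * meanEye m := by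
  have hc : Continuous fun σ => zetU (2 * compK m * σ + c) m :=
    (cts_zetU.continuous_left hm).comp (by fun_prop)
  simp_rw [cosEye_eq]
  rw [intervalIntegral.integral_add intervalIntegrable_const
    ((hc.intervalIntegrable _ _).const_mul _), intervalIntegral.integral_const_mul,
    integral_zetU hm, intervalIntegral.integral_const, smul_eq_mul]
  ring

lemma integral_cosOuter (hm : m ∈ Ioo (0 : ℝ) 1) (c : ℝ) :
    ∫ σ in (-1 : ℝ)..1, cosOuter (2 * compK m * σ + c) m = 2 * meanOuter m := by
  have hc : Continuous fun σ => zetU (2 * compK m * σ + c) m :=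
    (cts_zetU.continuous_left hm).comp (by fun_prop)
  simp_rw [cosOuter_eq]
  rw [intervalIntegral.integral_add intervalIntegrable_const
    ((hc.intervalIntegrable _ _).const_mul _), intervalIntegral.integral_const_mul,
    integral_zetU hm, intervalIntegral.integral_const, smul_eq_mul]
  ring

lemma div_compK_mem (hm : m ∈ Ioo (0 : ℝ) 1) : compB m / compK m ∈ Icc (0 : ℝ) 1 := by
  have h1 := half_le_compB hm
  have h2 := compB_le_one hm
  have h3 := one_le_compK hm
  exact ⟨div_nonneg (by linarith) (by linarith), div_le_one_of_le₀ (by linarith) (by linarith)⟩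

lemma abs_meanEye_le (hm : m ∈ Ioo (0 : ℝ) 1) : |meanEye m| ≤ 1 := by
  obtain ⟨h1, h2⟩ := div_compK_mem hm
  rw [meanEye, show 1 - 2 * m + 2 * m * (compB m / compK m)
    = 1 - 2 * (m * (1 - compB m / compK m)) by ring]
  exact abs_one_sub_two_le (mul_nonneg hm.1.le (by linarith))
    (mul_le_one₀ hm.2.le (by linarith) (by linarith))

lemma abs_meanOuter_le (hm : m ∈ Ioo (0 : ℝ) 1) : |meanOuter m| ≤ 1 := by
  obtain ⟨h1, h2⟩ := div_compK_mem hm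
  rw [meanOuter, abs_le]
  constructor <;> linarith

lemma continuousOn_div_compK : ContinuousOn (fun m => compB m / compK m) (Ioo 0 1) :=
  continuousOn_compB.div continuousOn_compK fun _ hm => (compK_pos hm).ne'

lemma continuousOn_meanEye : ContinuousOn meanEye (Ioo 0 1) :=
  (by fun_prop : ContinuousOn (fun m : ℝ => 1 - 2 * m) (Ioo 0 1)).add
    ((by fun_prop : ContinuousOn (fun m : ℝ => 2 * m) (Ioo 0 1)).mul continuousOn_div_compK)

lemma continuousOn_meanOuter : ContinuousOn meanOuter (Ioo 0 1) :=
  (continuousOn_const.mul continuousOn_div_compK).sub continuousOn_const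

lemma rpow_neg_two (hm : 0 < m) : m ^ (-2 : ℝ) = m ^ (-(3 / 2) : ℝ) * (√m)⁻¹ := by
  rw [Real.sqrt_eq_rpow, ← Real.rpow_neg hm.le, ← Real.rpow_add hm]; norm_num

theorem exists_abs_corrD_cosEye_le (hρ : 0 < ρ) (hμ : 0 ≤ μ) (hg : IsProfile ρ μ g₁) :
    ∃ D, ∀ t > 0, |corrD (weightEye ρ g₁) (fun _ => ρ) cosEye cosEyeD t| ≤ D / t ^ 2 := by
  refine exists_decay_of_const_mul (c := 8 * ρ ^ 2) (fun t _ => ?_) (kernelC_eye hρ hμ hg)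
  rw [← phaseInt_const_mul, corrD]
  refine phaseInt_congr fun m hm σ => ?_
  rw [weightEye, cosEye, cosEyeD]
  ring

theorem exists_abs_corrD_sinEye_le (hρ : 0 < ρ) (hμ : 0 ≤ μ) (hg : IsProfile ρ μ g₁) :
    ∃ D, ∀ t > 0, |corrD (weightEye ρ g₁) (fun _ => ρ) sinEye sinEyeD t| ≤ D / t ^ 2 := by
  refine exists_decay_of_const_mul (c := 16 * ρ ^ 2) (fun t _ => ?_) (kernelS_eye hρ hμ hg)
  rw [← phaseInt_const_mul, corrD]
  refine phaseInt_congr fun m hm σ => ?_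
  have h := Real.sq_sqrt hm.1.le
  rw [weightEye, sinEye, sinEyeD]
  generalize 2 * compK m * σ + t * ρ = y
  generalize 2 * compK m * σ = x
  linear_combination (16 * ρ ^ 2 * (compK m * g₁ (energyEye ρ m)) * (sn x m * dn x m)
    * (cn y m * (1 - 2 * m * sn y m ^ 2))) * h

theorem exists_abs_corrD_cosOuter_le (hρ : 0 < ρ) (hμ : 2 < μ) (hg : IsProfile ρ μ g₁) :
    ∃ D, ∀ t > 0, |corrD (weightOuter ρ g₁) (fun m => ρ / √m) cosOuter cosOuterD t|
      ≤ D / t ^ 2 := by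
  refine exists_decay_of_const_mul (c := 8 * ρ ^ 2) (fun t _ => ?_) (kernelC_outer hρ hμ hg)
  rw [← phaseInt_const_mul, corrD]
  refine phaseInt_congr fun m hm σ => ?_
  rw [weightOuter, cosOuter, cosOuterD, rpow_neg_two hm.1]
  ring

theorem exists_abs_corrD_sinOuter_le (hρ : 0 < ρ) (hμ : 2 < μ) (hg : IsProfile ρ μ g₁) :
    ∃ D, ∀ t > 0, |corrD (weightOuter ρ g₁) (fun m => ρ / √m) sinOuter sinOuterD t|
      ≤ D / t ^ 2 := by
  refine exists_decay_of_const_mul (c := 16 * ρ ^ 2) (fun t _ => ?_) (kernelS_outer hρ hμ hg)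
  rw [← phaseInt_const_mul, corrD]
  refine phaseInt_congr fun m hm σ => ?_
  rw [weightOuter, sinOuter, sinOuterD, rpow_neg_two hm.1]
  ring

theorem tendsto_corr_cosEye (hρ : 0 < ρ) (hμ : 0 ≤ μ) (hg : IsProfile ρ μ g₁) :
    Tendsto (corr (weightEye ρ g₁) (fun _ => ρ) cosEye) atTop
      (𝓝 (∫ m in Ioo (0 : ℝ) 1, weightEye ρ g₁ m * (2 * meanEye m ^ 2))) := by
  have h := (isCorr_cosEye hρ hμ hg).tendsto_corr continuousOn_meanEye
    (fun m hm => abs_meanEye_le hm) ?_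
  · convert h using 2
    refine setIntegral_congr_fun measurableSet_Ioo fun m hm => ?_
    have e := integral_cosEye hm 0
    simp only [add_zero] at e
    simp only
    rw [intervalIntegral.integral_const_mul, intervalIntegral.integral_mul_const, e]
    ring
  · refine exists_decay_of_const_mul (c := 8 * ρ) (fun t _ => ?_) (meanC_eye hρ hμ hg)
    rw [← phaseInt_const_mul]
    refine phaseInt_congr fun m hm σ => ?_
    rw [cosEye_eq (2 * compK m * σ + t * ρ), weightEye, cosEye]
    ring

theorem tendsto_corr_cosOuter (hρ : 0 < ρ) (hμ : 2 < μ) (hg : IsProfile ρ μ g₁) :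
    Tendsto (corr (weightOuter ρ g₁) (fun m => ρ / √m) cosOuter) atTop
      (𝓝 (∫ m in Ioo (0 : ℝ) 1, weightOuter ρ g₁ m * (2 * meanOuter m ^ 2))) := by
  have h := (isCorr_cosOuter hρ hμ hg).tendsto_corr continuousOn_meanOuter
    (fun m hm => abs_meanOuter_le hm) ?_
  · convert h using 2
    refine setIntegral_congr_fun measurableSet_Ioo fun m hm => ?_
    have e := integral_cosOuter hm 0
    simp only [add_zero] at e
    simp only
    rw [intervalIntegral.integral_const_mul, intervalIntegral.integral_mul_const, e]
    ring
  · refine exists_decay_of_const_mul (c := 8 * ρ) (fun t _ => ?_) (meanC_outer hρ hμ hg)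
    rw [← phaseInt_const_mul]
    refine phaseInt_congr fun m hm σ => ?_
    rw [cosOuter_eq (2 * compK m * σ + t * (ρ / √m)), weightOuter, cosOuter]
    ring

/-- The function `sn dn` is the derivative of the periodic function `-cn`, so the orbit mean of `sin
x` is zero and no subtraction is needed. -/
theorem tendsto_corr_sinEye (hρ : 0 < ρ) (hμ : 0 ≤ μ) (hg : IsProfile ρ μ g₁) :
    Tendsto (corr (weightEye ρ g₁) (fun _ => ρ) sinEye) atTop (𝓝 0) := by
  have h := (isCorr_sinEye hρ hμ hg).tendsto_corr (a := fun _ => 0) continuousOn_const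
    (C := 0) (fun m hm => by simp) ?_
  · simpa [phaseInt] using h
  · refine exists_decay_of_const_mul (c := 16 * ρ) (fun t _ => ?_) (meanS_eye hρ hμ hg)
    rw [← phaseInt_const_mul]
    refine phaseInt_congr fun m hm σ => ?_
    have h := Real.sq_sqrt hm.1.le
    rw [weightEye, sinEye, sinEye]
    generalize 2 * compK m * σ + t * ρ = y
    generalize 2 * compK m * σ = x
    linear_combination (16 * ρ * (compK m * g₁ (energyEye ρ m)) * (sn x m * dn x m)
      * (sn y m * dn y m)) * h

theorem tendsto_corr_sinOuter (hρ : 0 < ρ) (hμ : 2 < μ) (hg : IsProfile ρ μ g₁) :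
    Tendsto (corr (weightOuter ρ g₁) (fun m => ρ / √m) sinOuter) atTop (𝓝 0) := by
  have h := (isCorr_sinOuter hρ hμ hg).tendsto_corr (a := fun _ => 0) continuousOn_const
    (C := 0) (fun m hm => by simp) ?_
  · simpa [phaseInt] using h
  · refine exists_decay_of_const_mul (c := 16 * ρ) (fun t _ => ?_) (meanS_outer hρ hμ hg)
    rw [← phaseInt_const_mul]
    refine phaseInt_congr fun m hm σ => ?_
    rw [weightOuter, sinOuter, sinOuter]
    ring

end

section

variable {m ρ μ : ℝ} {g₁ G : ℝ → ℝ}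

open VlasovHMF

/-! ### The kernels as derivatives of correlations -/

/-- Two integrations by parts differentiate the amplitude, which contains `G'`, at most twice, so
bounds of the first three derivatives of `G` are what is needed. -/
lemma isProfile_deriv (hG : ContDiff ℝ 10 G)
    (hdecay : ∃ C : ℝ, ∀ n : ℕ, n ≤ 10 → ∀ y : ℝ, -ρ ^ 2 ≤ y →
      (1 + y ^ 2) ^ (μ / 2) * |iteratedDeriv n G y| ≤ C) : IsProfile ρ μ (deriv G) := by
  obtain ⟨C, hC⟩ := hdecay
  have hd : ∀ n : ℕ, n < 10 → ∀ y, HasDerivAt (iteratedDeriv n G) (iteratedDeriv (n + 1) G y) y := by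
    intro n hn y
    rw [iteratedDeriv_succ]
    refine (hG.differentiable_iteratedDeriv n ?_ y).hasDerivAt
    exact_mod_cast hn
  refine ⟨iteratedDeriv 2 G, iteratedDeriv 3 G, ?_, hd 2 (by norm_num), C, ?_, fun y hy => ?_⟩
  · have := hd 1 (by norm_num)
    rwa [iteratedDeriv_one] at this
  · exact le_trans (by positivity) (hC 0 (by norm_num) 0 (by nlinarith [sq_nonneg ρ]))
  · refine ⟨?_, hC 2 (by norm_num) y hy, hC 3 (by norm_num) y hy⟩
    have := hC 1 (by norm_num) y hy
    rwa [iteratedDeriv_one] at this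

lemma continuous_hamiltonian (M : ℝ) : Continuous (hamiltonian M) := by
  unfold hamiltonian; fun_prop

lemma integrable_inv_one_add_sq_snd :
    Integrable (fun z : ℝ × ℝ => (1 + z.2 ^ 2)⁻¹) phaseMeasure := by
  have : IsFiniteMeasure (ENNReal.ofReal (1 / (2 * Real.pi)) •
      volume.restrict (Ioc (-Real.pi) Real.pi)) := Measure.smul_finite _ ENNReal.ofReal_ne_top
  exact Integrable.comp_snd (f := fun v : ℝ => (1 + v ^ 2)⁻¹) integrable_inv_one_add_sq _

/-- The energy is quadratic in `v`, and `μ / 2 ≥ 1`, so `G'(h₀)` is at most a multiple of `(1 +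
v²)⁻²`. This leaves `(1 + v²)⁻¹` after multiplication by a factor of linear growth. -/
lemma integrable_profile_mul (hμ : 2 < μ) (hg : IsProfile ρ μ g₁) {W : ℝ × ℝ → ℝ}
    (hW : Continuous W) {A : ℝ} (hA : 0 ≤ A) (hb : ∀ z, |W z| ≤ A * (1 + |z.2|)) :
    Integrable (fun z => g₁ (hamiltonian (ρ ^ 2) z) * W z) phaseMeasure := by
  have hc := hg.continuous
  obtain ⟨_, _, _, _, C, hC, hgb⟩ := hg
  -- From `1 + v² ≤ (1 + 2 ρ²) + 2 |h|` and `(a + b)² ≤ 2 a² + 2 b²`, the square is at most `2 (1 +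
  -- 2 ρ²)² + 8 h²`, hence at most `Q (1 + h²)`.
  set Q := 8 + 2 * (1 + 2 * ρ ^ 2) ^ 2 with hQ
  refine Integrable.mono' (integrable_inv_one_add_sq_snd.const_mul (2 * A * (Q * C)))
    ((hc.comp (continuous_hamiltonian _)).mul hW).aestronglyMeasurable
    (Eventually.of_forall fun z => ?_)
  have hcos := Real.neg_one_le_cos z.1
  have hcos' := Real.cos_le_one z.1
  set h := hamiltonian (ρ ^ 2) z with hh
  have hv : z.2 ^ 2 = 2 * h + 2 * ρ ^ 2 * Real.cos z.1 := by rw [hh, hamiltonian]; ring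
  have hlow : -ρ ^ 2 ≤ h := by
    have : ρ ^ 2 * Real.cos z.1 ≤ ρ ^ 2 * 1 := mul_le_mul_of_nonneg_left hcos' (sq_nonneg ρ)
    nlinarith [sq_nonneg z.2]
  have b1 : (1 + h ^ 2) * |g₁ h| ≤ C := by
    refine le_trans (mul_le_mul_of_nonneg_right ?_ (abs_nonneg _)) (hgb h hlow).1
    have := Real.rpow_le_rpow_of_exponent_le (x := 1 + h ^ 2) (by nlinarith [sq_nonneg h])
      (show (1 : ℝ) ≤ μ / 2 by linarith)
    rwa [Real.rpow_one] at this
  have b2 : (1 + z.2 ^ 2) ^ 2 ≤ Q * (1 + h ^ 2) := by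
    have h1 : 1 + z.2 ^ 2 ≤ (1 + 2 * ρ ^ 2) + 2 * |h| := by
      have : ρ ^ 2 * Real.cos z.1 ≤ ρ ^ 2 * 1 := mul_le_mul_of_nonneg_left hcos' (sq_nonneg ρ)
      linarith [le_abs_self h]
    have h2 := pow_le_pow_left₀ (by positivity) h1 2
    have h3 : |h| ^ 2 = h ^ 2 := sq_abs h
    have h4 := sq_nonneg ((1 + 2 * ρ ^ 2) - 2 * |h|)
    have h5 : 0 ≤ (1 + 2 * ρ ^ 2) ^ 2 * h ^ 2 := by positivity
    rw [hQ]
    nlinarith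
  have b3 : 1 + |z.2| ≤ 2 * (1 + z.2 ^ 2) := by
    have := sq_nonneg (|z.2| - 1)
    rw [← sq_abs z.2]
    nlinarith [abs_nonneg z.2]
  have hp : 0 < 1 + z.2 ^ 2 := by positivity
  rw [Real.norm_eq_abs, abs_mul, ← div_eq_mul_inv, le_div_iff₀ hp]
  calc |g₁ h| * |W z| * (1 + z.2 ^ 2)
      ≤ |g₁ h| * (A * (2 * (1 + z.2 ^ 2))) * (1 + z.2 ^ 2) := by
        gcongr
        exact (hb z).trans (by gcongr)
    _ = 2 * A * ((1 + z.2 ^ 2) ^ 2 * |g₁ h|) := by ring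
    _ ≤ 2 * A * (Q * (1 + h ^ 2) * |g₁ h|) := by gcongr
    _ = 2 * A * (Q * ((1 + h ^ 2) * |g₁ h|)) := by ring
    _ ≤ 2 * A * (Q * C) := by gcongr

lemma hamiltonian_neg (M : ℝ) (z : ℝ × ℝ) : hamiltonian M (-z) = hamiltonian M z := by
  simp [hamiltonian]

lemma hamiltonian_add (M : ℝ) (z : ℝ × ℝ) :
    hamiltonian M (z + (2 * Real.pi, 0)) = hamiltonian M z := by
  simp [hamiltonian]

lemma isPhaseFunction_profile_mul (hg : IsProfile ρ μ g₁) {W : ℝ × ℝ → ℝ}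
    (hW : IsPhaseFunction W) :
    IsPhaseFunction fun z => g₁ (hamiltonian (ρ ^ 2) z) * W z where
  continuous := (hg.continuous.comp (continuous_hamiltonian _)).mul hW.continuous
  neg z := by rw [hamiltonian_neg, hW.neg]
  add z := by rw [hamiltonian_add, hW.add]

lemma hasDerivAt_state (hG : Differentiable ℝ G) (M : ℝ) (z : ℝ × ℝ) :
    HasDerivAt (fun v => state M G (z.1, v)) (deriv G (hamiltonian M z) * z.2) z.2 := by
  have h : HasDerivAt (fun v => hamiltonian M (z.1, v)) z.2 z.2 :=
    ((((hasDerivAt_id z.2).fun_pow 2).div_const 2).sub_const (M * Real.cos z.1)).congr_deriv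
      (by simp)
  exact ((hG _).hasDerivAt).comp z.2 h

lemma poissonBracket_cos (hG : Differentiable ℝ G) (M : ℝ) (z : ℝ × ℝ) :
    poissonBracket (state M G) (fun w => Real.cos w.1) z
      = deriv G (hamiltonian M z) * (z.2 * Real.sin z.1) := by
  rw [poissonBracket, (hasDerivAt_state hG M z).deriv]
  simp
  ring

lemma poissonBracket_sin (hG : Differentiable ℝ G) (M : ℝ) (z : ℝ × ℝ) :
    poissonBracket (state M G) (fun w => Real.sin w.1) z
      = -(deriv G (hamiltonian M z) * (z.2 * Real.cos z.1)) := by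
  rw [poissonBracket, (hasDerivAt_state hG M z).deriv]
  simp
  ring

/-- The correlation of `cos x`. -/
def corrCos (ρ : ℝ) (g₁ : ℝ → ℝ) (t : ℝ) : ℝ := 1 / (2 * Real.pi) *
  (corr (weightEye ρ g₁) (fun _ => ρ) cosEye t + corr (weightOuter ρ g₁) (fun m => ρ / √m) cosOuter t)

/-- The derivative of the correlation of `cos x`. -/
def corrCosD (ρ : ℝ) (g₁ : ℝ → ℝ) (t : ℝ) : ℝ := 1 / (2 * Real.pi) *
  (corrD (weightEye ρ g₁) (fun _ => ρ) cosEye cosEyeD t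
    + corrD (weightOuter ρ g₁) (fun m => ρ / √m) cosOuter cosOuterD t)

/-- The correlation of `sin x`. -/
def corrSin (ρ : ℝ) (g₁ : ℝ → ℝ) (t : ℝ) : ℝ := 1 / (2 * Real.pi) *
  (corr (weightEye ρ g₁) (fun _ => ρ) sinEye t + corr (weightOuter ρ g₁) (fun m => ρ / √m) sinOuter t)

/-- The derivative of the correlation of `sin x`. -/
def corrSinD (ρ : ℝ) (g₁ : ℝ → ℝ) (t : ℝ) : ℝ := 1 / (2 * Real.pi) *
  (corrD (weightEye ρ g₁) (fun _ => ρ) sinEye sinEyeD t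
    + corrD (weightOuter ρ g₁) (fun m => ρ / √m) sinOuter sinOuterD t)

lemma phaseInt_neg (f : ℝ → ℝ → ℝ) : phaseInt (fun σ m => -f σ m) = -phaseInt f := by
  simp only [phaseInt, intervalIntegral.integral_neg, integral_neg]

lemma sqrt_mul_self_eq (hm : m ∈ Ioo (0 : ℝ) 1) : √m * √m = m := Real.mul_self_sqrt hm.1.le

/-- The bracket is `G'(h₀) v sin x`, minus the derivative of `G'(h₀) cos x` along the orbit. Its
negative is the unshifted factor of a reversed correlation, and the reversal (`ε = 1`, as `cos x` is
even in `u`) restores the sign. -/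
theorem kernelC_eq (hρ : 0 < ρ) (hμ : 2 < μ) (hG : Differentiable ℝ G)
    (hg : IsProfile ρ μ (deriv G)) {t : ℝ} (ht : 0 ≤ t) :
    kernelC (ρ ^ 2) G t = corrCosD ρ (deriv G) t := by
  have hfl := continuous_pendulumFlow (M := ρ ^ 2) ht
  have hW : IsPhaseFunction fun z : ℝ × ℝ =>
      z.2 * Real.sin z.1 * Real.cos (pendulumFlow (ρ ^ 2) t z).1 :=
    ⟨by fun_prop, fun z => by simp [pendulumFlow_neg],
      fun z => by simp [pendulumFlow_add_two_pi]⟩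
  have hb : ∀ z : ℝ × ℝ, |z.2 * Real.sin z.1 * Real.cos (pendulumFlow (ρ ^ 2) t z).1|
      ≤ 1 * (1 + |z.2|) := fun z => by
    have := abs_mul_le_of_le (abs_mul_le_of_le (le_refl |z.2|) (Real.abs_sin_le_one z.1))
      (Real.abs_cos_le_one (pendulumFlow (ρ ^ 2) t z).1)
    linarith
  rw [kernelC, if_pos ht]
  simp_rw [poissonBracket_cos hG, mul_assoc (deriv G _)]
  rw [integral_phaseMeasure hρ (isPhaseFunction_profile_mul hg hW)
    (integrable_profile_mul hμ hg hW.continuous zero_le_one hb), corrCosD]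
  congr 2
  · rw [← neg_neg (corrD _ _ _ _ t), ← IsCorr.phaseInt_reverse (ε := 1)
      (fun m hm u => by simp only [cosEye, sn_add_four hm])
      (fun m hm u => by simp only [cosEyeD, sn_add_four hm, cn_add_four hm, dn_add_four hm])
      (by norm_num) (fun m hm u => by simp only [cosEye, sn_neg hm]; ring)
      (fun m hm u => by simp only [cosEyeD, sn_neg hm, cn_neg hm, dn_neg hm]; ring), ← phaseInt_neg]
    refine phaseInt_congr fun m hm σ => ?_
    rw [hamiltonian_eyePt hm, sin_eyePt hm, pendulumFlow_eyePt hm, cos_eyePt hm, eyePt, weightEye,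
      cosEyeD, cosEye]
    generalize 2 * compK m * σ + t * ρ = y
    generalize 2 * compK m * σ = x
    linear_combination (16 * ρ ^ 2 * (compK m * deriv G (energyEye ρ m)) * (sn x m * dn x m * cn x m)
      * (1 - 2 * m * sn y m ^ 2)) * sqrt_mul_self_eq hm
  · rw [← neg_neg (corrD _ _ _ _ t), ← IsCorr.phaseInt_reverse (ε := 1)
      (fun m hm u => by simp only [cosOuter, sn_add_four hm])
      (fun m hm u => by simp only [cosOuterD, sn_add_four hm, cn_add_four hm, dn_add_four hm])
      (by norm_num) (fun m hm u => by simp only [cosOuter, sn_neg hm]; ring)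
      (fun m hm u => by simp only [cosOuterD, sn_neg hm, cn_neg hm, dn_neg hm]; ring),
      ← phaseInt_neg]
    refine phaseInt_congr fun m hm σ => ?_
    rw [hamiltonian_outerPt hm, sin_outerPt, pendulumFlow_outerPt hm, cos_outerPt, outerPt,
      weightOuter, cosOuterD, cosOuter]
    ring

/-- As for the cosine, but here `{η, sin X} = -G'(h₀) v cos x`, and the minus sign in the definition
of the kernel makes it positive. The reversal therefore leaves a minus sign. Its parity is `ε = -1`
in both regions. -/
theorem kernelS_eq (hρ : 0 < ρ) (hμ : 2 < μ) (hG : Differentiable ℝ G)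
    (hg : IsProfile ρ μ (deriv G)) {t : ℝ} (ht : 0 ≤ t) :
    kernelS (ρ ^ 2) G t = -corrSinD ρ (deriv G) t := by
  have hfl := continuous_pendulumFlow (M := ρ ^ 2) ht
  have hW : IsPhaseFunction fun z : ℝ × ℝ =>
      z.2 * Real.cos z.1 * Real.sin (pendulumFlow (ρ ^ 2) t z).1 :=
    ⟨by fun_prop, fun z => by simp [pendulumFlow_neg],
      fun z => by simp [pendulumFlow_add_two_pi]⟩
  have hb : ∀ z : ℝ × ℝ, |z.2 * Real.cos z.1 * Real.sin (pendulumFlow (ρ ^ 2) t z).1|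
      ≤ 1 * (1 + |z.2|) := fun z => by
    have := abs_mul_le_of_le (abs_mul_le_of_le (le_refl |z.2|) (Real.abs_cos_le_one z.1))
      (Real.abs_sin_le_one (pendulumFlow (ρ ^ 2) t z).1)
    linarith
  rw [kernelS, if_pos ht]
  simp_rw [poissonBracket_sin hG, neg_mul, mul_assoc (deriv G _)]
  rw [integral_neg, neg_neg, integral_phaseMeasure hρ (isPhaseFunction_profile_mul hg hW)
    (integrable_profile_mul hμ hg hW.continuous zero_le_one hb), corrSinD, ← mul_neg, neg_add]
  congr 2
  · rw [← IsCorr.phaseInt_reverse (ε := -1)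
      (fun m hm u => by simp only [sinEye, sn_add_four hm, dn_add_four hm])
      (fun m hm u => by simp only [sinEyeD, sn_add_four hm, cn_add_four hm])
      (by norm_num) (fun m hm u => by simp only [sinEye, sn_neg hm, dn_neg hm]; ring)
      (fun m hm u => by simp only [sinEyeD, sn_neg hm, cn_neg hm]; ring)]
    refine phaseInt_congr fun m hm σ => ?_
    rw [hamiltonian_eyePt hm, cos_eyePt hm, pendulumFlow_eyePt hm, sin_eyePt hm, eyePt, weightEye,
      sinEyeD, sinEye]
    ring
  · rw [← IsCorr.phaseInt_reverse (ε := -1)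
      (fun m hm u => by simp only [sinOuter, sn_add_four hm, cn_add_four hm])
      (fun m hm u => by simp only [sinOuterD, sn_add_four hm, dn_add_four hm])
      (by norm_num) (fun m hm u => by simp only [sinOuter, sn_neg hm, cn_neg hm]; ring)
      (fun m hm u => by simp only [sinOuterD, sn_neg hm, dn_neg hm]; ring)]
    refine phaseInt_congr fun m hm σ => ?_
    rw [hamiltonian_outerPt hm, cos_outerPt, pendulumFlow_outerPt hm, sin_outerPt, outerPt,
      weightOuter, sinOuterD, sinOuter]
    ring

theorem integral_cos_sq_eq (hρ : 0 < ρ) (hμ : 2 < μ) (hg : IsProfile ρ μ g₁) :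
    ∫ z, g₁ (hamiltonian (ρ ^ 2) z) * Real.cos z.1 ^ 2 ∂phaseMeasure = corrCos ρ g₁ 0 := by
  have hW : IsPhaseFunction fun z : ℝ × ℝ => Real.cos z.1 ^ 2 :=
    ⟨by fun_prop, fun z => by simp, fun z => by simp⟩
  have hb : ∀ z : ℝ × ℝ, |Real.cos z.1 ^ 2| ≤ 1 * (1 + |z.2|) := fun z => by
    have := Real.cos_sq_le_one z.1
    rw [abs_of_nonneg (sq_nonneg _)]
    linarith [abs_nonneg z.2]
  rw [integral_phaseMeasure hρ (isPhaseFunction_profile_mul hg hW)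
    (integrable_profile_mul hμ hg hW.continuous zero_le_one hb), corrCos]
  congr 2
  · refine phaseInt_congr fun m hm σ => ?_
    rw [hamiltonian_eyePt hm, cos_eyePt hm, weightEye, zero_mul, add_zero, cosEye]
    ring
  · refine phaseInt_congr fun m hm σ => ?_
    rw [hamiltonian_outerPt hm, cos_outerPt, weightOuter, zero_mul, add_zero, cosOuter]
    ring

end

section

variable {m ρ μ : ℝ} {g₁ G : ℝ → ℝ}

open VlasovHMF

/-! ### The time integrals of the kernels -/

/-- The kernel is `F'` cut off to `t ≥ 0`. It is bounded near zero and `O(t⁻²)` at infinity, hence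
integrable, and the fundamental theorem on the half line gives its integral. -/
theorem integral_of_causal {K F F' : ℝ → ℝ} {L D₀ D : ℝ} (hF : ∀ t, HasDerivAt F (F' t) t)
    (hb : ∀ t, |F' t| ≤ D₀) (hd : ∀ t > 0, |F' t| ≤ D / t ^ 2) (hL : Tendsto F atTop (𝓝 L))
    (hK : ∀ t, 0 ≤ t → K t = F' t) (hK' : ∀ t < 0, K t = 0) :
    Integrable K ∧ ∫ t, K t = L - F 0 := by
  -- Continuity of `F'` is not available here; a derivative is always measurable.
  have hF' : Measurable F' := by
    have : F' = deriv F := funext fun t => (hF t).deriv.symm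
    rw [this]; exact measurable_deriv F
  have hi1 : IntegrableOn F' (Ioc 0 1) :=
    Measure.integrableOn_of_bounded (M := D₀) (by simp) hF'.aestronglyMeasurable
      (Eventually.of_forall hb)
  have hi2 : IntegrableOn F' (Ioi 1) := by
    refine Integrable.mono' ((integrableOn_Ioi_rpow_of_lt (a := -2) (by norm_num)
      zero_lt_one).const_mul D) hF'.aestronglyMeasurable
      ((ae_restrict_iff' measurableSet_Ioi).2 (Eventually.of_forall fun t ht => ?_))
    have ht0 : (0 : ℝ) < t := zero_lt_one.trans ht
    refine (hd t ht0).trans (le_of_eq ?_)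
    rw [Real.rpow_neg ht0.le, div_eq_mul_inv]
    norm_num
  have hi : IntegrableOn F' (Ioi 0) := by
    rw [← Ioc_union_Ioi_eq_Ioi zero_le_one]
    exact hi1.union hi2
  have hind : K = (Ici 0).indicator F' := by
    funext t
    by_cases ht : 0 ≤ t
    · rw [indicator_of_mem (show t ∈ Ici 0 from ht), hK t ht]
    · rw [indicator_of_notMem (show t ∉ Ici 0 from ht), hK' t (not_le.1 ht)]
  constructor
  · rw [hind, integrable_indicator_iff measurableSet_Ici, integrableOn_Ici_iff_integrableOn_Ioi]
    exact hi
  · rw [hind, integral_indicator measurableSet_Ici, integral_Ici_eq_integral_Ioi]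
    exact integral_Ioi_of_hasDerivAt_of_tendsto (hF 0).continuousAt.continuousWithinAt
      (fun t _ => hF t) hi hL

lemma fourierHat_zero (F : ℝ → ℝ) : fourierHat F 0 = ((∫ t, F t : ℝ) : ℂ) := by
  simp only [fourierHat, mul_zero, neg_zero, Complex.exp_zero, mul_one]
  exact integral_ofReal

lemma exists_decay_add {F₁ F₂ : ℝ → ℝ} (h₁ : ∃ D, ∀ t > 0, |F₁ t| ≤ D / t ^ 2)
    (h₂ : ∃ D, ∀ t > 0, |F₂ t| ≤ D / t ^ 2) (c : ℝ) :
    ∃ D, ∀ t > 0, |c * (F₁ t + F₂ t)| ≤ D / t ^ 2 := by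
  obtain ⟨D₁, h₁⟩ := h₁
  obtain ⟨D₂, h₂⟩ := h₂
  refine ⟨|c| * (D₁ + D₂), fun t ht => ?_⟩
  rw [abs_mul, mul_div_assoc, add_div]
  exact mul_le_mul_of_nonneg_left ((abs_add_le _ _).trans (add_le_add (h₁ t ht) (h₂ t ht)))
    (abs_nonneg c)

lemma exists_bound_add {F₁ F₂ : ℝ → ℝ} (h₁ : ∃ D, ∀ t, |F₁ t| ≤ D)
    (h₂ : ∃ D, ∀ t, |F₂ t| ≤ D) (c : ℝ) : ∃ D, ∀ t, |c * (F₁ t + F₂ t)| ≤ D := by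
  obtain ⟨D₁, h₁⟩ := h₁
  obtain ⟨D₂, h₂⟩ := h₂
  refine ⟨|c| * (D₁ + D₂), fun t => ?_⟩
  rw [abs_mul]
  exact mul_le_mul_of_nonneg_left ((abs_add_le _ _).trans (add_le_add (h₁ t) (h₂ t)))
    (abs_nonneg c)

/-- The limit of the correlation of `cos x`. -/
def limitCos (ρ : ℝ) (g₁ : ℝ → ℝ) : ℝ := 1 / (2 * Real.pi) *
  ((∫ m in Ioo (0 : ℝ) 1, weightEye ρ g₁ m * (2 * meanEye m ^ 2))
    + ∫ m in Ioo (0 : ℝ) 1, weightOuter ρ g₁ m * (2 * meanOuter m ^ 2))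

theorem kernelC_integral (hρ : 0 < ρ) (hμ : 2 < μ) (hG : Differentiable ℝ G)
    (hg : IsProfile ρ μ (deriv G)) : Integrable (kernelC (ρ ^ 2) G) ∧
    ∫ t, kernelC (ρ ^ 2) G t = limitCos ρ (deriv G) - corrCos ρ (deriv G) 0 := by
  have hμ0 : 0 ≤ μ := by linarith
  have h1 := isCorr_cosEye hρ hμ0 hg
  have h2 := isCorr_cosOuter hρ hμ hg
  obtain ⟨D, hD⟩ := exists_decay_add (exists_abs_corrD_cosEye_le hρ hμ0 hg)
    (exists_abs_corrD_cosOuter_le hρ hμ hg) (1 / (2 * Real.pi))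
  obtain ⟨D₀, hD₀⟩ := exists_bound_add h1.exists_abs_corrD_le h2.exists_abs_corrD_le
    (1 / (2 * Real.pi))
  exact integral_of_causal (F := corrCos ρ (deriv G)) (F' := corrCosD ρ (deriv G))
    (fun t => ((h1.hasDerivAt_corr t).add (h2.hasDerivAt_corr t)).const_mul _) hD₀ hD
    (((tendsto_corr_cosEye hρ hμ0 hg).add (tendsto_corr_cosOuter hρ hμ hg)).const_mul _)
    (fun t ht => kernelC_eq hρ hμ hG hg ht) (fun t ht => if_neg (not_le.2 ht))

/-- The correlation of `sin x` tends to zero, so the integral of `-S'` is the value `S(0)`. -/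
theorem kernelS_integral (hρ : 0 < ρ) (hμ : 2 < μ) (hG : Differentiable ℝ G)
    (hg : IsProfile ρ μ (deriv G)) : Integrable (kernelS (ρ ^ 2) G) ∧
    ∫ t, kernelS (ρ ^ 2) G t = corrSin ρ (deriv G) 0 := by
  have hμ0 : 0 ≤ μ := by linarith
  have h1 := isCorr_sinEye hρ hμ0 hg
  have h2 := isCorr_sinOuter hρ hμ hg
  obtain ⟨D, hD⟩ := exists_decay_add (exists_abs_corrD_sinEye_le hρ hμ0 hg)
    (exists_abs_corrD_sinOuter_le hρ hμ hg) (1 / (2 * Real.pi))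
  obtain ⟨D₀, hD₀⟩ := exists_bound_add h1.exists_abs_corrD_le h2.exists_abs_corrD_le
    (1 / (2 * Real.pi))
  have h := integral_of_causal (F := fun t => -corrSin ρ (deriv G) t) 
    (L := -(1 / (2 * Real.pi) * (0 + 0)))
    (F' := fun t => -corrSinD ρ (deriv G) t) (K := kernelS (ρ ^ 2) G)
    (fun t => (((h1.hasDerivAt_corr t).add (h2.hasDerivAt_corr t)).const_mul _).neg)
    (fun t => (abs_neg _).trans_le (hD₀ t)) (fun t ht => (abs_neg _).trans_le (hD t ht))
    (((tendsto_corr_sinEye hρ hμ0 hg).add (tendsto_corr_sinOuter hρ hμ hg)).const_mul _).neg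
    (fun t ht => kernelS_eq hρ hμ hG hg ht) (fun t ht => if_neg (not_le.2 ht))
  simpa using h

lemma phaseInt_nonpos {f : ℝ → ℝ → ℝ} (hf : ∀ m ∈ Ioo (0 : ℝ) 1, ∀ σ, f σ m ≤ 0) :
    phaseInt f ≤ 0 := by
  refine setIntegral_nonpos measurableSet_Ioo fun m hm => ?_
  have := intervalIntegral.integral_nonneg (a := -1) (b := 1) (f := fun σ => -f σ m) (μ := volume)
    (by norm_num) fun σ _ => neg_nonneg.2 (hf m hm σ)
  rw [intervalIntegral.integral_neg] at this
  linarith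

lemma corr_zero_nonpos {w ϖ : ℝ → ℝ} (A : ℝ → ℝ → ℝ) (hw : ∀ m ∈ Ioo (0 : ℝ) 1, w m ≤ 0) :
    corr w ϖ A 0 ≤ 0 := by
  refine phaseInt_nonpos fun m hm σ => ?_
  rw [zero_mul, add_zero]
  exact mul_nonpos_of_nonpos_of_nonneg (hw m hm) (mul_self_nonneg _)

/-- At `t = 0` the correlation is an integral of a square against `G'`. This is where the
monotonicity of `G` enters, and it makes the condition on `K_S` automatic. -/
lemma corrSin_zero_nonpos (hρ : 0 < ρ) (hg : ∀ y, -ρ ^ 2 ≤ y → g₁ y < 0) :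
    corrSin ρ g₁ 0 ≤ 0 := by
  have hpi := Real.pi_pos
  refine mul_nonpos_of_nonneg_of_nonpos (by positivity) (add_nonpos (corr_zero_nonpos _ fun m hm => ?_)
    (corr_zero_nonpos _ fun m hm => ?_))
  · exact mul_nonpos_of_nonneg_of_nonpos (by positivity) (mul_nonpos_of_nonneg_of_nonpos
      (compK_pos hm).le (hg _ (neg_sq_le_energyEye ρ hm)).le)
  · have := Real.rpow_nonneg hm.1.le (-(3 / 2))
    exact mul_nonpos_of_nonneg_of_nonpos (by positivity) (mul_nonpos_of_nonneg_of_nonpos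
      (compK_pos hm).le (hg _ (neg_sq_le_energyOuter ρ hm)).le)

end

section

variable {m ρ μ : ℝ} {g₁ G : ℝ → ℝ}

open VlasovHMF

/-! ### The action-angle variables -/

lemma abs_cos_le_one_sub (φ : ℝ) (hm : m ∈ Ioo (0 : ℝ) 1) (hφ : 0 ≤ Real.cos φ) :
    Real.cos φ ≤ dlt φ m ∧ dlt φ m ≤ Real.cos φ + √(1 - m) := by
  have h1 := Real.sin_sq_add_cos_sq φ
  have h2 : √(1 - m) ^ 2 = 1 - m := Real.sq_sqrt (by linarith [hm.2])
  have h3 := Real.sqrt_nonneg (1 - m)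
  constructor
  · refine Real.le_sqrt_of_sq_le ?_
    nlinarith [hm.2, sq_nonneg (Real.sin φ)]
  · refine Real.sqrt_le_iff.2 ⟨by positivity, ?_⟩
    nlinarith [hm.2, sq_nonneg (Real.cos φ), mul_nonneg hφ h3, sq_nonneg (Real.sin φ)]

/-- For acute angles `Δ` lies between `cos` and `cos + √(1 - m)`. Hence `E → 1` at the separatrix,
which fixes the endpoints of the action intervals. -/
lemma compE_bounds (hm : m ∈ Ioo (0 : ℝ) 1) :
    1 ≤ compE m ∧ compE m ≤ 1 + Real.pi / 2 * √(1 - m) := by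
  have hpi := Real.pi_pos
  have hc : ∀ φ ∈ Icc 0 (Real.pi / 2), 0 ≤ Real.cos φ := fun φ hφ =>
    Real.cos_nonneg_of_mem_Icc ⟨by linarith [hφ.1], hφ.2⟩
  have i1 : IntervalIntegrable Real.cos volume 0 (Real.pi / 2) :=
    Real.continuous_cos.intervalIntegrable _ _
  have i2 : IntervalIntegrable (fun φ => dlt φ m) volume 0 (Real.pi / 2) :=
    (continuous_dlt_left m).intervalIntegrable _ _
  have e1 : ∫ φ in (0)..(Real.pi / 2), Real.cos φ = 1 := by simp
  rw [compE_eq_integral hm]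
  constructor
  · rw [← e1]
    exact intervalIntegral.integral_mono_on (by positivity) i1 i2
      fun φ hφ => (abs_cos_le_one_sub φ hm (hc φ hφ)).1
  · have h := intervalIntegral.integral_mono_on (by positivity) i2
      (i1.add (intervalIntegrable_const (c := √(1 - m))))
      fun φ hφ => (abs_cos_le_one_sub φ hm (hc φ hφ)).2
    rw [intervalIntegral.integral_add i1 intervalIntegrable_const, e1,
      intervalIntegral.integral_const, sub_zero, smul_eq_mul] at h
    exact h

lemma tendsto_compE : Tendsto compE (𝓝[<] 1) (𝓝 1) := by
  have e1 : ∀ᶠ m : ℝ in 𝓝[<] 1, m ∈ Ioo (0 : ℝ) 1 := Ioo_mem_nhdsLT one_pos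
  have h : Tendsto (fun m : ℝ => 1 + Real.pi / 2 * √(1 - m)) (𝓝[<] 1) (𝓝 1) := by
    have : Continuous fun m : ℝ => 1 + Real.pi / 2 * √(1 - m) := by fun_prop
    have := this.tendsto 1
    simp only [sub_self, Real.sqrt_zero, mul_zero, add_zero] at this
    exact this.mono_left nhdsWithin_le_nhds
  exact tendsto_of_tendsto_of_tendsto_of_le_of_le' tendsto_const_nhds h
    (e1.mono fun m hm => (compE_bounds hm).1) (e1.mono fun m hm => (compE_bounds hm).2)

/-- `m B = E - (1 - m) K`, and the last term vanishes at the separatrix although `K` diverges. -/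
lemma tendsto_mul_compB : Tendsto (fun m => m * compB m) (𝓝[<] 1) (𝓝 1) := by
  have h0 : Tendsto (fun m : ℝ => m) (𝓝[<] 1) (𝓝 1) := tendsto_id.mono_left nhdsWithin_le_nhds
  have h1 := (tendsto_rpow_mul_compK (s := 1) one_pos (n := 1) (by norm_num)).2
  have h2 := (h0.mul tendsto_compE).sub h1
  have e1 : ∀ᶠ m : ℝ in 𝓝[<] 1, m ∈ Ioo (0 : ℝ) 1 := Ioo_mem_nhdsLT one_pos
  have h3 := h2.div h0 one_ne_zero
  simp only [mul_one, sub_zero, div_one] at h3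
  refine h3.congr' (e1.mono fun m hm => ?_)
  have := hm.1.ne'
  simp only [Pi.div_apply, Real.rpow_one, compE, pow_one]
  field_simp
  ring

/-- The derivative of the action with respect to the energy is the reciprocal of the frequency, that
is, the half period over `π`. So only `K` is left, the same factor as in the Jacobian of the
elliptic coordinates. -/
lemma hasDerivAt_mul_compB (hm : m ∈ Ioo (0 : ℝ) 1) :
    HasDerivAt (fun m => m * compB m) (compK m / 2) m := by
  refine ((hasDerivAt_id m).fun_mul (hasDerivAt_compB hm.2 hm.1.ne')).congr_deriv ?_
  have := hm.1.ne'
  simp only [id]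
  field_simp
  ring

lemma hasDerivAt_compE_div (hm : m ∈ Ioo (0 : ℝ) 1) :
    HasDerivAt (fun m => compE m / √m) (-(compK m / (2 * (m * √m)))) m := by
  have h0 := hm.1
  have hs := Real.sqrt_pos.2 h0
  refine ((hasDerivAt_compE hm).fun_div (Real.hasDerivAt_sqrt h0.ne') hs.ne').congr_deriv ?_
  have h2 := Real.sq_sqrt h0.le
  rw [compE, h2]
  field_simp
  rw [h2]
  ring

lemma image_Ioo_of_strictMonoOn {a : ℝ → ℝ} {l L : ℝ} (ha : StrictMonoOn a (Ioo 0 1))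
    (hc : ContinuousOn a (Ioo 0 1)) (h0 : Tendsto a (𝓝[>] 0) (𝓝 l))
    (h1 : Tendsto a (𝓝[<] 1) (𝓝 L)) : a '' Ioo 0 1 = Ioo l L := by
  have e0 : ∀ᶠ m : ℝ in 𝓝[>] 0, m ∈ Ioo (0 : ℝ) 1 := Ioo_mem_nhdsGT one_pos
  have e1 : ∀ᶠ m : ℝ in 𝓝[<] 1, m ∈ Ioo (0 : ℝ) 1 := Ioo_mem_nhdsLT one_pos
  have hle0 : ∀ m ∈ Ioo (0 : ℝ) 1, l ≤ a m := fun m hm =>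
    le_of_tendsto h0 (by
      filter_upwards [Ioo_mem_nhdsGT hm.1] with x hx
      exact (ha ⟨hx.1, hx.2.trans hm.2⟩ hm hx.2).le)
  have hle1 : ∀ m ∈ Ioo (0 : ℝ) 1, a m ≤ L := fun m hm =>
    ge_of_tendsto h1 (by
      filter_upwards [Ioo_mem_nhdsLT hm.2] with x hx
      exact (ha hm ⟨hm.1.trans hx.1, hx.2⟩ hx.1).le)
  refine Subset.antisymm ?_ fun b hb => ?_
  · rintro _ ⟨m, hm, rfl⟩
    have p : m / 2 ∈ Ioo (0 : ℝ) 1 := ⟨by linarith [hm.1], by linarith [hm.1, hm.2]⟩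
    have q : (m + 1) / 2 ∈ Ioo (0 : ℝ) 1 := ⟨by linarith [hm.1], by linarith [hm.2]⟩
    exact ⟨(hle0 _ p).trans_lt (ha p hm (by linarith [hm.1])),
      (ha hm q (by linarith [hm.2])).trans_le (hle1 _ q)⟩
  · obtain ⟨x, hx, hxm⟩ := ((h0.eventually (gt_mem_nhds hb.1)).and e0).exists
    obtain ⟨y, hy, hym⟩ := ((h1.eventually (lt_mem_nhds hb.2)).and e1).exists
    exact (isPreconnected_Ioo.image a hc).ordConnected.out ⟨x, hxm, rfl⟩ ⟨y, hym, rfl⟩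
      ⟨hx.le, hy.le⟩

lemma image_Ioo_of_strictAntiOn {a : ℝ → ℝ} {L : ℝ} (ha : StrictAntiOn a (Ioo 0 1))
    (hc : ContinuousOn a (Ioo 0 1)) (h0 : Tendsto a (𝓝[>] 0) atTop)
    (h1 : Tendsto a (𝓝[<] 1) (𝓝 L)) : a '' Ioo 0 1 = Ioi L := by
  have e0 : ∀ᶠ m : ℝ in 𝓝[>] 0, m ∈ Ioo (0 : ℝ) 1 := Ioo_mem_nhdsGT one_pos
  have e1 : ∀ᶠ m : ℝ in 𝓝[<] 1, m ∈ Ioo (0 : ℝ) 1 := Ioo_mem_nhdsLT one_pos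
  have hle1 : ∀ m ∈ Ioo (0 : ℝ) 1, L ≤ a m := fun m hm =>
    le_of_tendsto h1 (by
      filter_upwards [Ioo_mem_nhdsLT hm.2] with x hx
      exact (ha hm ⟨hm.1.trans hx.1, hx.2⟩ hx.1).le)
  refine Subset.antisymm ?_ fun b hb => ?_
  · rintro _ ⟨m, hm, rfl⟩
    have q : (m + 1) / 2 ∈ Ioo (0 : ℝ) 1 := ⟨by linarith [hm.1], by linarith [hm.2]⟩
    exact (hle1 _ q).trans_lt (ha hm q (by linarith [hm.2]))
  · obtain ⟨x, hx, hxm⟩ := ((h0.eventually (eventually_ge_atTop b)).and e0).exists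
    obtain ⟨y, hy, hym⟩ := ((h1.eventually (gt_mem_nhds hb)).and e1).exists
    exact (isPreconnected_Ioo.image a hc).ordConnected.out ⟨y, hym, rfl⟩ ⟨x, hxm, rfl⟩
      ⟨hy.le, hx⟩

/-- Integration over the actions of a chart in terms of a parameter `m ∈ (0, 1)` of its orbits. -/
lemma chartTerm_eq {M : ℝ} {c : Chart} {h a a' : ℝ → ℝ} (hh : h '' Ioo 0 1 = energies M c)
    (ha : ∀ m ∈ Ioo (0 : ℝ) 1, action M c (h m) = a m) (hinj : InjOn a (Ioo 0 1))
    (hd : ∀ m ∈ Ioo (0 : ℝ) 1, HasDerivAt a (a' m) m) (himg : a '' Ioo 0 1 = actions M c)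
    {C : ℝ → ℝ} (hC : ∀ m ∈ Ioo (0 : ℝ) 1, energyOfAction M c (a m) = h m →
      cosMean M c (a m) = C m) :
    chartTerm M G c = ∫ m in Ioo (0 : ℝ) 1, |a' m| * (deriv G (h m) * C m ^ 2) := by
  have hinj2 : InjOn (action M c) (energies M c) := by
    rw [← hh]
    rintro _ ⟨x, hx, rfl⟩ _ ⟨y, hy, rfl⟩ hxy
    rw [ha x hx, ha y hy] at hxy
    rw [hinj hx hy hxy]
  -- The action is injective on the energies of the chart, because as a function of `m` it is. The
  -- chosen inverse is then a genuine one, and all quantities become functions of `m`.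
  have he : ∀ m ∈ Ioo (0 : ℝ) 1, energyOfAction M c (a m) = h m := fun m hm => by
    rw [energyOfAction, ← ha m hm]
    exact hinj2.leftInvOn_invFunOn (hh ▸ mem_image_of_mem h hm)
  rw [chartTerm, ← himg, integral_image_eq_integral_abs_deriv_smul measurableSet_Ioo
    (fun m hm => (hd m hm).hasDerivWithinAt) hinj]
  refine setIntegral_congr_fun measurableSet_Ioo fun m hm => ?_
  simp only [smul_eq_mul]
  rw [he m hm, hC m hm (he m hm)]

/-! ### The eye -/

lemma image_energyEye (hρ : 0 < ρ) : energyEye ρ '' Ioo 0 1 = Ioo (-ρ ^ 2) (ρ ^ 2) := by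
  have hp : 0 < ρ ^ 2 := by positivity
  ext y
  constructor
  · rintro ⟨m, hm, rfl⟩
    rw [energyEye]
    constructor <;> nlinarith [hm.1, hm.2]
  · rintro ⟨h1, h2⟩
    refine ⟨(y / ρ ^ 2 + 1) / 2, ⟨?_, ?_⟩, ?_⟩
    · have : -1 < y / ρ ^ 2 := by rw [lt_div_iff₀ hp]; linarith
      linarith
    · have : y / ρ ^ 2 < 1 := by rw [div_lt_iff₀ hp]; linarith
      linarith
    · rw [energyEye]; field_simp; ring

lemma turningPoint_energyEye (hρ : 0 < ρ) (hm : m ∈ Ioo (0 : ℝ) 1) :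
    turningPoint (ρ ^ 2) (energyEye ρ m) = 2 * Real.arcsin √m := by
  have hs := Real.sqrt_nonneg m
  have h1 : Real.cos (2 * Real.arcsin √m) = 1 - 2 * m := by
    rw [Real.cos_two_mul, Real.cos_sq', Real.sin_arcsin (by linarith) (sqrt_le_one hm),
      Real.sq_sqrt hm.1.le]
    ring
  have h2 : -energyEye ρ m / ρ ^ 2 = 1 - 2 * m := by rw [energyEye]; field_simp; ring
  rw [turningPoint, h2, ← h1, Real.arccos_cos]
  · linarith [Real.arcsin_nonneg.2 hs]
  · linarith [Real.arcsin_le_pi_div_two √m]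

lemma sqrt_energyEye (hρ : 0 < ρ) (hm : m ∈ Ioo (0 : ℝ) 1) {φ : ℝ} (hφ : 0 ≤ Real.cos φ) :
    √(2 * (energyEye ρ m + ρ ^ 2 * Real.cos (2 * Real.arcsin (√m * Real.sin φ))))
      = 2 * ρ * √m * Real.cos φ := by
  have hmem := sqrt_mul_sin_mem hm φ
  have hs := Real.sq_sqrt hm.1.le
  rw [Real.cos_two_mul, Real.cos_sq', Real.sin_arcsin hmem.1.le hmem.2.le, mul_pow, hs,
    Real.sin_sq, energyEye, show 2 * (ρ ^ 2 * (2 * m - 1) + ρ ^ 2 * (2 * (1 - m * (1 - Real.cos φ ^ 2))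
      - 1)) = (2 * ρ * √m * Real.cos φ) ^ 2 by rw [mul_pow, mul_pow, hs]; ring]
  exact Real.sqrt_sq (by positivity)

lemma hasDerivAt_eye_angle (hm : m ∈ Ioo (0 : ℝ) 1) (φ : ℝ) :
    HasDerivAt (fun φ => 2 * Real.arcsin (√m * Real.sin φ)) (2 * √m * Real.cos φ / dlt φ m) φ := by
  have hmem := sqrt_mul_sin_mem hm φ
  have hs := Real.sq_sqrt hm.1.le
  have e : √(1 - (√m * Real.sin φ) ^ 2) = dlt φ m := by rw [mul_pow, hs]; rfl
  have h := ((Real.hasDerivAt_arcsin hmem.1.ne' hmem.2.ne).comp φ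
    ((Real.hasDerivAt_sin φ).const_mul √m)).const_mul 2
  rw [e] at h
  exact h.congr_deriv (by ring)

/-- The substitution `y = 2 arcsin (√m sin φ)`. -/
lemma integral_turningPoint (hρ : 0 < ρ) (hm : m ∈ Ioo (0 : ℝ) 1) (g : ℝ → ℝ) :
    ∫ y in (0)..turningPoint (ρ ^ 2) (energyEye ρ m),
        g √(2 * (energyEye ρ m + ρ ^ 2 * Real.cos y))
      = ∫ φ in (0)..(Real.pi / 2), g (2 * ρ * √m * Real.cos φ) * (2 * √m * Real.cos φ / dlt φ m) := by
  have hpi := Real.pi_pos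
  have hc : ∀ φ ∈ Icc 0 (Real.pi / 2), 0 ≤ Real.cos φ := fun φ hφ =>
    Real.cos_nonneg_of_mem_Icc ⟨by linarith [hφ.1], hφ.2⟩
  -- Monotonicity of the substitution makes assumptions on `g` unnecessary. This matters for the
  -- period, where `g` is the reciprocal and the integrand is singular at the turning point.
  have h := intervalIntegral.integral_comp_mul_deriv_of_deriv_nonneg (a := 0) (b := Real.pi / 2)
    (f := fun φ => 2 * Real.arcsin (√m * Real.sin φ)) (f' := fun φ => 2 * √m * Real.cos φ / dlt φ m)
    (g := fun y => g √(2 * (energyEye ρ m + ρ ^ 2 * Real.cos y)))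
    (fun φ _ => (hasDerivAt_eye_angle hm φ).continuousAt.continuousWithinAt)
    (fun φ _ => hasDerivAt_eye_angle hm φ) (fun φ hφ => by
      rw [min_eq_left (by positivity), max_eq_right (by positivity)] at hφ
      have h1 := hc φ (Ioo_subset_Icc_self hφ)
      have h2 := dlt_pos (φ := φ) hm.2
      positivity)
  simp only [Real.sin_zero, mul_zero, Real.arcsin_zero, Real.sin_pi_div_two, mul_one] at h
  rw [turningPoint_energyEye hρ hm, ← h]
  refine intervalIntegral.integral_congr fun φ hφ => ?_
  rw [uIcc_of_le (by positivity)] at hφ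
  simp only [Function.comp]
  rw [sqrt_energyEye hρ hm (hc φ hφ)]

lemma action_eye (hρ : 0 < ρ) (hm : m ∈ Ioo (0 : ℝ) 1) :
    action (ρ ^ 2) .eye (energyEye ρ m) = 8 * ρ / Real.pi * (m * compB m) := by
  have hs := Real.sq_sqrt hm.1.le
  rw [action, integral_turningPoint hρ hm (fun x => x)]
  have e : ∀ φ, 2 * ρ * √m * Real.cos φ * (2 * √m * Real.cos φ / dlt φ m)
      = 4 * ρ * m * (Real.cos φ ^ 2 / dlt φ m) := fun φ => by
    rw [show 2 * ρ * √m * Real.cos φ * (2 * √m * Real.cos φ / dlt φ m)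
      = 4 * ρ * √m ^ 2 * (Real.cos φ ^ 2 / dlt φ m) by ring, hs]
  simp only [e, intervalIntegral.integral_const_mul]
  change 2 / Real.pi * (4 * ρ * m * compB m) = _
  ring

lemma halfPeriod_eye (hρ : 0 < ρ) (hm : m ∈ Ioo (0 : ℝ) 1) :
    halfPeriod (ρ ^ 2) .eye (energyEye ρ m) = 2 * compK m / ρ := by
  have hpi := Real.pi_pos
  have hs := Real.sqrt_pos.2 hm.1
  rw [halfPeriod, integral_turningPoint hρ hm (fun x => 1 / x)]
  have e : ∫ φ in (0)..(Real.pi / 2), 1 / (2 * ρ * √m * Real.cos φ) * (2 * √m * Real.cos φ / dlt φ m)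
      = ∫ φ in (0)..(Real.pi / 2), ρ⁻¹ * (1 / dlt φ m) := by
    -- At `φ = π / 2` the cosine vanishes and the quotient takes the default value `0`, so the
    -- integrands are compared on the open interval only.
    rw [intervalIntegral.integral_of_le (by positivity), intervalIntegral.integral_of_le
      (by positivity), integral_Ioc_eq_integral_Ioo, integral_Ioc_eq_integral_Ioo]
    refine setIntegral_congr_fun measurableSet_Ioo fun φ hφ => ?_
    have h1 := Real.cos_pos_of_mem_Ioo ⟨by linarith [hφ.1], hφ.2⟩
    have h2 := dlt_pos (φ := φ) hm.2
    field_simp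
  rw [e, intervalIntegral.integral_const_mul]
  change 2 * (ρ⁻¹ * compK m) = _
  ring

lemma sn_compK (hm : m ∈ Ioo (0 : ℝ) 1) : sn (compK m) m = 1 := by
  rw [sn, am_compK hm.2, Real.sin_pi_div_two]

lemma cn_compK (hm : m ∈ Ioo (0 : ℝ) 1) : cn (compK m) m = 0 := by
  rw [cn, am_compK hm.2, Real.cos_pi_div_two]

lemma basePoint_eye (hρ : 0 < ρ) (hm : m ∈ Ioo (0 : ℝ) 1) :
    basePoint (ρ ^ 2) .eye (energyEye ρ m) = eyePt ρ (compK m) m := by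
  rw [basePoint, turningPoint_energyEye hρ hm, eyePt, sn_compK hm, cn_compK hm, mul_one, mul_zero]

lemma cosMean_eye (hρ : 0 < ρ) (hm : m ∈ Ioo (0 : ℝ) 1) {a : ℝ}
    (ha : energyOfAction (ρ ^ 2) .eye a = energyEye ρ m) :
    cosMean (ρ ^ 2) .eye a = meanEye m := by
  have hpi := Real.pi_pos
  have hK := compK_pos hm
  have e : ∀ θ, Real.cos (actionAngle (ρ ^ 2) .eye θ a).1
      = cosEye (2 * compK m * (θ / Real.pi) + compK m) m := fun θ => by
    rw [actionAngle, ha, basePoint_eye hρ hm, pendulumFlow_eyePt hm, cos_eyePt hm, frequency,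
      halfPeriod_eye hρ hm, cosEye]
    -- The turning point is `u = K`, and an angle of `2 π` is a full revolution of length `4 K` in
    -- `u`, so `θ / π` is the phase counted from the turning point.
    have : compK m + θ / (Real.pi / (2 * compK m / ρ)) * ρ
        = 2 * compK m * (θ / Real.pi) + compK m := by field_simp; ring
    rw [this]
  simp only [cosMean, e]
  rw [intervalIntegral.integral_comp_div (fun x => cosEye (2 * compK m * x + compK m) m) hpi.ne',
    neg_div, div_self hpi.ne', integral_cosEye hm, smul_eq_mul]
  field_simp

/-- The substitution of `m` for the action has derivative `4 ρ K / π`, the Jacobian factor contained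
in `weightEye`. The chart integral thus coincides with the limit of the correlation in the eye. -/
theorem chartTerm_eye (hρ : 0 < ρ) : chartTerm (ρ ^ 2) G .eye = 1 / (2 * Real.pi)
    * ∫ m in Ioo (0 : ℝ) 1, weightEye ρ (deriv G) m * (2 * meanEye m ^ 2) := by
  have hpi := Real.pi_pos
  have hd : ∀ m ∈ Ioo (0 : ℝ) 1, HasDerivAt (fun m => 8 * ρ / Real.pi * (m * compB m))
      (8 * ρ / Real.pi * (compK m / 2)) m := fun m hm => (hasDerivAt_mul_compB hm).const_mul _
  have hc : ContinuousOn (fun m => 8 * ρ / Real.pi * (m * compB m)) (Ioo 0 1) := fun m hm =>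
    (hd m hm).continuousAt.continuousWithinAt
  have hmono : StrictMonoOn (fun m => 8 * ρ / Real.pi * (m * compB m)) (Ioo 0 1) := by
    refine strictMonoOn_of_deriv_pos (convex_Ioo 0 1) hc fun m hm => ?_
    rw [interior_Ioo] at hm
    rw [(hd m hm).deriv]
    have := compK_pos hm
    positivity
  have e0 : ∀ᶠ m : ℝ in 𝓝[>] 0, m ∈ Ioo (0 : ℝ) 1 := Ioo_mem_nhdsGT one_pos
  have h0 : Tendsto (fun m => m * compB m) (𝓝[>] 0) (𝓝 0) := by
    refine tendsto_of_tendsto_of_tendsto_of_le_of_le' tendsto_const_nhds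
      (tendsto_id.mono_left nhdsWithin_le_nhds) (e0.mono fun m hm => ?_) (e0.mono fun m hm => ?_)
    · exact mul_nonneg hm.1.le (by linarith [half_le_compB hm])
    · exact mul_le_of_le_one_right hm.1.le (compB_le_one hm)
  rw [chartTerm_eq (M := ρ ^ 2) (c := .eye) (h := energyEye ρ) (image_energyEye hρ) (fun m hm => action_eye hρ hm)
    hmono.injOn hd ?_ (C := meanEye) (fun m hm h => cosMean_eye hρ hm h), ← integral_const_mul]
  · refine setIntegral_congr_fun measurableSet_Ioo fun m hm => ?_
    have := compK_pos hm
    rw [abs_of_pos (by positivity), weightEye]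
    field_simp
    ring
  · rw [image_Ioo_of_strictMonoOn hmono hc (h0.const_mul _) (tendsto_mul_compB.const_mul _), actions,
      Real.sqrt_sq hρ.le]
    congr 1 <;> ring

/-! ### The charts outside the eye -/

lemma image_energyOuter (hρ : 0 < ρ) : energyOuter ρ '' Ioo 0 1 = Ioi (ρ ^ 2) := by
  have hp : 0 < ρ ^ 2 := by positivity
  ext y
  constructor
  · rintro ⟨m, hm, rfl⟩
    have : 1 < 1 / m := by rw [lt_div_iff₀ hm.1]; linarith [hm.2]
    have e : energyOuter ρ m = ρ ^ 2 * (2 * (1 / m) - 1) := by rw [energyOuter]; ring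
    rw [mem_Ioi, e]
    nlinarith
  · intro h
    rw [mem_Ioi] at h
    have h2 : 1 < y / ρ ^ 2 := by rw [lt_div_iff₀ hp]; linarith
    refine ⟨2 / (y / ρ ^ 2 + 1), ⟨by positivity, ?_⟩, ?_⟩
    · rw [div_lt_one (by positivity)]; linarith
    · have h3 : y / ρ ^ 2 + 1 ≠ 0 := by positivity
      rw [energyOuter, div_div_cancel₀ two_ne_zero]
      field_simp
      ring

lemma sqrt_energyOuter (hρ : 0 < ρ) (hm : m ∈ Ioo (0 : ℝ) 1) (y : ℝ) :
    √(2 * (energyOuter ρ m + ρ ^ 2 * Real.cos y)) = 2 * (ρ / √m) * dlt (y / 2) m := by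
  have hm0 := hm.1
  have hs := Real.sqrt_pos.2 hm0
  have hd := dlt_pos (φ := y / 2) hm.2
  have e : Real.cos y = 1 - 2 * Real.sin (y / 2) ^ 2 := by
    rw [show y = 2 * (y / 2) by ring, Real.cos_two_mul, Real.cos_sq']; ring_nf
  rw [e, energyOuter, show 2 * (ρ ^ 2 * (2 / m - 1) + ρ ^ 2 * (1 - 2 * Real.sin (y / 2) ^ 2))
    = (2 * (ρ / √m) * dlt (y / 2) m) ^ 2 by
      rw [mul_pow, mul_pow, div_pow, Real.sq_sqrt hm0.le, dlt_sq hm.2]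
      field_simp
      ring]
  exact Real.sqrt_sq (by positivity)

lemma integral_half_angle (f : ℝ → ℝ) :
    ∫ y in (0)..Real.pi, f (y / 2) = 2 * ∫ φ in (0)..(Real.pi / 2), f φ := by
  rw [intervalIntegral.integral_comp_div f two_ne_zero, zero_div, smul_eq_mul]

lemma action_plus (hρ : 0 < ρ) (hm : m ∈ Ioo (0 : ℝ) 1) :
    action (ρ ^ 2) .plus (energyOuter ρ m) = 4 * ρ / Real.pi * (compE m / √m) := by
  simp only [action, sqrt_energyOuter hρ hm]
  rw [integral_half_angle (fun φ => 2 * (ρ / √m) * dlt φ m), intervalIntegral.integral_const_mul,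
    ← compE_eq_integral hm]
  ring

lemma halfPeriod_plus (hρ : 0 < ρ) (hm : m ∈ Ioo (0 : ℝ) 1) :
    halfPeriod (ρ ^ 2) .plus (energyOuter ρ m) = compK m / (ρ / √m) := by
  have hs := Real.sqrt_pos.2 hm.1
  simp only [halfPeriod, sqrt_energyOuter hρ hm]
  rw [integral_half_angle (fun φ => 1 / (2 * (ρ / √m) * dlt φ m))]
  have e : ∀ φ, 1 / (2 * (ρ / √m) * dlt φ m) = (2 * (ρ / √m))⁻¹ * (1 / dlt φ m) := fun φ => by
    rw [one_div, mul_inv, one_div]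
  simp only [e, intervalIntegral.integral_const_mul]
  change 2 * ((2 * (ρ / √m))⁻¹ * compK m) = _
  field_simp

lemma basePoint_plus (hρ : 0 < ρ) (hm : m ∈ Ioo (0 : ℝ) 1) :
    basePoint (ρ ^ 2) .plus (energyOuter ρ m) = outerPt ρ 0 m := by
  have h := sqrt_energyOuter hρ hm 0
  rw [Real.cos_zero, mul_one, zero_div] at h
  rw [basePoint, h, outerPt, dn, am_zero hm.2, mul_zero]

/-- Outside the eye one revolution is a shift of `u` by `2 K` only, half of that in the eye. The
angles in `(-π, π)` therefore correspond to `|u| < K`, which is a full period of `zet`. -/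
lemma integral_cosOuter_half (hm : m ∈ Ioo (0 : ℝ) 1) :
    ∫ σ in (-1 : ℝ)..1, cosOuter (compK m * σ) m = 2 * meanOuter m := by
  have hK := compK_pos hm
  have hz : Continuous fun u => zetU u m := cts_zetU.continuous_left hm
  have hc : Continuous fun σ => zetU (compK m * σ) m := hz.comp (by fun_prop)
  have h0 : ∫ σ in (-1 : ℝ)..1, zetU (compK m * σ) m = 0 := by
    rw [intervalIntegral.integral_comp_mul_left (fun u => zetU u m) hK.ne',
      intervalIntegral.integral_eq_sub_of_hasDerivAt (fun u _ => hasDerivAt_zet hm u)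
        (hz.intervalIntegrable _ _)]
    have h : zet (-compK m + 2 * compK m) m = zet (-compK m) m := zet_periodic hm (-compK m)
    rw [show -compK m + 2 * compK m = compK m by ring] at h
    rw [mul_one, mul_neg, mul_one, h, sub_self, smul_zero]
  simp_rw [cosOuter_eq]
  rw [intervalIntegral.integral_add intervalIntegrable_const
    ((hc.intervalIntegrable _ _).const_mul _), intervalIntegral.integral_const_mul,
    h0, intervalIntegral.integral_const, smul_eq_mul]
  ring

lemma cosMean_plus (hρ : 0 < ρ) (hm : m ∈ Ioo (0 : ℝ) 1) {a : ℝ}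
    (ha : energyOfAction (ρ ^ 2) .plus a = energyOuter ρ m) :
    cosMean (ρ ^ 2) .plus a = meanOuter m := by
  have hpi := Real.pi_pos
  have hK := compK_pos hm
  have hs := Real.sqrt_pos.2 hm.1
  have e : ∀ θ, Real.cos (actionAngle (ρ ^ 2) .plus θ a).1
      = cosOuter (compK m * (θ / Real.pi)) m := fun θ => by
    rw [actionAngle, ha, basePoint_plus hρ hm, pendulumFlow_outerPt hm, cos_outerPt, frequency,
      halfPeriod_plus hρ hm, cosOuter]
    have : 0 + θ / (Real.pi / (compK m / (ρ / √m))) * (ρ / √m)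
        = compK m * (θ / Real.pi) := by field_simp; ring
    rw [this]
  simp only [cosMean, e]
  rw [intervalIntegral.integral_comp_div (fun x => cosOuter (compK m * x) m) hpi.ne',
    neg_div, div_self hpi.ne', integral_cosOuter_half hm, smul_eq_mul]
  field_simp

/-- The action `4 ρ E / (π √m)` decreases from infinity to its separatrix value as `m` increases,
hence the absolute value of the derivative. The chart yields half of the limit of the outer
correlation; the other half is the chart `U₋`. -/
theorem chartTerm_plus (hρ : 0 < ρ) : chartTerm (ρ ^ 2) G .plus = 1 / (2 * Real.pi)
    * ∫ m in Ioo (0 : ℝ) 1, weightOuter ρ (deriv G) m * meanOuter m ^ 2 := by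
  have hpi := Real.pi_pos
  have hd : ∀ m ∈ Ioo (0 : ℝ) 1, HasDerivAt (fun m => 4 * ρ / Real.pi * (compE m / √m))
      (4 * ρ / Real.pi * -(compK m / (2 * (m * √m)))) m := fun m hm =>
    (hasDerivAt_compE_div hm).const_mul _
  have hc : ContinuousOn (fun m => 4 * ρ / Real.pi * (compE m / √m)) (Ioo 0 1) := fun m hm =>
    (hd m hm).continuousAt.continuousWithinAt
  have hpos : ∀ m ∈ Ioo (0 : ℝ) 1, 0 < 4 * ρ / Real.pi * (compK m / (2 * (m * √m))) :=
    fun m hm => by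
      have := compK_pos hm
      have := hm.1
      positivity
  have hanti : StrictAntiOn (fun m => 4 * ρ / Real.pi * (compE m / √m)) (Ioo 0 1) := by
    refine strictAntiOn_of_deriv_neg (convex_Ioo 0 1) hc fun m hm => ?_
    rw [interior_Ioo] at hm
    rw [(hd m hm).deriv, mul_neg]
    linarith [hpos m hm]
  have e0 : ∀ᶠ m : ℝ in 𝓝[>] 0, m ∈ Ioo (0 : ℝ) 1 := Ioo_mem_nhdsGT one_pos
  have hsq0 : Tendsto (fun m : ℝ => √m) (𝓝[>] 0) (𝓝[>] 0) := by
    refine tendsto_nhdsWithin_iff.2 ⟨?_, e0.mono fun m hm => Real.sqrt_pos.2 hm.1⟩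
    have := Real.continuous_sqrt.tendsto 0
    rw [Real.sqrt_zero] at this
    exact this.mono_left nhdsWithin_le_nhds
  have h0 : Tendsto (fun m => 4 * ρ / Real.pi * (compE m / √m)) (𝓝[>] 0) atTop := by
    have h := (tendsto_inv_nhdsGT_zero.comp hsq0).const_mul_atTop
      (show 0 < 4 * ρ / Real.pi * (1 / 2) by positivity)
    refine tendsto_atTop_mono' _ (e0.mono fun m hm => ?_) h
    have := Real.sqrt_pos.2 hm.1
    have h2 := half_le_compE hm
    simp only [Function.comp]
    rw [div_eq_mul_inv (compE m), mul_assoc]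
    gcongr
  have h1 : Tendsto (fun m => compE m / √m) (𝓝[<] 1) (𝓝 1) := by
    have hs : Tendsto (fun m : ℝ => √m) (𝓝[<] 1) (𝓝 1) := by
      have := Real.continuous_sqrt.tendsto 1
      rw [Real.sqrt_one] at this
      exact this.mono_left nhdsWithin_le_nhds
    have h := tendsto_compE.div hs one_ne_zero
    rwa [div_one] at h
  rw [chartTerm_eq (M := ρ ^ 2) (c := .plus) (h := energyOuter ρ) (image_energyOuter hρ) (fun m hm => action_plus hρ hm)
    hanti.injOn hd ?_ (C := meanOuter) (fun m hm h => cosMean_plus hρ hm h), ← integral_const_mul]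
  · refine setIntegral_congr_fun measurableSet_Ioo fun m hm => ?_
    have h0 := hm.1
    have hs := Real.sqrt_pos.2 h0
    rw [mul_neg, abs_neg, abs_of_pos (hpos m hm), weightOuter, Real.rpow_neg h0.le,
      rpow_three_halves h0]
    field_simp
    ring
  · rw [image_Ioo_of_strictAntiOn hanti hc h0 (h1.const_mul _), actions, Real.sqrt_sq hρ.le]
    congr 1; ring

lemma basePoint_minus (M h : ℝ) : basePoint M .minus h = -basePoint M .plus h := by
  simp [basePoint]

/-- The point reflection exchanges `U₊` and `U₋`, commutes with the flow and preserves `cos x`. -/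
theorem chartTerm_minus (M : ℝ) : chartTerm M G .minus = chartTerm M G .plus := by
  have h1 : ∀ a, energyOfAction M .minus a = energyOfAction M .plus a := fun _ => rfl
  have h2 : ∀ h, frequency M .minus h = frequency M .plus h := fun _ => rfl
  have h3 : ∀ θ a, actionAngle M .minus θ a = -actionAngle M .plus θ a := fun θ a => by
    rw [actionAngle, h1, h2, basePoint_minus, pendulumFlow_neg, actionAngle]
  have h4 : ∀ a, cosMean M .minus a = cosMean M .plus a := fun a => by
    simp only [cosMean, h3, Prod.fst_neg, Real.cos_neg]
  simp only [chartTerm, h1, h4]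
  rfl

theorem sum_chartTerm (hρ : 0 < ρ) : chartTerm (ρ ^ 2) G .plus + chartTerm (ρ ^ 2) G .minus
    + chartTerm (ρ ^ 2) G .eye = limitCos ρ (deriv G) := by
  rw [chartTerm_minus, chartTerm_plus hρ, chartTerm_eye hρ, limitCos]
  have e : ∫ m in Ioo (0 : ℝ) 1, weightOuter ρ (deriv G) m * (2 * meanOuter m ^ 2)
      = 2 * ∫ m in Ioo (0 : ℝ) 1, weightOuter ρ (deriv G) m * meanOuter m ^ 2 := by
    rw [← integral_const_mul]
    congr 1
    funext m
    ring
  rw [e]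
  ring

end

/-! ### Stability as the Penrose condition at frequency zero. -/

section

variable {ρ μ : ℝ} {G : ℝ → ℝ}

open VlasovHMF

lemma re_one_sub_fourierHat_zero (F : ℝ → ℝ) : (1 - fourierHat F 0).re = 1 - ∫ t, F t := by
  rw [fourierHat_zero, Complex.sub_re, Complex.one_re, Complex.ofReal_re]

/-- The Penrose condition at frequency zero and linear stability, with `M₀ = ρ²`. -/
theorem penroseAtZero_iff_linearlyStable (hρ : 0 < ρ) (hμ : 2 < μ) (hG : Differentiable ℝ G)
    (hg : IsProfile ρ μ (deriv G)) (hdecr : ∀ y, -ρ ^ 2 ≤ y → deriv G y < 0) :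
    PenroseAtZero (ρ ^ 2) G ↔ LinearlyStable (ρ ^ 2) G := by
  have hS := corrSin_zero_nonpos hρ hdecr
  rw [PenroseAtZero, LinearlyStable, re_one_sub_fourierHat_zero, re_one_sub_fourierHat_zero,
    (kernelC_integral hρ hμ hG hg).2, (kernelS_integral hρ hμ hG hg).2,
    integral_cos_sq_eq hρ hμ hg, sum_chartTerm hρ]
  exact ⟨fun h => by linarith [h.1], fun h => ⟨by linarith, by linarith⟩⟩

end

end Pendulum

end

theorem proposition2p8 (M₀ : ℝ) (hM₀ : 0 < M₀) (G : ℝ → ℝ) (μ : ℝ) (hμ : 2 < μ)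
    (hG : ContDiff ℝ 10 G)
    (hdecay : ∃ C : ℝ, ∀ n : ℕ, n ≤ 10 → ∀ y : ℝ, -M₀ ≤ y →
      (1 + y ^ 2) ^ (μ / 2) * |iteratedDeriv n G y| ≤ C)
    (hdecr : ∀ y : ℝ, -M₀ ≤ y → deriv G y < 0) :
    MeasureTheory.Integrable (VlasovHMF.kernelC M₀ G) ∧
    MeasureTheory.Integrable (VlasovHMF.kernelS M₀ G) ∧
    (VlasovHMF.PenroseAtZero M₀ G ↔ VlasovHMF.LinearlyStable M₀ G) := by
  -- Here `ρ = √M₀` is the frequency of small oscillations; it is the speed of `u` along every orbit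
  -- in the eye.
  obtain ⟨ρ, hρ, rfl⟩ : ∃ ρ : ℝ, 0 < ρ ∧ ρ ^ 2 = M₀ := ⟨√M₀, Real.sqrt_pos.2 hM₀, Real.sq_sqrt hM₀.le⟩
  have hg := Pendulum.isProfile_deriv hG hdecay
  have hGd : Differentiable ℝ G := hG.differentiable (by norm_num)
  exact ⟨(Pendulum.kernelC_integral hρ hμ hGd hg).1, (Pendulum.kernelS_integral hρ hμ hGd hg).1,
    Pendulum.penroseAtZero_iff_linearlyStable hρ hμ hGd hg hdecr⟩
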